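/- **Proposition 5.2.** Let $n\ge 1$, $0<\mu\le n$, $\kappa\in\mathbb R$, $0<\gamma\le 1$, $0\le\nu\le 1$, $\rho\ge 0$, and let $\ell_<$ satisfy $0\le \ell_<<n/2$ and $\ell_<>n/2-\mu$. Let $\widehat u(\xi)=(2\pi)^{-n/2}\int e^{-ix\cdot\xi}u(x)\,dx$ be the Fourier transform on $\mathbb R^n$ (extended to tempered distributions), put $f(\xi)=\exp(\rho\,\max(|\xi|^\nu,1))$, and let $K^k_\rho$ (complex functions) and $Y^\ell_\rho$ (real functions) be the spaces with norms $$|w|_k^2=\int_{|\xi|>1}|\xi|^{2k}f^2|\widehat w|^2\,d\xi+\int_{|\xi|\le1}f^2|\widehat w|^2\,d\xi,\qquad |\varphi|_\ell^2=\int_{|\xi|>1}|\xi|^{2\ell+4}f^2|\widehat\varphi|^2\,d\xi+\int_{|\xi|\le1}|\xi|^{2\ell_<}f^2|\widehat\varphi|^2\,d\xi .$$ Put $g_0(w_1,w_2)=\kappa\,\mathrm{Re}\,|\nabla|^{\mu-n}(w_1\overline{w_2})$ with $|\nabla|=(-\Delta)^{1/2}$, $\lambda=\mu-n+2$ and $\bar\lambda=\max(\lambda,1)$.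 For $t\ge1$ and integers $m\ge0$ put $$h(t)=\int_1^\infty \max(t,t_1)^{-1}t_1^{-\gamma}dt_1,\qquad \bar N_m(t)=\int_1^t t_1^{-\gamma}h(t_1)^m dt_1,$$ $$\bar Q_m(t)=\int_1^\infty \max(t,t_1)^{-1}t_1^{-\gamma}h(t_1)^m dt_1,\qquad \bar P_m(t)=\int_1^\infty h(\max(t,t_1))\,t_1^{-\gamma}h(t_1)^m dt_1 ,$$ where $\bar P_m$ is used only if $(m+2)\gamma>1$. Let $p\ge0$ be an integer, let $k>n/2$ and $k\ge(p+2)\bar\lambda-1$, and let $k_m=k-m\bar\lambda$, $\ell_m=k-m\bar\lambda-\lambda$ for $0\le m\le p+1$. For $w_+\in K^k_\rho$ put $w_0=w_+$ and consider on $[1,\infty)$ the triangular system $$\partial_t w_{m+1}=(2t^2)^{-1}\sum_{0\le j\le m}\bigl(2\nabla\varphi_j\cdot\nabla+(\Delta\varphi_j)\bigr)w_{m-j},\qquad w_{m+1}(\infty)=0\qquad(0\le m\le p),$$ $$\partial_t\varphi_m=(2t^2)^{-1}\sum_{0\le j\le m-1}\nabla\varphi_j\cdot\nabla\varphi_{m-1-j}+t^{-\gamma}\sum_{0\le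 j\le m}g_0(w_j,w_{m-j}),\qquad \varphi_m(1)=0\qquad(0\le m\le p),$$ and, if $(p+2)\gamma>1$, also the equation for $\varphi_{p+1}$ (the second one with $m=p+1$), now with $\varphi_{p+1}(\infty)=0$; equations and conditions at infinity are understood in the sense of tempered distributions. This problem has exactly one solution $\{w_{m+1},\varphi_m\}_{0\le m\le p}$ (and $\varphi_{p+1}$ if $(p+2)\gamma>1$), up to equality almost everywhere in $x$ for each $t\ge 1$. Moreover, for every $\gamma_0>0$ there is a nondecreasing function $A$, depending only on $n,\mu,\kappa,\ell_<,p,k,\gamma_0$, such that the following hold for all $\gamma\in[\gamma_0,1]$, $\nu\in[0,1]$, $\rho\ge0$. (1) For every $w_+\in K^k_\rho$, with $a=|w_+|_k$, and for $0\le m\le p$, one has $w_{m+1}\in\mathcal C([1,\infty),K^{k_{m+1}}_\rho)$, $\varphi_m\in\mathcal C([1,\infty),Y^{\ell_m}_\rho)$, and for all $t\ge1$ $$|w_{m+1}(t)|_{k_{m+1}}\le A(a)\bar Q_m(t),\qquad |\varphi_m(t)|_{\ell_m}\le A(a)\bar N_m(t).$$ If $(p+2)\gamma>1$, then also $\varphi_{p+1}\in\mathcal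 C([1,\infty),Y^{\ell_{p+1}}_\rho)$ and $|\varphi_{p+1}(t)|_{\ell_{p+1}}\le A(a)\bar P_p(t)$ for all $t\ge1$. (2) The phases are gauge invariant: if $w_+,w'_+\in K^k_\rho$ and $w'_+=w_+e^{i\omega}$ for some real valued function $\omega$, then the corresponding phases satisfy $\varphi'_m=\varphi_m$ for $0\le m\le p$, and also for $m=p+1$ if $(p+2)\gamma>1$. (3) The map $w_+\mapsto\{w_{m+1},\varphi_m\}$ is uniformly Lipschitz on bounded sets: if $|w_+|_k\le R$ and $|w'_+|_k\le R$, then for $0\le m\le p$ and all $t\ge1$ $$|w_{m+1}(t)-w'_{m+1}(t)|_{k_{m+1}}\le A(R)\,|w_+-w'_+|_k\,\bar Q_m(t),\qquad |\varphi_m(t)-\varphi'_m(t)|_{\ell_m}\le A(R)\,|w_+-w'_+|_k\,\bar N_m(t),$$ and, if $(p+2)\gamma>1$, $|\varphi_{p+1}(t)-\varphi'_{p+1}(t)|_{\ell_{p+1}}\le A(R)\,|w_+-w'_+|_k\,\bar P_p(t)$ for all $t\ge1$. -/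

import Mathlib

open MeasureTheory Filter Topology
open scoped ENNReal SchwartzMap FourierTransform

noncomputable section

namespace HartreeAsymptotics

/-- The Euclidean space `ℝⁿ`. -/
abbrev Sp (n : ℕ) : Type := EuclideanSpace ℝ (Fin n)

/-! ### Functions as tempered distributions -/

/-- The function `u` defines a tempered distribution `ψ ↦ ∫ u ψ`. -/
def IsTempered {n : ℕ} (u : Sp n → ℂ) : Prop :=
  ∀ ψ : 𝓢(Sp n, ℂ), Integrable (fun x => u x * ψ x)

/-- The unitary Fourier transform
`(Fψ)(ξ) = (2π)^(-n/2) ∫ exp(-i x·ξ) ψ(x) dx`, in terms of Mathlib's `𝓕`, whose kernel is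
`exp(-2πi x·ξ)`. -/
def unitaryFourier {n : ℕ} (ψ : Sp n → ℂ) (ξ : Sp n) : ℂ :=
  (((2 * Real.pi) ^ (-(n : ℝ) / 2) : ℝ) : ℂ) * 𝓕 ψ ((2 * Real.pi)⁻¹ • ξ)

/-- The function `v` is the Fourier transform of the function `u`, in the sense of tempered
distributions. -/
def HasFourier {n : ℕ} (u v : Sp n → ℂ) : Prop :=
  IsTempered u ∧ IsTempered v ∧
    ∀ ψ : 𝓢(Sp n, ℂ), ∫ x, u x * unitaryFourier ψ x = ∫ ξ, v ξ * ψ ξ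

/-- The function `v` is the partial derivative `∂ᵢ u`, in the sense of tempered distributions. -/
def HasPartial {n : ℕ} (i : Fin n) (u v : Sp n → ℂ) : Prop :=
  IsTempered u ∧ IsTempered v ∧
    ∀ ψ : 𝓢(Sp n, ℂ),
      ∫ x, u x * fderiv ℝ ψ x (EuclideanSpace.single i (1 : ℝ)) = -∫ x, v x * ψ x

/-- A real function seen as a complex one. -/
def toC {n : ℕ} (φ : Sp n → ℝ) : Sp n → ℂ := fun x => (φ x : ℂ)

/-! ### The spaces `K_ρ^k` and `Y_ρ^ℓ` -/

/-- `f(ξ) = exp(ρ (|ξ|^ν ∨ 1))`. -/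
def gevreyWeight {n : ℕ} (ρ ν : ℝ) (ξ : Sp n) : ℝ := Real.exp (ρ * max (‖ξ‖ ^ ν) 1)

/-- `‖F u · f · (|ξ|^a for |ξ| > 1, |ξ|^b for |ξ| ≤ 1)‖₂`, with value `⊤` if the Fourier transform
of `u` is not a function. (Fourier transforms are unique almost everywhere, so the infimum is over
one value or over the empty set.) -/
def weightedNorm {n : ℕ} (ρ ν a b : ℝ) (u : Sp n → ℂ) : ℝ≥0∞ :=
  ⨅ (v : Sp n → ℂ) (_ : HasFourier u v),
    eLpNorm (fun ξ =>
      (((if 1 < ‖ξ‖ then ‖ξ‖ ^ a else ‖ξ‖ ^ b) * gevreyWeight ρ ν ξ : ℝ) : ℂ) * v ξ) 2 volume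

/-- The norm of `K_ρ^k`; `w` belongs to `K_ρ^k` when it is finite. -/
def normK {n : ℕ} (ρ ν k : ℝ) (w : Sp n → ℂ) : ℝ≥0∞ := weightedNorm ρ ν k 0 w

/-- The norm of `Y_ρ^ℓ` (with low frequency exponent `ℓ_<`); `φ` belongs to `Y_ρ^ℓ` when it is
finite. -/
def normY {n : ℕ} (lLow ρ ν l : ℝ) (φ : Sp n → ℝ) : ℝ≥0∞ :=
  weightedNorm ρ ν (l + 2) lLow (toC φ)

/-- `w ∈ C([1, ∞), K_ρ^k)`. -/
def ContK {n : ℕ} (ρ ν k : ℝ) (w : ℝ → Sp n → ℂ) : Prop :=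
  ∀ t, 1 ≤ t → normK ρ ν k (w t) < ⊤ ∧
    Tendsto (fun s => normK ρ ν k (w s - w t)) (𝓝[Set.Ici 1] t) (𝓝 0)

/-- `φ ∈ C([1, ∞), Y_ρ^ℓ)`. -/
def ContY {n : ℕ} (lLow ρ ν l : ℝ) (φ : ℝ → Sp n → ℝ) : Prop :=
  ∀ t, 1 ≤ t → normY lLow ρ ν l (φ t) < ⊤ ∧
    Tendsto (fun s => normY lLow ρ ν l (φ s - φ t)) (𝓝[Set.Ici 1] t) (𝓝 0)

/-! ### The terms of the system -/

/-- `G = (2 ∇φ·∇ + (Δφ)) w`. -/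
def IsTransportTerm {n : ℕ} (φ : Sp n → ℝ) (w G : Sp n → ℂ) : Prop :=
  ∃ s d v : Fin n → Sp n → ℂ,
    (∀ i, HasPartial i (toC φ) (s i)) ∧ (∀ i, HasPartial i (s i) (d i)) ∧
    (∀ i, HasPartial i w (v i)) ∧
    G = fun x => 2 * ∑ i, s i x * v i x + (∑ i, d i x) * w x

/-- `G = ∇φ·∇χ`. -/
def IsGradDot {n : ℕ} (φ χ : Sp n → ℝ) (G : Sp n → ℂ) : Prop :=
  ∃ s r : Fin n → Sp n → ℂ,
    (∀ i, HasPartial i (toC φ) (s i)) ∧ (∀ i, HasPartial i (toC χ) (r i)) ∧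
    G = fun x => ∑ i, s i x * r i x

/-- `v = |∇|^s u`, where `|∇| = (-Δ)^(1/2)`. -/
def IsAbsGradPow {n : ℕ} (s : ℝ) (u v : Sp n → ℂ) : Prop :=
  ∃ û : Sp n → ℂ, HasFourier u û ∧ HasFourier v (fun ξ => ((‖ξ‖ ^ s : ℝ) : ℂ) * û ξ)

/-- `g = g₀(w₁, w₂) = κ Re |∇|^(μ-n) (w₁ w̄₂)`. -/
def IsG0 {n : ℕ} (κ μ : ℝ) (w₁ w₂ : Sp n → ℂ) (g : Sp n → ℝ) : Prop :=
  ∃ v : Sp n → ℂ, IsAbsGradPow (μ - n) (fun x => w₁ x * starRingEnd ℂ (w₂ x)) v ∧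
    g = fun x => κ * (v x).re

/-- `∂ₜ u = G` for `t ∈ [1, ∞)` (one-sided at `t = 1`), in the sense of tempered distributions. -/
def HasTimeDeriv {n : ℕ} (u G : ℝ → Sp n → ℂ) : Prop :=
  ∀ t, 1 ≤ t → IsTempered (u t) ∧ IsTempered (G t) ∧
    ∀ ψ : 𝓢(Sp n, ℂ),
      HasDerivWithinAt (fun τ => ∫ x, u τ x * ψ x) (∫ x, G t x * ψ x) (Set.Ici 1) t

/-- `u(t) → 0` as `t → ∞`, in the sense of tempered distributions. -/
def VanishesAtInfinity {n : ℕ} (u : ℝ → Sp n → ℂ) : Prop :=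
  ∀ ψ : 𝓢(Sp n, ℂ), Tendsto (fun t => ∫ x, u t x * ψ x) atTop (𝓝 0)

/-- The amplitude equation
`∂ₜ w_{m+1} = (2t²)⁻¹ ∑_{0 ≤ j ≤ m} (2 ∇φ_j·∇ + (Δφ_j)) w_{m-j}`. -/
def AmplitudeEq {n : ℕ} (w : ℕ → ℝ → Sp n → ℂ) (φ : ℕ → ℝ → Sp n → ℝ) (m : ℕ) : Prop :=
  ∃ G : ℕ → ℝ → Sp n → ℂ,
    (∀ j ∈ Finset.range (m + 1), ∀ t, 1 ≤ t →
      IsTransportTerm (φ j t) (w (m - j) t) (G j t)) ∧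
    HasTimeDeriv (w (m + 1)) (fun t x =>
      (((2 * t ^ 2)⁻¹ : ℝ) : ℂ) * ∑ j ∈ Finset.range (m + 1), G j t x)

/-- The phase equation
`∂ₜ φ_m = (2t²)⁻¹ ∑_{0 ≤ j ≤ m-1} ∇φ_j·∇φ_{m-1-j} + t^(-γ) ∑_{0 ≤ j ≤ m} g₀(w_j, w_{m-j})`,
where the first sum is empty for `m = 0`. -/
def PhaseEq {n : ℕ} (κ μ γ : ℝ) (w : ℕ → ℝ → Sp n → ℂ) (φ : ℕ → ℝ → Sp n → ℝ) (m : ℕ) : Prop :=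
  ∃ (G : ℕ → ℝ → Sp n → ℂ) (g : ℕ → ℝ → Sp n → ℝ),
    (∀ j ∈ Finset.range m, ∀ t, 1 ≤ t → IsGradDot (φ j t) (φ (m - 1 - j) t) (G j t)) ∧
    (∀ j ∈ Finset.range (m + 1), ∀ t, 1 ≤ t → IsG0 κ μ (w j t) (w (m - j) t) (g j t)) ∧
    HasTimeDeriv (fun t => toC (φ m t)) (fun t x =>
      (((2 * t ^ 2)⁻¹ : ℝ) : ℂ) * ∑ j ∈ Finset.range m, G j t x +
        ((t ^ (-γ) : ℝ) : ℂ) * ∑ j ∈ Finset.range (m + 1), (g j t x : ℂ))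

/-- `w₀ = w₊, w₁, …, w_{p+1}` and `φ₀, …, φ_p` solve the triangular system on `[1, ∞)` with
`w_m(∞) = 0` for `1 ≤ m ≤ p + 1` and `φ_m(1) = 0` for `0 ≤ m ≤ p`. -/
structure IsSolution {n : ℕ} (κ μ γ : ℝ) (p : ℕ) (wPlus : Sp n → ℂ)
    (w : ℕ → ℝ → Sp n → ℂ) (φ : ℕ → ℝ → Sp n → ℝ) : Prop where
  zero : ∀ t, 1 ≤ t → w 0 t =ᵐ[volume] wPlus
  amplitude : ∀ m ≤ p, AmplitudeEq w φ m
  amplitude_infty : ∀ m ≤ p, VanishesAtInfinity (w (m + 1))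
  phase : ∀ m ≤ p, PhaseEq κ μ γ w φ m
  phase_one : ∀ m ≤ p, φ m 1 =ᵐ[volume] 0

/-- `φ_{p+1}` solves the phase equation of index `p + 1` on `[1, ∞)` with `φ_{p+1}(∞) = 0`. -/
structure IsTopPhase {n : ℕ} (κ μ γ : ℝ) (p : ℕ)
    (w : ℕ → ℝ → Sp n → ℂ) (φ : ℕ → ℝ → Sp n → ℝ) : Prop where
  phase : PhaseEq κ μ γ w φ (p + 1)
  phase_infty : VanishesAtInfinity (fun t => toC (φ (p + 1) t))

/-! ### Estimating functions of time and exponents -/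

/-- `h(t) = ∫_1^∞ (t ∨ t₁)⁻¹ h₀'(t₁) dt₁`, with `h₀'(t) = t^(-γ)`. -/
def hBar (γ t : ℝ) : ℝ := ∫ s in Set.Ioi (1 : ℝ), (max t s)⁻¹ * s ^ (-γ)

/-- `N_m(t) = ∫_1^t h₀'(t₁) h(t₁)^m dt₁`. -/
def NBar (γ : ℝ) (m : ℕ) (t : ℝ) : ℝ := ∫ s in (1 : ℝ)..t, s ^ (-γ) * hBar γ s ^ m

/-- `Q_m(t) = ∫_1^∞ (t ∨ t₁)⁻¹ h₀'(t₁) h(t₁)^m dt₁`. -/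
def QBar (γ : ℝ) (m : ℕ) (t : ℝ) : ℝ :=
  ∫ s in Set.Ioi (1 : ℝ), (max t s)⁻¹ * s ^ (-γ) * hBar γ s ^ m

/-- `P_m(t) = ∫_1^∞ h(t ∨ t₁) h₀'(t₁) h(t₁)^m dt₁`, convergent for `(m + 2)γ > 1`. -/
def PBar (γ : ℝ) (m : ℕ) (t : ℝ) : ℝ :=
  ∫ s in Set.Ioi (1 : ℝ), hBar γ (max t s) * s ^ (-γ) * hBar γ s ^ m

/-- `λ = μ - n + 2`. -/
def lam (n : ℕ) (μ : ℝ) : ℝ := μ - n + 2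

/-- `λ̄ = λ ∨ 1`. -/
def lamBar (n : ℕ) (μ : ℝ) : ℝ := max (lam n μ) 1

/-- `k_m = k - m λ̄`. -/
def kExp (n : ℕ) (μ k : ℝ) (m : ℕ) : ℝ := k - m * lamBar n μ

/-- `ℓ_m = k - m λ̄ - λ`. -/
def lExp (n : ℕ) (μ k : ℝ) (m : ℕ) : ℝ := k - m * lamBar n μ - lam n μ

end HartreeAsymptotics

end

/-! Take as unknowns the Fourier transforms of amplitudes and phases multiplied by the weights of
their spaces; these live in L². Each term of the system becomes a bilinear convolution operator with
kernel ω(η+ζ) σ(η,ζ) / (ω₁(η) ω₂(ζ)). Such an operator is bounded on L² as soon as its kernel is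
dominated by c₁(η) + c₂(ζ) + c₃(η+ζ) with square integrable cᵢ (`KerBound.nrm_lconv_le`). The factor
f is submultiplicative, so it drops out with constant one for all ρ ≥ 0 and ν in [0,1]. The
polynomial weights leave (|ξ| ∨ 1)^(-k) (|ξ| ∧ 1)^(-ℓ_<), which is in L² because k > n/2 and ℓ_< <
n/2; for g₀ at low output frequency they leave |ξ|^(ℓ_<+μ-n), which is locally in L² because ℓ_< >
n/2 - μ. One step of the system costs λ̄ derivatives, and k ≥ (p+2)λ̄ - 1 keeps enough of them up to
index p + 1.

The system is triangular, so in L² it is solved by successive time integrations (`exists_evolves`).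
With dσ = t^(-γ) dt, the estimating functions are iterated integrals against σ. Fubini and the
monotonicity of h show that products and integrals of N, Q stay in the family with added indices
(`N_mul_q_le`, `q_mul_q_le`, `lintegral_Ioc_r2_N_N_le`), with numerical constants that do not see σ.
Induction on the index (`majorant`) then bounds everything in terms of the operator bound and the
size of the datum alone, which is the uniformity in γ. The same induction, run on max(‖x‖, ‖x'‖, ‖x
- x'‖/δ) with δ the distance of the data, yields the Lipschitz estimates.

For gauge invariance, the equation ∂ₜ|w|² = t⁻² ∇·(|w|² ∇φ) holds order by order: the coefficients
of |w|² of positive index vanish at infinity and are driven by densities and phases of lower index,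
while g₀ depends only on the density. So |w₊|² determines all phases (`Evolves.gauge`).

The return to distributions rests on two facts. The transform of a product is a convolution when
both transforms lie in L¹ + L² (`HasFourier.mul`), so the operators represent the actual terms. The
difference of two solutions, tested against a Schwartz function, has zero time derivative, and the
condition at 1 or at infinity fixes the constant (`IsSolution.ae_eq`). Hence every solution is the
constructed one and inherits its estimates. -/

noncomputable section

open MeasureTheory Filter Topology
open scoped ENNReal SchwartzMap FourierTransform NNReal

namespace HartreeAsymptotics

/-! ### Estimating functions of time, for a general measure -/

namespace Time

/-- The decreasing weight `(t ∨ 1)⁻¹`. -/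
def r (t : ℝ) : ℝ≥0∞ := ENNReal.ofReal (max t 1)⁻¹

/-- The weight `t⁻²`. -/
def r2 (t : ℝ) : ℝ≥0∞ := ENNReal.ofReal (t ^ 2)⁻¹

variable (σ : Measure ℝ)

/-- `h(t) = ∫ (t ∨ s)⁻¹ dσ(s)`. -/
def h (t : ℝ) : ℝ≥0∞ := ∫⁻ s, r (max t s) ∂σ

/-- `N_m(t) = ∫_{s ≤ t} h(s)^m dσ(s)`. -/
def N (m : ℕ) (t : ℝ) : ℝ≥0∞ := ∫⁻ s in Set.Iic t, h σ s ^ m ∂σ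

/-- `Q_m(t) = ∫ (t ∨ s)⁻¹ h(s)^m dσ(s)`. -/
def Q (m : ℕ) (t : ℝ) : ℝ≥0∞ := ∫⁻ s, r (max t s) * h σ s ^ m ∂σ

/-- `P_m(t) = ∫ h(t ∨ s) h(s)^m dσ(s)`. -/
def P (m : ℕ) (t : ℝ) : ℝ≥0∞ := ∫⁻ s, h σ (max t s) * h σ s ^ m ∂σ

/-- The decay rate of the amplitude of index `m`: `1` for `m = 0` and `Q_{m-1}` otherwise. -/
def q : ℕ → ℝ → ℝ≥0∞
  | 0, _ => 1
  | m + 1, t => Q σ m t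

lemma r_antitone : Antitone r := by
  intro a b hab
  unfold r
  gcongr

lemma r_measurable : Measurable r := r_antitone.measurable

lemma r2_measurable : Measurable r2 := by unfold r2; fun_prop

lemma h_antitone : Antitone (h σ) := fun a b hab =>
  lintegral_mono fun s => r_antitone (max_le_max_right s hab)

lemma h_measurable : Measurable (h σ) := (h_antitone σ).measurable

lemma N_mono (m : ℕ) : Monotone (N σ m) := fun _ _ hab =>
  lintegral_mono_set (Set.Iic_subset_Iic.2 hab)

lemma N_measurable (m : ℕ) : Measurable (N σ m) := (N_mono σ m).measurable

lemma Q_antitone (m : ℕ) : Antitone (Q σ m) := fun a b hab =>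
  lintegral_mono fun s => mul_le_mul_left (r_antitone (max_le_max_right s hab)) _

lemma Q_measurable (m : ℕ) : Measurable (Q σ m) := (Q_antitone σ m).measurable

lemma q_measurable (m : ℕ) : Measurable (q σ m) := by
  cases m with
  | zero => exact measurable_const
  | succ m => exact Q_measurable σ m

lemma lintegral_Ioi_r2 {t : ℝ} (ht : 1 ≤ t) : ∫⁻ s in Set.Ioi t, r2 s = r t := by
  have h0 : (0 : ℝ) < t := by linarith
  have hi : IntegrableOn (fun s : ℝ => s ^ (-2 : ℝ)) (Set.Ioi t) :=
    integrableOn_Ioi_rpow_of_lt (by norm_num) h0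
  have hv := integral_Ioi_rpow_of_lt (a := -2) (by norm_num) h0
  have he : ∫⁻ s in Set.Ioi t, r2 s = ∫⁻ s in Set.Ioi t, ENNReal.ofReal (s ^ (-2 : ℝ)) := by
    refine setLIntegral_congr_fun measurableSet_Ioi fun s hs => ?_
    have : (0 : ℝ) < s := h0.trans hs
    simp only [r2]
    rw [Real.rpow_neg this.le]; norm_cast
  rw [he, ← ofReal_integral_eq_lintegral_ofReal hi, hv, r, max_eq_left ht]
  · congr 1
    norm_num
    rw [Real.rpow_neg_one]
  · filter_upwards [self_mem_ae_restrict measurableSet_Ioi] with s hs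
    exact Real.rpow_nonneg (h0.trans hs).le _

variable {σ} [SFinite σ]

/-- Fubini: for fixed x the variable s runs over s > t, s ≥ x, and the integral of s⁻² there is (t ∨
x)⁻¹. This is how a phase of size `N` in the transport term produces an amplitude of size `Q`. -/
lemma lintegral_Ioi_r2_N (m : ℕ) {t : ℝ} (ht : 1 ≤ t) :
    ∫⁻ s in Set.Ioi t, r2 s * N σ m s = Q σ m t := by
  have e1 : ∀ s, r2 s * N σ m s
      = ∫⁻ x, r2 s * (Set.Ici x).indicator (fun _ => h σ x ^ m) s ∂σ := by
    intro s
    rw [N, ← lintegral_indicator measurableSet_Iic, ← lintegral_const_mul]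
    · rfl
    · exact ((h_measurable σ).pow_const m).indicator measurableSet_Iic
  have hm : Measurable (Function.uncurry fun s x =>
      r2 s * (Set.Ici x).indicator (fun _ => h σ x ^ m) s) := by
    refine (r2_measurable.comp measurable_fst).mul ?_
    exact (((h_measurable σ).pow_const m).comp measurable_snd).indicator
      (measurableSet_le measurable_snd measurable_fst)
  simp_rw [e1]
  rw [lintegral_lintegral_swap hm.aemeasurable]
  refine lintegral_congr fun x => ?_
  have e2 : ∀ s, r2 s * (Set.Ici x).indicator (fun _ => h σ x ^ m) s
      = (Set.Ici x).indicator (fun s => r2 s * h σ x ^ m) s := by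
    intro s
    by_cases hs : s ∈ Set.Ici x <;> simp [hs]
  simp_rw [e2]
  rw [setLIntegral_indicator measurableSet_Ici, lintegral_mul_const _ r2_measurable]
  congr 1
  rw [← lintegral_Ioi_r2 (le_max_of_le_left ht)]
  refine setLIntegral_congr ?_
  by_cases hx : t < x
  · rw [max_eq_right hx.le, Set.inter_eq_left.2 (Set.Ici_subset_Ioi.2 hx)]
    exact Ioi_ae_eq_Ici.symm
  · rw [max_eq_left (not_lt.1 hx), Set.inter_eq_right.2
      (Set.Ioi_subset_Ici (not_lt.1 hx))]
    exact ae_eq_refl _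

/-- A symmetric double integral of powers of `h` is controlled by the part where the smaller
variable carries all the powers. -/
lemma lintegral_lintegral_le {K : ℝ → ℝ → ℝ≥0∞} (hK : Measurable (Function.uncurry K))
    (hsym : ∀ x y, K x y = K y x) {L : ℝ → ℝ≥0∞}
    (hL : ∀ x, ∫⁻ y in Set.Ici x, K x y ∂σ ≤ L x) (i j : ℕ) :
    ∫⁻ x, ∫⁻ y, K x y * (h σ x ^ i * h σ y ^ j) ∂σ ∂σ ≤ 2 * ∫⁻ x, L x * h σ x ^ (i + j) ∂σ := by
  let F : ℝ → ℝ → ℝ≥0∞ := fun x y => (Set.Ici x).indicator (fun y => K x y * h σ x ^ (i + j)) y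
  have hF : Measurable (Function.uncurry F) := by
    have : Function.uncurry F = Set.indicator {z : ℝ × ℝ | z.1 ≤ z.2}
        (fun z => K z.1 z.2 * h σ z.1 ^ (i + j)) := by
      ext ⟨x, y⟩
      simp [F, Set.indicator]
    rw [this]
    exact (hK.mul (((h_measurable σ).pow_const _).comp measurable_fst)).indicator
      (measurableSet_le measurable_fst measurable_snd)
  have h1 : ∀ x, ∫⁻ y, F x y ∂σ ≤ L x * h σ x ^ (i + j) := by
    intro x
    simp only [F]
    rw [lintegral_indicator measurableSet_Ici, lintegral_mul_const _ hK.of_uncurry_left]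
    gcongr
    exact hL x
  -- `h` is nonincreasing, so the smaller of the two variables may carry all `i + j` powers. The two
  -- half-planes have equal integrals by symmetry, whence the factor 2.
  have h2 : ∀ x y, K x y * (h σ x ^ i * h σ y ^ j) ≤ F x y + F y x := by
    intro x y
    rcases le_total x y with hxy | hxy
    · refine le_add_right ?_
      simp only [F, Set.indicator_of_mem (Set.mem_Ici.2 hxy), pow_add]
      gcongr
      exact h_antitone σ hxy
    · refine le_add_left ?_
      simp only [F, Set.indicator_of_mem (Set.mem_Ici.2 hxy), pow_add, hsym x y]
      gcongr
      exact h_antitone σ hxy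
  have hF' : Measurable (Function.uncurry fun x y => F y x) := hF.comp measurable_swap
  calc _ ≤ ∫⁻ x, ∫⁻ y, (F x y + F y x) ∂σ ∂σ :=
        lintegral_mono fun x => lintegral_mono fun y => h2 x y
    _ = ∫⁻ x, ∫⁻ y, F x y ∂σ ∂σ + ∫⁻ x, ∫⁻ y, F y x ∂σ ∂σ := by
        rw [← lintegral_add_left (f := fun x => ∫⁻ y, F x y ∂σ) hF.lintegral_prod_right']
        exact lintegral_congr fun x => lintegral_add_left hF.of_uncurry_left _
    _ = 2 * ∫⁻ x, ∫⁻ y, F x y ∂σ ∂σ := by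
        rw [lintegral_lintegral_swap hF'.aemeasurable, two_mul]
    _ ≤ _ := by
        gcongr with x
        exact h1 x

lemma lintegral_indicator_Iic_mul_h (m : ℕ) (t : ℝ) :
    ∫⁻ x, (Set.Iic t).indicator (h σ) x * h σ x ^ m ∂σ = N σ (m + 1) t := by
  rw [N, ← lintegral_indicator measurableSet_Iic]
  refine lintegral_congr fun x => ?_
  by_cases hx : x ∈ Set.Iic t <;> simp [hx, pow_succ']

lemma N_mul_N_eq (i j : ℕ) (t : ℝ) :
    N σ i t * N σ j t = ∫⁻ x, ∫⁻ y,
      ((Set.Iic t).indicator 1 x * (Set.Iic t).indicator 1 y) * (h σ x ^ i * h σ y ^ j) ∂σ ∂σ := by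
  have e : ∀ m, N σ m t = ∫⁻ x, (Set.Iic t).indicator 1 x * h σ x ^ m ∂σ := by
    intro m
    rw [N, ← lintegral_indicator measurableSet_Iic]
    refine lintegral_congr fun x => ?_
    by_cases hx : x ∈ Set.Iic t <;> simp [hx]
  have hm : ∀ m, Measurable fun x => (Set.Iic t).indicator (1 : ℝ → ℝ≥0∞) x * h σ x ^ m := fun m =>
    (measurable_one.indicator measurableSet_Iic).mul ((h_measurable σ).pow_const m)
  rw [e, e, ← lintegral_mul_const _ (hm i)]
  refine lintegral_congr fun x => ?_
  rw [← lintegral_const_mul _ (hm j)]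
  exact lintegral_congr fun y => by ring

/-- On the square x, y ≤ t one has t⁻¹ ≤ (x ∨ y)⁻¹, and integrating this kernel over the larger
variable supplies the additional factor h(x). -/
lemma r_mul_N_mul_N_le (i j : ℕ) (t : ℝ) : r t * (N σ i t * N σ j t) ≤ 2 * N σ (i + j + 1) t := by
  rw [N_mul_N_eq, ← lintegral_indicator_Iic_mul_h]
  have hind : Measurable ((Set.Iic t).indicator (1 : ℝ → ℝ≥0∞)) :=
    measurable_one.indicator measurableSet_Iic
  have hK : Measurable (Function.uncurry fun x y : ℝ =>
      r t * ((Set.Iic t).indicator (1 : ℝ → ℝ≥0∞) x * (Set.Iic t).indicator 1 y)) :=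
    ((hind.comp measurable_fst).mul (hind.comp measurable_snd)).const_mul _
  refine le_trans (le_of_eq ?_) (lintegral_lintegral_le hK (fun x y => by ring) ?_ i j)
  · have hm : Measurable (Function.uncurry fun x y : ℝ =>
        ((Set.Iic t).indicator (1 : ℝ → ℝ≥0∞) x * (Set.Iic t).indicator 1 y) *
          (h σ x ^ i * h σ y ^ j)) :=
      ((hind.comp measurable_fst).mul (hind.comp measurable_snd)).mul
        ((((h_measurable σ).pow_const _).comp measurable_fst).mul
          (((h_measurable σ).pow_const _).comp measurable_snd))
    refine (lintegral_const_mul _ hm.lintegral_prod_right').symm.trans ?_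
    refine lintegral_congr fun x => ?_
    refine (lintegral_const_mul _ hm.of_uncurry_left).symm.trans ?_
    exact lintegral_congr fun y => by ring
  · intro x
    by_cases hx : x ∈ Set.Iic t
    · rw [Set.indicator_of_mem hx (h σ)]
      unfold h
      refine (setLIntegral_le_lintegral _ _).trans (lintegral_mono fun y => ?_)
      by_cases hy : y ∈ Set.Iic t
      · simp only [Set.indicator_of_mem hx, Set.indicator_of_mem hy, Pi.one_apply, mul_one]
        exact r_antitone (max_le hx hy)
      · simp [hy]
    · simp [hx]

lemma lintegral_Ioi_r_h_le (m : ℕ) (t : ℝ) :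
    ∫⁻ s in Set.Ioi t, r (max t s) * h σ s ^ m ∂σ ≤ h σ t ^ (m + 1) := by
  have hr : Measurable fun s => r (max t s) := r_measurable.comp (measurable_const.max measurable_id)
  have e : h σ t ^ (m + 1) = ∫⁻ s, r (max t s) * h σ t ^ m ∂σ := by
    rw [lintegral_mul_const _ hr, pow_succ']; rfl
  rw [e]
  refine (setLIntegral_mono_ae' measurableSet_Ioi (ae_of_all _ fun s hs => ?_)).trans
    (setLIntegral_le_lintegral _ _)
  gcongr
  exact h_antitone σ (le_of_lt hs)

lemma h_pow_mul_N_le (i j : ℕ) (t : ℝ) : N σ j t * h σ t ^ i ≤ N σ (i + j) t := by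
  rw [N, N, ← lintegral_mul_const _ ((h_measurable σ).pow_const _)]
  refine setLIntegral_mono_ae' measurableSet_Iic (ae_of_all _ fun s hs => ?_)
  rw [pow_add, mul_comm]
  gcongr
  exact h_antitone σ hs

/-- Split at s = t: before t the weight is the constant t⁻¹, after t the powers of h(s) are at most
those of h(t). Both pieces can then be multiplied by `N`. -/
lemma Q_le (m : ℕ) (t : ℝ) : Q σ m t ≤ r t * N σ m t + h σ t ^ (m + 1) := by
  rw [Q, ← lintegral_add_compl _ (measurableSet_Iic (a := t)), Set.compl_Iic]
  gcongr
  · rw [N, ← lintegral_const_mul _ ((h_measurable σ).pow_const _)]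
    exact setLIntegral_mono_ae' measurableSet_Iic (ae_of_all _ fun s hs => by
      rw [max_eq_left (Set.mem_Iic.1 hs)])
  · exact lintegral_Ioi_r_h_le m t

lemma N_mul_Q_le (i j : ℕ) (t : ℝ) : N σ j t * Q σ i t ≤ 3 * N σ (j + i + 1) t := by
  calc _ ≤ N σ j t * (r t * N σ i t + h σ t ^ (i + 1)) := by gcongr; exact Q_le i t
    _ = r t * (N σ j t * N σ i t) + N σ j t * h σ t ^ (i + 1) := by ring
    _ ≤ 2 * N σ (j + i + 1) t + N σ (i + 1 + j) t :=
        add_le_add (r_mul_N_mul_N_le j i t) (h_pow_mul_N_le _ _ _)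
    _ = _ := by rw [show i + 1 + j = j + i + 1 by ring]; ring

lemma N_mul_q_le (i j : ℕ) (t : ℝ) : N σ j t * q σ i t ≤ 3 * N σ (j + i) t := by
  cases i with
  | zero => simpa [q] using le_mul_of_one_le_left zero_le (by norm_num : (1 : ℝ≥0∞) ≤ 3)
  | succ i => exact N_mul_Q_le i j t

/-- In the double integral with kernel (t ∨ x)⁻¹ (t ∨ y)⁻¹ and x ≤ y, the second factor is at most
(x ∨ y)⁻¹; integrating it in y gives h(x), and the first factor survives as the weight of `Q`. -/
lemma Q_mul_Q_le (i j : ℕ) (t : ℝ) : Q σ i t * Q σ j t ≤ 2 * Q σ (i + j + 1) t := by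
  have hr : Measurable fun s => r (max t s) := r_measurable.comp (measurable_const.max measurable_id)
  have hm : ∀ m, Measurable fun s => r (max t s) * h σ s ^ m := fun m =>
    hr.mul ((h_measurable σ).pow_const m)
  have hK : Measurable (Function.uncurry fun x y : ℝ => r (max t x) * r (max t y)) :=
    (hr.comp measurable_fst).mul (hr.comp measurable_snd)
  have e : Q σ (i + j + 1) t = ∫⁻ x, (r (max t x) * h σ x) * h σ x ^ (i + j) ∂σ :=
    lintegral_congr fun x => by rw [pow_succ]; ring
  rw [e]
  refine le_trans (le_of_eq ?_) (lintegral_lintegral_le hK (fun x y => by ring) ?_ i j)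
  · rw [Q, Q, ← lintegral_mul_const _ (hm i)]
    refine lintegral_congr fun x => ?_
    rw [← lintegral_const_mul _ (hm j)]
    exact lintegral_congr fun y => by ring
  · intro x
    rw [lintegral_const_mul _ hr]
    refine mul_le_mul' le_rfl ?_
    refine (setLIntegral_mono_ae' (measurableSet_Ici (a := x)) (ae_of_all _ fun y hy => ?_)).trans
      (setLIntegral_le_lintegral _ _)
    exact r_antitone (max_le (le_max_of_le_right hy) (le_max_right _ _))

lemma q_mul_q_le (i j : ℕ) (t : ℝ) : q σ i t * q σ j t ≤ 2 * q σ (i + j) t := by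
  have h2 : (1 : ℝ≥0∞) ≤ 2 := by norm_num
  rcases i with _ | i <;> rcases j with _ | j
  · simp [q]
  · simpa [q] using le_mul_of_one_le_left zero_le h2
  · simpa [q] using le_mul_of_one_le_left zero_le h2
  · rw [show i + 1 + (j + 1) = (i + j + 1) + 1 by ring]
    exact Q_mul_Q_le i j t

/-- The double integral behind `∫ s⁻² N_i(s) N_j(s) ds`. -/
lemma lintegral_r2_N_N (S : Set ℝ) (hS : MeasurableSet S) (i j : ℕ) :
    ∫⁻ s in S, r2 s * (N σ i s * N σ j s) = ∫⁻ x, ∫⁻ y,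
      (∫⁻ s in S ∩ Set.Ici (max x y), r2 s) * (h σ x ^ i * h σ y ^ j) ∂σ ∂σ := by
  let G : ℝ → ℝ × ℝ → ℝ≥0∞ := fun s z =>
    r2 s * (((Set.Iic s).indicator 1 z.1 * (Set.Iic s).indicator 1 z.2) *
      (h σ z.1 ^ i * h σ z.2 ^ j))
  have i1 : Measurable fun z : ℝ × (ℝ × ℝ) => (Set.Iic z.1).indicator (1 : ℝ → ℝ≥0∞) z.2.1 :=
    (measurable_one (α := ℝ≥0∞)).indicator
      (measurableSet_le (measurable_fst.comp measurable_snd) measurable_fst)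
  have i2 : Measurable fun z : ℝ × (ℝ × ℝ) => (Set.Iic z.1).indicator (1 : ℝ → ℝ≥0∞) z.2.2 :=
    (measurable_one (α := ℝ≥0∞)).indicator
      (measurableSet_le (measurable_snd.comp measurable_snd) measurable_fst)
  have hG : Measurable (Function.uncurry G) := by
    refine (r2_measurable.comp measurable_fst).mul ((i1.mul i2).mul (Measurable.mul ?_ ?_))
    · exact ((h_measurable σ).pow_const _).comp (measurable_fst.comp measurable_snd)
    · exact ((h_measurable σ).pow_const _).comp (measurable_snd.comp measurable_snd)
  have hind : ∀ s : ℝ, Measurable ((Set.Iic s).indicator (1 : ℝ → ℝ≥0∞)) := fun s =>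
    measurable_one.indicator measurableSet_Iic
  have hm : ∀ s, Measurable fun z : ℝ × ℝ =>
      ((Set.Iic s).indicator (1 : ℝ → ℝ≥0∞) z.1 * (Set.Iic s).indicator 1 z.2) *
        (h σ z.1 ^ i * h σ z.2 ^ j) := fun s =>
    (((hind s).comp measurable_fst).mul ((hind s).comp measurable_snd)).mul
      ((((h_measurable σ).pow_const _).comp measurable_fst).mul
        (((h_measurable σ).pow_const _).comp measurable_snd))
  have e1 : ∀ s, r2 s * (N σ i s * N σ j s) = ∫⁻ z, G s z ∂(σ.prod σ) := by
    intro s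
    rw [N_mul_N_eq, lintegral_const_mul _ (hm s), lintegral_prod _ (hm s).aemeasurable]
  simp_rw [e1]
  rw [lintegral_lintegral_swap hG.aemeasurable, lintegral_prod
    (f := fun z => ∫⁻ s in S, G s z) (hG.comp measurable_swap).lintegral_prod_right'.aemeasurable]
  refine lintegral_congr fun x => lintegral_congr fun y => ?_
  rw [Set.inter_comm, ← setLIntegral_indicator measurableSet_Ici, ← lintegral_mul_const _
    (r2_measurable.indicator measurableSet_Ici)]
  refine lintegral_congr fun s => ?_
  simp only [G, Set.indicator, Set.mem_Iic, Set.mem_Ici, max_le_iff, Pi.one_apply]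
  by_cases hx : x ≤ s <;> by_cases hy : y ≤ s <;> simp [hx, hy]

lemma lintegral_inter_Ici_r2_le {S : Set ℝ} {t u : ℝ} (hS : S ⊆ Set.Ioi t) (ht : 1 ≤ t) :
    ∫⁻ s in S ∩ Set.Ici u, r2 s ≤ r (max t u) := by
  rw [← lintegral_Ioi_r2 (le_max_of_le_left ht), setLIntegral_congr (Ioi_ae_eq_Ici (a := max t u))]
  exact lintegral_mono_set fun s hs => Set.mem_Ici.2 (max_le (le_of_lt (hS hs.1)) hs.2)

/-- After Fubini the time variable is bounded below by x ∨ y, so its integral is at most (x ∨ y)⁻¹;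
integration over the larger variable produces one more power of h. -/
lemma lintegral_Ioc_r2_N_N_le (i j : ℕ) (t : ℝ) :
    ∫⁻ s in Set.Ioc 1 t, r2 s * (N σ i s * N σ j s) ≤ 2 * N σ (i + j + 1) t := by
  have hind : Measurable ((Set.Iic t).indicator (1 : ℝ → ℝ≥0∞)) :=
    measurable_one.indicator measurableSet_Iic
  have hr : Measurable fun z : ℝ × ℝ => r (max z.1 z.2) :=
    r_measurable.comp (measurable_fst.max measurable_snd)
  have hK : Measurable (Function.uncurry fun x y : ℝ =>
      r (max x y) * ((Set.Iic t).indicator (1 : ℝ → ℝ≥0∞) x * (Set.Iic t).indicator 1 y)) :=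
    hr.mul ((hind.comp measurable_fst).mul (hind.comp measurable_snd))
  rw [lintegral_r2_N_N _ measurableSet_Ioc, ← lintegral_indicator_Iic_mul_h]
  refine le_trans ?_ (lintegral_lintegral_le hK (fun x y => by rw [max_comm]; ring) ?_ i j)
  · refine lintegral_mono fun x => lintegral_mono fun y => ?_
    gcongr
    by_cases hxy : max x y ≤ t
    · have hx : x ∈ Set.Iic t := (le_max_left _ _).trans hxy
      have hy : y ∈ Set.Iic t := (le_max_right _ _).trans hxy
      simp only [Set.indicator_of_mem hx, Set.indicator_of_mem hy, Pi.one_apply, mul_one]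
      refine (lintegral_inter_Ici_r2_le Set.Ioc_subset_Ioi_self le_rfl).trans (le_of_eq ?_)
      rw [r, r, max_comm 1, max_assoc, max_self]
    · have : Set.Ioc 1 t ∩ Set.Ici (max x y) = ∅ := by
        ext s
        simp only [Set.mem_inter_iff, Set.mem_Ioc, Set.mem_Ici, Set.mem_empty_iff_false, iff_false]
        rintro ⟨⟨_, h2⟩, h3⟩
        exact hxy (h3.trans h2)
      simp [this]
  · intro x
    by_cases hx : x ∈ Set.Iic t
    · rw [Set.indicator_of_mem hx (h σ)]
      unfold h
      refine (setLIntegral_le_lintegral _ _).trans (lintegral_mono fun y => ?_)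
      by_cases hy : y ∈ Set.Iic t <;> simp [Set.indicator_of_mem hx, hy]
    · simp [hx]

/-- Here the time integral starts at t ∨ x ∨ y, so the integration in y gives h(t ∨ x). This is the
origin of the weight in `P`, the rate of a phase that vanishes at infinity. -/
lemma lintegral_Ioi_r2_N_N_le (i j : ℕ) {t : ℝ} (ht : 1 ≤ t) :
    ∫⁻ s in Set.Ioi t, r2 s * (N σ i s * N σ j s) ≤ 2 * P σ (i + j) t := by
  have hK : Measurable (Function.uncurry fun x y : ℝ => r (max t (max x y))) :=
    r_measurable.comp (measurable_const.max (measurable_fst.max measurable_snd))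
  rw [lintegral_r2_N_N _ measurableSet_Ioi, P]
  refine le_trans ?_ (lintegral_lintegral_le hK (fun x y => by rw [max_comm x]) ?_ i j)
  · refine lintegral_mono fun x => lintegral_mono fun y => ?_
    gcongr
    exact lintegral_inter_Ici_r2_le subset_rfl ht
  · intro x
    rw [h]
    refine (setLIntegral_le_lintegral _ _).trans (lintegral_mono fun y => ?_)
    rw [max_assoc]

/-- Exchange the two integrals. For x ≤ t the inner one is at most h(x), which raises the power. For
x > t the kernel x⁻¹ no longer depends on s ≤ t and factors out `N σ 0 t`, leaving a tail bounded by
h(t)^(m+1); that product is again at most `N σ (m + 1) t`. -/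
lemma lintegral_Ioc_Q_le (m : ℕ) (t : ℝ) :
    ∫⁻ s in Set.Ioc 1 t, Q σ m s ∂σ ≤ 2 * N σ (m + 1) t := by
  have hr : Measurable fun z : ℝ × ℝ => r (max z.1 z.2) :=
    r_measurable.comp (measurable_fst.max measurable_snd)
  have hm : Measurable (Function.uncurry fun s x => r (max s x) * h σ x ^ m) :=
    hr.mul (((h_measurable σ).pow_const _).comp measurable_snd)
  have hr' : ∀ x, Measurable fun s => r (max s x) := fun x =>
    r_measurable.comp (measurable_id.max measurable_const)
  refine (lintegral_mono_set (Set.Ioc_subset_Iic_self)).trans ?_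
  simp only [Q]
  rw [lintegral_lintegral_swap hm.aemeasurable,
    ← lintegral_add_compl _ (measurableSet_Iic (a := t)), Set.compl_Iic, two_mul]
  gcongr
  · rw [N]
    refine setLIntegral_mono_ae' measurableSet_Iic (ae_of_all _ fun x hx => ?_)
    rw [lintegral_mul_const _ (hr' x), pow_succ']
    gcongr
    refine (setLIntegral_le_lintegral _ _).trans (lintegral_mono fun y => ?_)
    simp only [max_comm, le_refl]
  · calc ∫⁻ x in Set.Ioi t, ∫⁻ s in Set.Iic t, r (max s x) * h σ x ^ m ∂σ ∂σ
        ≤ ∫⁻ x in Set.Ioi t, N σ 0 t * (r (max t x) * h σ x ^ m) ∂σ := by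
          refine setLIntegral_mono_ae' measurableSet_Ioi (ae_of_all _ fun x hx => ?_)
          rw [N, ← lintegral_mul_const _ ((h_measurable σ).pow_const _)]
          refine setLIntegral_mono_ae' measurableSet_Iic (ae_of_all _ fun s hs => ?_)
          have hx' : t ≤ x := le_of_lt hx
          rw [pow_zero, one_mul, max_eq_right hx', max_eq_right ((Set.mem_Iic.1 hs).trans hx')]
      _ ≤ N σ 0 t * h σ t ^ (m + 1) := by
          rw [lintegral_const_mul]
          · gcongr
            exact lintegral_Ioi_r_h_le m t
          · exact (r_measurable.comp (measurable_const.max measurable_id)).mul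
              ((h_measurable σ).pow_const _)
      _ ≤ _ := h_pow_mul_N_le _ _ _

lemma lintegral_Ioc_q_le (m : ℕ) (t : ℝ) : ∫⁻ s in Set.Ioc 1 t, q σ m s ∂σ ≤ 2 * N σ m t := by
  cases m with
  | zero =>
    simp only [q, N, pow_zero]
    exact (lintegral_mono_set Set.Ioc_subset_Iic_self).trans
      (le_mul_of_one_le_left zero_le (by norm_num))
  | succ m => exact lintegral_Ioc_Q_le m t

lemma lintegral_Ioi_Q_le (m : ℕ) (t : ℝ) : ∫⁻ s in Set.Ioi t, Q σ m s ∂σ ≤ P σ m t := by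
  have hr : Measurable fun z : ℝ × ℝ => r (max z.1 z.2) :=
    r_measurable.comp (measurable_fst.max measurable_snd)
  have hm : Measurable (Function.uncurry fun s x => r (max s x) * h σ x ^ m) :=
    hr.mul (((h_measurable σ).pow_const _).comp measurable_snd)
  have hr' : ∀ x, Measurable fun s => r (max s x) := fun x =>
    r_measurable.comp (measurable_id.max measurable_const)
  simp only [Q, P]
  rw [lintegral_lintegral_swap hm.aemeasurable]
  refine lintegral_mono fun x => ?_
  rw [lintegral_mul_const _ (hr' x)]
  gcongr
  rw [h]
  refine (setLIntegral_mono_ae' measurableSet_Ioi (ae_of_all _ fun s hs => ?_)).trans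
    (setLIntegral_le_lintegral _ _)
  exact r_antitone (max_le (max_le (le_max_of_le_left (le_of_lt hs)) (le_max_right _ _))
    (le_max_left _ _))

end Time

end HartreeAsymptotics

end

/-! ### The majorant induction: integral inequalities of the triangular system imply the stated
rates. -/

noncomputable section

open MeasureTheory Filter Topology
open scoped ENNReal SchwartzMap FourierTransform NNReal

namespace HartreeAsymptotics

namespace Time

/-- Constants `(X_m, Y_m)` in the estimates of the amplitudes and of the phases of index at most
`m`, for bilinear terms of size `C` and data of size `a`. -/
def coeff (C a : ℝ≥0) : ℕ → ℝ≥0 × ℝ≥0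
  | 0 => (a, C * (2 * (2 * a ^ 2)))
  | m + 1 =>
    let X := (coeff C a m).1 + 3 * C * (m + 1) * ((coeff C a m).2 * (coeff C a m).1)
    (X, (coeff C a m).2 +
      (C * ((m + 1) * (2 * (coeff C a m).2 ^ 2)) + C * ((m + 2) * (2 * (2 * X ^ 2)))))

lemma coeff_mono_index (C a : ℝ≥0) : Monotone (coeff C a) :=
  monotone_nat_of_le_succ fun m => ⟨le_self_add, le_self_add⟩

lemma coeff_mono (C : ℝ≥0) (m : ℕ) : Monotone fun a => coeff C a m := by
  intro a b hab
  induction m with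
  | zero => exact ⟨hab, by simp only [coeff]; gcongr⟩
  | succ m ih =>
    obtain ⟨h1, h2⟩ := ih
    simp only at h1 h2
    have hX : (coeff C a (m + 1)).1 ≤ (coeff C b (m + 1)).1 := by
      simp only [coeff]; gcongr
    refine ⟨hX, ?_⟩
    change (coeff C a m).2 + (_ + C * ((m + 2) * (2 * (2 * (coeff C a (m + 1)).1 ^ 2)))) ≤
      (coeff C b m).2 + (_ + C * ((m + 2) * (2 * (2 * (coeff C b (m + 1)).1 ^ 2))))
    gcongr

variable {σ : Measure ℝ} [SFinite σ]

lemma lintegral_sum_le_of_le {α ι : Type*} [MeasurableSpace α] {ν : Measure α} (s : Finset ι)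
    {f g : ι → α → ℝ≥0∞} {c B : ℝ≥0∞} (hg : ∀ i ∈ s, Measurable (g i))
    (hfg : ∀ i ∈ s, ∀ᵐ x ∂ν, f i x ≤ c * g i x) (hB : ∀ i ∈ s, ∫⁻ x, g i x ∂ν ≤ B) :
    ∫⁻ x, ∑ i ∈ s, f i x ∂ν ≤ s.card * (c * B) := by
  calc ∫⁻ x, ∑ i ∈ s, f i x ∂ν ≤ ∫⁻ x, ∑ i ∈ s, c * g i x ∂ν := by
        refine lintegral_mono_ae ?_
        have : ∀ᵐ x ∂ν, ∀ i ∈ s, f i x ≤ c * g i x := (ae_ball_iff s.countable_toSet).2 hfg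
        filter_upwards [this] with x hx
        exact Finset.sum_le_sum hx
    _ = ∑ i ∈ s, c * ∫⁻ x, g i x ∂ν := by
        rw [lintegral_finsetSum s fun i hi => (hg i hi).const_mul c]
        exact Finset.sum_congr rfl fun i hi => lintegral_const_mul c (hg i hi)
    _ ≤ ∑ _i ∈ s, c * B := Finset.sum_le_sum fun i hi => mul_le_mul' le_rfl (hB i hi)
    _ = _ := by rw [Finset.sum_const, nsmul_eq_mul]

/-- A bound for the time integral of the quadratic terms in the phases. -/
lemma lintegral_phase_phase_le {b : ℕ → ℝ → ℝ≥0∞} {Y : ℝ≥0∞} {m : ℕ} {S : Set ℝ}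
    (hS : MeasurableSet S) (hS1 : S ⊆ Set.Ici 1) {B : ℝ≥0∞}
    (hb : ∀ i < m, ∀ t, 1 ≤ t → b i t ≤ Y * N σ i t)
    (hB : ∀ i j, i + j + 1 = m → ∫⁻ s in S, r2 s * (N σ i s * N σ j s) ≤ B) :
    ∫⁻ s in S, r2 s * ∑ j ∈ Finset.range m, b j s * b (m - 1 - j) s ≤ m * (Y ^ 2 * B) := by
  simp_rw [Finset.mul_sum]
  have := lintegral_sum_le_of_le (ν := volume.restrict S) (Finset.range m)
    (f := fun j s => r2 s * (b j s * b (m - 1 - j) s))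
    (g := fun j s => r2 s * (N σ j s * N σ (m - 1 - j) s)) (c := Y ^ 2) (B := B)
    (fun j _ => r2_measurable.mul ((N_measurable σ _).mul (N_measurable σ _))) ?_ ?_
  · simpa using this
  · intro j hj
    have hj' := Finset.mem_range.1 hj
    filter_upwards [self_mem_ae_restrict hS] with s hs
    calc _ ≤ r2 s * ((Y * N σ j s) * (Y * N σ (m - 1 - j) s)) := by
          gcongr
          · exact hb j hj' s (hS1 hs)
          · exact hb _ (by omega) s (hS1 hs)
      _ = _ := by ring
  · intro j hj
    have hj' := Finset.mem_range.1 hj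
    exact hB _ _ (by omega)

/-- A bound for the time integral of the quadratic terms in the amplitudes. -/
lemma lintegral_amplitude_amplitude_le {a : ℕ → ℝ → ℝ≥0∞} {X : ℝ≥0∞} {m : ℕ} {S : Set ℝ}
    (hS : MeasurableSet S) (hS1 : S ⊆ Set.Ici 1) {B : ℝ≥0∞}
    (ha : ∀ i ≤ m, ∀ t, 1 ≤ t → a i t ≤ X * q σ i t) (hB : ∫⁻ s in S, q σ m s ∂σ ≤ B) :
    ∫⁻ s in S, ∑ j ∈ Finset.range (m + 1), a j s * a (m - j) s ∂σ
      ≤ (m + 1) * (2 * X ^ 2 * B) := by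
  have := lintegral_sum_le_of_le (ν := σ.restrict S) (Finset.range (m + 1))
    (f := fun j s => a j s * a (m - j) s) (g := fun _ s => q σ m s) (c := 2 * X ^ 2) (B := B)
    (fun j _ => q_measurable σ _) ?_ ?_
  · simpa using this
  · intro j hj
    have hj' := Finset.mem_range.1 hj
    filter_upwards [self_mem_ae_restrict hS] with s hs
    calc _ ≤ (X * q σ j s) * (X * q σ (m - j) s) := by
          gcongr
          · exact ha j (by omega) s (hS1 hs)
          · exact ha _ (by omega) s (hS1 hs)
      _ = X ^ 2 * (q σ j s * q σ (m - j) s) := by ring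
      _ ≤ X ^ 2 * (2 * q σ (j + (m - j)) s) := mul_le_mul' le_rfl (q_mul_q_le _ _ _)
      _ = _ := by rw [show j + (m - j) = m by omega]; ring
  · exact fun _ _ => hB

/-- A bound for the time integral of the transport terms. -/
lemma lintegral_phase_amplitude_le {a b : ℕ → ℝ → ℝ≥0∞} {X Y : ℝ≥0∞} {m : ℕ} {t : ℝ} (ht : 1 ≤ t)
    (ha : ∀ i ≤ m, ∀ t, 1 ≤ t → a i t ≤ X * q σ i t)
    (hb : ∀ i ≤ m, ∀ t, 1 ≤ t → b i t ≤ Y * N σ i t) :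
    ∫⁻ s in Set.Ioi t, r2 s * ∑ j ∈ Finset.range (m + 1), b j s * a (m - j) s
      ≤ (m + 1) * (3 * (Y * X) * Q σ m t) := by
  simp_rw [Finset.mul_sum]
  have := lintegral_sum_le_of_le (ν := volume.restrict (Set.Ioi t)) (Finset.range (m + 1))
    (f := fun j s => r2 s * (b j s * a (m - j) s)) (g := fun _ s => r2 s * N σ m s)
    (c := 3 * (Y * X)) (B := Q σ m t)
    (fun j _ => r2_measurable.mul (N_measurable σ _)) ?_ ?_
  · simpa using this
  · intro j hj
    have hj' := Finset.mem_range.1 hj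
    filter_upwards [self_mem_ae_restrict measurableSet_Ioi] with s hs
    have hs1 : 1 ≤ s := ht.trans (le_of_lt hs)
    calc _ ≤ r2 s * ((Y * N σ j s) * (X * q σ (m - j) s)) := by
          gcongr
          · exact hb j (by omega) s hs1
          · exact ha _ (by omega) s hs1
      _ = Y * X * r2 s * (N σ j s * q σ (m - j) s) := by ring
      _ ≤ Y * X * r2 s * (3 * N σ (j + (m - j)) s) := mul_le_mul' le_rfl (N_mul_q_le _ _ _)
      _ = _ := by rw [show j + (m - j) = m by omega]; ring
  · exact fun _ _ => (lintegral_Ioi_r2_N m ht).le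

/-- Sequences satisfying the integral inequalities of the triangular system are bounded by the
estimating functions. -/
theorem majorant {C a₀ : ℝ≥0} {a b : ℕ → ℝ → ℝ≥0∞} (ha0 : ∀ t, 1 ≤ t → a 0 t ≤ a₀)
    (ha : ∀ m t, 1 ≤ t → a (m + 1) t ≤
      C * ∫⁻ s in Set.Ioi t, r2 s * ∑ j ∈ Finset.range (m + 1), b j s * a (m - j) s)
    -- `a` and `b` are not assumed measurable, while the integral of a sum splits only with a
    -- measurable summand. The inequality is therefore required for measurable majorants, which will
    -- be multiples of `q` and `N`.
    (hb : ∀ m (a' b' : ℕ → ℝ → ℝ≥0∞), (∀ i, Measurable (a' i)) → (∀ i, Measurable (b' i)) →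
      (∀ i ≤ m, ∀ t, 1 ≤ t → a i t ≤ a' i t) → (∀ i < m, ∀ t, 1 ≤ t → b i t ≤ b' i t) →
      ∀ t, 1 ≤ t → b m t ≤
      C * (∫⁻ s in Set.Ioc 1 t, r2 s * ∑ j ∈ Finset.range m, b' j s * b' (m - 1 - j) s) +
      C * ∫⁻ s in Set.Ioc 1 t, ∑ j ∈ Finset.range (m + 1), a' j s * a' (m - j) s ∂σ) (m : ℕ) :
    ∀ i ≤ m, ∀ t, 1 ≤ t →
      a i t ≤ (coeff C a₀ m).1 * q σ i t ∧ b i t ≤ (coeff C a₀ m).2 * N σ i t := by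
  have hIoc : ∀ t : ℝ, Set.Ioc 1 t ⊆ Set.Ici 1 := fun t s hs => le_of_lt hs.1
  induction m with
  | zero =>
    intro i hi t ht
    obtain rfl : i = 0 := by omega
    have h0 : ∀ i ≤ 0, ∀ t, 1 ≤ t → a i t ≤ (a₀ : ℝ≥0∞) * q σ i t := by
      intro i hi t ht
      obtain rfl : i = 0 := by omega
      simpa [q] using ha0 t ht
    refine ⟨h0 0 le_rfl t ht, (hb 0 (fun i t => a₀ * q σ i t) 0
      (fun i => (q_measurable σ i).const_mul _) (fun _ => measurable_zero) h0 (by simp) t ht).trans ?_⟩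
    have := lintegral_amplitude_amplitude_le (a := fun i t => a₀ * q σ i t) measurableSet_Ioc
      (hIoc t) (m := 0) (fun i _ t _ => le_rfl) (lintegral_Ioc_q_le 0 t)
    simp only [Finset.range_zero, Finset.sum_empty, mul_zero, lintegral_zero, zero_add, coeff,
      ENNReal.coe_mul, ENNReal.coe_ofNat, ENNReal.coe_pow] at this ⊢
    calc _ ≤ (C : ℝ≥0∞) * (((0 : ℕ) + 1) * (2 * (a₀ : ℝ≥0∞) ^ 2 * (2 * N σ 0 t))) := by gcongr
      _ = _ := by simp; ring
  | succ m ih =>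
    have hle := coeff_mono_index C a₀ (Nat.le_succ m)
    -- The amplitude of index `m + 1` comes before the phase of the same index, whose source term
    -- contains it.
    have hX : ∀ i ≤ m + 1, ∀ t, 1 ≤ t → a i t ≤ (coeff C a₀ (m + 1)).1 * q σ i t := by
      intro i hi t ht
      rcases Nat.lt_or_eq_of_le hi with hi | rfl
      · refine ((ih i (by omega) t ht).1).trans ?_
        gcongr
        exact hle.1
      · refine (ha m t ht).trans ?_
        have := lintegral_phase_amplitude_le ht (fun i hi t ht => (ih i hi t ht).1)
          (fun i hi t ht => (ih i hi t ht).2)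
        calc _ ≤ (C : ℝ≥0∞) * ((m + 1) * (3 * ((coeff C a₀ m).2 * (coeff C a₀ m).1) * Q σ m t)) := by
              gcongr
          _ = ((3 * C * (m + 1) * ((coeff C a₀ m).2 * (coeff C a₀ m).1) : ℝ≥0) : ℝ≥0∞)
                * Q σ m t := by push_cast; ring
          _ ≤ _ := by
              simp only [q, coeff]
              gcongr
              exact le_add_self
    intro i hi t ht
    refine ⟨hX i hi t ht, ?_⟩
    rcases Nat.lt_or_eq_of_le hi with hi | rfl
    · refine ((ih i (by omega) t ht).2).trans ?_
      gcongr
      exact hle.2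
    · refine (hb (m + 1) (fun i t => (coeff C a₀ (m + 1)).1 * q σ i t)
        (fun i t => (coeff C a₀ m).2 * N σ i t) (fun i => (q_measurable σ i).const_mul _)
        (fun i => (N_measurable σ i).const_mul _) hX
        (fun i hi t ht => (ih i (by omega) t ht).2) t ht).trans ?_
      have h1 := lintegral_phase_phase_le (b := fun i t => (coeff C a₀ m).2 * N σ i t)
        (m := m + 1) measurableSet_Ioc (hIoc t) (fun i _ t _ => le_rfl)
        (B := 2 * N σ (m + 1) t) (fun i j hij => hij ▸ lintegral_Ioc_r2_N_N_le i j t)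
      have h2 := lintegral_amplitude_amplitude_le
        (a := fun i t => (coeff C a₀ (m + 1)).1 * q σ i t) measurableSet_Ioc (hIoc t)
        (fun i _ t _ => le_rfl) (lintegral_Ioc_q_le (m + 1) t)
      calc _ ≤ (C : ℝ≥0∞) * ((m + 1 : ℕ) * ((coeff C a₀ m).2 ^ 2 * (2 * N σ (m + 1) t))) +
            C * (((m + 1 : ℕ) + 1) * (2 * (coeff C a₀ (m + 1)).1 ^ 2 * (2 * N σ (m + 1) t))) := by
              gcongr
        _ = ((C * ((m + 1) * (2 * (coeff C a₀ m).2 ^ 2)) +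
            C * ((m + 2) * (2 * (2 * (coeff C a₀ (m + 1)).1 ^ 2))) : ℝ≥0) : ℝ≥0∞)
              * N σ (m + 1) t := by push_cast; ring
        _ ≤ _ := by
            gcongr
            exact le_add_self

/-- The bounds of `majorant`, inserted into the equation of a phase vanishing at infinity. -/
theorem majorant_top {C a₀ : ℝ≥0} {m : ℕ} {t : ℝ} (ht : 1 ≤ t) :
    C * (∫⁻ s in Set.Ioi t, r2 s * ∑ j ∈ Finset.range (m + 1),
        ((coeff C a₀ m).2 * N σ j s) * ((coeff C a₀ m).2 * N σ (m - j) s)) +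
      C * ∫⁻ s in Set.Ioi t, ∑ j ∈ Finset.range (m + 2),
        ((coeff C a₀ (m + 1)).1 * q σ j s) * ((coeff C a₀ (m + 1)).1 * q σ (m + 1 - j) s) ∂σ
      ≤ (coeff C a₀ (m + 1)).2 * P σ m t := by
  have hI : Set.Ioi t ⊆ Set.Ici 1 := fun s hs => ht.trans (le_of_lt hs)
  have h1 := lintegral_phase_phase_le (b := fun i t => (coeff C a₀ m).2 * N σ i t) (m := m + 1)
    measurableSet_Ioi hI (fun i _ t _ => le_rfl)
    (B := 2 * P σ m t) (fun i j hij => by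
      obtain rfl : i + j = m := by omega
      exact lintegral_Ioi_r2_N_N_le i j ht)
  have h2 := lintegral_amplitude_amplitude_le (a := fun i t => (coeff C a₀ (m + 1)).1 * q σ i t)
    (m := m + 1) measurableSet_Ioi hI (fun i _ t _ => le_rfl) (lintegral_Ioi_Q_le m t)
  calc _ ≤ (C : ℝ≥0∞) * ((m + 1 : ℕ) * ((coeff C a₀ m).2 ^ 2 * (2 * P σ m t))) +
        C * (((m + 1 : ℕ) + 1) * (2 * (coeff C a₀ (m + 1)).1 ^ 2 * P σ m t)) := by
          gcongr
          simpa using h1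
    -- A factor 2 is given away so that the constant is the one already recorded in `coeff`.
    _ ≤ (C : ℝ≥0∞) * ((m + 1 : ℕ) * ((coeff C a₀ m).2 ^ 2 * (2 * P σ m t))) +
        C * (((m + 1 : ℕ) + 1) * (2 * (coeff C a₀ (m + 1)).1 ^ 2 * (2 * P σ m t))) := by
          gcongr
          exact le_mul_of_one_le_left zero_le (by norm_num)
    _ = ((C * ((m + 1) * (2 * (coeff C a₀ m).2 ^ 2)) +
        C * ((m + 2) * (2 * (2 * (coeff C a₀ (m + 1)).1 ^ 2))) : ℝ≥0) : ℝ≥0∞)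
          * P σ m t := by push_cast; ring
    _ ≤ _ := by
        gcongr
        exact le_add_self

end Time

end HartreeAsymptotics

end

/-! ### The measure t^(-γ) dt: finiteness, and agreement with the estimating functions of the
statement. -/

noncomputable section

open MeasureTheory Filter Topology
open scoped ENNReal SchwartzMap FourierTransform NNReal

namespace HartreeAsymptotics

namespace Time

/-- The measure `t^(-γ) dt` on `(1, ∞)`. -/
def powMeasure (γ : ℝ) : Measure ℝ :=
  (volume.restrict (Set.Ioi 1)).withDensity fun s => ENNReal.ofReal (s ^ (-γ))

instance (γ : ℝ) : SFinite (powMeasure γ) := by unfold powMeasure; infer_instance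

lemma measurable_ofReal_rpow (γ : ℝ) : Measurable fun s : ℝ => ENNReal.ofReal (s ^ (-γ)) := by
  fun_prop

lemma lintegral_powMeasure (γ : ℝ) (f : ℝ → ℝ≥0∞) :
    ∫⁻ s, f s ∂(powMeasure γ) = ∫⁻ s in Set.Ioi 1, ENNReal.ofReal (s ^ (-γ)) * f s :=
  lintegral_withDensity_eq_lintegral_mul_non_measurable₀ _ (measurable_ofReal_rpow γ).aemeasurable
    (ae_of_all _ fun _ => ENNReal.ofReal_lt_top) f

lemma setLIntegral_powMeasure (γ : ℝ) (f : ℝ → ℝ≥0∞) {S : Set ℝ} (hS : MeasurableSet S) :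
    ∫⁻ s in S, f s ∂(powMeasure γ)
      = ∫⁻ s in S ∩ Set.Ioi 1, ENNReal.ofReal (s ^ (-γ)) * f s := by
  rw [← lintegral_indicator hS, lintegral_powMeasure, ← setLIntegral_indicator hS]
  refine lintegral_congr fun s => ?_
  by_cases hs : s ∈ S <;> simp [hs]

lemma ae_powMeasure (γ : ℝ) : ∀ᵐ s ∂(powMeasure γ), 1 < s :=
  (withDensity_absolutelyContinuous _ _).ae_le (ae_restrict_mem measurableSet_Ioi)

lemma r_eq {t : ℝ} (ht : 1 ≤ t) : r t = ENNReal.ofReal t⁻¹ := by rw [r, max_eq_left ht]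

lemma lintegral_ofReal_rpow_lt_top {a : ℝ} (ha : a < -1) :
    ∫⁻ s in Set.Ioi (1 : ℝ), ENNReal.ofReal (s ^ a) < ⊤ :=
  (integrableOn_Ioi_rpow_of_lt ha one_pos).lintegral_lt_top

/-- `h` decays at every rate slower than `t^(-γ)`. -/
lemma exists_h_powMeasure_le {γ γ' : ℝ} (h0 : 0 ≤ γ') (h1 : γ' < γ) (h2 : γ ≤ 1) :
    ∃ B : ℝ≥0∞, B < ⊤ ∧ ∀ t, 1 ≤ t → h (powMeasure γ) t ≤ B * ENNReal.ofReal (t ^ (-γ')) := by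
  refine ⟨∫⁻ s in Set.Ioi (1 : ℝ), ENNReal.ofReal (s ^ (-1 - (γ - γ'))),
    lintegral_ofReal_rpow_lt_top (by linarith), fun t ht => ?_⟩
  rw [h, lintegral_powMeasure, ← lintegral_mul_const' _ _ ENNReal.ofReal_ne_top]
  refine setLIntegral_mono_ae' measurableSet_Ioi (ae_of_all _ fun s (hs : 1 < s) => ?_)
  have hs0 : 0 < s := by linarith
  have ht0 : 0 < t := by linarith
  have hm : 0 < max t s := lt_max_of_lt_left ht0
  rw [r_eq (le_max_of_le_left ht), ← ENNReal.ofReal_mul (by positivity),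
    ← ENNReal.ofReal_mul (by positivity)]
  refine ENNReal.ofReal_le_ofReal ?_
  -- The first power, compared with s, makes the integral converge since γ' < γ; the second,
  -- compared with t, is the decay.
  have e : (max t s)⁻¹ = max t s ^ (-(1 - γ')) * max t s ^ (-γ') := by
    rw [← Real.rpow_add hm, ← Real.rpow_neg_one]; ring_nf
  have e2 : s ^ (-1 - (γ - γ')) = s ^ (-γ) * s ^ (-(1 - γ')) := by
    rw [← Real.rpow_add hs0]; ring_nf
  rw [e, e2, ← mul_assoc]
  gcongr ?_ * ?_ * ?_
  · exact Real.rpow_le_rpow_of_nonpos hs0 (le_max_right _ _) (by linarith)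
  · exact Real.rpow_le_rpow_of_nonpos ht0 (le_max_left _ _) (by linarith)

lemma h_powMeasure_one_lt_top {γ : ℝ} (h1 : 0 < γ) (h2 : γ ≤ 1) : h (powMeasure γ) 1 < ⊤ := by
  obtain ⟨B, hB, hle⟩ := exists_h_powMeasure_le le_rfl h1 h2
  exact (hle 1 le_rfl).trans_lt (ENNReal.mul_lt_top hB ENNReal.ofReal_lt_top)

lemma h_powMeasure_lt_top {γ : ℝ} (h1 : 0 < γ) (h2 : γ ≤ 1) {t : ℝ} (ht : 1 ≤ t) :
    h (powMeasure γ) t < ⊤ :=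
  (h_antitone _ ht).trans_lt (h_powMeasure_one_lt_top h1 h2)

lemma N_powMeasure_lt_top {γ : ℝ} (h1 : 0 < γ) (h2 : γ ≤ 1) (m : ℕ) (t : ℝ) :
    N (powMeasure γ) m t < ⊤ := by
  rw [N, setLIntegral_powMeasure _ _ measurableSet_Iic]
  calc _ ≤ ∫⁻ _ in Set.Ioc 1 t, h (powMeasure γ) 1 ^ m := by
        rw [Set.inter_comm, Set.Ioi_inter_Iic]
        refine setLIntegral_mono_ae' measurableSet_Ioc (ae_of_all _ fun s hs => ?_)
        rw [← one_mul (h (powMeasure γ) 1 ^ m)]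
        gcongr
        · rw [ENNReal.ofReal_le_one]
          exact Real.rpow_le_one_of_one_le_of_nonpos hs.1.le (by linarith)
        · exact h_antitone _ hs.1.le
    _ < ⊤ := by
        rw [setLIntegral_const]
        exact ENNReal.mul_lt_top (ENNReal.pow_lt_top (h_powMeasure_one_lt_top h1 h2)) (by simp)

lemma Q_powMeasure_lt_top {γ : ℝ} (h1 : 0 < γ) (h2 : γ ≤ 1) (m : ℕ) {t : ℝ} (ht : 1 ≤ t) :
    Q (powMeasure γ) m t < ⊤ := by
  calc Q (powMeasure γ) m t ≤ ∫⁻ s, r (max t s) * h (powMeasure γ) 1 ^ m ∂(powMeasure γ) := by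
        refine lintegral_mono_ae ?_
        filter_upwards [ae_powMeasure γ] with s hs
        gcongr
        exact h_antitone _ hs.le
    _ = h (powMeasure γ) t * h (powMeasure γ) 1 ^ m :=
        lintegral_mul_const _ (r_measurable.comp (measurable_const.max measurable_id))
    _ < ⊤ := ENNReal.mul_lt_top (h_powMeasure_lt_top h1 h2 ht)
        (ENNReal.pow_lt_top (h_powMeasure_one_lt_top h1 h2))

/-- Up to an arbitrarily small loss h decays like s^(-γ), so the integrand is of order s^(-(m+2)γ);
this is where (m + 2)γ > 1 is needed. -/
lemma P_powMeasure_lt_top {γ : ℝ} (h1 : 0 < γ) (h2 : γ ≤ 1) (m : ℕ) (hm : 1 < ((m : ℝ) + 2) * γ)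
    (t : ℝ) : P (powMeasure γ) m t < ⊤ := by
  -- The loss ε is incurred `m + 1` times; with this choice the total is less than the excess of (m
  -- + 2)γ over 1.
  set ε : ℝ := (((m : ℝ) + 2) * γ - 1) / (2 * ((m : ℝ) + 2)) with hε
  have hm0 : (0 : ℝ) ≤ m := m.cast_nonneg
  have hε0 : 0 < ε := by apply div_pos <;> linarith
  have hε1 : ε * (2 * ((m : ℝ) + 2)) = ((m : ℝ) + 2) * γ - 1 := by
    rw [hε]; field_simp
  have hε2 : ε ≤ γ := by
    have : ε * ((m : ℝ) + 2) ≤ γ * ((m : ℝ) + 2) := by nlinarith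
    exact le_of_mul_le_mul_right this (by linarith)
  obtain ⟨B, hB, hle⟩ := exists_h_powMeasure_le (γ := γ) (γ' := γ - ε) (by linarith) (by linarith) h2
  calc P (powMeasure γ) m t
      ≤ ∫⁻ s, h (powMeasure γ) s ^ (m + 1) ∂(powMeasure γ) := by
        refine lintegral_mono fun s => ?_
        rw [pow_succ']
        gcongr
        exact h_antitone _ (le_max_right _ _)
    _ ≤ ∫⁻ s in Set.Ioi 1, B ^ (m + 1) * ENNReal.ofReal (s ^ (-γ + -(γ - ε) * (m + 1))) := by
        rw [lintegral_powMeasure]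
        refine setLIntegral_mono_ae' measurableSet_Ioi (ae_of_all _ fun s (hs : 1 < s) => ?_)
        have hs0 : 0 < s := by linarith
        calc _ ≤ ENNReal.ofReal (s ^ (-γ)) * (B * ENNReal.ofReal (s ^ (-(γ - ε)))) ^ (m + 1) := by
              gcongr
              exact hle s hs.le
          _ = _ := by
              rw [mul_pow, mul_left_comm, ← ENNReal.ofReal_pow (by positivity),
                ← ENNReal.ofReal_mul (by positivity), Real.rpow_add hs0, Real.rpow_mul hs0.le]
              norm_cast
    _ < ⊤ := by
        rw [lintegral_const_mul' _ _ (ENNReal.pow_lt_top hB).ne]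
        refine ENNReal.mul_lt_top (ENNReal.pow_lt_top hB) (lintegral_ofReal_rpow_lt_top ?_)
        nlinarith

/-- A real integral of a nonnegative function is the `toReal` of the extended one, which loses the
value ∞. Finiteness is what allows the passage back, here and in the analogues for `N`, `Q` and `P`.
-/
lemma h_powMeasure_eq {γ : ℝ} (h1 : 0 < γ) (h2 : γ ≤ 1) {t : ℝ} (ht : 1 ≤ t) :
    h (powMeasure γ) t = ENNReal.ofReal (hBar γ t) := by
  have e : hBar γ t = (h (powMeasure γ) t).toReal := by
    rw [hBar, integral_eq_lintegral_of_nonneg_ae, h, lintegral_powMeasure]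
    · congr 1
      refine setLIntegral_congr_fun measurableSet_Ioi fun s (hs : 1 < s) => ?_
      rw [r_eq (le_max_of_le_left ht), mul_comm, ENNReal.ofReal_mul]
      have : 0 < s := by linarith
      positivity
    · filter_upwards [ae_restrict_mem measurableSet_Ioi] with s (hs : 1 < s)
      have : 0 < s := by linarith
      have : 0 < max t s := lt_max_of_lt_right this
      simp only [Pi.zero_apply]
      positivity
    · exact Measurable.aestronglyMeasurable (by fun_prop)
  rw [e, ENNReal.ofReal_toReal (h_powMeasure_lt_top h1 h2 ht).ne]

lemma hBar_nonneg (γ t : ℝ) : 0 ≤ hBar γ t := by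
  refine setIntegral_nonneg measurableSet_Ioi fun s (hs : 1 < s) => ?_
  have : 0 < s := by linarith
  have : 0 < max t s := lt_max_of_lt_right this
  positivity

lemma aestronglyMeasurable_hBar {γ : ℝ} (h1 : 0 < γ) (h2 : γ ≤ 1) {S : Set ℝ}
    (hS : MeasurableSet S) (hS1 : S ⊆ Set.Ici 1) :
    AEStronglyMeasurable (hBar γ) (volume.restrict S) := by
  refine (((h_measurable (powMeasure γ)).ennreal_toReal).aestronglyMeasurable).congr ?_
  filter_upwards [ae_restrict_mem hS] with s hs
  rw [h_powMeasure_eq h1 h2 (hS1 hs), ENNReal.toReal_ofReal (hBar_nonneg γ s)]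

lemma aestronglyMeasurable_rpow_mul_hBar {γ : ℝ} (h1 : 0 < γ) (h2 : γ ≤ 1) {S : Set ℝ}
    (hS : MeasurableSet S) (hS1 : S ⊆ Set.Ici 1) (m : ℕ) :
    AEStronglyMeasurable (fun s => s ^ (-γ) * hBar γ s ^ m) (volume.restrict S) :=
  Measurable.aestronglyMeasurable (by fun_prop) |>.mul
    ((aestronglyMeasurable_hBar h1 h2 hS hS1).pow m)

lemma N_powMeasure_eq {γ : ℝ} (h1 : 0 < γ) (h2 : γ ≤ 1) (m : ℕ) {t : ℝ} (ht : 1 ≤ t) :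
    N (powMeasure γ) m t = ENNReal.ofReal (NBar γ m t) := by
  have e : NBar γ m t = (N (powMeasure γ) m t).toReal := by
    rw [NBar, intervalIntegral.integral_of_le ht, integral_eq_lintegral_of_nonneg_ae, N,
      setLIntegral_powMeasure _ _ measurableSet_Iic, Set.inter_comm, Set.Ioi_inter_Iic]
    · congr 1
      refine setLIntegral_congr_fun measurableSet_Ioc fun s hs => ?_
      have : 0 < s := by linarith [hs.1]
      rw [h_powMeasure_eq h1 h2 hs.1.le, ENNReal.ofReal_mul (by positivity),
        ENNReal.ofReal_pow (hBar_nonneg γ s)]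
    · filter_upwards [ae_restrict_mem measurableSet_Ioc] with s hs
      have : 0 < s := by linarith [hs.1]
      have := hBar_nonneg γ s
      simp only [Pi.zero_apply]
      positivity
    · exact aestronglyMeasurable_rpow_mul_hBar h1 h2 measurableSet_Ioc (fun s hs => hs.1.le) m
  rw [e, ENNReal.ofReal_toReal (N_powMeasure_lt_top h1 h2 m t).ne]

lemma Q_powMeasure_eq {γ : ℝ} (h1 : 0 < γ) (h2 : γ ≤ 1) (m : ℕ) {t : ℝ} (ht : 1 ≤ t) :
    Q (powMeasure γ) m t = ENNReal.ofReal (QBar γ m t) := by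
  have e : QBar γ m t = (Q (powMeasure γ) m t).toReal := by
    rw [QBar, integral_eq_lintegral_of_nonneg_ae, Q, lintegral_powMeasure]
    · congr 1
      refine setLIntegral_congr_fun measurableSet_Ioi fun s (hs : 1 < s) => ?_
      have h0 : 0 < s := by linarith
      have : 0 < max t s := lt_max_of_lt_right h0
      rw [h_powMeasure_eq h1 h2 hs.le, r_eq (le_max_of_le_left ht),
        ENNReal.ofReal_mul (by positivity), ENNReal.ofReal_mul (by positivity),
        ENNReal.ofReal_pow (hBar_nonneg γ s)]
      ring
    · filter_upwards [ae_restrict_mem measurableSet_Ioi] with s (hs : 1 < s)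
      have h0 : 0 < s := by linarith
      have : 0 < max t s := lt_max_of_lt_right h0
      have := hBar_nonneg γ s
      simp only [Pi.zero_apply]
      positivity
    · simp_rw [mul_assoc]
      exact (Measurable.aestronglyMeasurable (by fun_prop)).mul
        (aestronglyMeasurable_rpow_mul_hBar h1 h2 measurableSet_Ioi Set.Ioi_subset_Ici_self m)
  rw [e, ENNReal.ofReal_toReal (Q_powMeasure_lt_top h1 h2 m ht).ne]

lemma P_powMeasure_eq {γ : ℝ} (h1 : 0 < γ) (h2 : γ ≤ 1) (m : ℕ) (hm : 1 < ((m : ℝ) + 2) * γ)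
    {t : ℝ} (ht : 1 ≤ t) : P (powMeasure γ) m t = ENNReal.ofReal (PBar γ m t) := by
  have e : PBar γ m t = (P (powMeasure γ) m t).toReal := by
    rw [PBar, integral_eq_lintegral_of_nonneg_ae, P, lintegral_powMeasure]
    · congr 1
      refine setLIntegral_congr_fun measurableSet_Ioi fun s (hs : 1 < s) => ?_
      have h0 : 0 < s := by linarith
      have := hBar_nonneg γ (max t s)
      rw [h_powMeasure_eq h1 h2 hs.le, h_powMeasure_eq h1 h2 (le_max_of_le_left ht),
        ENNReal.ofReal_mul (by positivity), ENNReal.ofReal_mul (by positivity),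
        ENNReal.ofReal_pow (hBar_nonneg γ s)]
      ring
    · filter_upwards [ae_restrict_mem measurableSet_Ioi] with s (hs : 1 < s)
      have h0 : 0 < s := by linarith
      have := hBar_nonneg γ (max t s)
      have := hBar_nonneg γ s
      simp only [Pi.zero_apply]
      positivity
    · simp_rw [mul_assoc]
      refine AEStronglyMeasurable.mul ?_
        (aestronglyMeasurable_rpow_mul_hBar h1 h2 measurableSet_Ioi Set.Ioi_subset_Ici_self m)
      refine ((((h_measurable (powMeasure γ)).comp
        ((measurable_const (a := t)).max measurable_id)).ennreal_toReal).aestronglyMeasurable).congr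
        (ae_of_all _ fun s => ?_)
      simp only [Function.comp, id]
      rw [h_powMeasure_eq h1 h2 (le_max_of_le_left ht), ENNReal.toReal_ofReal (hBar_nonneg γ _)]
  rw [e, ENNReal.ofReal_toReal (P_powMeasure_lt_top h1 h2 m hm t).ne]

end Time

end HartreeAsymptotics

end

noncomputable section

open MeasureTheory Filter Topology
open scoped ENNReal SchwartzMap FourierTransform NNReal

namespace HartreeAsymptotics

/-! ### The triangular system in a Banach space -/

/-- Strong recursion for a step which only looks at the earlier values. -/
lemma exists_seq_of_step {α : Type*} [Inhabited α] (step : ℕ → (ℕ → α) → α)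
    (hstep : ∀ m x y, (∀ j < m, x j = y j) → step m x = step m y) :
    ∃ x : ℕ → α, ∀ m, x m = step m x := by
  let x : ℕ → α := fun m => Nat.strongRec (motive := fun _ => α)
    (fun m ih => step m fun j => if h : j < m then ih j h else default) m
  refine ⟨x, fun m => ?_⟩
  have e : x m = step m fun j => if _h : j < m then x j else default := by
    simp only [x]
    rw [Nat.strongRec_eq]
  rw [e]
  exact hstep m _ _ fun j hj => by simp [hj]

lemma hasDerivWithinAt_integral_Ici {E : Type*} [NormedAddCommGroup E] [NormedSpace ℝ E]
    [CompleteSpace E] {F : ℝ → E} (hF : ContinuousOn F (Set.Ici 1)) {t : ℝ} (ht : 1 ≤ t) :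
    HasDerivWithinAt (fun t => ∫ s in (1 : ℝ)..t, F s) (F t) (Set.Ici 1) t := by
  -- Constant extension to the left of 1 reduces the one-sided statement at the endpoint to a
  -- function continuous on the line.
  have hc : Continuous fun s => F (max s 1) :=
    hF.comp_continuous (continuous_id.max continuous_const) fun s =>
      Set.mem_Ici.2 (le_max_right _ _)
  have h := (hc.integral_hasStrictDerivAt 1 t).hasDerivAt.hasDerivWithinAt (s := Set.Ici 1)
  rw [max_eq_left ht] at h
  refine h.congr (fun u hu => ?_) ?_
  all_goals
    refine intervalIntegral.integral_congr fun s hs => ?_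
    rw [Set.uIcc_of_le (by assumption)] at hs
    simp only [max_eq_left hs.1]

/-- Rewriting a tail integral as a constant plus an integral from 1 makes continuity and
differentiability in t consequences of the fundamental theorem of calculus. -/
lemma integral_Ioi_eq_sub {E : Type*} [NormedAddCommGroup E] [NormedSpace ℝ E]
    {F : ℝ → E} (hF : IntegrableOn F (Set.Ioi 1)) {t : ℝ} (ht : 1 ≤ t) :
    -∫ s in Set.Ioi t, F s = -(∫ s in Set.Ioi 1, F s) + ∫ s in (1 : ℝ)..t, F s := by
  have h1 : IntegrableOn F (Set.Ioc 1 t) := hF.mono_set Set.Ioc_subset_Ioi_self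
  have h2 : IntegrableOn F (Set.Ioi t) := hF.mono_set (Set.Ioi_subset_Ioi ht)
  rw [intervalIntegral.integral_of_le ht, ← Set.Ioc_union_Ioi_eq_Ioi ht,
    setIntegral_union (Set.Ioc_disjoint_Ioi le_rfl) measurableSet_Ioi h1 h2]
  abel

lemma tendsto_neg_integral_Ioi {E : Type*} [NormedAddCommGroup E] [NormedSpace ℝ E]
    {F : ℝ → E} (hF : IntegrableOn F (Set.Ioi 1)) :
    Tendsto (fun t => -∫ s in Set.Ioi t, F s) atTop (𝓝 0) := by
  have h := (intervalIntegral_tendsto_integral_Ioi 1 hF tendsto_id).const_add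
    (-(∫ s in Set.Ioi 1, F s))
  rw [neg_add_cancel] at h
  refine h.congr' ?_
  filter_upwards [eventually_ge_atTop 1] with t ht
  exact (integral_Ioi_eq_sub hF ht).symm

namespace Evolution

open Time

variable {E : Type*} [NormedAddCommGroup E] [NormedSpace ℝ E]

/-- The right-hand side of the amplitude equation. -/
def ampRHS (T : ℕ → ℕ → E →L[ℝ] E →L[ℝ] E) (W Φ : ℕ → ℝ → E) (m : ℕ) (s : ℝ) : E :=
  (2 * s ^ 2)⁻¹ • ∑ j ∈ Finset.range (m + 1), T j (m - j) (Φ j s) (W (m - j) s)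

/-- The right-hand side of the phase equation. -/
def phaseRHS (D G : ℕ → ℕ → E →L[ℝ] E →L[ℝ] E) (γ : ℝ) (W Φ : ℕ → ℝ → E) (m : ℕ) (s : ℝ) : E :=
  (2 * s ^ 2)⁻¹ • ∑ j ∈ Finset.range m, D j (m - 1 - j) (Φ j s) (Φ (m - 1 - j) s) +
    s ^ (-γ) • ∑ j ∈ Finset.range (m + 1), G j (m - j) (W j s) (W (m - j) s)

/-- The integrated triangular system. -/
structure Evolves (T D G : ℕ → ℕ → E →L[ℝ] E →L[ℝ] E) (γ : ℝ) (w : E) (W Φ : ℕ → ℝ → E) :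
    Prop where
  zero : ∀ t, W 0 t = w
  succ : ∀ m t, W (m + 1) t = -∫ s in Set.Ioi t, ampRHS T W Φ m s
  phase : ∀ m t, Φ m t = ∫ s in (1 : ℝ)..t, phaseRHS D G γ W Φ m s

/-- No estimate is involved: the integrals have a value even when they diverge, so the formulas are
a recursion on the index. Convergence is established afterwards. -/
theorem exists_evolves (T D G : ℕ → ℕ → E →L[ℝ] E →L[ℝ] E) (γ : ℝ) (w : E) :
    ∃ W Φ : ℕ → ℝ → E, Evolves T D G γ w W Φ := by
  let newW : ℕ → (ℕ → (ℝ → E) × (ℝ → E)) → ℝ → E := fun m x =>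
    match m with
    | 0 => fun _ => w
    | m + 1 => fun t => -∫ s in Set.Ioi t, ampRHS T (fun i => (x i).1) (fun i => (x i).2) m s
  have hW : ∀ m x y, (∀ j < m, x j = y j) → newW m x = newW m y := by
    intro m x y hxy
    cases m with
    | zero => rfl
    | succ m =>
      have : ampRHS T (fun i => (x i).1) (fun i => (x i).2) m =
          ampRHS T (fun i => (y i).1) (fun i => (y i).2) m := by
        ext s
        simp only [ampRHS]
        congr 1
        refine Finset.sum_congr rfl fun j hj => ?_
        have := Finset.mem_range.1 hj
        rw [hxy j (by omega), hxy (m - j) (by omega)]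
      simp only [newW, this]
  -- The phase of index `m` uses the amplitude of the same index, so the step computes it through
  -- `newW` instead of reading it from the earlier values.
  let step : ℕ → (ℕ → (ℝ → E) × (ℝ → E)) → (ℝ → E) × (ℝ → E) := fun m x =>
    (newW m x, fun t => ∫ s in (1 : ℝ)..t,
      phaseRHS D G γ (fun i => newW i x) (fun i => (x i).2) m s)
  haveI : Inhabited ((ℝ → E) × (ℝ → E)) := ⟨0⟩
  obtain ⟨x, hx⟩ := exists_seq_of_step step (by
    intro m x y hxy
    simp only [step]
    rw [hW m x y hxy]
    have : phaseRHS D G γ (fun i => newW i x) (fun i => (x i).2) m =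
        phaseRHS D G γ (fun i => newW i y) (fun i => (y i).2) m := by
      ext s
      simp only [phaseRHS]
      congr 2
      · refine Finset.sum_congr rfl fun j hj => ?_
        have := Finset.mem_range.1 hj
        rw [hxy j (by omega), hxy (m - 1 - j) (by omega)]
      · refine Finset.sum_congr rfl fun j hj => ?_
        have := Finset.mem_range.1 hj
        rw [hW j x y fun i hi => hxy i (by omega), hW (m - j) x y fun i hi => hxy i (by omega)]
    rw [this])
  have h1 : ∀ m, (x m).1 = newW m x := fun m => by rw [hx m]
  have h2 : (fun i => newW i x) = fun i => (x i).1 := funext fun m => (h1 m).symm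
  refine ⟨fun m => (x m).1, fun m => (x m).2, ⟨fun t => ?_, fun m t => ?_, fun m t => ?_⟩⟩
  · simp only [h1]; rfl
  · simp only [h1 (m + 1)]; rfl
  · have := congrArg (fun z => z.2 t) (hx m)
    simpa only [step, h2] using this

/-- A subadditive size of pairs of vectors. -/
structure IsPairSize (S : E → E → ℝ≥0∞) : Prop where
  zero : S 0 0 = 0
  add : ∀ x x' y y', S (x + y) (x' + y') ≤ S x x' + S y y'
  smul : ∀ (c : ℝ) x x', S (c • x) (c • x') ≤ ‖c‖ₑ * S x x'

lemma IsPairSize.sum {S : E → E → ℝ≥0∞} (hS : IsPairSize S) {ι : Type*} (s : Finset ι)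
    (f f' : ι → E) : S (∑ i ∈ s, f i) (∑ i ∈ s, f' i) ≤ ∑ i ∈ s, S (f i) (f' i) := by
  classical
  induction s using Finset.induction_on with
  | empty => simp [hS.zero]
  | insert a s ha ih =>
    rw [Finset.sum_insert ha, Finset.sum_insert ha, Finset.sum_insert ha]
    exact (hS.add _ _ _ _).trans (by gcongr)

/-- A family of bilinear maps is bounded by `C` for a size of pairs. -/
def PairBound (S : E → E → ℝ≥0∞) (C : ℝ≥0) (T : ℕ → ℕ → E →L[ℝ] E →L[ℝ] E) : Prop :=
  ∀ i j x x' y y', S (T i j x y) (T i j x' y') ≤ C * (S x x' * S y y')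

lemma enorm_two_mul_sq_inv_le (s : ℝ) : ‖(2 * s ^ 2)⁻¹‖ₑ ≤ r2 s := by
  rw [r2, Real.enorm_eq_ofReal (by positivity), mul_inv]
  refine ENNReal.ofReal_le_ofReal ?_
  have : 0 ≤ (s ^ 2)⁻¹ := by positivity
  linarith

section PairSize

variable {T D G : ℕ → ℕ → E →L[ℝ] E →L[ℝ] E} {γ : ℝ} {S : E → E → ℝ≥0∞} {C : ℝ≥0}
  {W W' Φ Φ' : ℕ → ℝ → E}

lemma pairSize_sum_le (hS : IsPairSize S) (hT : PairBound S C T) (x x' y y' : ℕ → E)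
    (m n : ℕ) :
    S (∑ j ∈ Finset.range m, T j (n - j) (x j) (y (n - j)))
      (∑ j ∈ Finset.range m, T j (n - j) (x' j) (y' (n - j))) ≤
      C * ∑ j ∈ Finset.range m, S (x j) (x' j) * S (y (n - j)) (y' (n - j)) := by
  refine (hS.sum _ _ _).trans ?_
  rw [Finset.mul_sum]
  exact Finset.sum_le_sum fun j _ => hT _ _ _ _ _ _

lemma pairSize_ampRHS_le (hS : IsPairSize S) (hT : PairBound S C T) (m : ℕ) (s : ℝ) :
    S (ampRHS T W Φ m s) (ampRHS T W' Φ' m s) ≤ C * (r2 s * ∑ j ∈ Finset.range (m + 1),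
      S (Φ j s) (Φ' j s) * S (W (m - j) s) (W' (m - j) s)) := by
  refine (hS.smul _ _ _).trans ?_
  refine (mul_le_mul' (enorm_two_mul_sq_inv_le s) (pairSize_sum_le hS hT (fun j => Φ j s)
    (fun j => Φ' j s) (fun j => W j s) (fun j => W' j s) _ _)).trans (le_of_eq ?_)
  ring

lemma pairSize_phaseRHS_le (hS : IsPairSize S) (hD : PairBound S C D) (hG : PairBound S C G)
    (m : ℕ) {s : ℝ} (hs : 0 ≤ s) :
    S (phaseRHS D G γ W Φ m s) (phaseRHS D G γ W' Φ' m s) ≤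
      C * (r2 s * ∑ j ∈ Finset.range m,
        S (Φ j s) (Φ' j s) * S (Φ (m - 1 - j) s) (Φ' (m - 1 - j) s)) +
      C * (ENNReal.ofReal (s ^ (-γ)) * ∑ j ∈ Finset.range (m + 1),
        S (W j s) (W' j s) * S (W (m - j) s) (W' (m - j) s)) := by
  refine (hS.add _ _ _ _).trans (add_le_add ?_ ?_)
  · refine (hS.smul _ _ _).trans ?_
    refine (mul_le_mul' (enorm_two_mul_sq_inv_le s) (pairSize_sum_le hS hD (fun j => Φ j s)
      (fun j => Φ' j s) (fun j => Φ j s) (fun j => Φ' j s) _ _)).trans (le_of_eq ?_)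
    ring
  · refine (hS.smul _ _ _).trans ?_
    rw [Real.enorm_eq_ofReal (by positivity)]
    refine (mul_le_mul' le_rfl (pairSize_sum_le hS hG (fun j => W j s)
      (fun j => W' j s) (fun j => W j s) (fun j => W' j s) _ _)).trans (le_of_eq ?_)
    ring

lemma lintegral_add_le_of_le {ν : Measure ℝ} {f g₁ g₂ : ℝ → ℝ≥0∞}
    (hg : AEMeasurable g₂ ν) (hf : ∀ᵐ s ∂ν, f s ≤ C * g₁ s + C * g₂ s) :
    ∫⁻ s, f s ∂ν ≤ C * (∫⁻ s, g₁ s ∂ν) + C * ∫⁻ s, g₂ s ∂ν := by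
  refine (lintegral_mono_ae hf).trans ?_
  rw [lintegral_add_right' _ (hg.const_mul _), lintegral_const_mul' _ _ ENNReal.coe_ne_top,
    lintegral_const_mul' _ _ ENNReal.coe_ne_top]

end PairSize

end Evolution

end HartreeAsymptotics

end

/-! ### A priori bounds, Lipschitz bounds and regularity for the system in a Banach space. -/

noncomputable section

open MeasureTheory Filter Topology
open scoped ENNReal SchwartzMap FourierTransform NNReal

namespace HartreeAsymptotics

namespace Evolution

open Time

variable {E : Type*} [NormedAddCommGroup E] [NormedSpace ℝ E]

section Bounds

variable {T D G : ℕ → ℕ → E →L[ℝ] E →L[ℝ] E} {γ : ℝ} {S : E → E → ℝ≥0∞} {C : ℝ≥0}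
  {w w' : E} {W W' Φ Φ' : ℕ → ℝ → E}

lemma lintegral_pairSize_phaseRHS_le (hS : IsPairSize S) (hD : PairBound S C D)
    (hG : PairBound S C G) {m : ℕ} {a b : ℕ → ℝ → ℝ≥0∞} (ha : ∀ i, Measurable (a i))
    (hWa : ∀ i ≤ m, ∀ t, 1 ≤ t → S (W i t) (W' i t) ≤ a i t)
    (hΦb : ∀ i < m, ∀ t, 1 ≤ t → S (Φ i t) (Φ' i t) ≤ b i t) {I : Set ℝ} (hI : MeasurableSet I)
    (hI1 : I ⊆ Set.Ioi 1) :
    ∫⁻ s in I, S (phaseRHS D G γ W Φ m s) (phaseRHS D G γ W' Φ' m s) ≤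
      C * (∫⁻ s in I, r2 s * ∑ j ∈ Finset.range m, b j s * b (m - 1 - j) s) +
      C * ∫⁻ s in I, ∑ j ∈ Finset.range (m + 1), a j s * a (m - j) s ∂(powMeasure γ) := by
  rw [setLIntegral_powMeasure _ _ hI, Set.inter_eq_left.2 hI1]
  refine lintegral_add_le_of_le ?_ ?_
  · refine ((measurable_ofReal_rpow γ).mul ?_).aemeasurable
    exact Finset.measurable_fun_sum _ fun j _ => (ha _).mul (ha _)
  · filter_upwards [ae_restrict_mem hI] with s hs
    have hs1 : 1 ≤ s := le_of_lt (hI1 hs)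
    refine (pairSize_phaseRHS_le hS hD hG m (by linarith)).trans ?_
    gcongr with j hj j hj
    · exact hΦb _ (Finset.mem_range.1 hj) s hs1
    · have := Finset.mem_range.1 hj
      exact hΦb _ (by omega) s hs1
    · have := Finset.mem_range.1 hj
      exact hWa _ (by omega) s hs1
    · exact hWa _ (by omega) s hs1

/-- One induction serves the norm and the Lipschitz estimates. The comparison of the size of an
integral with the integral of the size is left as a hypothesis, because it is unconditional for the
norm but needs integrability for differences. -/
theorem pairSize_le (hS : IsPairSize S) (hT : PairBound S C T) (hD : PairBound S C D)
    (hG : PairBound S C G) (hW : Evolves T D G γ w W Φ) (hW' : Evolves T D G γ w' W' Φ')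
    {a₀ : ℝ≥0} (h0 : S w w' ≤ a₀)
    (hI1 : ∀ m t, 1 ≤ t → S (W (m + 1) t) (W' (m + 1) t) ≤
      ∫⁻ s in Set.Ioi t, S (ampRHS T W Φ m s) (ampRHS T W' Φ' m s))
    (hI2 : ∀ m t, 1 ≤ t → S (Φ m t) (Φ' m t) ≤
      ∫⁻ s in Set.Ioc 1 t, S (phaseRHS D G γ W Φ m s) (phaseRHS D G γ W' Φ' m s)) (m : ℕ) :
    ∀ i ≤ m, ∀ t, 1 ≤ t → S (W i t) (W' i t) ≤ (coeff C a₀ m).1 * q (powMeasure γ) i t ∧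
      S (Φ i t) (Φ' i t) ≤ (coeff C a₀ m).2 * N (powMeasure γ) i t := by
  refine majorant (σ := powMeasure γ) (a := fun i t => S (W i t) (W' i t))
    (b := fun i t => S (Φ i t) (Φ' i t)) ?_ ?_ ?_ m
  · intro t _
    simpa only [hW.zero, hW'.zero] using h0
  · intro m t ht
    refine (hI1 m t ht).trans ?_
    rw [← lintegral_const_mul' _ _ ENNReal.coe_ne_top]
    exact lintegral_mono fun s => pairSize_ampRHS_le hS hT m s
  · intro m a b ha hb hWa hΦb t ht
    exact (hI2 m t ht).trans (lintegral_pairSize_phaseRHS_le hS hD hG ha hWa hΦb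
      measurableSet_Ioc Set.Ioc_subset_Ioi_self)

theorem lintegral_pairSize_ampRHS_le (hS : IsPairSize S) (hT : PairBound S C T) {X Y : ℝ≥0} {m : ℕ}
    (hX : ∀ i ≤ m, ∀ t, 1 ≤ t → S (W i t) (W' i t) ≤ X * q (powMeasure γ) i t)
    (hY : ∀ i ≤ m, ∀ t, 1 ≤ t → S (Φ i t) (Φ' i t) ≤ Y * N (powMeasure γ) i t) :
    ∫⁻ s in Set.Ioi 1, S (ampRHS T W Φ m s) (ampRHS T W' Φ' m s) ≤
      C * ((m + 1) * (3 * (Y * X) * Q (powMeasure γ) m 1)) := by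
  refine (lintegral_mono fun s => pairSize_ampRHS_le hS hT m s).trans ?_
  rw [lintegral_const_mul' _ _ ENNReal.coe_ne_top]
  gcongr
  exact lintegral_phase_amplitude_le (a := fun i t => S (W i t) (W' i t))
    (b := fun i t => S (Φ i t) (Φ' i t)) le_rfl hX hY

theorem lintegral_pairSize_top_le (hS : IsPairSize S) (hD : PairBound S C D)
    (hG : PairBound S C G) {a₀ : ℝ≥0} {p : ℕ}
    (hX : ∀ i ≤ p + 1, ∀ t, 1 ≤ t →
      S (W i t) (W' i t) ≤ (coeff C a₀ (p + 1)).1 * q (powMeasure γ) i t)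
    (hY : ∀ i ≤ p, ∀ t, 1 ≤ t → S (Φ i t) (Φ' i t) ≤ (coeff C a₀ p).2 * N (powMeasure γ) i t)
    {t : ℝ} (ht : 1 ≤ t) :
    ∫⁻ s in Set.Ioi t, S (phaseRHS D G γ W Φ (p + 1) s) (phaseRHS D G γ W' Φ' (p + 1) s) ≤
      (coeff C a₀ (p + 1)).2 * P (powMeasure γ) p t := by
  refine (lintegral_pairSize_phaseRHS_le hS hD hG
    (a := fun i t => (coeff C a₀ (p + 1)).1 * q (powMeasure γ) i t)
    (b := fun i t => (coeff C a₀ p).2 * N (powMeasure γ) i t)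
    (fun i => (q_measurable _ i).const_mul _)
    hX (fun i hi => hY i (by omega)) measurableSet_Ioi (Set.Ioi_subset_Ioi ht)).trans ?_
  exact majorant_top ht

end Bounds

/-- The size of the first component. -/
lemma isPairSize_enorm : IsPairSize fun x _ : E => ‖x‖ₑ where
  zero := by simp
  add x _ y _ := enorm_add_le x y
  smul c x _ := (enorm_smul c x).le

/-- The size of a pair and of its difference, scaled by `δ⁻¹`. -/
def lipSize (δ : ℝ≥0∞) (x x' : E) : ℝ≥0∞ := max (max ‖x‖ₑ ‖x'‖ₑ) (δ⁻¹ * ‖x - x'‖ₑ)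

lemma enorm_left_le_lipSize (δ : ℝ≥0∞) (x x' : E) : ‖x‖ₑ ≤ lipSize δ x x' :=
  le_max_of_le_left (le_max_left _ _)

lemma enorm_right_le_lipSize (δ : ℝ≥0∞) (x x' : E) : ‖x'‖ₑ ≤ lipSize δ x x' :=
  le_max_of_le_left (le_max_right _ _)

lemma enorm_sub_le_lipSize (δ : ℝ≥0∞) (x x' : E) : δ⁻¹ * ‖x - x'‖ₑ ≤ lipSize δ x x' :=
  le_max_right _ _

lemma isPairSize_lipSize (δ : ℝ≥0∞) : IsPairSize (lipSize (E := E) δ) where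
  zero := by simp [lipSize]
  add x x' y y' := by
    refine max_le (max_le ?_ ?_) ?_
    · exact (enorm_add_le _ _).trans
        (add_le_add (enorm_left_le_lipSize _ _ _) (enorm_left_le_lipSize _ _ _))
    · exact (enorm_add_le _ _).trans
        (add_le_add (enorm_right_le_lipSize _ _ _) (enorm_right_le_lipSize _ _ _))
    · rw [add_sub_add_comm]
      refine (mul_le_mul' le_rfl (enorm_add_le _ _)).trans ?_
      rw [mul_add]
      exact add_le_add (enorm_sub_le_lipSize _ _ _) (enorm_sub_le_lipSize _ _ _)
  smul c x x' := by
    refine max_le (max_le ?_ ?_) ?_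
    · rw [enorm_smul]; exact mul_le_mul' le_rfl (enorm_left_le_lipSize _ _ _)
    · rw [enorm_smul]; exact mul_le_mul' le_rfl (enorm_right_le_lipSize _ _ _)
    · rw [← smul_sub, enorm_smul, mul_left_comm]
      exact mul_le_mul' le_rfl (enorm_sub_le_lipSize _ _ _)

lemma enorm_le_of_norm_le {C : ℝ≥0} {x y z : E} (h : ‖z‖ ≤ C * ‖x‖ * ‖y‖) :
    ‖z‖ₑ ≤ C * (‖x‖ₑ * ‖y‖ₑ) := by
  have : ‖z‖₊ ≤ C * (‖x‖₊ * ‖y‖₊) := by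
    rw [← NNReal.coe_le_coe]; simpa [mul_assoc] using h
  simpa [enorm_eq_nnnorm] using ENNReal.coe_le_coe.2 this

lemma pairBound_enorm {T : ℕ → ℕ → E →L[ℝ] E →L[ℝ] E} {C : ℝ≥0}
    (hT : ∀ i j x y, ‖T i j x y‖ ≤ C * ‖x‖ * ‖y‖) : PairBound (fun x _ => ‖x‖ₑ) C T :=
  fun i j x _ y _ => enorm_le_of_norm_le (hT i j x y)

/-- The difference is split as T(x,y) - T(x',y') = T(x-x',y) + T(x',y-y'). In each half exactly one
factor is a difference and takes the scaling δ⁻¹; the two halves cost the factor 2. -/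
lemma pairBound_lipSize {T : ℕ → ℕ → E →L[ℝ] E →L[ℝ] E} {C : ℝ≥0}
    (hT : ∀ i j x y, ‖T i j x y‖ ≤ C * ‖x‖ * ‖y‖) (δ : ℝ≥0∞) :
    PairBound (lipSize δ) (2 * C) T := by
  intro i j x x' y y'
  have h := pairBound_enorm hT
  have h2 : (C : ℝ≥0∞) ≤ (2 * C : ℝ≥0) := by
    rw [ENNReal.coe_mul]; exact le_mul_of_one_le_left zero_le (by norm_num)
  refine max_le (max_le ?_ ?_) ?_
  · exact (h i j x x y y).trans (mul_le_mul' h2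
      (mul_le_mul' (enorm_left_le_lipSize _ _ _) (enorm_left_le_lipSize _ _ _)))
  · exact (h i j x' x' y' y').trans (mul_le_mul' h2
      (mul_le_mul' (enorm_right_le_lipSize _ _ _) (enorm_right_le_lipSize _ _ _)))
  · have e : T i j x y - T i j x' y' = T i j (x - x') y + T i j x' (y - y') := by
      simp only [map_sub, ContinuousLinearMap.sub_apply]; abel
    rw [e]
    calc δ⁻¹ * ‖T i j (x - x') y + T i j x' (y - y')‖ₑ
        ≤ δ⁻¹ * (C * (‖x - x'‖ₑ * ‖y‖ₑ) + C * (‖x'‖ₑ * ‖y - y'‖ₑ)) := by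
          gcongr
          exact (enorm_add_le _ _).trans
            (add_le_add (h i j _ (x - x') _ y) (h i j _ x' _ (y - y')))
      _ = C * ((δ⁻¹ * ‖x - x'‖ₑ) * ‖y‖ₑ) + C * (‖x'‖ₑ * (δ⁻¹ * ‖y - y'‖ₑ)) := by ring
      _ ≤ C * (lipSize δ x x' * lipSize δ y y') + C * (lipSize δ x x' * lipSize δ y y') := by
          gcongr
          · exact enorm_sub_le_lipSize _ _ _
          · exact enorm_left_le_lipSize _ _ _
          · exact enorm_right_le_lipSize _ _ _
          · exact enorm_sub_le_lipSize _ _ _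
      _ = _ := by push_cast; ring

lemma lipSize_neg (δ : ℝ≥0∞) (x x' : E) : lipSize δ (-x) (-x') = lipSize δ x x' := by
  rw [lipSize, enorm_neg, enorm_neg, neg_sub_neg, ← neg_sub, enorm_neg, lipSize]

lemma lipSize_integral_le {ν : Measure ℝ} {f f' : ℝ → E} (hf : Integrable f ν)
    (hf' : Integrable f' ν) {δ : ℝ≥0∞} (hδ : δ ≠ 0) :
    lipSize δ (∫ s, f s ∂ν) (∫ s, f' s ∂ν) ≤ ∫⁻ s, lipSize δ (f s) (f' s) ∂ν := by
  refine max_le (max_le ?_ ?_) ?_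
  · exact (enorm_integral_le_lintegral_enorm _).trans
      (lintegral_mono fun s => enorm_left_le_lipSize _ _ _)
  · exact (enorm_integral_le_lintegral_enorm _).trans
      (lintegral_mono fun s => enorm_right_le_lipSize _ _ _)
  · rw [← integral_sub hf hf']
    refine (mul_le_mul' le_rfl (enorm_integral_le_lintegral_enorm _)).trans ?_
    rw [← lintegral_const_mul' _ _ (ENNReal.inv_ne_top.2 hδ)]
    exact lintegral_mono fun s => enorm_sub_le_lipSize _ _ _

section Regularity

variable {T D G : ℕ → ℕ → E →L[ℝ] E →L[ℝ] E} {γ : ℝ} {C : ℝ≥0}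
  {w w' : E} {W W' Φ Φ' : ℕ → ℝ → E}

/-- These bounds require neither continuity nor integrability, since the norm of an integral is
always at most the integral of the norm. They can therefore be used to prove integrability. -/
theorem Evolves.enorm_le (hT : ∀ i j x y, ‖T i j x y‖ ≤ C * ‖x‖ * ‖y‖)
    (hD : ∀ i j x y, ‖D i j x y‖ ≤ C * ‖x‖ * ‖y‖) (hG : ∀ i j x y, ‖G i j x y‖ ≤ C * ‖x‖ * ‖y‖)
    (hW : Evolves T D G γ w W Φ) (m : ℕ) :
    ∀ i ≤ m, ∀ t, 1 ≤ t → ‖W i t‖ₑ ≤ (coeff C ‖w‖₊ m).1 * q (powMeasure γ) i t ∧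
      ‖Φ i t‖ₑ ≤ (coeff C ‖w‖₊ m).2 * N (powMeasure γ) i t := by
  refine pairSize_le isPairSize_enorm (pairBound_enorm hT) (pairBound_enorm hD)
    (pairBound_enorm hG) hW hW (by rw [enorm_eq_nnnorm]) ?_ ?_ m
  · intro m t _
    simp only [hW.succ m t, enorm_neg]
    exact enorm_integral_le_lintegral_enorm _
  · intro m t ht
    simp only [hW.phase m t, intervalIntegral.integral_of_le ht]
    exact enorm_integral_le_lintegral_enorm _

lemma continuousOn_two_mul_sq_inv : ContinuousOn (fun s : ℝ => (2 * s ^ 2)⁻¹) (Set.Ici 1) := by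
  refine ContinuousOn.inv₀ (by fun_prop) fun s hs => ?_
  have : (0 : ℝ) < s := lt_of_lt_of_le one_pos hs
  positivity

lemma continuousOn_ampRHS {m : ℕ} (hW : ∀ i ≤ m, ContinuousOn (W i) (Set.Ici 1))
    (hΦ : ∀ i ≤ m, ContinuousOn (Φ i) (Set.Ici 1)) :
    ContinuousOn (ampRHS T W Φ m) (Set.Ici 1) := by
  refine continuousOn_two_mul_sq_inv.smul (continuousOn_finsetSum _ fun j hj => ?_)
  have := Finset.mem_range.1 hj
  exact (continuousOn_const.clm_apply (hΦ j (by omega))).clm_apply (hW _ (by omega))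

lemma continuousOn_phaseRHS {m : ℕ} (hW : ∀ i ≤ m, ContinuousOn (W i) (Set.Ici 1))
    (hΦ : ∀ i < m, ContinuousOn (Φ i) (Set.Ici 1)) :
    ContinuousOn (phaseRHS D G γ W Φ m) (Set.Ici 1) := by
  refine (continuousOn_two_mul_sq_inv.smul (continuousOn_finsetSum _ fun j hj => ?_)).add
    (ContinuousOn.smul ?_ (continuousOn_finsetSum _ fun j hj => ?_))
  · have := Finset.mem_range.1 hj
    exact (continuousOn_const.clm_apply (hΦ j (by omega))).clm_apply (hΦ _ (by omega))
  · refine continuousOn_id.rpow_const fun s hs => Or.inl ?_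
    exact (lt_of_lt_of_le one_pos hs).ne'
  · have := Finset.mem_range.1 hj
    exact (continuousOn_const.clm_apply (hW j (by omega))).clm_apply (hW _ (by omega))

variable [CompleteSpace E] (hγ0 : 0 < γ) (hγ1 : γ ≤ 1)
  (hT : ∀ i j x y, ‖T i j x y‖ ≤ C * ‖x‖ * ‖y‖) (hD : ∀ i j x y, ‖D i j x y‖ ≤ C * ‖x‖ * ‖y‖)
  (hG : ∀ i j x y, ‖G i j x y‖ ≤ C * ‖x‖ * ‖y‖) (hW : Evolves T D G γ w W Φ)
  (hW' : Evolves T D G γ w' W' Φ')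

include hγ0 hγ1 hT hD hG hW

lemma Evolves.integrableOn_ampRHS_of_continuousOn {m : ℕ}
    (hc : ContinuousOn (ampRHS T W Φ m) (Set.Ici 1)) :
    IntegrableOn (ampRHS T W Φ m) (Set.Ioi 1) := by
  refine ⟨(hc.mono Set.Ioi_subset_Ici_self).aestronglyMeasurable measurableSet_Ioi, ?_⟩
  have h := hW.enorm_le hT hD hG m
  refine (lintegral_pairSize_ampRHS_le isPairSize_enorm (pairBound_enorm hT) (γ := γ)
    (W' := W) (Φ' := Φ) (fun i hi t ht => (h i hi t ht).1)
    (fun i hi t ht => (h i hi t ht).2)).trans_lt ?_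
  have := Q_powMeasure_lt_top hγ0 hγ1 m le_rfl
  refine ENNReal.mul_lt_top ENNReal.coe_lt_top (ENNReal.mul_lt_top (by simp)
    (ENNReal.mul_lt_top (ENNReal.mul_lt_top (by simp) ?_) this))
  exact ENNReal.mul_lt_top ENNReal.coe_lt_top ENNReal.coe_lt_top

/-- Continuity at lower indices makes the right-hand sides continuous, the a priori bounds make the
amplitude's one integrable up to infinity, and integration then gives continuity at the next index.
-/
theorem Evolves.continuousOn (m : ℕ) :
    ContinuousOn (W m) (Set.Ici 1) ∧ ContinuousOn (Φ m) (Set.Ici 1) := by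
  induction m using Nat.strong_induction_on with
  | _ m ih =>
    have h1 : ContinuousOn (W m) (Set.Ici 1) := by
      cases m with
      | zero =>
        have : W 0 = fun _ => w := funext hW.zero
        rw [this]
        exact continuousOn_const
      | succ m =>
        have hc : ContinuousOn (ampRHS T W Φ m) (Set.Ici 1) :=
          continuousOn_ampRHS (fun i hi => (ih i (by omega)).1) (fun i hi => (ih i (by omega)).2)
        have hi := hW.integrableOn_ampRHS_of_continuousOn hγ0 hγ1 hT hD hG hc
        have h : ContinuousOn (fun t => -(∫ s in Set.Ioi 1, ampRHS T W Φ m s) +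
            ∫ s in (1 : ℝ)..t, ampRHS T W Φ m s) (Set.Ici 1) :=
          continuousOn_const.add fun t ht =>
            (hasDerivWithinAt_integral_Ici hc ht).continuousWithinAt
        exact h.congr fun t ht => by rw [hW.succ, integral_Ioi_eq_sub hi ht]
    refine ⟨h1, ?_⟩
    have hc : ContinuousOn (phaseRHS D G γ W Φ m) (Set.Ici 1) := by
      refine continuousOn_phaseRHS (fun i hi => ?_) (fun i hi => (ih i hi).2)
      rcases Nat.lt_or_eq_of_le hi with hi | rfl
      · exact (ih i hi).1
      · exact h1
    have : Φ m = fun t => ∫ s in (1 : ℝ)..t, phaseRHS D G γ W Φ m s := funext (hW.phase m)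
    rw [this]
    exact fun t ht => (hasDerivWithinAt_integral_Ici hc ht).continuousWithinAt

lemma Evolves.continuousOn_ampRHS (m : ℕ) : ContinuousOn (ampRHS T W Φ m) (Set.Ici 1) :=
  Evolution.continuousOn_ampRHS (fun i _ => (hW.continuousOn hγ0 hγ1 hT hD hG i).1)
    (fun i _ => (hW.continuousOn hγ0 hγ1 hT hD hG i).2)

lemma Evolves.continuousOn_phaseRHS (m : ℕ) : ContinuousOn (phaseRHS D G γ W Φ m) (Set.Ici 1) :=
  Evolution.continuousOn_phaseRHS (fun i _ => (hW.continuousOn hγ0 hγ1 hT hD hG i).1)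
    (fun i _ => (hW.continuousOn hγ0 hγ1 hT hD hG i).2)

lemma Evolves.integrableOn_ampRHS (m : ℕ) : IntegrableOn (ampRHS T W Φ m) (Set.Ioi 1) :=
  hW.integrableOn_ampRHS_of_continuousOn hγ0 hγ1 hT hD hG
    (hW.continuousOn_ampRHS hγ0 hγ1 hT hD hG m)

theorem Evolves.hasDerivWithinAt_succ (m : ℕ) {t : ℝ} (ht : 1 ≤ t) :
    HasDerivWithinAt (W (m + 1)) (ampRHS T W Φ m t) (Set.Ici 1) t := by
  have hi := hW.integrableOn_ampRHS hγ0 hγ1 hT hD hG m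
  refine ((hasDerivWithinAt_integral_Ici (hW.continuousOn_ampRHS hγ0 hγ1 hT hD hG m) ht).const_add
    (-(∫ s in Set.Ioi 1, ampRHS T W Φ m s))).congr (fun u hu => ?_) ?_
  · rw [hW.succ, integral_Ioi_eq_sub hi hu]
  · rw [hW.succ, integral_Ioi_eq_sub hi ht]

theorem Evolves.tendsto_succ (m : ℕ) : Tendsto (W (m + 1)) atTop (𝓝 0) := by
  refine (tendsto_neg_integral_Ioi (hW.integrableOn_ampRHS hγ0 hγ1 hT hD hG m)).congr fun t => ?_
  rw [hW.succ]

theorem Evolves.hasDerivWithinAt_phase (m : ℕ) {t : ℝ} (ht : 1 ≤ t) :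
    HasDerivWithinAt (Φ m) (phaseRHS D G γ W Φ m t) (Set.Ici 1) t := by
  have : Φ m = fun t => ∫ s in (1 : ℝ)..t, phaseRHS D G γ W Φ m s := funext (hW.phase m)
  rw [this]
  exact hasDerivWithinAt_integral_Ici (hW.continuousOn_phaseRHS hγ0 hγ1 hT hD hG m) ht

omit hγ0 hγ1 [CompleteSpace E] in
theorem Evolves.lintegral_top_le (p : ℕ) {t : ℝ} (ht : 1 ≤ t) :
    ∫⁻ s in Set.Ioi t, ‖phaseRHS D G γ W Φ (p + 1) s‖ₑ ≤
      (coeff C ‖w‖₊ (p + 1)).2 * P (powMeasure γ) p t :=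
  lintegral_pairSize_top_le (W' := W) (Φ' := Φ) isPairSize_enorm (pairBound_enorm hD)
    (pairBound_enorm hG)
    (fun i hi t ht => (hW.enorm_le hT hD hG (p + 1) i hi t ht).1)
    (fun i hi t ht => (hW.enorm_le hT hD hG p i hi t ht).2) ht

theorem Evolves.integrableOn_top {p : ℕ} (hp : 1 < ((p : ℝ) + 2) * γ) :
    IntegrableOn (phaseRHS D G γ W Φ (p + 1)) (Set.Ioi 1) := by
  refine ⟨((hW.continuousOn_phaseRHS hγ0 hγ1 hT hD hG (p + 1)).mono
    Set.Ioi_subset_Ici_self).aestronglyMeasurable measurableSet_Ioi, ?_⟩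
  exact (hW.lintegral_top_le hT hD hG p le_rfl).trans_lt
    (ENNReal.mul_lt_top ENNReal.coe_lt_top (P_powMeasure_lt_top hγ0 hγ1 p hp 1))

include hW'

theorem Evolves.lipSize_le {δ : ℝ≥0∞} (hδ : δ ≠ 0) {a₀ : ℝ≥0} (h0 : lipSize δ w w' ≤ a₀) (m : ℕ) :
    ∀ i ≤ m, ∀ t, 1 ≤ t →
      lipSize δ (W i t) (W' i t) ≤ (coeff (2 * C) a₀ m).1 * q (powMeasure γ) i t ∧
      lipSize δ (Φ i t) (Φ' i t) ≤ (coeff (2 * C) a₀ m).2 * N (powMeasure γ) i t := by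
  refine pairSize_le (isPairSize_lipSize δ) (pairBound_lipSize hT δ) (pairBound_lipSize hD δ)
    (pairBound_lipSize hG δ) hW hW' h0 ?_ ?_ m
  · intro m t ht
    rw [hW.succ m t, hW'.succ m t, lipSize_neg]
    exact lipSize_integral_le
      ((hW.integrableOn_ampRHS hγ0 hγ1 hT hD hG m).mono_set (Set.Ioi_subset_Ioi ht))
      ((hW'.integrableOn_ampRHS hγ0 hγ1 hT hD hG m).mono_set (Set.Ioi_subset_Ioi ht)) hδ
  · intro m t ht
    rw [hW.phase m t, hW'.phase m t, intervalIntegral.integral_of_le ht,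
      intervalIntegral.integral_of_le ht]
    have hI : ∀ {F : ℝ → E}, ContinuousOn F (Set.Ici 1) → IntegrableOn F (Set.Ioc 1 t) :=
      fun hF => ((hF.mono Set.Icc_subset_Ici_self).integrableOn_Icc).mono_set Set.Ioc_subset_Icc_self
    exact lipSize_integral_le (hI (hW.continuousOn_phaseRHS hγ0 hγ1 hT hD hG m))
      (hI (hW'.continuousOn_phaseRHS hγ0 hγ1 hT hD hG m)) hδ

theorem Evolves.lipSize_top_le {δ : ℝ≥0∞} (hδ : δ ≠ 0) {a₀ : ℝ≥0} (h0 : lipSize δ w w' ≤ a₀)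
    {p : ℕ} (hp : 1 < ((p : ℝ) + 2) * γ) {t : ℝ} (ht : 1 ≤ t) :
    lipSize δ (-∫ s in Set.Ioi t, phaseRHS D G γ W Φ (p + 1) s)
      (-∫ s in Set.Ioi t, phaseRHS D G γ W' Φ' (p + 1) s) ≤
      (coeff (2 * C) a₀ (p + 1)).2 * P (powMeasure γ) p t := by
  rw [lipSize_neg]
  refine (lipSize_integral_le
    ((hW.integrableOn_top hγ0 hγ1 hT hD hG hp).mono_set (Set.Ioi_subset_Ioi ht))
    ((hW'.integrableOn_top hγ0 hγ1 hT hD hG hp).mono_set (Set.Ioi_subset_Ioi ht)) hδ).trans ?_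
  exact lintegral_pairSize_top_le (isPairSize_lipSize δ) (pairBound_lipSize hD δ)
    (pairBound_lipSize hG δ)
    (fun i hi t ht => (hW.lipSize_le hγ0 hγ1 hT hD hG hW' hδ h0 (p + 1) i hi t ht).1)
    (fun i hi t ht => (hW.lipSize_le hγ0 hγ1 hT hD hG hW' hδ h0 p i hi t ht).2) ht

end Regularity

end Evolution

end HartreeAsymptotics

end

/-! ### Gauge invariance of the system in a Banach space. -/

noncomputable section

open MeasureTheory Filter Topology
open scoped ENNReal SchwartzMap FourierTransform NNReal

namespace HartreeAsymptotics

namespace Evolution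

open Time

variable {E : Type*} [NormedAddCommGroup E] [NormedSpace ℝ E]

/-- Two ways to sum over `l + q + j = m`. -/
lemma sum_triangle_assoc {M : Type*} [AddCommMonoid M] (m : ℕ) (f : ℕ → ℕ → ℕ → M) :
    ∑ i ∈ Finset.range (m + 1), ∑ l ∈ Finset.range (i + 1), f l (i - l) (m - i) =
      ∑ l ∈ Finset.range (m + 1), ∑ q ∈ Finset.range (m - l + 1), f l q (m - l - q) := by
  rw [Finset.sum_sigma', Finset.sum_sigma']
  refine Finset.sum_bij' (fun x _ => ⟨x.2, x.1 - x.2⟩) (fun x _ => ⟨x.1 + x.2, x.1⟩) ?_ ?_ ?_ ?_ ?_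
  · rintro ⟨i, l⟩ h
    simp only [Finset.mem_sigma, Finset.mem_range] at h ⊢
    omega
  · rintro ⟨l, q⟩ h
    simp only [Finset.mem_sigma, Finset.mem_range] at h ⊢
    omega
  · rintro ⟨i, l⟩ h
    simp only [Finset.mem_sigma, Finset.mem_range] at h
    simp only [Sigma.mk.injEq, heq_eq_eq, and_true]
    omega
  · rintro ⟨l, q⟩ h
    simp
  · rintro ⟨i, l⟩ h
    simp only [Finset.mem_sigma, Finset.mem_range] at h
    simp only
    congr 1
    omega

lemma sum_triangle_comm {M : Type*} [AddCommMonoid M] (m : ℕ) (f : ℕ → ℕ → ℕ → M) :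
    ∑ q ∈ Finset.range (m + 1), ∑ l ∈ Finset.range (m - q + 1), f l q (m - q - l) =
      ∑ l ∈ Finset.range (m + 1), ∑ q ∈ Finset.range (m - l + 1), f l q (m - l - q) := by
  have : ∑ l ∈ Finset.range (m + 1), ∑ q ∈ Finset.range (m - l + 1), f l q (m - l - q) =
      ∑ l ∈ Finset.range (m + 1), ∑ q ∈ Finset.range (m - l + 1), f l q (m - q - l) :=
    Finset.sum_congr rfl fun l _ => Finset.sum_congr rfl fun q _ => by rw [Nat.sub_right_comm]
  rw [this]
  refine Finset.sum_comm' fun x y => ?_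
  simp only [Finset.mem_range]
  omega

/-- The coefficients of the density `|w|²`. -/
def density (P : ℕ → ℕ → E →L[ℝ] E →L[ℝ] E) (J : E →L[ℝ] E) (x : ℕ → E) (m : ℕ) : E :=
  ∑ j ∈ Finset.range (m + 1), P j (m - j) (x j) (J (x (m - j)))

variable {T D G P S : ℕ → ℕ → E →L[ℝ] E →L[ℝ] E} {J : E →L[ℝ] E} {γ : ℝ} {C : ℝ≥0} {p : ℕ}
  {w w' : E} {W W' Φ Φ' : ℕ → ℝ → E}

/-- The transport equation for the density: the bilinear identities behind
`∂ₜ|w|² = t⁻² ∇·(|w|² ∇φ)`. -/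
lemma sum_transport_density
    (hJT : ∀ i j x y, J (T i j x y) = T i j (J x) (J y))
    (hassoc : ∀ l q j x y z, l + q + j ≤ p →
      P (l + q + 1) j (T l q x y) z + P q (l + j + 1) y (T l j x z) = S l (q + j) x (P q j y z))
    {m : ℕ} (hm : m ≤ p) (x y : ℕ → E) (hx : ∀ i, J (x i) = x i) :
    ∑ i ∈ Finset.range (m + 1),
        P (i + 1) (m - i) (∑ l ∈ Finset.range (i + 1), T l (i - l) (x l) (y (i - l)))
          (J (y (m - i))) +
      ∑ q ∈ Finset.range (m + 1),
        P q (m - q + 1) (y q)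
          (J (∑ l ∈ Finset.range (m - q + 1), T l (m - q - l) (x l) (y (m - q - l)))) =
      ∑ l ∈ Finset.range (m + 1), S l (m - l) (x l) (density P J y (m - l)) := by
  have e1 : ∑ i ∈ Finset.range (m + 1),
      P (i + 1) (m - i) (∑ l ∈ Finset.range (i + 1), T l (i - l) (x l) (y (i - l)))
          (J (y (m - i))) = ∑ i ∈ Finset.range (m + 1), ∑ l ∈ Finset.range (i + 1),
      P (l + (i - l) + 1) (m - i) (T l (i - l) (x l) (y (i - l))) (J (y (m - i))) := by
    refine Finset.sum_congr rfl fun i _ => ?_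
    rw [map_sum, ContinuousLinearMap.sum_apply]
    refine Finset.sum_congr rfl fun l hl => ?_
    have := Finset.mem_range.1 hl
    rw [show l + (i - l) = i by omega]
  have e2 : ∑ q ∈ Finset.range (m + 1),
        P q (m - q + 1) (y q)
          (J (∑ l ∈ Finset.range (m - q + 1), T l (m - q - l) (x l) (y (m - q - l)))) =
      ∑ q ∈ Finset.range (m + 1), ∑ l ∈ Finset.range (m - q + 1),
        P q (l + (m - q - l) + 1) (y q) (T l (m - q - l) (x l) (J (y (m - q - l)))) := by
    refine Finset.sum_congr rfl fun i _ => ?_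
    rw [map_sum, map_sum]
    refine Finset.sum_congr rfl fun l hl => ?_
    have := Finset.mem_range.1 hl
    rw [hJT, hx, show l + (m - i - l) = m - i by omega]
  -- Both double sums are reindexed by the triples with l + q + j = m, so that `hassoc` applies
  -- triple by triple.
  rw [e1, e2, sum_triangle_assoc m fun l q j => P (l + q + 1) j (T l q (x l) (y q)) (J (y j)),
    sum_triangle_comm m fun l q j => P q (l + j + 1) (y q) (T l j (x l) (J (y j))),
    ← Finset.sum_add_distrib]
  refine Finset.sum_congr rfl fun l hl => ?_
  have hl' := Finset.mem_range.1 hl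
  rw [density, map_sum, ← Finset.sum_add_distrib]
  refine Finset.sum_congr rfl fun q hq => ?_
  have hq' := Finset.mem_range.1 hq
  rw [hassoc _ _ _ _ _ _ (by omega), show q + (m - l - q) = m - l by omega]

variable [CompleteSpace E]

section Invariance

variable (hγ0 : 0 < γ) (hγ1 : γ ≤ 1)
  (hT : ∀ i j x y, ‖T i j x y‖ ≤ C * ‖x‖ * ‖y‖) (hD : ∀ i j x y, ‖D i j x y‖ ≤ C * ‖x‖ * ‖y‖)
  (hG : ∀ i j x y, ‖G i j x y‖ ≤ C * ‖x‖ * ‖y‖) (hW : Evolves T D G γ w W Φ)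
  (hW' : Evolves T D G γ w' W' Φ')
  (hJD : ∀ i j x y, J (D i j x y) = D i j (J x) (J y)) (hJG : ∀ i j x y, J (G i j x y) = G i j x y)

include hJD hJG in
omit [CompleteSpace E] in
lemma map_phaseRHS {m : ℕ} {s : ℝ} (h : ∀ i < m, J (Φ i s) = Φ i s) :
    J (phaseRHS D G γ W Φ m s) = phaseRHS D G γ W Φ m s := by
  simp only [phaseRHS, map_add, map_smul, map_sum, hJD, hJG]
  congr 2
  refine Finset.sum_congr rfl fun j hj => ?_
  have := Finset.mem_range.1 hj
  rw [h j (by omega), h (m - 1 - j) (by omega)]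

include hγ0 hγ1 hT hD hG hW hJD hJG

/-- The phases are invariant under `J`. -/
lemma Evolves.map_phase (m : ℕ) {t : ℝ} (ht : 1 ≤ t) : J (Φ m t) = Φ m t := by
  induction m using Nat.strong_induction_on generalizing t with
  | _ m ih =>
    rw [hW.phase, ← ContinuousLinearMap.intervalIntegral_comp_comm]
    · refine intervalIntegral.integral_congr fun s hs => ?_
      rw [Set.uIcc_of_le ht] at hs
      exact map_phaseRHS hJD hJG fun i hi => ih i hi hs.1
    · refine ContinuousOn.intervalIntegrable_of_Icc ht ?_
      exact (hW.continuousOn_phaseRHS hγ0 hγ1 hT hD hG m).mono Set.Icc_subset_Ici_self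

lemma Evolves.map_top (hp : 1 < ((p : ℝ) + 2) * γ) {t : ℝ} (ht : 1 ≤ t) :
    J (-∫ s in Set.Ioi t, phaseRHS D G γ W Φ (p + 1) s) =
      -∫ s in Set.Ioi t, phaseRHS D G γ W Φ (p + 1) s := by
  rw [map_neg, ← ContinuousLinearMap.integral_comp_comm]
  · congr 1
    refine setIntegral_congr_fun measurableSet_Ioi fun s hs => ?_
    exact map_phaseRHS hJD hJG fun i _ => hW.map_phase hγ0 hγ1 hT hD hG hJD hJG i
      (ht.trans (le_of_lt hs))
  · exact (hW.integrableOn_top hγ0 hγ1 hT hD hG hp).mono_set (Set.Ioi_subset_Ioi ht)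

variable (hJT : ∀ i j x y, J (T i j x y) = T i j (J x) (J y))
  (hassoc : ∀ l q j x y z, l + q + j ≤ p →
    P (l + q + 1) j (T l q x y) z + P q (l + j + 1) y (T l j x z) = S l (q + j) x (P q j y z))
include hJT hassoc

/-- The amplitude of index 0 is constant in time, so the two extreme terms of the product rule
disappear. The derivative of the density of index `m + 1` then involves only densities and phases of
index at most `m`, which is what an induction needs. -/
lemma Evolves.hasDerivWithinAt_density {m : ℕ} (hm : m ≤ p) {t : ℝ} (ht : 1 ≤ t) :
    HasDerivWithinAt (fun t => density P J (fun i => W i t) (m + 1))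
      ((2 * t ^ 2)⁻¹ • ∑ l ∈ Finset.range (m + 1),
        S l (m - l) (Φ l t) (density P J (fun i => W i t) (m - l))) (Set.Ici 1) t := by
  let dW : ℕ → E := fun i => match i with
    | 0 => 0
    | i + 1 => ampRHS T W Φ i t
  have hdW : ∀ i, HasDerivWithinAt (W i) (dW i) (Set.Ici 1) t := by
    intro i
    cases i with
    | zero =>
      have : W 0 = fun _ => w := funext hW.zero
      rw [this]
      exact hasDerivWithinAt_const _ _ _
    | succ i => exact hW.hasDerivWithinAt_succ hγ0 hγ1 hT hD hG i ht
  have h1 : HasDerivWithinAt (fun t => density P J (fun i => W i t) (m + 1))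
      (∑ j ∈ Finset.range (m + 1 + 1), (P j (m + 1 - j) (dW j) (J (W (m + 1 - j) t)) +
        P j (m + 1 - j) (W j t) (J (dW (m + 1 - j))))) (Set.Ici 1) t := by
    refine HasDerivWithinAt.fun_sum fun j _ => ?_
    exact ((P j (m + 1 - j)).hasFDerivAt.comp_hasDerivWithinAt t (hdW j)).clm_apply
      (J.hasFDerivAt.comp_hasDerivWithinAt t (hdW (m + 1 - j)))
  convert h1 using 1
  rw [Finset.sum_add_distrib,
    Finset.sum_range_succ' (fun j => P j (m + 1 - j) (dW j) (J (W (m + 1 - j) t))),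
    Finset.sum_range_succ
    (fun j => P j (m + 1 - j) (W j t) (J (dW (m + 1 - j))))]
  simp only [dW, map_zero, ContinuousLinearMap.zero_apply, add_zero, Nat.sub_self,
    Nat.add_sub_add_right]
  have h2 := sum_transport_density hJT hassoc hm (fun i => Φ i t) (fun i => W i t)
    (fun i => hW.map_phase hγ0 hγ1 hT hD hG hJD hJG i ht)
  rw [← h2, smul_add, Finset.smul_sum, Finset.smul_sum]
  congr 1
  · refine Finset.sum_congr rfl fun i _ => ?_
    simp only [ampRHS, map_smul, ContinuousLinearMap.smul_apply]
  · refine Finset.sum_congr rfl fun i hi => ?_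
    have := Finset.mem_range.1 hi
    rw [show m + 1 - i = m - i + 1 by omega]
    simp only [ampRHS, map_smul]

-- In a product of total index `m + 1` at least one factor has positive index, hence tends to 0,
-- while the other factor converges.
omit hJD hJG hJT hassoc in
lemma Evolves.tendsto_density (m : ℕ) :
    Tendsto (fun t => density P J (fun i => W i t) (m + 1)) atTop (𝓝 0) := by
  let lW : ℕ → E := fun i => if i = 0 then w else 0
  have hl : ∀ i, Tendsto (W i) atTop (𝓝 (lW i)) := by
    intro i
    cases i with
    | zero =>
      have : W 0 = fun _ => w := funext hW.zero
      rw [this]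
      exact tendsto_const_nhds
    | succ i => exact hW.tendsto_succ hγ0 hγ1 hT hD hG i
  have h0 : (0 : E) = ∑ j ∈ Finset.range (m + 1 + 1),
      P j (m + 1 - j) (lW j) (J (lW (m + 1 - j))) := by
    refine (Finset.sum_eq_zero fun j _ => ?_).symm
    rcases Nat.eq_zero_or_pos j with rfl | hj
    · simp [lW]
    · simp [lW, hj.ne']
  rw [h0]
  refine tendsto_finsetSum _ fun j _ => ?_
  have hc : Continuous fun z : E × E => P j (m + 1 - j) z.1 (J z.2) :=
    ((P j (m + 1 - j)).continuous.comp continuous_fst).clm_apply (J.continuous.comp continuous_snd)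
  exact (hc.tendsto (lW j, lW (m + 1 - j))).comp ((hl j).prodMk_nhds (hl _))

include hW'
variable (hPG : ∀ m ≤ p + 1, ∀ x y : ℕ → E, density P J x m = density P J y m →
    ∑ j ∈ Finset.range (m + 1), G j (m - j) (x j) (x (m - j)) =
      ∑ j ∈ Finset.range (m + 1), G j (m - j) (y j) (y (m - j)))
  (h0 : P 0 0 w (J w) = P 0 0 w' (J w'))
include hPG h0

/-- The phases and the densities only depend on the density of the data. -/
theorem Evolves.gauge {m : ℕ} (hm : m ≤ p + 1) {t : ℝ} (ht : 1 ≤ t) :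
    density P J (fun i => W i t) m = density P J (fun i => W' i t) m ∧
      phaseRHS D G γ W Φ m t = phaseRHS D G γ W' Φ' m t ∧ Φ m t = Φ' m t := by
  induction m using Nat.strong_induction_on generalizing t with
  | _ m ih =>
    have hd : ∀ t, 1 ≤ t →
        density P J (fun i => W i t) m = density P J (fun i => W' i t) m := by
      cases m with
      | zero =>
        intro t _
        simpa [density, hW.zero, hW'.zero] using h0
      | succ m =>
        have hm' : m ≤ p := by omega
        set f : ℝ → E := fun t => density P J (fun i => W i t) (m + 1) -
          density P J (fun i => W' i t) (m + 1) with hf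
        -- By the induction hypothesis the two densities have the same derivative. Their difference
        -- is thus constant, and its limit at infinity is 0.
        have hder : ∀ t, 1 ≤ t → HasDerivWithinAt f 0 (Set.Ici 1) t := by
          intro t ht
          have h1 := (hW.hasDerivWithinAt_density hγ0 hγ1 hT hD hG hJD hJG hJT hassoc hm' ht).sub
            (hW'.hasDerivWithinAt_density hγ0 hγ1 hT hD hG hJD hJG hJT hassoc hm' ht)
          refine h1.congr_deriv ?_
          rw [← smul_sub, ← Finset.sum_sub_distrib, Finset.sum_eq_zero, smul_zero]
          intro l hl
          have := Finset.mem_range.1 hl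
          rw [(ih l (by omega) (by omega) ht).2.2, (ih (m - l) (by omega) (by omega) ht).1, sub_self]
        have hconst : ∀ t, 1 ≤ t → f t = f 1 := by
          intro t ht
          exact (convex_Ici (1 : ℝ)).is_const_of_fderivWithin_eq_zero (𝕜 := ℝ)
            (fun x hx => (hder x hx).differentiableWithinAt)
            (fun x hx => by
              have := (hder x hx).hasFDerivWithinAt.fderivWithin
                ((uniqueDiffOn_Ici (1 : ℝ)) x hx)
              rw [this]; ext; simp) ht (Set.mem_Ici.2 le_rfl)
        have hlim : Tendsto f atTop (𝓝 0) := by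
          simpa using (hW.tendsto_density (P := P) (J := J) hγ0 hγ1 hT hD hG m).sub
            (hW'.tendsto_density (P := P) (J := J) hγ0 hγ1 hT hD hG m)
        have h1 : f 1 = 0 := by
          refine tendsto_nhds_unique (tendsto_const_nhds.congr' ?_) hlim
          filter_upwards [eventually_ge_atTop 1] with t ht
          exact (hconst t ht).symm
        intro t ht
        exact sub_eq_zero.1 ((hconst t ht).trans h1)
    have hrhs : ∀ t, 1 ≤ t → phaseRHS D G γ W Φ m t = phaseRHS D G γ W' Φ' m t := by
      intro t ht
      simp only [phaseRHS]
      congr 2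
      · refine Finset.sum_congr rfl fun j hj => ?_
        have := Finset.mem_range.1 hj
        rw [(ih j (by omega) (by omega) ht).2.2, (ih (m - 1 - j) (by omega) (by omega) ht).2.2]
      · exact hPG m hm (fun i => W i t) (fun i => W' i t) (hd t ht)
    refine ⟨hd t ht, hrhs t ht, ?_⟩
    rw [hW.phase, hW'.phase]
    refine intervalIntegral.integral_congr fun s hs => ?_
    rw [Set.uIcc_of_le ht] at hs
    exact hrhs s hs.1

end Invariance

end Evolution

end HartreeAsymptotics

end

noncomputable section

open MeasureTheory Filter Topology
open scoped ENNReal SchwartzMap FourierTransform NNReal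

namespace HartreeAsymptotics

/-! ### Bilinear convolution operators on `L²` -/

variable {n : ℕ}

/-- The `L²` norm of a nonnegative function. -/
def nrm (f : Sp n → ℝ≥0∞) : ℝ≥0∞ := (∫⁻ x, f x ^ (2 : ℝ)) ^ (1 / 2 : ℝ)

lemma nrm_mono {f g : Sp n → ℝ≥0∞} (h : ∀ x, f x ≤ g x) : nrm f ≤ nrm g :=
  ENNReal.rpow_le_rpow (lintegral_mono fun x => ENNReal.rpow_le_rpow (h x) (by norm_num))
    (by norm_num)

lemma nrm_add_le {f g : Sp n → ℝ≥0∞} (hf : Measurable f) (hg : Measurable g) :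
    nrm (fun x => f x + g x) ≤ nrm f + nrm g :=
  ENNReal.lintegral_Lp_add_le hf.aemeasurable hg.aemeasurable (by norm_num)

lemma lintegral_mul_le_nrm {f g : Sp n → ℝ≥0∞} (hf : Measurable f) (hg : Measurable g) :
    ∫⁻ x, f x * g x ≤ nrm f * nrm g :=
  ENNReal.lintegral_mul_le_Lp_mul_Lq volume Real.HolderConjugate.two_two hf.aemeasurable
    hg.aemeasurable

lemma nrm_mul_const {f : Sp n → ℝ≥0∞} (hf : Measurable f) (c : ℝ≥0∞) :
    nrm (fun x => f x * c) = nrm f * c := by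
  simp only [nrm, ENNReal.mul_rpow_of_nonneg _ _ (by norm_num : (0 : ℝ) ≤ 2)]
  rw [lintegral_mul_const _ (hf.pow_const _), ENNReal.mul_rpow_of_nonneg _ _ (by norm_num),
    ← ENNReal.rpow_mul]
  norm_num

lemma nrm_enorm_eq (f : Sp n → ℂ) : nrm (fun x => ‖f x‖ₑ) = eLpNorm f 2 volume := by
  rw [eLpNorm_eq_lintegral_rpow_enorm_toReal (by norm_num) (by norm_num)]
  simp [nrm]

lemma nrm_reflect {f : Sp n → ℝ≥0∞} (x : Sp n) : nrm (fun y => f (x - y)) = nrm f := by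
  simp only [nrm]
  rw [lintegral_sub_left_eq_self (fun y => f y ^ (2 : ℝ)) x]

/-- **Young's inequality** for the convolution of an integrable and a square integrable
function. -/
lemma nrm_convolution_le {u g : Sp n → ℝ≥0∞} (hu : Measurable u) (hg : Measurable g) :
    nrm (fun x => ∫⁻ y, u y * g (x - y)) ≤ (∫⁻ y, u y) * nrm g := by
  have hm : Measurable (Function.uncurry fun x y : Sp n => u y * g (x - y) ^ (2 : ℝ)) :=
    (hu.comp measurable_snd).mul
      ((hg.comp (measurable_fst.sub measurable_snd)).pow_const _)
  -- Cauchy–Schwarz for the measure u dy, obtained by writing u as the product of its two square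
  -- roots.
  have hpt : ∀ x, (∫⁻ y, u y * g (x - y)) ^ (2 : ℝ) ≤
      (∫⁻ y, u y) * ∫⁻ y, u y * g (x - y) ^ (2 : ℝ) := by
    intro x
    have e : ∀ y, u y * g (x - y) = u y ^ (1 / 2 : ℝ) * (u y ^ (1 / 2 : ℝ) * g (x - y)) := by
      intro y
      rw [← mul_assoc, ← ENNReal.rpow_add_of_nonneg _ _ (by norm_num) (by norm_num)]
      norm_num
    have h1 := lintegral_mul_le_nrm (f := fun y => u y ^ (1 / 2 : ℝ))
      (g := fun y => u y ^ (1 / 2 : ℝ) * g (x - y)) (hu.pow_const _)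
      ((hu.pow_const _).mul (hg.comp (measurable_const.sub measurable_id)))
    simp_rw [← e] at h1
    have h2 := ENNReal.rpow_le_rpow h1 (by norm_num : (0 : ℝ) ≤ 2)
    refine h2.trans (le_of_eq ?_)
    simp only [nrm]
    rw [ENNReal.mul_rpow_of_nonneg _ _ (by norm_num), ← ENNReal.rpow_mul, ← ENNReal.rpow_mul]
    norm_num
    congr 1
    · refine lintegral_congr fun y => ?_
      rw [← ENNReal.rpow_natCast, ← ENNReal.rpow_mul]; norm_num
    · refine lintegral_congr fun y => ?_
      rw [mul_pow, ← ENNReal.rpow_natCast, ← ENNReal.rpow_mul]; norm_num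
  have h3 : ∫⁻ x, (∫⁻ y, u y * g (x - y)) ^ (2 : ℝ) ≤
      (∫⁻ y, u y) ^ (2 : ℝ) * ∫⁻ y, g y ^ (2 : ℝ) := by
    refine (lintegral_mono hpt).trans (le_of_eq ?_)
    rw [lintegral_const_mul (f := fun x => ∫⁻ y, u y * g (x - y) ^ (2 : ℝ)) _
      hm.lintegral_prod_right', lintegral_lintegral_swap hm.aemeasurable]
    have : ∀ y, ∫⁻ x, u y * g (x - y) ^ (2 : ℝ) = u y * ∫⁻ x, g x ^ (2 : ℝ) := by
      intro y
      have hgy : Measurable fun x => g (x - y) ^ (2 : ℝ) :=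
        (hg.comp (measurable_id.sub measurable_const)).pow_const _
      rw [lintegral_const_mul _ hgy]
      exact congrArg _ (lintegral_sub_right_eq_self (fun x => g x ^ (2 : ℝ)) y)
    simp_rw [this]
    rw [lintegral_mul_const _ hu, ← mul_assoc]
    norm_num [sq]
  refine (ENNReal.rpow_le_rpow h3 (by norm_num : (0 : ℝ) ≤ 1 / 2)).trans (le_of_eq ?_)
  rw [ENNReal.mul_rpow_of_nonneg _ _ (by norm_num), ← ENNReal.rpow_mul]
  norm_num [nrm]

/-- The kernel `b` is dominated by `c₁(η) + c₂(ζ) + c₃(η + ζ)` with square integrable `cᵢ`. -/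
def KerBound (b : Sp n → Sp n → ℝ) (K : ℝ≥0) : Prop :=
  Measurable (Function.uncurry b) ∧ ∃ c₁ c₂ c₃ : Sp n → ℝ≥0∞,
    Measurable c₁ ∧ Measurable c₂ ∧ Measurable c₃ ∧
    (∀ η ζ, ‖b η ζ‖ₑ ≤ c₁ η + c₂ ζ + c₃ (η + ζ)) ∧ nrm c₁ + nrm c₂ + nrm c₃ ≤ K

/-- The nonnegative convolution with kernel `|b|`. -/
def lconv (b : Sp n → Sp n → ℝ) (f g : Sp n → ℝ≥0∞) (ξ : Sp n) : ℝ≥0∞ :=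
  ∫⁻ η, ‖b η (ξ - η)‖ₑ * (f η * g (ξ - η))

lemma measurable_sub_pair : Measurable fun z : Sp n × Sp n => (z.2, z.1 - z.2) :=
  measurable_snd.prodMk (measurable_fst.sub measurable_snd)

lemma measurable_lconv {b : Sp n → Sp n → ℝ} (hb : Measurable (Function.uncurry b))
    {f g : Sp n → ℝ≥0∞} (hf : Measurable f) (hg : Measurable g) : Measurable (lconv b f g) := by
  refine Measurable.lintegral_prod_right' (f := fun z : Sp n × Sp n =>
    ‖b z.2 (z.1 - z.2)‖ₑ * (f z.2 * g (z.1 - z.2))) ?_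
  exact ((hb.comp measurable_sub_pair).enorm).mul
    ((hf.comp measurable_snd).mul (hg.comp (measurable_fst.sub measurable_snd)))

/-- The three parts of the majorant use two inequalities. By Cauchy–Schwarz c₁f is integrable, and
Young's inequality convolves it with g; the part c₂ is symmetric. The part c₃ depends only on the
output variable, leaves the integral, and the remaining convolution of f and g is bounded pointwise
by Cauchy–Schwarz. -/
lemma KerBound.nrm_lconv_le {b : Sp n → Sp n → ℝ} {K : ℝ≥0} (hb : KerBound b K)
    {f g : Sp n → ℝ≥0∞} (hf : Measurable f) (hg : Measurable g) :
    nrm (lconv b f g) ≤ K * (nrm f * nrm g) := by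
  obtain ⟨_, c₁, c₂, c₃, h1, h2, h3, hle, hK⟩ := hb
  have hs : ∀ ξ : Sp n, Measurable fun η => g (ξ - η) := fun ξ =>
    hg.comp (measurable_const.sub measurable_id)
  have hs2 : ∀ ξ : Sp n, Measurable fun η => c₂ (ξ - η) := fun ξ =>
    h2.comp (measurable_const.sub measurable_id)
  let I1 : Sp n → ℝ≥0∞ := fun ξ => ∫⁻ η, (c₁ η * f η) * g (ξ - η)
  let I2 : Sp n → ℝ≥0∞ := fun ξ => ∫⁻ η, (c₂ η * g η) * f (ξ - η)
  have mc : ∀ {u v : Sp n → ℝ≥0∞}, Measurable u → Measurable v →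
      Measurable fun ξ => ∫⁻ η, u η * v (ξ - η) := by
    intro u v hu hv
    refine Measurable.lintegral_prod_right' (f := fun z : Sp n × Sp n => u z.2 * v (z.1 - z.2)) ?_
    exact (hu.comp measurable_snd).mul (hv.comp (measurable_fst.sub measurable_snd))
  have hI1 : Measurable I1 := mc (h1.mul hf) hg
  have hI2 : Measurable I2 := mc (h2.mul hg) hf
  have key : ∀ ξ, lconv b f g ξ ≤ (I1 ξ + I2 ξ) + c₃ ξ * (nrm f * nrm g) := by
    intro ξ
    have e2 : I2 ξ = ∫⁻ η, (c₂ (ξ - η) * g (ξ - η)) * f η := by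
      rw [← lintegral_sub_left_eq_self (fun η => (c₂ (ξ - η) * g (ξ - η)) * f η) ξ]
      simp only [I2, sub_sub_cancel]
    calc lconv b f g ξ ≤ ∫⁻ η, ((c₁ η * f η) * g (ξ - η) + (c₂ (ξ - η) * g (ξ - η)) * f η +
          c₃ ξ * (f η * g (ξ - η))) := by
          refine lintegral_mono fun η => ?_
          have := hle η (ξ - η)
          rw [add_sub_cancel] at this
          refine (mul_le_mul' this le_rfl).trans (le_of_eq ?_)
          ring
      _ = I1 ξ + I2 ξ + c₃ ξ * ∫⁻ η, f η * g (ξ - η) := by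
          rw [lintegral_add_right, lintegral_add_right, e2, lintegral_const_mul]
          · exact hf.mul (hs ξ)
          · exact ((hs2 ξ).mul (hs ξ)).mul hf
          · exact (hf.mul (hs ξ)).const_mul _
      _ ≤ _ := by
          gcongr
          refine (lintegral_mul_le_nrm hf (hs ξ)).trans ?_
          rw [nrm_reflect]
  calc nrm (lconv b f g) ≤ nrm (fun ξ => (I1 ξ + I2 ξ) + c₃ ξ * (nrm f * nrm g)) := nrm_mono key
    _ ≤ (nrm I1 + nrm I2) + nrm c₃ * (nrm f * nrm g) := by
        refine (nrm_add_le (hI1.add hI2) (h3.mul_const _)).trans ?_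
        rw [nrm_mul_const h3]
        gcongr
        exact nrm_add_le hI1 hI2
    _ ≤ ((nrm c₁ * nrm f) * nrm g + (nrm c₂ * nrm g) * nrm f) + nrm c₃ * (nrm f * nrm g) := by
        gcongr
        · refine (nrm_convolution_le (h1.mul hf) hg).trans ?_
          gcongr
          exact lintegral_mul_le_nrm h1 hf
        · refine (nrm_convolution_le (h2.mul hg) hf).trans ?_
          gcongr
          exact lintegral_mul_le_nrm h2 hg
    _ = (nrm c₁ + nrm c₂ + nrm c₃) * (nrm f * nrm g) := by ring
    _ ≤ _ := by gcongr

lemma ae_lt_top_of_nrm_lt_top {f : Sp n → ℝ≥0∞} (hf : Measurable f) (h : nrm f < ⊤) :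
    ∀ᵐ x, f x < ⊤ := by
  have h1 : ∫⁻ x, f x ^ (2 : ℝ) ≠ ⊤ := by
    intro h'
    rw [nrm, h', ENNReal.top_rpow_of_pos (by norm_num)] at h
    exact lt_irrefl _ h
  filter_upwards [ae_lt_top (hf.pow_const _) h1] with x hx
  by_contra hc
  rw [not_lt, top_le_iff] at hc
  rw [hc, ENNReal.top_rpow_of_pos (by norm_num)] at hx
  exact lt_irrefl _ hx

/-- `L²(ℝⁿ)`. -/
abbrev L2 (n : ℕ) : Type := Lp ℂ 2 (volume : Measure (Sp n))

lemma measurable_coe (F : L2 n) : Measurable (F : Sp n → ℂ) := (Lp.stronglyMeasurable F).measurable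

lemma nrm_coe (F : L2 n) : nrm (fun x => ‖F x‖ₑ) = ‖F‖ₑ := by
  rw [nrm_enorm_eq, Lp.enorm_def]

/-- The convolution with kernel `b`. -/
def convFun (b : Sp n → Sp n → ℝ) (F G : Sp n → ℂ) (ξ : Sp n) : ℂ :=
  ∫ η, (b η (ξ - η) : ℂ) * (F η * G (ξ - η))

lemma enorm_ofReal (x : ℝ) : ‖(x : ℂ)‖ₑ = ‖x‖ₑ := by
  rw [← ofReal_norm, ← ofReal_norm, Complex.norm_real]

lemma enorm_convFun_integrand (b : Sp n → Sp n → ℝ) (F G : Sp n → ℂ) (ξ η : Sp n) :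
    ‖(b η (ξ - η) : ℂ) * (F η * G (ξ - η))‖ₑ =
      ‖b η (ξ - η)‖ₑ * (‖F η‖ₑ * ‖G (ξ - η)‖ₑ) := by
  rw [enorm_mul, enorm_mul, enorm_ofReal]

lemma enorm_convFun_le (b : Sp n → Sp n → ℝ) (F G : Sp n → ℂ) (ξ : Sp n) :
    ‖convFun b F G ξ‖ₑ ≤ lconv b (fun x => ‖F x‖ₑ) (fun x => ‖G x‖ₑ) ξ := by
  refine (enorm_integral_le_lintegral_enorm _).trans (le_of_eq ?_)
  simp only [enorm_convFun_integrand]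
  rfl

lemma measurable_convFun_integrand {b : Sp n → Sp n → ℝ} (hb : Measurable (Function.uncurry b))
    {F G : Sp n → ℂ} (hF : Measurable F) (hG : Measurable G) :
    Measurable fun z : Sp n × Sp n => (b z.2 (z.1 - z.2) : ℂ) * (F z.2 * G (z.1 - z.2)) :=
  (Complex.measurable_ofReal.comp (hb.comp measurable_sub_pair)).mul
    ((hF.comp measurable_snd).mul (hG.comp (measurable_fst.sub measurable_snd)))

lemma measurable_convFun {b : Sp n → Sp n → ℝ} (hb : Measurable (Function.uncurry b))
    {F G : Sp n → ℂ} (hF : Measurable F) (hG : Measurable G) : Measurable (convFun b F G) := by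
  have := (measurable_convFun_integrand hb hF hG).stronglyMeasurable
  exact (this.integral_prod_right (ν := volume)).measurable

lemma ae_reflect {p : Sp n → Prop} (h : ∀ᵐ x, p x) (ξ : Sp n) : ∀ᵐ η, p (ξ - η) :=
  (quasiMeasurePreserving_sub_left volume ξ).ae h

lemma convFun_congr (b : Sp n → Sp n → ℝ) {F F' G G' : Sp n → ℂ} (hF : F =ᵐ[volume] F')
    (hG : G =ᵐ[volume] G') (ξ : Sp n) : convFun b F G ξ = convFun b F' G' ξ := by
  refine integral_congr_ae ?_
  filter_upwards [hF, ae_reflect hG ξ] with η h1 h2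
  rw [h1, h2]

lemma integrable_convFun {b : Sp n → Sp n → ℝ} (hb : Measurable (Function.uncurry b))
    {F G : Sp n → ℂ} (hF : Measurable F) (hG : Measurable G) {ξ : Sp n}
    (h : lconv b (fun x => ‖F x‖ₑ) (fun x => ‖G x‖ₑ) ξ < ⊤) :
    Integrable fun η => (b η (ξ - η) : ℂ) * (F η * G (ξ - η)) := by
  refine ⟨((measurable_convFun_integrand hb hF hG).comp
    measurable_prodMk_left).aestronglyMeasurable, ?_⟩
  rw [hasFiniteIntegral_iff_enorm]
  simp only [enorm_convFun_integrand]
  exact h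

section Operator

variable {b : Sp n → Sp n → ℝ} {K : ℝ≥0}

lemma KerBound.nrm_lconv_coe_le (hb : KerBound b K) (F G : L2 n) :
    nrm (lconv b (fun x => ‖F x‖ₑ) (fun x => ‖G x‖ₑ)) ≤ K * (‖F‖ₑ * ‖G‖ₑ) := by
  simpa only [nrm_coe] using
    hb.nrm_lconv_le (measurable_coe F).enorm (measurable_coe G).enorm

lemma KerBound.ae_lconv_lt_top (hb : KerBound b K) (F G : L2 n) :
    ∀ᵐ ξ, lconv b (fun x => ‖F x‖ₑ) (fun x => ‖G x‖ₑ) ξ < ⊤ := by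
  refine ae_lt_top_of_nrm_lt_top
    (measurable_lconv hb.1 (measurable_coe F).enorm (measurable_coe G).enorm)
    ((hb.nrm_lconv_coe_le F G).trans_lt ?_)
  exact ENNReal.mul_lt_top ENNReal.coe_lt_top (ENNReal.mul_lt_top enorm_lt_top enorm_lt_top)

lemma KerBound.ae_integrable (hb : KerBound b K) (F G : L2 n) :
    ∀ᵐ ξ, Integrable fun η => (b η (ξ - η) : ℂ) * (F η * G (ξ - η)) := by
  filter_upwards [hb.ae_lconv_lt_top F G] with ξ hξ
  exact integrable_convFun hb.1 (measurable_coe F) (measurable_coe G) hξ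

lemma KerBound.eLpNorm_convFun_le (hb : KerBound b K) (F G : L2 n) :
    eLpNorm (convFun b F G) 2 volume ≤ K * (‖F‖ₑ * ‖G‖ₑ) := by
  rw [← nrm_enorm_eq]
  exact (nrm_mono fun ξ => enorm_convFun_le b F G ξ).trans (hb.nrm_lconv_coe_le F G)

lemma KerBound.memLp_convFun (hb : KerBound b K) (F G : L2 n) :
    MemLp (convFun b F G) 2 volume :=
  ⟨(measurable_convFun hb.1 (measurable_coe F) (measurable_coe G)).aestronglyMeasurable,
    (hb.eLpNorm_convFun_le F G).trans_lt
      (ENNReal.mul_lt_top ENNReal.coe_lt_top (ENNReal.mul_lt_top enorm_lt_top enorm_lt_top))⟩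

/-- The bilinear operator of a bounded kernel. -/
def KerBound.op (hb : KerBound b K) : L2 n →L[ℝ] L2 n →L[ℝ] L2 n :=
  LinearMap.mkContinuous₂ (LinearMap.mk₂ ℝ (fun F G => (hb.memLp_convFun F G).toLp _)
    (by
      intro F F' G
      refine Lp.ext ?_
      filter_upwards [(hb.memLp_convFun (F + F') G).coeFn_toLp, (hb.memLp_convFun F G).coeFn_toLp,
        (hb.memLp_convFun F' G).coeFn_toLp, Lp.coeFn_add ((hb.memLp_convFun F G).toLp _)
          ((hb.memLp_convFun F' G).toLp _), hb.ae_integrable F G, hb.ae_integrable F' G]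
        with ξ h1 h2 h3 h4 h5 h6
      rw [h1, h4, Pi.add_apply, h2, h3, convFun_congr b (Lp.coeFn_add F F') (ae_eq_refl _)]
      rw [convFun, convFun, convFun, ← integral_add h5 h6]
      refine integral_congr_ae (ae_of_all _ fun η => ?_)
      simp only [Pi.add_apply]
      ring)
    (by
      intro c F G
      refine Lp.ext ?_
      filter_upwards [(hb.memLp_convFun (c • F) G).coeFn_toLp, (hb.memLp_convFun F G).coeFn_toLp,
        Lp.coeFn_smul c ((hb.memLp_convFun F G).toLp _)] with ξ h1 h2 h3
      rw [h1, h3, Pi.smul_apply, h2, convFun_congr b (Lp.coeFn_smul c F) (ae_eq_refl _)]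
      rw [convFun, convFun, ← integral_smul]
      refine integral_congr_ae (ae_of_all _ fun η => ?_)
      simp only [Pi.smul_apply, Complex.real_smul]
      ring)
    (by
      intro F G G'
      refine Lp.ext ?_
      filter_upwards [(hb.memLp_convFun F (G + G')).coeFn_toLp, (hb.memLp_convFun F G).coeFn_toLp,
        (hb.memLp_convFun F G').coeFn_toLp, Lp.coeFn_add ((hb.memLp_convFun F G).toLp _)
          ((hb.memLp_convFun F G').toLp _), hb.ae_integrable F G, hb.ae_integrable F G']
        with ξ h1 h2 h3 h4 h5 h6
      rw [h1, h4, Pi.add_apply, h2, h3, convFun_congr b (ae_eq_refl _) (Lp.coeFn_add G G')]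
      rw [convFun, convFun, convFun, ← integral_add h5 h6]
      refine integral_congr_ae (ae_of_all _ fun η => ?_)
      simp only [Pi.add_apply]
      ring)
    (by
      intro c F G
      refine Lp.ext ?_
      filter_upwards [(hb.memLp_convFun F (c • G)).coeFn_toLp, (hb.memLp_convFun F G).coeFn_toLp,
        Lp.coeFn_smul c ((hb.memLp_convFun F G).toLp _)] with ξ h1 h2 h3
      rw [h1, h3, Pi.smul_apply, h2, convFun_congr b (ae_eq_refl _) (Lp.coeFn_smul c G)]
      rw [convFun, convFun, ← integral_smul]
      refine integral_congr_ae (ae_of_all _ fun η => ?_)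
      simp only [Pi.smul_apply, Complex.real_smul]
      ring)) K
    (by
      intro F G
      rw [LinearMap.mk₂_apply, Lp.norm_toLp]
      refine (ENNReal.toReal_mono ?_ (hb.eLpNorm_convFun_le F G)).trans (le_of_eq ?_)
      · exact (ENNReal.mul_lt_top ENNReal.coe_lt_top
          (ENNReal.mul_lt_top enorm_lt_top enorm_lt_top)).ne
      · simp [mul_assoc])

lemma KerBound.op_ae (hb : KerBound b K) (F G : L2 n) : hb.op F G =ᵐ[volume] convFun b F G :=
  (hb.memLp_convFun F G).coeFn_toLp

lemma KerBound.norm_op_le (hb : KerBound b K) (F G : L2 n) : ‖hb.op F G‖ ≤ K * ‖F‖ * ‖G‖ := by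
  change ‖(hb.memLp_convFun F G).toLp _‖ ≤ _
  rw [Lp.norm_toLp]
  refine (ENNReal.toReal_mono ?_ (hb.eLpNorm_convFun_le F G)).trans (le_of_eq ?_)
  · exact (ENNReal.mul_lt_top ENNReal.coe_lt_top
      (ENNReal.mul_lt_top enorm_lt_top enorm_lt_top)).ne
  · simp [mul_assoc]

end Operator

end HartreeAsymptotics

end

/-! ### Conjugation in Fourier variables, and iterated bilinear operators. -/

noncomputable section

open MeasureTheory Filter Topology
open scoped ENNReal SchwartzMap FourierTransform NNReal

namespace HartreeAsymptotics

variable {n : ℕ}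

/-- The reflected conjugate `ξ ↦ conj (v (-ξ))`, the Fourier image of complex conjugation. -/
def reflConj (v : Sp n → ℂ) (ξ : Sp n) : ℂ := starRingEnd ℂ (v (-ξ))

lemma ae_neg {p : Sp n → Prop} (h : ∀ᵐ x, p x) : ∀ᵐ x, p (-x) :=
  (Measure.measurePreserving_neg (volume : Measure (Sp n))).quasiMeasurePreserving.ae h

lemma reflConj_congr {u v : Sp n → ℂ} (h : u =ᵐ[volume] v) : reflConj u =ᵐ[volume] reflConj v := by
  filter_upwards [ae_neg h] with x hx
  rw [reflConj, reflConj, hx]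

/-- `reflConj` as an operator on `L²`. -/
def reflConjL : L2 n →L[ℝ] L2 n :=
  ((Complex.conjCLE : ℂ →L[ℝ] ℂ).compLpL 2 volume).comp
    (Lp.compMeasurePreservingₗᵢ ℝ (fun x : Sp n => -x)
      (Measure.measurePreserving_neg (volume : Measure (Sp n)))).toContinuousLinearMap

lemma reflConjL_ae (F : L2 n) : reflConjL F =ᵐ[volume] reflConj F := by
  have h1 := (Complex.conjCLE : ℂ →L[ℝ] ℂ).coeFn_compLpL (p := 2)
    (Lp.compMeasurePreservingₗᵢ ℝ (fun x : Sp n => -x)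
      (Measure.measurePreserving_neg (volume : Measure (Sp n))) F)
  have h2 := Lp.coeFn_compMeasurePreserving F
    (Measure.measurePreserving_neg (volume : Measure (Sp n)))
  filter_upwards [h1, h2] with x hx hx2
  refine hx.trans ?_
  exact congrArg _ hx2

lemma convFun_reflConj {b : Sp n → Sp n → ℝ} (hb : ∀ η ζ, b (-η) (-ζ) = b η ζ) (F G : Sp n → ℂ)
    (ξ : Sp n) : reflConj (convFun b F G) ξ = convFun b (reflConj F) (reflConj G) ξ := by
  rw [reflConj, convFun, ← integral_conj, convFun, ← integral_neg_eq_self]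
  refine integral_congr_ae (ae_of_all _ fun η => ?_)
  simp only [reflConj, map_mul, Complex.conj_ofReal]
  rw [show -ξ - -η = -(ξ - η) by abel, hb]

lemma KerBound.reflConjL_op {b : Sp n → Sp n → ℝ} {K : ℝ≥0} (hb : KerBound b K)
    (hs : ∀ η ζ, b (-η) (-ζ) = b η ζ) (F G : L2 n) :
    reflConjL (hb.op F G) = hb.op (reflConjL F) (reflConjL G) := by
  refine Lp.ext ?_
  filter_upwards [reflConjL_ae (hb.op F G), reflConj_congr (hb.op_ae F G),
    hb.op_ae (reflConjL F) (reflConjL G)] with ξ h1 h2 h3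
  rw [h1, h2, h3, convFun_reflConj hs]
  exact (convFun_congr b (reflConjL_ae F) (reflConjL_ae G) ξ).symm

/-! ### Associativity -/

/-- An iterated convolution is one absolutely convergent double integral over the frequencies of the
first two factors. The left-nested case is brought to the same variables, so that identities between
kernels can be used pointwise. -/
lemma convFun_nested_right {b b' : Sp n → Sp n → ℝ} (hb : Measurable (Function.uncurry b))
    (hb' : Measurable (Function.uncurry b')) {F G H : Sp n → ℂ} (hF : Measurable F)
    (hG : Measurable G) (hH : Measurable H) {ξ : Sp n}
    (h : lconv b (fun x => ‖F x‖ₑ) (lconv b' (fun x => ‖G x‖ₑ) (fun x => ‖H x‖ₑ)) ξ < ⊤) :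
    Integrable (fun z : Sp n × Sp n => (b z.1 (ξ - z.1) : ℂ) * (b' z.2 (ξ - z.1 - z.2) : ℂ) *
      (F z.1 * (G z.2 * H (ξ - z.1 - z.2)))) (volume.prod volume) ∧
    convFun b F (convFun b' G H) ξ = ∫ z : Sp n × Sp n, (b z.1 (ξ - z.1) : ℂ) *
      (b' z.2 (ξ - z.1 - z.2) : ℂ) * (F z.1 * (G z.2 * H (ξ - z.1 - z.2))) ∂(volume.prod volume) := by
  have m3 : Measurable fun z : Sp n × Sp n => ξ - z.1 - z.2 :=
    (measurable_const.sub measurable_fst).sub measurable_snd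
  have mb : Measurable fun z : Sp n × Sp n => b z.1 (ξ - z.1) :=
    hb.comp (measurable_fst.prodMk (measurable_const.sub measurable_fst))
  have mb' : Measurable fun z : Sp n × Sp n => b' z.2 (ξ - z.1 - z.2) :=
    hb'.comp (measurable_snd.prodMk m3)
  have hm : Measurable fun z : Sp n × Sp n => (b z.1 (ξ - z.1) : ℂ) *
      (b' z.2 (ξ - z.1 - z.2) : ℂ) * (F z.1 * (G z.2 * H (ξ - z.1 - z.2))) :=
    ((Complex.measurable_ofReal.comp mb).mul (Complex.measurable_ofReal.comp mb')).mul
      ((hF.comp measurable_fst).mul ((hG.comp measurable_snd).mul (hH.comp m3)))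
  have hi : Integrable (fun z : Sp n × Sp n => (b z.1 (ξ - z.1) : ℂ) *
      (b' z.2 (ξ - z.1 - z.2) : ℂ) * (F z.1 * (G z.2 * H (ξ - z.1 - z.2))))
      (volume.prod volume) := by
    refine ⟨hm.aestronglyMeasurable, ?_⟩
    rw [hasFiniteIntegral_iff_enorm, lintegral_prod _ hm.enorm.aemeasurable]
    refine lt_of_eq_of_lt (lintegral_congr fun x => ?_) h
    simp only [lconv]
    rw [← lintegral_const_mul, ← lintegral_const_mul]
    · refine lintegral_congr fun y => ?_
      rw [enorm_mul, enorm_mul, enorm_mul, enorm_mul, enorm_ofReal, enorm_ofReal]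
      ring
    · exact ((mb'.comp measurable_prodMk_left).enorm.mul
        (hG.enorm.mul ((hH.comp m3).comp measurable_prodMk_left).enorm)).const_mul _
    · exact (mb'.comp measurable_prodMk_left).enorm.mul
        (hG.enorm.mul ((hH.comp m3).comp measurable_prodMk_left).enorm)
  refine ⟨hi, ?_⟩
  rw [integral_prod _ hi]
  refine integral_congr_ae (ae_of_all _ fun x => ?_)
  simp only [convFun]
  rw [← integral_const_mul, ← integral_const_mul]
  refine integral_congr_ae (ae_of_all _ fun y => ?_)
  simp only
  ring

lemma convFun_nested_left {b b' : Sp n → Sp n → ℝ} (hb : Measurable (Function.uncurry b))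
    (hb' : Measurable (Function.uncurry b')) {F G H : Sp n → ℂ} (hF : Measurable F)
    (hG : Measurable G) (hH : Measurable H) {ξ : Sp n}
    (h : lconv b (lconv b' (fun x => ‖F x‖ₑ) (fun x => ‖G x‖ₑ)) (fun x => ‖H x‖ₑ) ξ < ⊤) :
    Integrable (fun z : Sp n × Sp n => (b (z.1 + z.2) (ξ - z.1 - z.2) : ℂ) * (b' z.1 z.2 : ℂ) *
      (F z.1 * (G z.2 * H (ξ - z.1 - z.2)))) (volume.prod volume) ∧
    convFun b (convFun b' F G) H ξ = ∫ z : Sp n × Sp n, (b (z.1 + z.2) (ξ - z.1 - z.2) : ℂ) *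
      (b' z.1 z.2 : ℂ) * (F z.1 * (G z.2 * H (ξ - z.1 - z.2))) ∂(volume.prod volume) := by
  -- the integrand in the variables `α = η + ζ` and `η`
  let k : Sp n × Sp n → ℂ := fun z => (b z.1 (ξ - z.1) : ℂ) *
    (b' z.2 (z.1 - z.2) : ℂ) * (F z.2 * (G (z.1 - z.2) * H (ξ - z.1)))
  have mb : Measurable fun z : Sp n × Sp n => b z.1 (ξ - z.1) :=
    hb.comp (measurable_fst.prodMk (measurable_const.sub measurable_fst))
  have mb' : Measurable fun z : Sp n × Sp n => b' z.2 (z.1 - z.2) := hb'.comp measurable_sub_pair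
  have hm : Measurable k :=
    ((Complex.measurable_ofReal.comp mb).mul (Complex.measurable_ofReal.comp mb')).mul
      ((hF.comp measurable_snd).mul ((hG.comp (measurable_fst.sub measurable_snd)).mul
        (hH.comp (measurable_const.sub measurable_fst))))
  have hi : Integrable k (volume.prod volume) := by
    refine ⟨hm.aestronglyMeasurable, ?_⟩
    rw [hasFiniteIntegral_iff_enorm, lintegral_prod _ hm.enorm.aemeasurable]
    refine lt_of_eq_of_lt (lintegral_congr fun x => ?_) h
    have m1 : Measurable fun y => ‖b' y (x - y)‖ₑ * (‖F y‖ₑ * ‖G (x - y)‖ₑ) :=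
      (mb'.comp measurable_prodMk_left).enorm.mul
        (hF.enorm.mul (hG.comp (measurable_const.sub measurable_id)).enorm)
    simp only [lconv]
    rw [← lintegral_mul_const _ m1, ← lintegral_const_mul _ (m1.mul_const _)]
    refine lintegral_congr fun y => ?_
    simp only [k]
    rw [enorm_mul, enorm_mul, enorm_mul, enorm_mul, enorm_ofReal, enorm_ofReal]
    ring
  -- The map (η, ζ) ↦ (η + ζ, η) preserves volume; it replaces the frequency of the inner
  -- convolution by that of its second factor.
  have hshear : MeasurePreserving (fun z : Sp n × Sp n => (z.1 + z.2, z.1))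
      (volume.prod volume) (volume.prod volume) := by
    have h1 := measurePreserving_prod_add (volume : Measure (Sp n)) (volume : Measure (Sp n))
    exact (Measure.measurePreserving_swap).comp h1
  have hcomp : ∀ z : Sp n × Sp n, k (z.1 + z.2, z.1) = (b (z.1 + z.2) (ξ - z.1 - z.2) : ℂ) *
      (b' z.1 z.2 : ℂ) * (F z.1 * (G z.2 * H (ξ - z.1 - z.2))) := by
    intro z
    simp only [k, add_sub_cancel_left, sub_sub]
  have hi2 := hshear.integrable_comp_of_integrable hi
  simp only [Function.comp_def, hcomp] at hi2
  refine ⟨hi2, ?_⟩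
  have e1 : convFun b (convFun b' F G) H ξ = ∫ z, k z ∂(volume.prod volume) := by
    rw [integral_prod _ hi]
    refine integral_congr_ae (ae_of_all _ fun x => ?_)
    simp only [convFun, k]
    rw [← integral_mul_const, ← integral_const_mul]
    refine integral_congr_ae (ae_of_all _ fun y => ?_)
    simp only
    ring
  rw [e1, ← hshear.map_eq, integral_map hshear.measurable.aemeasurable
    (by rw [hshear.map_eq]; exact hm.aestronglyMeasurable)]
  simp only [hcomp, hshear.map_eq]

/-- A pointwise identity between kernels gives an identity between iterated operators. -/
theorem KerBound.op_assoc {b₁ b₂ b₃ b₄ b₅ b₆ : Sp n → Sp n → ℝ} {K₁ K₂ K₃ K₄ K₅ K₆ : ℝ≥0}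
    (h₁ : KerBound b₁ K₁) (h₂ : KerBound b₂ K₂) (h₃ : KerBound b₃ K₃) (h₄ : KerBound b₄ K₄)
    (h₅ : KerBound b₅ K₅) (h₆ : KerBound b₆ K₆)
    (h : ∀ η ζ θ, b₁ (η + ζ) θ * b₂ η ζ + b₃ ζ (η + θ) * b₄ η θ = b₅ η (ζ + θ) * b₆ ζ θ)
    (F G H : L2 n) :
    h₁.op (h₂.op F G) H + h₃.op G (h₄.op F H) = h₅.op F (h₆.op G H) := by
  have mF := measurable_coe F
  have mG := measurable_coe G
  have mH := measurable_coe H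
  have hfin : ∀ {b b' : Sp n → Sp n → ℝ} {K K' : ℝ≥0} (_ : KerBound b K) (_ : KerBound b' K')
      (A B C : L2 n), ∀ᵐ ξ, lconv b (fun x => ‖A x‖ₑ)
        (lconv b' (fun x => ‖B x‖ₑ) (fun x => ‖C x‖ₑ)) ξ < ⊤ := by
    intro b b' K K' hb hb' A B C
    have m1 := measurable_lconv hb'.1 (measurable_coe B).enorm (measurable_coe C).enorm
    refine ae_lt_top_of_nrm_lt_top (measurable_lconv hb.1 (measurable_coe A).enorm m1)
      ((hb.nrm_lconv_le (measurable_coe A).enorm m1).trans_lt ?_)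
    rw [nrm_coe]
    exact ENNReal.mul_lt_top ENNReal.coe_lt_top (ENNReal.mul_lt_top enorm_lt_top
      ((hb'.nrm_lconv_coe_le B C).trans_lt
        (ENNReal.mul_lt_top ENNReal.coe_lt_top (ENNReal.mul_lt_top enorm_lt_top enorm_lt_top))))
  have hfin1 : ∀ᵐ ξ, lconv b₁ (lconv b₂ (fun x => ‖F x‖ₑ) (fun x => ‖G x‖ₑ))
      (fun x => ‖H x‖ₑ) ξ < ⊤ := by
    have m1 := measurable_lconv h₂.1 mF.enorm mG.enorm
    refine ae_lt_top_of_nrm_lt_top (measurable_lconv h₁.1 m1 mH.enorm)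
      ((h₁.nrm_lconv_le m1 mH.enorm).trans_lt ?_)
    rw [nrm_coe]
    exact ENNReal.mul_lt_top ENNReal.coe_lt_top (ENNReal.mul_lt_top
      ((h₂.nrm_lconv_coe_le F G).trans_lt
        (ENNReal.mul_lt_top ENNReal.coe_lt_top (ENNReal.mul_lt_top enorm_lt_top enorm_lt_top)))
      enorm_lt_top)
  refine Lp.ext ?_
  filter_upwards [Lp.coeFn_add (h₁.op (h₂.op F G) H) (h₃.op G (h₄.op F H)),
    h₁.op_ae (h₂.op F G) H, h₃.op_ae G (h₄.op F H), h₅.op_ae F (h₆.op G H), hfin1,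
    hfin h₃ h₄ G F H, hfin h₅ h₆ F G H] with ξ e1 e2 e3 e4 f1 f2 f3
  rw [e1, Pi.add_apply, e2, e3, e4, convFun_congr b₁ (h₂.op_ae F G) (ae_eq_refl _),
    convFun_congr b₃ (ae_eq_refl _) (h₄.op_ae F H), convFun_congr b₅ (ae_eq_refl _) (h₆.op_ae G H)]
  obtain ⟨i1, q1⟩ := convFun_nested_left h₁.1 h₂.1 mF mG mH f1
  obtain ⟨i2, q2⟩ := convFun_nested_right h₃.1 h₄.1 mG mF mH f2
  obtain ⟨i3, q3⟩ := convFun_nested_right h₅.1 h₆.1 mF mG mH f3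
  -- In this term `G` stands outermost, so the two integration variables have to be exchanged to
  -- match the other two terms.
  have q2' := q2.trans (integral_prod_swap _).symm
  rw [q1, q2', q3]
  refine (integral_add i1 i2.swap).symm.trans ?_
  refine integral_congr_ae (ae_of_all _ fun z => ?_)
  have := h z.1 z.2 (ξ - z.1 - z.2)
  rw [show z.1 + (ξ - z.1 - z.2) = ξ - z.2 by abel, show z.2 + (ξ - z.1 - z.2) = ξ - z.1 by abel]
    at this
  have hc : (b₁ (z.1 + z.2) (ξ - z.1 - z.2) : ℂ) * (b₂ z.1 z.2 : ℂ) +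
      (b₃ z.2 (ξ - z.2) : ℂ) * (b₄ z.1 (ξ - z.1 - z.2) : ℂ) =
      (b₅ z.1 (ξ - z.1) : ℂ) * (b₆ z.2 (ξ - z.1 - z.2) : ℂ) := by exact_mod_cast this
  simp only [Function.comp, Prod.swap]
  rw [show ξ - z.2 - z.1 = ξ - z.1 - z.2 by abel, ← hc]
  ring

end HartreeAsymptotics

end

noncomputable section

open MeasureTheory Filter Topology
open scoped ENNReal SchwartzMap FourierTransform NNReal

namespace HartreeAsymptotics

variable {n : ℕ}

/-! ### Weights -/

/-- `|ξ| ∨ 1`. -/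
def hi (ξ : Sp n) : ℝ := max ‖ξ‖ 1

/-- `|ξ| ∧ 1`. -/
def lo (ξ : Sp n) : ℝ := min ‖ξ‖ 1

/-- The weight that defines the norm `weightedNorm`. -/
def wt (ρ ν a b : ℝ) (ξ : Sp n) : ℝ :=
  (if 1 < ‖ξ‖ then ‖ξ‖ ^ a else ‖ξ‖ ^ b) * gevreyWeight ρ ν ξ

lemma one_le_hi (ξ : Sp n) : 1 ≤ hi ξ := le_max_right _ _
lemma hi_pos (ξ : Sp n) : 0 < hi ξ := one_pos.trans_le (one_le_hi ξ)
lemma lo_nonneg (ξ : Sp n) : 0 ≤ lo ξ := le_min (norm_nonneg _) zero_le_one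
lemma lo_le_one (ξ : Sp n) : lo ξ ≤ 1 := min_le_right _ _
lemma lo_pos {ξ : Sp n} (h : ξ ≠ 0) : 0 < lo ξ := lt_min (norm_pos_iff.2 h) one_pos
lemma norm_le_hi (ξ : Sp n) : ‖ξ‖ ≤ hi ξ := le_max_left _ _
lemma hi_neg (ξ : Sp n) : hi (-ξ) = hi ξ := by simp [hi]
lemma lo_neg (ξ : Sp n) : lo (-ξ) = lo ξ := by simp [lo]
lemma measurable_hi : Measurable (hi : Sp n → ℝ) := measurable_norm.max measurable_const
lemma measurable_lo : Measurable (lo : Sp n → ℝ) := measurable_norm.min measurable_const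

lemma hi_rpow_mul_lo_rpow (a b : ℝ) (ξ : Sp n) :
    hi ξ ^ a * lo ξ ^ b = if 1 < ‖ξ‖ then ‖ξ‖ ^ a else ‖ξ‖ ^ b := by
  split_ifs with h
  · rw [hi, lo, max_eq_left h.le, min_eq_right h.le, Real.one_rpow, mul_one]
  · rw [hi, lo, max_eq_right (not_lt.1 h), min_eq_left (not_lt.1 h), Real.one_rpow, one_mul]

lemma wt_eq (ρ ν a b : ℝ) (ξ : Sp n) :
    wt ρ ν a b ξ = hi ξ ^ a * lo ξ ^ b * gevreyWeight ρ ν ξ := by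
  rw [wt, hi_rpow_mul_lo_rpow]

lemma gevreyWeight_pos (ρ ν : ℝ) (ξ : Sp n) : 0 < gevreyWeight ρ ν ξ := Real.exp_pos _

lemma one_le_gevreyWeight {ρ : ℝ} (hρ : 0 ≤ ρ) (ν : ℝ) (ξ : Sp n) : 1 ≤ gevreyWeight ρ ν ξ :=
  Real.one_le_exp (mul_nonneg hρ (zero_le_one.trans (le_max_right _ _)))

lemma gevreyWeight_neg (ρ ν : ℝ) (ξ : Sp n) : gevreyWeight ρ ν (-ξ) = gevreyWeight ρ ν ξ := by
  simp [gevreyWeight]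

lemma measurable_gevreyWeight (ρ ν : ℝ) : Measurable (gevreyWeight ρ ν : Sp n → ℝ) :=
  (((measurable_norm.pow_const ν).max measurable_const).const_mul ρ).exp

/-- For 0 ≤ ν ≤ 1 the function r ↦ r^ν is subadditive, and taking the maximum with 1 preserves this.
No constant appears, so every later bound is uniform in ρ and ν. -/
lemma gevreyWeight_add_le {ρ ν : ℝ} (hρ : 0 ≤ ρ) (h0 : 0 ≤ ν) (h1 : ν ≤ 1) (η ζ : Sp n) :
    gevreyWeight ρ ν (η + ζ) ≤ gevreyWeight ρ ν η * gevreyWeight ρ ν ζ := by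
  rw [gevreyWeight, gevreyWeight, gevreyWeight, ← Real.exp_add, ← mul_add]
  refine Real.exp_le_exp.2 (mul_le_mul_of_nonneg_left (max_le ?_ ?_) hρ)
  · calc ‖η + ζ‖ ^ ν ≤ (‖η‖ + ‖ζ‖) ^ ν := Real.rpow_le_rpow (norm_nonneg _) (norm_add_le _ _) h0
      _ ≤ ‖η‖ ^ ν + ‖ζ‖ ^ ν := Real.rpow_add_le_add_rpow (norm_nonneg _) (norm_nonneg _) h0 h1
      _ ≤ _ := add_le_add (le_max_left _ _) (le_max_left _ _)
  · linarith [le_max_right (‖η‖ ^ ν) 1, le_max_right (‖ζ‖ ^ ν) 1]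

lemma measurable_wt (ρ ν a b : ℝ) : Measurable (wt ρ ν a b : Sp n → ℝ) := by
  have : (wt ρ ν a b : Sp n → ℝ) = fun ξ => hi ξ ^ a * lo ξ ^ b * gevreyWeight ρ ν ξ :=
    funext (wt_eq ρ ν a b)
  rw [this]
  exact ((measurable_hi.pow_const a).mul (measurable_lo.pow_const b)).mul
    (measurable_gevreyWeight ρ ν)

lemma wt_neg (ρ ν a b : ℝ) (ξ : Sp n) : wt ρ ν a b (-ξ) = wt ρ ν a b ξ := by
  rw [wt_eq, wt_eq, hi_neg, lo_neg, gevreyWeight_neg]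

lemma wt_nonneg (ρ ν a b : ℝ) (ξ : Sp n) : 0 ≤ wt ρ ν a b ξ := by
  rw [wt_eq]
  have := hi_pos ξ
  have := lo_nonneg ξ
  have := gevreyWeight_pos ρ ν ξ
  positivity

lemma wt_pos (ρ ν a b : ℝ) {ξ : Sp n} (h : ξ ≠ 0) : 0 < wt ρ ν a b ξ := by
  rw [wt_eq]
  have := hi_pos ξ
  have := lo_pos h
  have := gevreyWeight_pos ρ ν ξ
  positivity

lemma wt_zero_pos (ρ ν a : ℝ) (ξ : Sp n) : 0 < wt ρ ν a 0 ξ := by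
  rw [wt_eq, Real.rpow_zero]
  have := hi_pos ξ
  have := gevreyWeight_pos ρ ν ξ
  positivity

/-! ### Square integrable majorants -/

/-- In polar coordinates the radial density is r^(n-1+b) on (0,1] and r^(n-1+a) beyond 1. -/
lemma integrable_hi_lo (hn : 0 < n) {a b : ℝ} (ha : a < -n) (hb : -n < b) :
    Integrable (fun ξ : Sp n => hi ξ ^ a * lo ξ ^ b) := by
  have : Nonempty (Fin n) := ⟨⟨0, hn⟩⟩
  have hd : Module.finrank ℝ (Sp n) = n := finrank_euclideanSpace_fin
  have : Nontrivial (Sp n) := Module.nontrivial_of_finrank_pos (R := ℝ) (by rw [hd]; exact hn)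
  refine (integrable_fun_norm_addHaar volume (f := fun y : ℝ => max y 1 ^ a * min y 1 ^ b)).2 ?_
  rw [hd, ← Set.Ioc_union_Ioi_eq_Ioi zero_le_one]
  have hpow : ∀ y : ℝ, 0 < y → ∀ c : ℝ, y ^ (n - 1) * y ^ c = y ^ ((n : ℝ) - 1 + c) := by
    intro y hy c
    rw [Real.rpow_add hy, ← Real.rpow_natCast, Nat.cast_sub hn, Nat.cast_one]
  refine IntegrableOn.union ?_ ?_
  · have h1 : IntegrableOn (fun y : ℝ => y ^ ((n : ℝ) - 1 + b)) (Set.Ioc 0 1) :=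
      (intervalIntegrable_iff_integrableOn_Ioc_of_le zero_le_one).1
        (intervalIntegral.intervalIntegrable_rpow' (by linarith))
    refine h1.congr_fun (fun y hy => ?_) measurableSet_Ioc
    simp only [max_eq_right hy.2, min_eq_left hy.2, Real.one_rpow, one_mul, smul_eq_mul]
    exact (hpow y hy.1 b).symm
  · have h1 : IntegrableOn (fun y : ℝ => y ^ ((n : ℝ) - 1 + a)) (Set.Ioi 1) :=
      integrableOn_Ioi_rpow_of_lt (by linarith) one_pos
    refine h1.congr_fun (fun y hy => ?_) measurableSet_Ioi
    simp only [max_eq_left (Set.mem_Ioi.1 hy).le, min_eq_right (Set.mem_Ioi.1 hy).le,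
      Real.one_rpow, mul_one, smul_eq_mul]
    exact (hpow y (one_pos.trans hy) a).symm

lemma ae_ne_zero (hn : 0 < n) : ∀ᵐ ξ : Sp n, ξ ≠ 0 := by
  have hd : Module.finrank ℝ (Sp n) = n := finrank_euclideanSpace_fin
  have : Nontrivial (Sp n) := Module.nontrivial_of_finrank_pos (R := ℝ) (by rw [hd]; exact hn)
  rw [ae_iff]
  simp

/-- The majorant `hi^(-k) lo^(-l)`, with the value `⊤` at the origin. -/
def maj (k l : ℝ) (ξ : Sp n) : ℝ≥0∞ :=
  if ξ = 0 then ⊤ else ENNReal.ofReal (hi ξ ^ (-k) * lo ξ ^ (-l))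

lemma measurable_maj (k l : ℝ) : Measurable (maj k l : Sp n → ℝ≥0∞) :=
  Measurable.ite (measurableSet_singleton 0) measurable_const
    ((measurable_hi.pow_const _).mul (measurable_lo.pow_const _)).ennreal_ofReal

/-- The value ⊤ at the origin costs nothing because a point is null for n > 0, and it makes
domination by `maj` automatic where the negative power of `lo` is not meaningful. -/
lemma nrm_maj_lt_top (hn : 0 < n) {k l : ℝ} (hk : (n : ℝ) / 2 < k) (hl : l < (n : ℝ) / 2) :
    nrm (maj k l : Sp n → ℝ≥0∞) < ⊤ := by
  have hi2 := (integrable_hi_lo (n := n) hn (a := -(2 * k)) (b := -(2 * l)) (by linarith)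
    (by linarith)).lintegral_lt_top
  refine ENNReal.rpow_lt_top_of_nonneg (by norm_num) (ne_of_lt (lt_of_le_of_lt ?_ hi2))
  refine lintegral_mono_ae ?_
  filter_upwards [ae_ne_zero hn] with ξ h
  have p1 := hi_pos ξ
  have p2 := lo_pos h
  rw [maj, if_neg h, ENNReal.ofReal_rpow_of_nonneg (by positivity) (by norm_num),
    Real.mul_rpow (by positivity) (by positivity), ← Real.rpow_mul p1.le, ← Real.rpow_mul p2.le]
  refine ENNReal.ofReal_le_ofReal (le_of_eq ?_)
  congr 2 <;> ring

/-! ### Pointwise product estimates -/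

lemma hi_add_le {η ζ : Sp n} (h : ‖ζ‖ ≤ ‖η‖) : hi (η + ζ) ≤ 2 * hi η := by
  have := norm_add_le η ζ
  refine max_le ?_ ?_
  · linarith [norm_le_hi η]
  · linarith [one_le_hi η]

lemma lo_add_le {η ζ : Sp n} (h : ‖ζ‖ ≤ ‖η‖) : lo (η + ζ) ≤ 2 * lo η := by
  have := norm_add_le η ζ
  rcases le_total ‖η‖ 1 with h1 | h1
  · rw [show lo η = ‖η‖ from min_eq_left h1]
    exact (min_le_left _ _).trans (by linarith)
  · rw [show lo η = 1 from min_eq_right h1]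
    exact (min_le_right _ _).trans (by norm_num)

/-- The sum of frequencies is controlled by the larger one, η. The unused exponent a₁ - s of η is
transferred to the smaller frequency ζ, where together with a₂ it leaves a surplus of at least k. -/
lemma hi_rpow_add_le_of_le {k s a₁ a₂ : ℝ} (hs : 0 ≤ s) (h1 : s ≤ a₁) (h : k ≤ a₁ + a₂ - s)
    {η ζ : Sp n} (hle : ‖ζ‖ ≤ ‖η‖) :
    hi (η + ζ) ^ s ≤ 2 ^ s * (hi η ^ a₁ * hi ζ ^ a₂ * hi ζ ^ (-k)) := by
  have p1 := hi_pos η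
  have p2 := hi_pos ζ
  have hhi : hi ζ ≤ hi η := max_le_max hle le_rfl
  calc hi (η + ζ) ^ s ≤ (2 * hi η) ^ s := Real.rpow_le_rpow (hi_pos _).le (hi_add_le hle) hs
    _ = 2 ^ s * (hi η ^ a₁ * hi η ^ (s - a₁)) := by
      rw [Real.mul_rpow two_pos.le p1.le, ← Real.rpow_add p1]; congr 2; ring
    _ ≤ 2 ^ s * (hi η ^ a₁ * hi ζ ^ (s - a₁)) := by
      gcongr 2 ^ s * (hi η ^ a₁ * ?_)
      exact Real.rpow_le_rpow_of_nonpos p2 hhi (by linarith)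
    _ ≤ 2 ^ s * (hi η ^ a₁ * hi ζ ^ (a₂ - k)) := by
      gcongr 2 ^ s * (hi η ^ a₁ * ?_)
      exact Real.rpow_le_rpow_of_exponent_le (one_le_hi ζ) (by linarith)
    _ = _ := by rw [sub_eq_add_neg, Real.rpow_add p2]; ring

lemma lo_mul_lo_neg {η : Sp n} (l : ℝ) (h : η ≠ 0) : lo η ^ l * lo η ^ (-l) = 1 := by
  rw [← Real.rpow_add (lo_pos h), add_neg_cancel, Real.rpow_zero]

section
variable {k l s a₁ a₂ : ℝ} (hl : 0 ≤ l) (hs : 0 ≤ s) (h1 : s ≤ a₁) (h2 : s ≤ a₂)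
  (h : k ≤ a₁ + a₂ - s) {η ζ : Sp n} (hη : η ≠ 0) (hζ : ζ ≠ 0)

include hl hs h1 h hη hζ in
lemma hi_lo_add_le_of_le (hle : ‖ζ‖ ≤ ‖η‖) :
    hi (η + ζ) ^ s * lo (η + ζ) ^ l ≤ 2 ^ (s + l) *
      (hi η ^ a₁ * lo η ^ l * (hi ζ ^ a₂ * lo ζ ^ l) * (hi ζ ^ (-k) * lo ζ ^ (-l))) := by
  have p1 := hi_pos η
  have p2 := hi_pos ζ
  have q1 := lo_pos hη
  calc _ ≤ 2 ^ s * (hi η ^ a₁ * hi ζ ^ a₂ * hi ζ ^ (-k)) * (2 * lo η) ^ l :=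
        mul_le_mul (hi_rpow_add_le_of_le hs h1 h hle)
          (Real.rpow_le_rpow (lo_nonneg _) (lo_add_le hle) hl)
          (Real.rpow_nonneg (lo_nonneg _) _) (by positivity)
    _ = 2 ^ (s + l) * (hi η ^ a₁ * lo η ^ l * (hi ζ ^ a₂ * hi ζ ^ (-k))) *
        (lo ζ ^ l * lo ζ ^ (-l)) := by
      rw [lo_mul_lo_neg l hζ, Real.mul_rpow two_pos.le q1.le, Real.rpow_add two_pos]; ring
    _ = _ := by ring

include hl hs h1 h2 h hη hζ in
lemma hi_lo_add_le : hi (η + ζ) ^ s * lo (η + ζ) ^ l ≤ 2 ^ (s + l) *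
      (hi η ^ a₁ * lo η ^ l * (hi ζ ^ a₂ * lo ζ ^ l) *
        (hi η ^ (-k) * lo η ^ (-l) + hi ζ ^ (-k) * lo ζ ^ (-l))) := by
  have p1 := hi_pos η
  have p2 := hi_pos ζ
  have q1 := lo_pos hη
  have q2 := lo_pos hζ
  rcases le_total ‖ζ‖ ‖η‖ with hle | hle
  · refine (hi_lo_add_le_of_le hl hs h1 h hη hζ hle).trans ?_
    gcongr
    exact le_add_of_nonneg_left (by positivity)
  · rw [add_comm η ζ]
    refine (hi_lo_add_le_of_le (k := k) hl hs h2 (a₂ := a₁) (by linarith) hζ hη hle).trans ?_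
    rw [mul_comm (hi ζ ^ a₂ * lo ζ ^ l)]
    have : hi η ^ (-k) * lo η ^ (-l) ≤ hi η ^ (-k) * lo η ^ (-l) + hi ζ ^ (-k) * lo ζ ^ (-l) :=
      le_add_of_nonneg_right (by positivity)
    gcongr

-- Version in which only η carries a low-frequency weight, as for a phase acting on an amplitude.
-- When η is larger, lo ζ ≤ lo η makes the factor (lo η)^l (lo ζ)^(-l) at least 1; when ζ is larger,
-- the weight of η is compensated by its own inverse.
include hl hs h1 h2 h hη hζ in
lemma hi_add_le_lo : hi (η + ζ) ^ s ≤ 2 ^ s *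
      (hi η ^ a₁ * lo η ^ l * hi ζ ^ a₂ *
        (hi η ^ (-k) * lo η ^ (-l) + hi ζ ^ (-k) * lo ζ ^ (-l))) := by
  have p1 := hi_pos η
  have p2 := hi_pos ζ
  have q1 := lo_pos hη
  have q2 := lo_pos hζ
  rcases le_total ‖ζ‖ ‖η‖ with hle | hle
  · refine (hi_rpow_add_le_of_le hs h1 h hle).trans ?_
    have hlo : lo ζ ≤ lo η := min_le_min_right _ hle
    have : 1 ≤ lo η ^ l * lo ζ ^ (-l) := by
      rw [← lo_mul_lo_neg l hζ]
      gcongr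
    calc 2 ^ s * (hi η ^ a₁ * hi ζ ^ a₂ * hi ζ ^ (-k))
        = 2 ^ s * (hi η ^ a₁ * hi ζ ^ a₂ * hi ζ ^ (-k)) * 1 := by ring
      _ ≤ 2 ^ s * (hi η ^ a₁ * hi ζ ^ a₂ * hi ζ ^ (-k)) * (lo η ^ l * lo ζ ^ (-l)) := by gcongr
      _ = 2 ^ s * (hi η ^ a₁ * lo η ^ l * hi ζ ^ a₂ * (hi ζ ^ (-k) * lo ζ ^ (-l))) := by ring
      _ ≤ _ := by
        gcongr
        exact le_add_of_nonneg_left (by positivity)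
  · rw [add_comm η ζ]
    refine (hi_rpow_add_le_of_le (k := k) hs h2 (a₂ := a₁) (by linarith) hle).trans ?_
    calc 2 ^ s * (hi ζ ^ a₂ * hi η ^ a₁ * hi η ^ (-k))
        = 2 ^ s * (hi ζ ^ a₂ * hi η ^ a₁ * hi η ^ (-k)) * (lo η ^ l * lo η ^ (-l)) := by
          rw [lo_mul_lo_neg l hη, mul_one]
      _ = 2 ^ s * (hi η ^ a₁ * lo η ^ l * hi ζ ^ a₂ * (hi η ^ (-k) * lo η ^ (-l))) := by ring
      _ ≤ _ := by
        have : hi η ^ (-k) * lo η ^ (-l) ≤ hi η ^ (-k) * lo η ^ (-l) + hi ζ ^ (-k) * lo ζ ^ (-l) :=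
          le_add_of_nonneg_right (by positivity)
        gcongr

end

/-! ### Kernels -/

/-- The kernel of the bilinear operator with symbol `σ`, conjugated by weights. -/
def ker (ω ω₁ ω₂ : Sp n → ℝ) (σ : Sp n → Sp n → ℝ) (η ζ : Sp n) : ℝ :=
  ω (η + ζ) * σ η ζ * (ω₁ η)⁻¹ * (ω₂ ζ)⁻¹

lemma measurable_ker {ω ω₁ ω₂ : Sp n → ℝ} {σ : Sp n → Sp n → ℝ} (h : Measurable ω)
    (h₁ : Measurable ω₁) (h₂ : Measurable ω₂) (hσ : Measurable (Function.uncurry σ)) :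
    Measurable (Function.uncurry (ker ω ω₁ ω₂ σ)) :=
  (((h.comp (measurable_fst.add measurable_snd)).mul hσ).mul
    (h₁.comp measurable_fst).inv).mul (h₂.comp measurable_snd).inv

/-- The bound attached to the majorants. -/
def majConst (n : ℕ) (k l μ : ℝ) : ℝ≥0∞ :=
  nrm (maj k l : Sp n → ℝ≥0∞) + nrm (maj k l : Sp n → ℝ≥0∞) +
    nrm (maj k (n - μ - l) : Sp n → ℝ≥0∞)

/-- The three terms become the three majorants of `KerBound`. The exponent n - μ - l of the last is
below n/2 by the lower bound on l. Nothing is required at vanishing frequencies, where a majorant is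
infinite. -/
lemma kerBound_of_le {k l μ B : ℝ} (hn : 0 < n) (hk : (n : ℝ) / 2 < k) (hl : l < (n : ℝ) / 2)
    (hμ : (n : ℝ) / 2 - μ < l) (hB : 0 < B) {b : Sp n → Sp n → ℝ}
    (hb : Measurable (Function.uncurry b))
    (h : ∀ η ζ, η ≠ 0 → ζ ≠ 0 → η + ζ ≠ 0 → |b η ζ| ≤ B * (hi η ^ (-k) * lo η ^ (-l) +
      hi ζ ^ (-k) * lo ζ ^ (-l) + hi (η + ζ) ^ (-k) * lo (η + ζ) ^ (-(n - μ - l)))) :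
    KerBound b ((majConst n k l μ).toNNReal * B.toNNReal) := by
  have f1 := nrm_maj_lt_top (n := n) hn hk hl
  have f2 := nrm_maj_lt_top (n := n) hn hk (l := n - μ - l) (by linarith)
  have hB' : ENNReal.ofReal B ≠ 0 := by simpa using hB
  refine ⟨hb, fun ξ => maj k l ξ * ENNReal.ofReal B, fun ξ => maj k l ξ * ENNReal.ofReal B,
    fun ξ => maj k (n - μ - l) ξ * ENNReal.ofReal B, (measurable_maj _ _).mul_const _,
    (measurable_maj _ _).mul_const _, (measurable_maj _ _).mul_const _, ?_, ?_⟩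
  · intro η ζ
    by_cases h1 : η = 0
    · simp [maj, h1, ENNReal.top_mul hB']
    by_cases h2 : ζ = 0
    · simp [maj, h2, ENNReal.top_mul hB']
    by_cases h3 : η + ζ = 0
    · simp [maj, h3, ENNReal.top_mul hB']
    have p1 := hi_pos η
    have p2 := hi_pos ζ
    have p3 := hi_pos (η + ζ)
    have q1 := lo_pos h1
    have q2 := lo_pos h2
    have q3 := lo_pos h3
    simp only [maj, if_neg h1, if_neg h2, if_neg h3]
    rw [← add_mul, ← add_mul,
      ← ENNReal.ofReal_add (by positivity) (by positivity),
      ← ENNReal.ofReal_add (by positivity) (by positivity),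
      ← ENNReal.ofReal_mul (by positivity), Real.enorm_eq_ofReal_abs, mul_comm _ B]
    exact ENNReal.ofReal_le_ofReal (h η ζ h1 h2 h3)
  · rw [nrm_mul_const (measurable_maj _ _), nrm_mul_const (measurable_maj _ _), ← add_mul,
      ← add_mul, ENNReal.coe_mul, ENNReal.coe_toNNReal, majConst]
    · rfl
    · rw [majConst]
      exact (ENNReal.add_lt_top.2 ⟨ENNReal.add_lt_top.2 ⟨f1, f1⟩, f2⟩).ne

/-- Submultiplicativity removes the Gevrey factors, so only polynomial weights remain to be
compared. -/
lemma abs_ker_wt_le {ρ ν a b a₁ b₁ a₂ b₂ X : ℝ} (hρ : 0 ≤ ρ) (h0 : 0 ≤ ν) (h1 : ν ≤ 1)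
    {σ : Sp n → Sp n → ℝ} {η ζ : Sp n} (hη : η ≠ 0) (hζ : ζ ≠ 0)
    (h : hi (η + ζ) ^ a * lo (η + ζ) ^ b * |σ η ζ| ≤
      X * (hi η ^ a₁ * lo η ^ b₁ * (hi ζ ^ a₂ * lo ζ ^ b₂))) :
    |ker (wt ρ ν a b) (wt ρ ν a₁ b₁) (wt ρ ν a₂ b₂) σ η ζ| ≤ X := by
  have p1 := wt_pos ρ ν a₁ b₁ hη
  have p2 := wt_pos ρ ν a₂ b₂ hζ
  have p3 := wt_nonneg ρ ν a b (η + ζ)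
  have g := gevreyWeight_add_le hρ h0 h1 η ζ
  have g1 := gevreyWeight_pos ρ ν (η + ζ)
  have r1 := hi_pos (η + ζ)
  have r2 := lo_nonneg (η + ζ)
  rw [ker, abs_mul, abs_mul, abs_mul, abs_inv, abs_inv, abs_of_pos p1, abs_of_pos p2,
    abs_of_nonneg p3, ← div_eq_mul_inv, ← div_eq_mul_inv, div_div, div_le_iff₀ (mul_pos p1 p2),
    wt_eq, wt_eq, wt_eq]
  calc _ = hi (η + ζ) ^ a * lo (η + ζ) ^ b * |σ η ζ| * gevreyWeight ρ ν (η + ζ) := by ring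
    _ ≤ X * (hi η ^ a₁ * lo η ^ b₁ * (hi ζ ^ a₂ * lo ζ ^ b₂)) *
        (gevreyWeight ρ ν η * gevreyWeight ρ ν ζ) :=
      mul_le_mul h g g1.le (le_trans (by positivity) h)
    _ = _ := by ring

end HartreeAsymptotics

end

/-! ### The symbols of the system and the bounds of their weighted kernels. -/

noncomputable section

open MeasureTheory Filter Topology
open scoped ENNReal SchwartzMap FourierTransform NNReal

namespace HartreeAsymptotics

/-- The normalization constant `(2π)^(-n/2)`. -/
def c₀ (n : ℕ) : ℝ := (2 * Real.pi) ^ (-(n : ℝ) / 2)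

lemma c₀_pos (n : ℕ) : 0 < c₀ n := Real.rpow_pos_of_pos (by positivity) _

/-- The parameters of the problem. -/
structure Setting (n : ℕ) where
  (μ κ lLow k ρ ν : ℝ)
  p : ℕ
  hμ : 0 < μ
  hμn : μ ≤ n
  hl : 0 ≤ lLow
  hl_lt : lLow < (n : ℝ) / 2
  hl_gt : (n : ℝ) / 2 - μ < lLow
  hk : (n : ℝ) / 2 < k
  hk' : ((p : ℝ) + 2) * lamBar n μ - 1 ≤ k
  hν0 : 0 ≤ ν
  hν1 : ν ≤ 1
  hρ : 0 ≤ ρ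

/-- The bound of the kernels up to the majorants. -/
def kerFactor (n : ℕ) (κ l k : ℝ) : ℝ := 2 ^ (k + n + 1 + l) * (3 * (c₀ n + 1) * (|κ| + 1))

/-- The bound of the bilinear operators. -/
def kerConst (n : ℕ) (μ κ l k : ℝ) : ℝ≥0 :=
  (majConst n k l μ).toNNReal * (kerFactor n κ l k).toNNReal

variable {n : ℕ}

/-- The symbol of `(2 ∇φ·∇ + Δφ) w`. -/
def symT (η ζ : Sp n) : ℝ := -(c₀ n * (2 * inner ℝ η ζ + ‖η‖ ^ 2))
/-- The symbol of `∇φ·∇χ`. -/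
def symD (η ζ : Sp n) : ℝ := -(c₀ n * inner ℝ η ζ)
/-- The symbol of `κ |∇|^(μ-n) (w₁ w₂)`. -/
def symG (κ μ : ℝ) (η ζ : Sp n) : ℝ := c₀ n * κ * ‖η + ζ‖ ^ (μ - n)
/-- The symbol of the divergence form `2 ∇·(w ∇φ)`. -/
def symS (η ζ : Sp n) : ℝ := -(2 * c₀ n * inner ℝ η (η + ζ))
/-- The symbol of the plain product. -/
def symP (_ _ : Sp n) : ℝ := 1

lemma measurable_symT : Measurable (Function.uncurry (symT : Sp n → Sp n → ℝ)) := by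
  refine Continuous.measurable ?_
  change Continuous fun z : Sp n × Sp n => -(c₀ n * (2 * inner ℝ z.1 z.2 + ‖z.1‖ ^ 2))
  fun_prop
lemma measurable_symD : Measurable (Function.uncurry (symD : Sp n → Sp n → ℝ)) := by
  refine Continuous.measurable ?_
  change Continuous fun z : Sp n × Sp n => -(c₀ n * inner ℝ z.1 z.2)
  fun_prop
lemma measurable_symS : Measurable (Function.uncurry (symS : Sp n → Sp n → ℝ)) := by
  refine Continuous.measurable ?_
  change Continuous fun z : Sp n × Sp n => -(2 * c₀ n * inner ℝ z.1 (z.1 + z.2))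
  fun_prop
lemma measurable_symG (κ μ : ℝ) : Measurable (Function.uncurry (symG κ μ : Sp n → Sp n → ℝ)) :=
  ((measurable_fst.add measurable_snd).norm.pow_const _).const_mul _
lemma measurable_symP : Measurable (Function.uncurry (symP : Sp n → Sp n → ℝ)) := measurable_const

lemma abs_symT_le (η ζ : Sp n) : |symT η ζ| ≤ c₀ n * (2 * (hi η * hi ζ) + hi η * hi η) := by
  have h := abs_real_inner_le_norm η ζ
  have := c₀_pos n
  have h1 := norm_le_hi η
  have h3 := (hi_pos η).le
  have h2 := norm_le_hi ζ
  rw [symT, abs_neg, abs_mul, abs_of_pos this]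
  gcongr
  refine (abs_add_le _ _).trans (add_le_add ?_ ?_)
  · rw [abs_mul, abs_of_pos two_pos]
    gcongr
    exact h.trans (by gcongr)
  · rw [abs_of_nonneg (by positivity), sq]
    gcongr

lemma abs_symD_le (η ζ : Sp n) : |symD η ζ| ≤ c₀ n * (hi η * hi ζ) := by
  have := c₀_pos n
  have h1 := norm_le_hi η
  have h3 := (hi_pos η).le
  have h2 := norm_le_hi ζ
  rw [symD, abs_neg, abs_mul, abs_of_pos this]
  gcongr
  exact (abs_real_inner_le_norm η ζ).trans (by gcongr)

lemma abs_symS_le (η ζ : Sp n) : |symS η ζ| ≤ 2 * c₀ n * (hi η * hi (η + ζ)) := by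
  have := c₀_pos n
  have h1 := norm_le_hi η
  have h3 := (hi_pos η).le
  have h2 := norm_le_hi (η + ζ)
  rw [symS, abs_neg, abs_mul, abs_of_pos (by positivity)]
  gcongr
  exact (abs_real_inner_le_norm η (η + ζ)).trans (by gcongr)

namespace Setting

variable (s : Setting n)

/-- The weight of `K^{k_m}`. -/
def kw (m : ℕ) : Sp n → ℝ := wt s.ρ s.ν (kExp n s.μ s.k m) 0
/-- The weight of `Y^{ℓ_m}`. -/
def yw (m : ℕ) : Sp n → ℝ := wt s.ρ s.ν (lExp n s.μ s.k m + 2) s.lLow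
/-- The uniform bound of the operators. -/
def C : ℝ≥0 := kerConst n s.μ s.κ s.lLow s.k

include s in
lemma hn : 0 < n := by
  have h := s.hμ.trans_le s.hμn
  exact_mod_cast h

lemma measurable_kw (m : ℕ) : Measurable (s.kw m) := measurable_wt _ _ _ _
lemma measurable_yw (m : ℕ) : Measurable (s.yw m) := measurable_wt _ _ _ _
lemma kw_pos (m : ℕ) (ξ : Sp n) : 0 < s.kw m ξ := wt_zero_pos _ _ _ _
lemma yw_pos (m : ℕ) {ξ : Sp n} (h : ξ ≠ 0) : 0 < s.yw m ξ := wt_pos _ _ _ _ h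
lemma kw_neg (m : ℕ) (ξ : Sp n) : s.kw m (-ξ) = s.kw m ξ := wt_neg _ _ _ _ _
lemma yw_neg (m : ℕ) (ξ : Sp n) : s.yw m (-ξ) = s.yw m ξ := wt_neg _ _ _ _ _

lemma one_le_lamBar : 1 ≤ lamBar n s.μ := le_max_right _ _
lemma lam_le_lamBar : lam n s.μ ≤ lamBar n s.μ := le_max_left _ _

/-- From k ≥ (p+2)λ̄ - 1 and λ̄ ≥ 1 one gets k_{p+1} ≥ λ̄ - 1 ≥ 0. In the same way k_p ≥ 2λ̄ - 1 ≥
1, and ℓ_p ≥ 2λ̄ - 1 - λ ≥ 0 because λ̄ ≥ λ. -/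
lemma kExp_nonneg {m : ℕ} (hm : m ≤ s.p + 1) : 0 ≤ kExp n s.μ s.k m := by
  have h1 := s.one_le_lamBar
  have h2 := s.hk'
  have h3 : (m : ℝ) ≤ s.p + 1 := by exact_mod_cast hm
  rw [kExp]
  nlinarith

lemma one_le_kExp {m : ℕ} (hm : m ≤ s.p) : 1 ≤ kExp n s.μ s.k m := by
  have h1 := s.one_le_lamBar
  have h2 := s.hk'
  have h3 : (m : ℝ) ≤ s.p := by exact_mod_cast hm
  rw [kExp]
  nlinarith

lemma lExp_eq (m : ℕ) : lExp n s.μ s.k m = kExp n s.μ s.k m - lam n s.μ := rfl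

lemma lExp_nonneg {m : ℕ} (hm : m ≤ s.p) : 0 ≤ lExp n s.μ s.k m := by
  have h1 := s.one_le_lamBar
  have h2 := s.hk'
  have h3 : (m : ℝ) ≤ s.p := by exact_mod_cast hm
  have h4 := s.lam_le_lamBar
  rw [lExp]
  nlinarith

/-- The high-frequency weight of a phase exceeds that of the amplitude of the same index by n - μ,
which is the smoothing of |∇|^(μ-n). -/
lemma lExp_add_two (m : ℕ) : lExp n s.μ s.k m + 2 = kExp n s.μ s.k m + (n - s.μ) := by
  rw [lExp_eq, lam]; ring

lemma kExp_le (m : ℕ) : kExp n s.μ s.k m ≤ s.k := by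
  have h1 := s.one_le_lamBar
  have : 0 ≤ (m : ℝ) * lamBar n s.μ := by positivity
  rw [kExp]; linarith

lemma kExp_anti (i j : ℕ) : kExp n s.μ s.k (i + j) ≤ kExp n s.μ s.k i := by
  have h1 := s.one_le_lamBar
  have : 0 ≤ (j : ℝ) * lamBar n s.μ := by positivity
  rw [kExp, kExp]; push_cast; linarith

/-- In a product of factors of index i and j, with output index i + j, the exponents leave a surplus
of exactly k; being larger than n/2, it makes the majorants square integrable. -/
lemma kExp_add (i j : ℕ) : kExp n s.μ s.k i + kExp n s.μ s.k j = kExp n s.μ s.k (i + j) + s.k := by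
  rw [kExp, kExp, kExp]; push_cast; ring

lemma kExp_succ (i : ℕ) : kExp n s.μ s.k (i + 1) = kExp n s.μ s.k i - lamBar n s.μ := by
  rw [kExp, kExp]; push_cast; ring

lemma kerFactor_pos : 0 < kerFactor n s.κ s.lLow s.k := by
  have := c₀_pos n
  rw [kerFactor]; positivity

/-- Common form of the kernel bounds: `kerFactor` exceeds every constant 2^e L that occurs below, so
a single operator bound serves all terms. The third majorant is merely added here; it is needed only
for g₀ at low output frequency. -/
lemma abs_ker_le {a b a₁ b₁ a₂ b₂ L e : ℝ} {σ : Sp n → Sp n → ℝ} {η ζ : Sp n} (hη : η ≠ 0)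
    (hζ : ζ ≠ 0) (hηζ : η + ζ ≠ 0) (hL0 : 0 ≤ L) (hL : L ≤ 3 * (c₀ n + 1) * (|s.κ| + 1))
    (he : e ≤ s.k + n + 1 + s.lLow)
    (h : hi (η + ζ) ^ a * lo (η + ζ) ^ b * |σ η ζ| ≤
      L * (2 ^ e * (hi η ^ a₁ * lo η ^ b₁ * (hi ζ ^ a₂ * lo ζ ^ b₂) *
        (hi η ^ (-s.k) * lo η ^ (-s.lLow) + hi ζ ^ (-s.k) * lo ζ ^ (-s.lLow))))) :
    |ker (wt s.ρ s.ν a b) (wt s.ρ s.ν a₁ b₁) (wt s.ρ s.ν a₂ b₂) σ η ζ| ≤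
      kerFactor n s.κ s.lLow s.k * (hi η ^ (-s.k) * lo η ^ (-s.lLow) +
      hi ζ ^ (-s.k) * lo ζ ^ (-s.lLow) +
        hi (η + ζ) ^ (-s.k) * lo (η + ζ) ^ (-(n - s.μ - s.lLow))) := by
  have p1 := hi_pos η
  have p2 := hi_pos ζ
  have p3 := hi_pos (η + ζ)
  have q1 := lo_pos hη
  have q2 := lo_pos hζ
  have q3 := lo_pos hηζ
  have h2 : (2 : ℝ) ^ e ≤ 2 ^ (s.k + n + 1 + s.lLow) :=
    Real.rpow_le_rpow_of_exponent_le one_le_two he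
  refine abs_ker_wt_le s.hρ s.hν0 s.hν1 hη hζ (h.trans ?_)
  calc _ = 2 ^ e * L * (hi η ^ (-s.k) * lo η ^ (-s.lLow) + hi ζ ^ (-s.k) * lo ζ ^ (-s.lLow)) *
        (hi η ^ a₁ * lo η ^ b₁ * (hi ζ ^ a₂ * lo ζ ^ b₂)) := by ring
    _ ≤ _ := by
      rw [kerFactor]
      refine mul_le_mul_of_nonneg_right ?_ (by positivity)
      refine mul_le_mul (mul_le_mul h2 hL hL0 (by positivity)) ?_ (by positivity) (le_trans (mul_nonneg (by positivity) hL0) (mul_le_mul h2 hL hL0 (by positivity)))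
      exact le_add_of_nonneg_right (by positivity)

lemma factor_le {L : ℝ} (h : L ≤ 3 * c₀ n) : L ≤ 3 * (c₀ n + 1) * (|s.κ| + 1) := by
  have := c₀_pos n
  have := abs_nonneg s.κ
  nlinarith

/-- The symbol spends two derivatives, either one on each factor or both on the phase. The remaining
exponents must be at least k_{j+q+1} separately: k_q - 1 is because λ̄ ≥ 1, and ℓ_j = k_j - λ is
because λ̄ ≥ λ. Their sum exceeds k_{j+q+1} by k + λ̄ - λ ≥ k. This is why a step costs λ̄ = λ ∨ 1.
-/
lemma kerBound_T {j q : ℕ} (h : j + q ≤ s.p) :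
    KerBound (ker (s.kw (j + q + 1)) (s.yw j) (s.kw q) symT) s.C := by
  refine kerBound_of_le s.hn s.hk s.hl_lt s.hl_gt s.kerFactor_pos
    (measurable_ker (s.measurable_kw _) (s.measurable_yw _) (s.measurable_kw _) measurable_symT)
    fun η ζ hη hζ hηζ => ?_
  have c0 := c₀_pos n
  have p1 := hi_pos η
  have p2 := hi_pos ζ
  have p3 := hi_pos (η + ζ)
  have e1 := s.kExp_anti j (q + 1)
  have e2 := s.kExp_add j q
  have e3 := s.kExp_succ (j + q)
  have e4 := s.kExp_succ j
  have e5 := s.kExp_succ q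
  have e6 := s.one_le_lamBar
  have e7 := s.lam_le_lamBar
  have e8 := s.kExp_anti (j + 1) q
  have e9 := s.kExp_anti (q + 1) j
  rw [show q + 1 + j = j + q + 1 by ring] at e9
  rw [show j + 1 + q = j + q + 1 by ring] at e8
  have e10 := s.kExp_nonneg (m := j + q + 1) (by omega)
  have v1 := hi_add_le_lo (k := s.k) (l := s.lLow) (s := kExp n s.μ s.k (j + q + 1))
    (a₁ := lExp n s.μ s.k j + 1) (a₂ := kExp n s.μ s.k q - 1) s.hl e10
    (by rw [lExp_eq]; linarith) (by linarith) (by rw [lExp_eq]; linarith) hη hζ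
  have v2 := hi_add_le_lo (k := s.k) (l := s.lLow) (s := kExp n s.μ s.k (j + q + 1))
    (a₁ := lExp n s.μ s.k j) (a₂ := kExp n s.μ s.k q) s.hl e10
    (by rw [lExp_eq]; linarith) (by linarith) (by rw [lExp_eq]; linarith) hη hζ
  refine s.abs_ker_le hη hζ hηζ (L := 3 * c₀ n) (e := kExp n s.μ s.k (j + q + 1)) (by positivity)
    (s.factor_le le_rfl) (by linarith [s.kExp_le (j + q + 1), s.hl, n.cast_nonneg (α := ℝ)]) ?_
  rw [Real.rpow_zero, Real.rpow_zero, mul_one, mul_one]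
  have d1 : hi η ^ (lExp n s.μ s.k j + 2) = hi η ^ (lExp n s.μ s.k j + 1) * hi η := by
    rw [← Real.rpow_add_one p1.ne']; congr 1; ring
  have d2 : hi η ^ (lExp n s.μ s.k j + 2) = hi η ^ (lExp n s.μ s.k j) * hi η * hi η := by
    rw [← Real.rpow_add_one p1.ne', ← Real.rpow_add_one p1.ne']; congr 1; ring
  have d3 : hi ζ ^ kExp n s.μ s.k q = hi ζ ^ (kExp n s.μ s.k q - 1) * hi ζ := by
    rw [← Real.rpow_add_one p2.ne']; congr 1; ring
  set X := hi η ^ (-s.k) * lo η ^ (-s.lLow) + hi ζ ^ (-s.k) * lo ζ ^ (-s.lLow) with hX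
  calc hi (η + ζ) ^ kExp n s.μ s.k (j + q + 1) * |symT η ζ|
      ≤ hi (η + ζ) ^ kExp n s.μ s.k (j + q + 1) *
          (c₀ n * (2 * (hi η * hi ζ) + hi η * hi η)) := by gcongr; exact abs_symT_le η ζ
    _ = 2 * c₀ n * (hi (η + ζ) ^ kExp n s.μ s.k (j + q + 1) * (hi η * hi ζ)) +
        c₀ n * (hi (η + ζ) ^ kExp n s.μ s.k (j + q + 1) * (hi η * hi η)) := by ring
    _ ≤ 2 * c₀ n * (2 ^ kExp n s.μ s.k (j + q + 1) * (hi η ^ (lExp n s.μ s.k j + 1) *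
          lo η ^ s.lLow * hi ζ ^ (kExp n s.μ s.k q - 1) * X) * (hi η * hi ζ)) +
        c₀ n * (2 ^ kExp n s.μ s.k (j + q + 1) * (hi η ^ (lExp n s.μ s.k j) *
          lo η ^ s.lLow * hi ζ ^ (kExp n s.μ s.k q) * X) * (hi η * hi η)) := by gcongr
    _ = 2 * c₀ n * (2 ^ kExp n s.μ s.k (j + q + 1) * ((hi η ^ (lExp n s.μ s.k j + 1) * hi η) *
          lo η ^ s.lLow * (hi ζ ^ (kExp n s.μ s.k q - 1) * hi ζ) * X)) +
        c₀ n * (2 ^ kExp n s.μ s.k (j + q + 1) * ((hi η ^ (lExp n s.μ s.k j) * hi η * hi η) *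
          lo η ^ s.lLow * hi ζ ^ (kExp n s.μ s.k q) * X)) := by ring
    _ = _ := by rw [← d1, ← d2, ← d3]; ring

/-- One derivative falls on each phase, leaving ℓ_i + 1 and ℓ_j + 1 against ℓ_{i+j+1} + 2. Each
comparison uses λ̄ ≥ 1, and the total surplus is again k + λ̄ - λ. -/
lemma kerBound_D {i j : ℕ} (h : i + j ≤ s.p) :
    KerBound (ker (s.yw (i + j + 1)) (s.yw i) (s.yw j) symD) s.C := by
  refine kerBound_of_le s.hn s.hk s.hl_lt s.hl_gt s.kerFactor_pos
    (measurable_ker (s.measurable_yw _) (s.measurable_yw _) (s.measurable_yw _) measurable_symD)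
    fun η ζ hη hζ hηζ => ?_
  have c0 := c₀_pos n
  have p1 := hi_pos η
  have p2 := hi_pos ζ
  have p3 := hi_pos (η + ζ)
  have p4 := lo_pos hηζ
  have e2 := s.kExp_add i j
  have e3 := s.kExp_succ (i + j)
  have e4 := s.kExp_succ i
  have e5 := s.kExp_succ j
  have e6 := s.one_le_lamBar
  have e7 := s.lam_le_lamBar
  have e8 := s.kExp_anti (i + 1) j
  have e9 := s.kExp_anti (j + 1) i
  rw [show j + 1 + i = i + j + 1 by ring] at e9
  rw [show i + 1 + j = i + j + 1 by ring] at e8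
  have e10 := s.kExp_nonneg (m := i + j + 1) (by omega)
  have e11 := s.hμn
  have e12 := s.hμ
  have v1 := hi_lo_add_le (k := s.k) (l := s.lLow) (s := lExp n s.μ s.k (i + j + 1) + 2)
    (a₁ := lExp n s.μ s.k i + 1) (a₂ := lExp n s.μ s.k j + 1) s.hl
    (by rw [lExp_add_two]; linarith) (by simp only [lExp_eq]; linarith)
    (by simp only [lExp_eq]; linarith) (by simp only [lExp_eq]; linarith) hη hζ
  refine s.abs_ker_le hη hζ hηζ (L := c₀ n)
    (e := lExp n s.μ s.k (i + j + 1) + 2 + s.lLow) (by positivity)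
    (s.factor_le (by linarith)) (by rw [lExp_add_two]; linarith [s.kExp_le (i + j + 1)]) ?_
  have d1 : ∀ i, ∀ x : Sp n, hi x ^ (lExp n s.μ s.k i + 2) =
      hi x ^ (lExp n s.μ s.k i + 1) * hi x := by
    intro i x
    rw [← Real.rpow_add_one (hi_pos x).ne']; congr 1; ring
  set X := hi η ^ (-s.k) * lo η ^ (-s.lLow) + hi ζ ^ (-s.k) * lo ζ ^ (-s.lLow) with hX
  rw [d1 i, d1 j]
  calc _ ≤ hi (η + ζ) ^ (lExp n s.μ s.k (i + j + 1) + 2) * lo (η + ζ) ^ s.lLow *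
        (c₀ n * (hi η * hi ζ)) := by gcongr; exact abs_symD_le η ζ
    _ ≤ 2 ^ (lExp n s.μ s.k (i + j + 1) + 2 + s.lLow) * (hi η ^ (lExp n s.μ s.k i + 1) *
        lo η ^ s.lLow * (hi ζ ^ (lExp n s.μ s.k j + 1) * lo ζ ^ s.lLow) * X) *
        (c₀ n * (hi η * hi ζ)) := by gcongr
    _ = _ := by ring

/-- In divergence form one derivative falls on the product: it raises the output exponent by one and
leaves the density undifferentiated. The surplus is the same as for the transport term. -/
lemma kerBound_S {l r : ℕ} (h : l + r ≤ s.p) :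
    KerBound (ker (s.kw (l + r + 1)) (s.yw l) (s.kw r) symS) s.C := by
  refine kerBound_of_le s.hn s.hk s.hl_lt s.hl_gt s.kerFactor_pos
    (measurable_ker (s.measurable_kw _) (s.measurable_yw _) (s.measurable_kw _) measurable_symS)
    fun η ζ hη hζ hηζ => ?_
  have c0 := c₀_pos n
  have p1 := hi_pos η
  have p2 := hi_pos ζ
  have p3 := hi_pos (η + ζ)
  have e2 := s.kExp_add l r
  have e3 := s.kExp_succ (l + r)
  have e4 := s.kExp_succ l
  have e5 := s.kExp_succ r
  have e6 := s.one_le_lamBar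
  have e7 := s.lam_le_lamBar
  have e8 := s.kExp_anti (l + 1) r
  have e9 := s.kExp_anti (r + 1) l
  rw [show r + 1 + l = l + r + 1 by ring] at e9
  rw [show l + 1 + r = l + r + 1 by ring] at e8
  have e10 := s.kExp_nonneg (m := l + r + 1) (by omega)
  have v1 := hi_add_le_lo (k := s.k) (l := s.lLow) (s := kExp n s.μ s.k (l + r + 1) + 1)
    (a₁ := lExp n s.μ s.k l + 1) (a₂ := kExp n s.μ s.k r) s.hl (by linarith)
    (by rw [lExp_eq]; linarith) (by linarith) (by rw [lExp_eq]; linarith) hη hζ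
  refine s.abs_ker_le hη hζ hηζ (L := 2 * c₀ n) (e := kExp n s.μ s.k (l + r + 1) + 1)
    (by positivity)
    (s.factor_le (by linarith))
    (by linarith [s.kExp_le (l + r + 1), s.hl, n.cast_nonneg (α := ℝ)]) ?_
  rw [Real.rpow_zero, Real.rpow_zero, mul_one, mul_one]
  have d1 : hi η ^ (lExp n s.μ s.k l + 2) = hi η ^ (lExp n s.μ s.k l + 1) * hi η := by
    rw [← Real.rpow_add_one p1.ne']; congr 1; ring
  rw [Real.rpow_add_one p3.ne'] at v1
  rw [d1]
  set X := hi η ^ (-s.k) * lo η ^ (-s.lLow) + hi ζ ^ (-s.k) * lo ζ ^ (-s.lLow) with hX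
  calc hi (η + ζ) ^ kExp n s.μ s.k (l + r + 1) * |symS η ζ|
      ≤ hi (η + ζ) ^ kExp n s.μ s.k (l + r + 1) *
          (2 * c₀ n * (hi η * hi (η + ζ))) := by gcongr; exact abs_symS_le η ζ
    _ = 2 * c₀ n * hi η * (hi (η + ζ) ^ kExp n s.μ s.k (l + r + 1) * hi (η + ζ)) := by ring
    _ ≤ 2 * c₀ n * hi η * (2 ^ (kExp n s.μ s.k (l + r + 1) + 1) *
        (hi η ^ (lExp n s.μ s.k l + 1) * lo η ^ s.lLow * hi ζ ^ kExp n s.μ s.k r * X)) := by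
      gcongr
    _ = _ := by ring

lemma hi_kExp_add_le {i j : ℕ} (h : i + j ≤ s.p + 1) {η ζ : Sp n} (hη : η ≠ 0) (hζ : ζ ≠ 0) :
    hi (η + ζ) ^ kExp n s.μ s.k (i + j) ≤ 2 ^ kExp n s.μ s.k (i + j) *
      (hi η ^ kExp n s.μ s.k i * hi ζ ^ kExp n s.μ s.k j *
        (hi η ^ (-s.k) * lo η ^ (-s.lLow) + hi ζ ^ (-s.k) * lo ζ ^ (-s.lLow))) := by
  have p1 := hi_pos η
  have p2 := hi_pos ζ
  have q1 := lo_pos hη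
  have q2 := lo_pos hζ
  have e8 := s.kExp_anti i j
  have e9 := s.kExp_anti j i
  rw [add_comm j i] at e9
  refine (hi_add_le_lo (k := s.k) (l := s.lLow) (s := kExp n s.μ s.k (i + j)) s.hl
    (s.kExp_nonneg h) e8 e9 (by linarith [s.kExp_add i j]) hη hζ).trans ?_
  gcongr
  exact mul_le_of_le_one_right (by positivity) (Real.rpow_le_one q1.le (lo_le_one _) s.hl)

lemma kerBound_P {i j : ℕ} (h : i + j ≤ s.p + 1) :
    KerBound (ker (s.kw (i + j)) (s.kw i) (s.kw j) symP) s.C := by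
  refine kerBound_of_le s.hn s.hk s.hl_lt s.hl_gt s.kerFactor_pos
    (measurable_ker (s.measurable_kw _) (s.measurable_kw _) (s.measurable_kw _) measurable_symP)
    fun η ζ hη hζ hηζ => ?_
  have c0 := c₀_pos n
  refine s.abs_ker_le hη hζ hηζ (L := 1) (e := kExp n s.μ s.k (i + j)) (by positivity) ?_
    (by linarith [s.kExp_le (i + j), s.hl, n.cast_nonneg (α := ℝ)]) ?_
  · nlinarith [abs_nonneg s.κ]
  · simp only [Real.rpow_zero, mul_one, symP, abs_one, one_mul]
    exact s.hi_kExp_add_le h hη hζ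

/-- For output frequency above 1 the factor |ξ|^(μ-n) cancels the additional weight n - μ and a
plain product estimate remains. Below 1 the output weight and the symbol combine to |ξ|^(ℓ_<+μ-n),
which is the third majorant, and the input weights are at least 1. -/
lemma kerBound_G {i j : ℕ} (h : i + j ≤ s.p + 1) :
    KerBound (ker (s.yw (i + j)) (s.kw i) (s.kw j) (symG s.κ s.μ)) s.C := by
  refine kerBound_of_le s.hn s.hk s.hl_lt s.hl_gt s.kerFactor_pos
    (measurable_ker (s.measurable_yw _) (s.measurable_kw _) (s.measurable_kw _)
      (measurable_symG _ _))
    fun η ζ hη hζ hηζ => ?_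
  have c0 := c₀_pos n
  have p1 := hi_pos η
  have p2 := hi_pos ζ
  have p3 := hi_pos (η + ζ)
  have q1 := lo_pos hη
  have q2 := lo_pos hζ
  have q3 := lo_pos hηζ
  have hnorm := norm_pos_iff.2 hηζ
  have hL : c₀ n * |s.κ| ≤ 3 * (c₀ n + 1) * (|s.κ| + 1) := by nlinarith [abs_nonneg s.κ]
  have hσ : |symG s.κ s.μ η ζ| = c₀ n * |s.κ| * ‖η + ζ‖ ^ (s.μ - n) := by
    rw [symG, abs_mul, abs_mul, abs_of_pos c0, abs_of_pos (Real.rpow_pos_of_pos hnorm _)]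
  rcases lt_or_ge 1 ‖η + ζ‖ with h1 | h1
  · refine s.abs_ker_le hη hζ hηζ (L := c₀ n * |s.κ|) (e := kExp n s.μ s.k (i + j))
      (by positivity) hL (by linarith [s.kExp_le (i + j), s.hl, n.cast_nonneg (α := ℝ)]) ?_
    have h2 : hi (η + ζ) = ‖η + ζ‖ := max_eq_left h1.le
    have h3 : lo (η + ζ) = 1 := min_eq_right h1.le
    have h4 := s.hi_kExp_add_le h hη hζ
    simp only [Real.rpow_zero, mul_one]
    rw [hσ, h3, Real.one_rpow, mul_one, lExp_add_two, h2]
    rw [h2] at h4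
    calc _ = c₀ n * |s.κ| * (‖η + ζ‖ ^ (kExp n s.μ s.k (i + j) + (n - s.μ)) *
          ‖η + ζ‖ ^ (s.μ - n)) := by ring
      _ = c₀ n * |s.κ| * ‖η + ζ‖ ^ kExp n s.μ s.k (i + j) := by
        rw [← Real.rpow_add hnorm]; congr 2; ring
      _ ≤ _ := by gcongr
  · have h2 : hi (η + ζ) = 1 := max_eq_right h1
    have h3 : lo (η + ζ) = ‖η + ζ‖ := min_eq_left h1
    refine abs_ker_wt_le s.hρ s.hν0 s.hν1 hη hζ ?_
    simp only [Real.rpow_zero, mul_one]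
    rw [hσ, h2, h3, Real.one_rpow, Real.one_rpow, one_mul, one_mul]
    have hk1 : 1 ≤ hi η ^ kExp n s.μ s.k i :=
      Real.one_le_rpow (one_le_hi _) (s.kExp_nonneg (by omega))
    have hk2 : 1 ≤ hi ζ ^ kExp n s.μ s.k j :=
      Real.one_le_rpow (one_le_hi _) (s.kExp_nonneg (by omega))
    have hf : c₀ n * |s.κ| ≤ kerFactor n s.κ s.lLow s.k := by
      refine hL.trans ?_
      rw [kerFactor]
      refine le_mul_of_one_le_left (by positivity) (Real.one_le_rpow one_le_two ?_)
      linarith [s.hk, s.hl, n.cast_nonneg (α := ℝ)]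
    calc _ = c₀ n * |s.κ| * (‖η + ζ‖ ^ s.lLow * ‖η + ζ‖ ^ (s.μ - n)) := by ring
      _ = c₀ n * |s.κ| * ‖η + ζ‖ ^ (-(n - s.μ - s.lLow)) := by
        rw [← Real.rpow_add hnorm]; congr 2; ring
      _ ≤ kerFactor n s.κ s.lLow s.k * ‖η + ζ‖ ^ (-(n - s.μ - s.lLow)) := by gcongr
      _ ≤ kerFactor n s.κ s.lLow s.k * (hi η ^ (-s.k) * lo η ^ (-s.lLow) +
          hi ζ ^ (-s.k) * lo ζ ^ (-s.lLow) + ‖η + ζ‖ ^ (-(n - s.μ - s.lLow))) := by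
        have := s.kerFactor_pos
        gcongr
        exact le_add_of_nonneg_left (by positivity)
      _ ≤ _ := by
        have := s.kerFactor_pos
        refine le_mul_of_one_le_right (by positivity) (one_le_mul_of_one_le_of_one_le hk1 hk2)

end Setting

end HartreeAsymptotics

end

/-! ### The operators of the system on L² and their algebraic identities. -/

noncomputable section

open MeasureTheory Filter Topology
open scoped ENNReal SchwartzMap FourierTransform NNReal

namespace HartreeAsymptotics

variable {n : ℕ}

lemma ker_neg {ω ω₁ ω₂ : Sp n → ℝ} {σ : Sp n → Sp n → ℝ} (h : ∀ ξ, ω (-ξ) = ω ξ)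
    (h₁ : ∀ ξ, ω₁ (-ξ) = ω₁ ξ) (h₂ : ∀ ξ, ω₂ (-ξ) = ω₂ ξ) (hσ : ∀ η ζ, σ (-η) (-ζ) = σ η ζ)
    (η ζ : Sp n) : ker ω ω₁ ω₂ σ (-η) (-ζ) = ker ω ω₁ ω₂ σ η ζ := by
  rw [ker, ker, ← neg_add, h, h₁, h₂, hσ]

lemma symT_neg (η ζ : Sp n) : symT (-η) (-ζ) = symT η ζ := by simp [symT]
lemma symD_neg (η ζ : Sp n) : symD (-η) (-ζ) = symD η ζ := by simp [symD]

lemma norm_reflConjL (F : L2 n) : ‖reflConjL F‖ = ‖F‖ := by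
  have h : ‖reflConjL F‖ₑ = ‖F‖ₑ := by
    have e : nrm (fun x => ‖reflConjL F x‖ₑ) = nrm (fun x => ‖F (0 - x)‖ₑ) := by
      refine congrArg (· ^ (1 / 2 : ℝ)) (lintegral_congr_ae ?_)
      filter_upwards [reflConjL_ae F] with x hx
      rw [hx, reflConj, zero_sub, ← ofReal_norm, ← ofReal_norm, RCLike.norm_conj]
    rw [← nrm_coe, e, nrm_reflect (f := fun x => ‖F x‖ₑ) 0, nrm_coe]
  rwa [← toReal_enorm, ← toReal_enorm, ENNReal.toReal_eq_toReal_iff' (by simp) (by simp)]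

lemma reflConjL_reflConjL (F : L2 n) : reflConjL (reflConjL F) = F := by
  refine Lp.ext ?_
  filter_upwards [reflConjL_ae (reflConjL F), reflConj_congr (reflConjL_ae F)] with x h1 h2
  rw [h1, h2, reflConj, reflConj, neg_neg, Complex.conj_conj]

/-- A multiplier relation passes to finite sums. -/
lemma sum_ae_eq_mul {ι : Type*} (I : Finset ι) (f g : ι → L2 n) (m : Sp n → ℂ)
    (h : ∀ i ∈ I, f i =ᵐ[volume] fun ξ => m ξ * g i ξ) :
    (∑ i ∈ I, f i : L2 n) =ᵐ[volume] fun ξ => m ξ * (∑ i ∈ I, g i : L2 n) ξ := by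
  classical
  induction I using Finset.induction_on with
  | empty =>
    simp only [Finset.sum_empty]
    filter_upwards [Lp.coeFn_zero ℂ 2 (volume : Measure (Sp n))] with ξ hξ
    rw [hξ]; simp
  | insert a I ha ih =>
    rw [Finset.sum_insert ha, Finset.sum_insert ha]
    filter_upwards [Lp.coeFn_add (f a) (∑ i ∈ I, f i), Lp.coeFn_add (g a) (∑ i ∈ I, g i),
      h a (Finset.mem_insert_self a I), ih fun i hi => h i (Finset.mem_insert_of_mem hi)]
      with ξ h1 h2 h3 h4
    rw [h1, h2, Pi.add_apply, Pi.add_apply, h3, h4, mul_add]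

/-- The real part (in physical space) of `x (conj y)`, from the bilinear map `Γ`. -/
def realPart (Γ : L2 n →L[ℝ] L2 n →L[ℝ] L2 n) : L2 n →L[ℝ] L2 n →L[ℝ] L2 n :=
  let g := Γ.bilinearComp (ContinuousLinearMap.id ℝ (L2 n)) reflConjL
  (1 / 2 : ℝ) • (g + (ContinuousLinearMap.compL ℝ (L2 n) (L2 n) (L2 n) reflConjL).comp g)

lemma realPart_apply (Γ : L2 n →L[ℝ] L2 n →L[ℝ] L2 n) (x y : L2 n) :
    realPart Γ x y = (1 / 2 : ℝ) • (Γ x (reflConjL y) + reflConjL (Γ x (reflConjL y))) := rfl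

lemma reflConjL_realPart (Γ : L2 n →L[ℝ] L2 n →L[ℝ] L2 n) (x y : L2 n) :
    reflConjL (realPart Γ x y) = realPart Γ x y := by
  rw [realPart_apply, map_smul, map_add, reflConjL_reflConjL, add_comm]

lemma norm_realPart_le {Γ : L2 n →L[ℝ] L2 n →L[ℝ] L2 n} {C : ℝ}
    (h : ∀ x y, ‖Γ x y‖ ≤ C * ‖x‖ * ‖y‖) (x y : L2 n) : ‖realPart Γ x y‖ ≤ C * ‖x‖ * ‖y‖ := by
  have h1 := h x (reflConjL y)
  rw [norm_reflConjL] at h1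
  rw [realPart_apply, norm_smul, Real.norm_of_nonneg (by norm_num)]
  have h2 := norm_add_le (Γ x (reflConjL y)) (reflConjL (Γ x (reflConjL y)))
  rw [norm_reflConjL] at h2
  linarith

namespace Setting

variable (s : Setting n)

/-- The transport operator `(2 ∇φ·∇ + Δφ) w` in weighted Fourier variables. -/
def T (j q : ℕ) : L2 n →L[ℝ] L2 n →L[ℝ] L2 n :=
  if h : j + q ≤ s.p then (s.kerBound_T h).op else 0
/-- The operator `∇φ·∇χ` in weighted Fourier variables. -/
def D (i j : ℕ) : L2 n →L[ℝ] L2 n →L[ℝ] L2 n :=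
  if h : i + j ≤ s.p then (s.kerBound_D h).op else 0
/-- The operator `κ |∇|^(μ-n) (w₁ w₂)` in weighted Fourier variables. -/
def Γ (i j : ℕ) : L2 n →L[ℝ] L2 n →L[ℝ] L2 n :=
  if h : i + j ≤ s.p + 1 then (s.kerBound_G h).op else 0
/-- The operator `g₀` in weighted Fourier variables. -/
def G (i j : ℕ) : L2 n →L[ℝ] L2 n →L[ℝ] L2 n := realPart (s.Γ i j)
/-- The product in weighted Fourier variables. -/
def P (i j : ℕ) : L2 n →L[ℝ] L2 n →L[ℝ] L2 n :=
  if h : i + j ≤ s.p + 1 then (s.kerBound_P h).op else 0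
/-- The operator `2 ∇·(w ∇φ)` in weighted Fourier variables. -/
def S (l r : ℕ) : L2 n →L[ℝ] L2 n →L[ℝ] L2 n :=
  if h : l + r ≤ s.p then (s.kerBound_S h).op else 0

/-- Outside the range where the kernel is controlled the operator is zero by definition. The bound
thus holds for all indices, as the abstract system demands. -/
lemma norm_T_le (i j : ℕ) (x y : L2 n) : ‖s.T i j x y‖ ≤ s.C * ‖x‖ * ‖y‖ := by
  rw [T]
  split_ifs with h
  · exact (s.kerBound_T h).norm_op_le x y
  · simpa using by positivity

lemma norm_D_le (i j : ℕ) (x y : L2 n) : ‖s.D i j x y‖ ≤ s.C * ‖x‖ * ‖y‖ := by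
  rw [D]
  split_ifs with h
  · exact (s.kerBound_D h).norm_op_le x y
  · simpa using by positivity

lemma norm_G_le (i j : ℕ) (x y : L2 n) : ‖s.G i j x y‖ ≤ s.C * ‖x‖ * ‖y‖ := by
  refine norm_realPart_le (fun x y => ?_) x y
  rw [Γ]
  split_ifs with h
  · exact (s.kerBound_G h).norm_op_le x y
  · simpa using by positivity

lemma reflConjL_T (i j : ℕ) (x y : L2 n) :
    reflConjL (s.T i j x y) = s.T i j (reflConjL x) (reflConjL y) := by
  rw [T]
  split_ifs with h
  · exact (s.kerBound_T h).reflConjL_op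
      (ker_neg (s.kw_neg _) (s.yw_neg _) (s.kw_neg _) symT_neg) x y
  · simp

lemma reflConjL_D (i j : ℕ) (x y : L2 n) :
    reflConjL (s.D i j x y) = s.D i j (reflConjL x) (reflConjL y) := by
  rw [D]
  split_ifs with h
  · exact (s.kerBound_D h).reflConjL_op
      (ker_neg (s.yw_neg _) (s.yw_neg _) (s.yw_neg _) symD_neg) x y
  · simp

lemma reflConjL_G (i j : ℕ) (x y : L2 n) : reflConjL (s.G i j x y) = s.G i j x y :=
  reflConjL_realPart _ x y

/-- The weights cancel, and the Leibniz rule remains at the level of symbols: (2η·ζ + |η|²) + (2η·θ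
+ |η|²) = 2η·(η + ζ + θ). In physical space, the transport terms of two factors add up to a
divergence. -/
lemma transport_product (l q j : ℕ) (x y z : L2 n) (h : l + q + j ≤ s.p) :
    s.P (l + q + 1) j (s.T l q x y) z + s.P q (l + j + 1) y (s.T l j x z) =
      s.S l (q + j) x (s.P q j y z) := by
  have h1 : l + q + 1 + j ≤ s.p + 1 := by omega
  have h2 : q + (l + j + 1) ≤ s.p + 1 := by omega
  have h3 : l + q ≤ s.p := by omega
  have h4 : l + j ≤ s.p := by omega
  have h5 : l + (q + j) ≤ s.p := by omega
  have h6 : q + j ≤ s.p + 1 := by omega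
  simp only [P, T, S, dif_pos h1, dif_pos h2, dif_pos h3, dif_pos h4, dif_pos h5, dif_pos h6]
  refine KerBound.op_assoc _ _ _ _ _ _ (fun η ζ θ => ?_) x y z
  have i1 : l + q + 1 + j = l + (q + j) + 1 := by ring
  have i2 : q + (l + j + 1) = l + (q + j) + 1 := by ring
  have a1 : ζ + (η + θ) = η + (ζ + θ) := by abel
  have e1 := (s.kw_pos (l + q + 1) (η + ζ)).ne'
  have e2 := (s.kw_pos (l + j + 1) (η + θ)).ne'
  have e3 := (s.kw_pos (q + j) (ζ + θ)).ne'
  have e4 : inner ℝ η (η + (ζ + θ)) = inner ℝ η ζ + inner ℝ η θ + ‖η‖ ^ 2 := by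
    rw [inner_add_right, inner_add_right, real_inner_self_eq_norm_sq]; ring
  simp only [ker, symP, symT, symS, i1, i2, a1, add_assoc η ζ θ, e4]
  field_simp
  ring

lemma ker_G_eq {i j : ℕ} (η ξ : Sp n) :
    ker (s.yw (i + j)) (s.kw i) (s.kw j) (symG s.κ s.μ) η (ξ - η) =
      s.yw (i + j) ξ * (c₀ n * s.κ * ‖ξ‖ ^ (s.μ - n)) * (s.kw (i + j) ξ)⁻¹ *
        ker (s.kw (i + j)) (s.kw i) (s.kw j) symP η (ξ - η) := by
  have e1 := (s.kw_pos (i + j) ξ).ne'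
  simp only [ker, symP, symG, add_sub_cancel]
  field_simp

/-- The symbol of |∇|^(μ-n) depends on the output frequency alone, so it comes out of the
convolution as a multiplier acting on the product. -/
lemma Γ_ae_eq {i j : ℕ} (h : i + j ≤ s.p + 1) (x y : L2 n) :
    s.Γ i j x y =ᵐ[volume] fun ξ =>
      ((s.yw (i + j) ξ * (c₀ n * s.κ * ‖ξ‖ ^ (s.μ - n)) * (s.kw (i + j) ξ)⁻¹ : ℝ) : ℂ) *
        s.P i j x y ξ := by
  simp only [Γ, P, dif_pos h]
  filter_upwards [(s.kerBound_G h).op_ae x y, (s.kerBound_P h).op_ae x y] with ξ h1 h2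
  rw [h1, h2, convFun, convFun, ← integral_const_mul]
  refine integral_congr_ae (ae_of_all _ fun η => ?_)
  simp only [ker_G_eq]
  push_cast
  ring

/-- All terms of the sum share the output index m, hence the same multiplier; the sum is a function
of the density. -/
lemma sum_G_eq_of_density_eq (m : ℕ) (hm : m ≤ s.p + 1) (x y : ℕ → L2 n)
    (h : Evolution.density s.P reflConjL x m = Evolution.density s.P reflConjL y m) :
    ∑ j ∈ Finset.range (m + 1), s.G j (m - j) (x j) (x (m - j)) =
      ∑ j ∈ Finset.range (m + 1), s.G j (m - j) (y j) (y (m - j)) := by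
  have key : ∀ x : ℕ → L2 n, (∑ j ∈ Finset.range (m + 1),
      s.Γ j (m - j) (x j) (reflConjL (x (m - j))) : L2 n) =ᵐ[volume] fun ξ =>
      ((s.yw m ξ * (c₀ n * s.κ * ‖ξ‖ ^ (s.μ - n)) * (s.kw m ξ)⁻¹ : ℝ) : ℂ) *
        (Evolution.density s.P reflConjL x m) ξ := by
    intro x
    refine sum_ae_eq_mul _ _ _ _ fun j hj => ?_
    have h1 : j + (m - j) = m := by have := Finset.mem_range.1 hj; omega
    have h2 := s.Γ_ae_eq (i := j) (j := m - j) (by omega) (x j) (reflConjL (x (m - j)))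
    rwa [h1] at h2
  have hΓ : ∑ j ∈ Finset.range (m + 1), s.Γ j (m - j) (x j) (reflConjL (x (m - j))) =
      ∑ j ∈ Finset.range (m + 1), s.Γ j (m - j) (y j) (reflConjL (y (m - j))) := by
    refine Lp.ext ?_
    filter_upwards [key x, key y] with ξ h1 h2
    rw [h1, h2, h]
  simp only [G, realPart_apply, ← Finset.smul_sum, Finset.sum_add_distrib, ← map_sum]
  rw [hΓ]

end Setting

end HartreeAsymptotics

end

noncomputable section

open MeasureTheory Filter Topology
open scoped ENNReal SchwartzMap FourierTransform NNReal ContDiff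

namespace HartreeAsymptotics

variable {n : ℕ}

/-! ### Tempered functions -/

namespace IsTempered

variable {u v : Sp n → ℂ}

lemma congr (hu : IsTempered u) (h : u =ᵐ[volume] v) : IsTempered v := fun ψ =>
  (hu ψ).congr (h.mono fun x hx => by simp only [hx])

lemma add (hu : IsTempered u) (hv : IsTempered v) : IsTempered (u + v) := fun ψ =>
  ((hu ψ).add (hv ψ)).congr (ae_of_all _ fun x => by simp [add_mul])

lemma const_mul (c : ℂ) (hu : IsTempered u) : IsTempered (fun x => c * u x) := fun ψ =>
  ((hu ψ).const_mul c).congr (ae_of_all _ fun x => by simp [mul_assoc])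

lemma of_memLp {p : ℝ≥0∞} [hp : Fact (1 ≤ p)] (hu : MemLp u p) : IsTempered u := by
  intro ψ
  have hpq : ENNReal.HolderConjugate p (1 - p⁻¹)⁻¹ := ENNReal.HolderConjugate.inv_one_sub_inv' hp.out
  exact hu.integrable_mul (ψ.memLp (1 - p⁻¹)⁻¹ volume)

lemma of_integrable (hu : Integrable u) : IsTempered u :=
  of_memLp (memLp_one_iff_integrable.2 hu)

/-- Test against a smooth bump equal to 1 on a ball. -/
lemma locallyIntegrable (hu : IsTempered u) : LocallyIntegrable u := by
  intro x
  obtain ⟨f, hf⟩ : ∃ f : ContDiffBump x, f.rIn = 1 := ⟨⟨1, 2, one_pos, one_lt_two⟩, rfl⟩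
  have hc : HasCompactSupport (Complex.ofRealCLM ∘ f) := f.hasCompactSupport.comp_left rfl
  have hs : ContDiff ℝ ∞ (Complex.ofRealCLM ∘ f) :=
    Complex.ofRealCLM.contDiff.comp f.contDiff
  refine ⟨Metric.closedBall x 1, Metric.closedBall_mem_nhds x one_pos, ?_⟩
  refine ((hu (hc.toSchwartzMap hs)).integrableOn (s := Metric.closedBall x 1)).congr_fun
    (fun y hy => ?_) Metric.isClosed_closedBall.measurableSet
  have : f y = 1 := f.one_of_mem_closedBall (by rwa [hf])
  simp [this]

lemma aestronglyMeasurable (hu : IsTempered u) : AEStronglyMeasurable u :=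
  hu.locallyIntegrable.aestronglyMeasurable

/-- A tempered function is determined by its distribution. -/
lemma ae_eq (hu : IsTempered u) (hv : IsTempered v)
    (h : ∀ ψ : 𝓢(Sp n, ℂ), ∫ x, u x * ψ x = ∫ x, v x * ψ x) : u =ᵐ[volume] v := by
  have hl : LocallyIntegrable (fun x => u x - v x) :=
    hu.locallyIntegrable.sub hv.locallyIntegrable
  have := ae_eq_zero_of_integral_contDiff_smul_eq_zero hl fun g g_smooth g_cpt => by
    have hg₁ : HasCompactSupport (Complex.ofRealCLM ∘ g) := g_cpt.comp_left rfl
    have hg₂ : ContDiff ℝ ∞ (Complex.ofRealCLM ∘ g) := by fun_prop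
    have h1 := h (hg₁.toSchwartzMap hg₂)
    rw [← sub_eq_zero, ← integral_sub (hu _) (hv _)] at h1
    rw [← h1]
    refine integral_congr_ae (ae_of_all _ fun x => ?_)
    simp
    ring
  filter_upwards [this] with x hx
  exact sub_eq_zero.1 hx

end IsTempered

/-! ### The Fourier transform on Schwartz functions -/

/-- The dilation by `(2π)⁻¹`. -/
def dilation (n : ℕ) : Sp n ≃L[ℝ] Sp n :=
  ContinuousLinearEquiv.smulLeft (Units.mk0 (2 * Real.pi)⁻¹ (inv_ne_zero Real.two_pi_pos.ne'))

lemma dilation_apply (x : Sp n) : dilation n x = (2 * Real.pi)⁻¹ • x := rfl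

/-- The unitary Fourier transform on Schwartz functions. -/
def uF (ψ : 𝓢(Sp n, ℂ)) : 𝓢(Sp n, ℂ) :=
  (c₀ n : ℂ) • SchwartzMap.compCLMOfContinuousLinearEquiv ℂ (dilation n) (𝓕 ψ)

lemma uF_apply (ψ : 𝓢(Sp n, ℂ)) (x : Sp n) : uF ψ x = (c₀ n : ℂ) * 𝓕 ψ ((2 * Real.pi)⁻¹ • x) :=
  rfl

lemma unitaryFourier_eq (ψ : 𝓢(Sp n, ℂ)) : unitaryFourier ψ = uF ψ := by
  funext x
  rw [uF_apply, SchwartzMap.fourier_coe]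
  rfl

/-- Every test function is a transform, so a tempered function is determined by its pairings with
transforms; this gives injectivity of the Fourier transform below. -/
lemma uF_surjective : Function.Surjective (uF : 𝓢(Sp n, ℂ) → 𝓢(Sp n, ℂ)) := by
  intro ψ
  refine ⟨𝓕⁻ ((c₀ n : ℂ)⁻¹ •
    SchwartzMap.compCLMOfContinuousLinearEquiv ℂ (dilation n).symm ψ), ?_⟩
  have hc : (c₀ n : ℂ) ≠ 0 := by exact_mod_cast (c₀_pos n).ne'
  ext x
  rw [uF, FourierTransform.fourier_fourierInv_eq]
  simp [hc]

lemma c₀_sq (n : ℕ) : c₀ n * c₀ n * (2 * Real.pi) ^ n = 1 := by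
  have h := Real.two_pi_pos
  rw [c₀, ← Real.rpow_add h, ← Real.rpow_natCast, ← Real.rpow_add h]
  ring_nf
  exact Real.rpow_zero _

lemma integral_dilation (f : Sp n → ℂ) :
    ∫ x, f ((2 * Real.pi)⁻¹ • x) = (((2 * Real.pi) ^ n : ℝ) : ℂ) * ∫ x, f x := by
  have h := Real.two_pi_pos
  rw [Measure.integral_comp_smul, finrank_euclideanSpace_fin, inv_pow, inv_inv,
    abs_of_pos (by positivity), Complex.real_smul]

lemma uF_eq_integral (ψ : 𝓢(Sp n, ℂ)) (x : Sp n) :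
    uF ψ x = c₀ n * ∫ ξ, Complex.exp (-(inner ℝ ξ x : ℝ) * Complex.I) * ψ ξ := by
  rw [uF_apply, SchwartzMap.fourier_coe, Real.fourier_eq']
  congr 1
  refine integral_congr_ae (ae_of_all _ fun ξ => ?_)
  simp only [smul_eq_mul]
  congr 2
  rw [inner_smul_right]
  have h := Real.pi_ne_zero
  push_cast
  have h2 : (Real.pi : ℂ) ≠ 0 := by exact_mod_cast h
  field_simp

/-- The inversion formula for Schwartz functions. -/
lemma uF_inversion (ψ : 𝓢(Sp n, ℂ)) (ξ : Sp n) :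
    c₀ n * ∫ x, Complex.exp ((inner ℝ ξ x : ℝ) * Complex.I) * uF ψ x = ψ ξ := by
  have e : ∀ x : Sp n, Complex.exp ((inner ℝ ξ x : ℝ) * Complex.I) * uF ψ x =
      (fun y : Sp n => (c₀ n : ℂ) * (Complex.exp (((2 * Real.pi * inner ℝ y ξ : ℝ) : ℂ) * Complex.I) •
        (𝓕 ψ) y)) ((2 * Real.pi)⁻¹ • x) := by
    intro x
    rw [uF_apply]
    simp only [smul_eq_mul]
    rw [inner_smul_left, real_inner_comm]
    have h : 2 * Real.pi * ((starRingEnd ℝ) (2 * Real.pi)⁻¹ * inner ℝ x ξ) = inner ℝ x ξ := by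
      simp only [conj_trivial]
      field_simp
    rw [h]
    ring
  have d := (integral_congr_ae (ae_of_all volume e)).trans (integral_dilation (fun y : Sp n =>
    (c₀ n : ℂ) * (Complex.exp (((2 * Real.pi * inner ℝ y ξ : ℝ) : ℂ) * Complex.I) •
      (𝓕 ψ : 𝓢(Sp n, ℂ)) y)))
  rw [d, integral_const_mul, ← Real.fourierInv_eq', ← SchwartzMap.fourierInv_coe,
    FourierTransform.fourierInv_fourier_eq]
  have h := c₀_sq n
  have h2 : (c₀ n : ℂ) * c₀ n * ((2 * Real.pi) ^ n : ℝ) = 1 := by exact_mod_cast h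
  linear_combination ψ ξ * h2

/-! ### The Fourier transform of tempered functions -/

namespace HasFourier

variable {u u' v v' : Sp n → ℂ}

lemma integral_uF (h : HasFourier u v) (ψ : 𝓢(Sp n, ℂ)) : ∫ x, u x * uF ψ x = ∫ ξ, v ξ * ψ ξ := by
  rw [← h.2.2 ψ, unitaryFourier_eq]

lemma mk' (hu : IsTempered u) (hv : IsTempered v)
    (h : ∀ ψ, ∫ x, u x * uF ψ x = ∫ ξ, v ξ * ψ ξ) : HasFourier u v :=
  ⟨hu, hv, fun ψ => by rw [← h ψ, unitaryFourier_eq]⟩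

lemma congr (h : HasFourier u v) (hu : u =ᵐ[volume] u') (hv : v =ᵐ[volume] v') :
    HasFourier u' v' := by
  refine ⟨h.1.congr hu, h.2.1.congr hv, fun ψ => ?_⟩
  refine Eq.trans (integral_congr_ae (hu.mono fun x hx => ?_))
    ((h.2.2 ψ).trans (integral_congr_ae (hv.mono fun x hx => ?_)))
  · simp only [hx]
  · simp only [hx]

lemma unique_right (h : HasFourier u v) (h' : HasFourier u v') : v =ᵐ[volume] v' :=
  h.2.1.ae_eq h'.2.1 fun ψ => (h.2.2 ψ).symm.trans (h'.2.2 ψ)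

lemma unique_left (h : HasFourier u v) (h' : HasFourier u' v) : u =ᵐ[volume] u' := by
  refine h.1.ae_eq h'.1 fun ψ => ?_
  obtain ⟨χ, rfl⟩ := uF_surjective ψ
  exact (h.integral_uF χ).trans (h'.integral_uF χ).symm

lemma add (h : HasFourier u v) (h' : HasFourier u' v') : HasFourier (u + u') (v + v') := by
  refine mk' (h.1.add h'.1) (h.2.1.add h'.2.1) fun ψ => ?_
  simp only [Pi.add_apply, add_mul]
  rw [integral_add (h.1 _) (h'.1 _), integral_add (h.2.1 _) (h'.2.1 _), h.integral_uF,
    h'.integral_uF]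

lemma const_mul (c : ℂ) (h : HasFourier u v) :
    HasFourier (fun x => c * u x) (fun ξ => c * v ξ) := by
  refine mk' (h.1.const_mul c) (h.2.1.const_mul c) fun ψ => ?_
  simp only [mul_assoc]
  rw [integral_const_mul, integral_const_mul, h.integral_uF]

lemma sub (h : HasFourier u v) (h' : HasFourier u' v') : HasFourier (u - u') (v - v') := by
  have := h.add (h'.const_mul (-1))
  refine this.congr (ae_of_all _ fun x => ?_) (ae_of_all _ fun x => ?_) <;>
  simp [sub_eq_add_neg]

lemma zero : HasFourier (0 : Sp n → ℂ) 0 := by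
  refine mk' (fun ψ => ?_) (fun ψ => ?_) fun ψ => ?_ <;> simp

lemma sum {ι : Type*} (I : Finset ι) {f g : ι → Sp n → ℂ} (h : ∀ i ∈ I, HasFourier (f i) (g i)) :
    HasFourier (fun x => ∑ i ∈ I, f i x) (fun ξ => ∑ i ∈ I, g i ξ) := by
  classical
  induction I using Finset.induction_on with
  | empty => simpa only [Finset.sum_empty] using! zero
  | insert a I ha ih =>
    simp only [Finset.sum_insert ha]
    exact (h a (Finset.mem_insert_self a I)).add
      (ih fun i hi => h i (Finset.mem_insert_of_mem hi))

/-- The Fourier transform of the complex conjugate. -/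
lemma conj (h : HasFourier u v) : HasFourier (fun x => starRingEnd ℂ (u x)) (reflConj v) := by
  have cj : ∀ ψ : 𝓢(Sp n, ℂ), ∃ χ : 𝓢(Sp n, ℂ), ∀ x, χ x = starRingEnd ℂ (ψ x) := fun ψ =>
    ⟨ψ.postcompCLM (𝕜 := ℝ) (Complex.conjCLE : ℂ →L[ℝ] ℂ), fun x => rfl⟩
  have tc : ∀ {f : Sp n → ℂ}, IsTempered f → IsTempered fun x => starRingEnd ℂ (f x) := by
    intro f hf ψ
    obtain ⟨χ, hχ⟩ := cj ψ
    refine ((Complex.conjCLE : ℂ →L[ℝ] ℂ).integrable_comp (hf χ)).congr (ae_of_all _ fun x => ?_)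
    simp [hχ]
  have hneg : ∀ ψ : 𝓢(Sp n, ℂ), ∃ χ : 𝓢(Sp n, ℂ), ∀ x, χ x = ψ (-x) := fun ψ =>
    ⟨SchwartzMap.compCLMOfContinuousLinearEquiv ℂ (ContinuousLinearEquiv.neg ℝ) ψ, fun x => rfl⟩
  have tr : ∀ {f : Sp n → ℂ}, IsTempered f → IsTempered fun x => f (-x) := by
    intro f hf ψ
    obtain ⟨χ, hχ⟩ := hneg ψ
    refine ((hf χ).comp_neg).congr (ae_of_all _ fun x => ?_)
    simp [hχ]
  refine mk' (tc h.1) (tc (tr h.2.1)) fun ψ => ?_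
  obtain ⟨ψ₁, h1⟩ := cj ψ
  obtain ⟨χ, h2⟩ := hneg ψ₁
  -- `χ` is the conjugate of `ψ` reflected through the origin, and reflection undoes the sign change
  -- that conjugation makes in the exponential.
  have e : ∀ x, uF χ x = starRingEnd ℂ (uF ψ x) := by
    intro x
    rw [uF_eq_integral, uF_eq_integral, map_mul, Complex.conj_ofReal, ← integral_conj,
      ← integral_neg_eq_self]
    congr 1
    refine integral_congr_ae (ae_of_all _ fun ξ => ?_)
    simp only [map_mul, h2, h1, neg_neg, ← Complex.exp_conj, map_neg, Complex.conj_ofReal,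
      Complex.conj_I, inner_neg_left, Complex.ofReal_neg]
    ring_nf
  have h3 := congrArg (starRingEnd ℂ) (h.integral_uF χ)
  rw [← integral_conj, ← integral_conj, ← integral_neg_eq_self (fun ξ => (starRingEnd ℂ) (v ξ * χ ξ))]
    at h3
  simp only [map_mul, e, Complex.conj_conj, h2, h1, neg_neg] at h3
  exact h3

/-- A function with Hermitian Fourier transform is real. -/
lemma eq_ofReal (h : HasFourier u v) (hv : reflConj v =ᵐ[volume] v) :
    (fun x => ((u x).re : ℂ)) =ᵐ[volume] u := by
  have := (h.conj.congr (ae_eq_refl _) hv).unique_left h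
  filter_upwards [this] with x hx
  exact Complex.conj_eq_iff_re.1 hx

end HasFourier

/-! ### Partial derivatives -/

lemma HasPartial.unique {i : Fin n} {u u' v v' : Sp n → ℂ} (h : HasPartial i u v)
    (h' : HasPartial i u' v') (hu : u =ᵐ[volume] u') : v =ᵐ[volume] v' := by
  refine h.2.1.ae_eq h'.2.1 fun ψ => ?_
  have h1 := h.2.2 ψ
  have h2 := h'.2.2 ψ
  have h3 : ∫ x, u x * fderiv ℝ ψ x (EuclideanSpace.single i (1 : ℝ)) =
      ∫ x, u' x * fderiv ℝ ψ x (EuclideanSpace.single i (1 : ℝ)) :=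
    integral_congr_ae (hu.mono fun x hx => by simp only [hx])
  exact neg_injective (h1.symm.trans (h3.trans h2))

-- By duality: the i-th derivative of the transform of χ is -i times the transform of ξᵢχ, and
-- moving the factor ξᵢ onto v gives the symbol iξᵢ.
open LineDeriv in
lemma HasFourier.hasPartial {i : Fin n} {u u' v : Sp n → ℂ} (h : HasFourier u v)
    (h' : HasFourier u' (fun ξ => (Complex.I * (ξ i : ℂ)) * v ξ)) : HasPartial i u u' := by
  refine ⟨h.1, h'.1, fun ψ => ?_⟩
  obtain ⟨χ, rfl⟩ := uF_surjective ψ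
  set m : Sp n := EuclideanSpace.single i (1 : ℝ) with hm
  have hg : (inner ℝ · m : Sp n → ℝ).HasTemperateGrowth := by fun_prop
  set θ : 𝓢(Sp n, ℂ) := SchwartzMap.smulLeftCLM ℂ (inner ℝ · m) χ with hθ
  have hθx : ∀ x, θ x = (x i : ℂ) * χ x := by
    intro x
    rw [hθ, SchwartzMap.smulLeftCLM_apply_apply hg, hm, EuclideanSpace.inner_single_right]
    simp
  have e : ∀ x, fderiv ℝ (uF χ) x m = -Complex.I * uF θ x := by
    intro x
    have h1 : HasFDerivAt (uF χ) ((c₀ n : ℂ) • (fderiv ℝ (𝓕 χ : 𝓢(Sp n, ℂ)) (dilation n x)).comp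
        (dilation n : Sp n →L[ℝ] Sp n)) x :=
      ((SchwartzMap.differentiable (𝓕 χ) (dilation n x)).hasFDerivAt.comp x
        (dilation n : Sp n →L[ℝ] Sp n).hasFDerivAt).const_smul (c₀ n : ℂ)
    rw [h1.fderiv]
    have h2 := congrArg (fun f : 𝓢(Sp n, ℂ) => f (dilation n x)) (SchwartzMap.lineDerivOp_fourier_eq χ m)
    simp only [SchwartzMap.lineDerivOp_apply_eq_fderiv] at h2
    rw [uF_apply]
    simp only [ContinuousLinearMap.smul_apply, ContinuousLinearMap.comp_apply,
      ContinuousLinearEquiv.coe_coe, smul_eq_mul]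
    rw [dilation_apply m, map_smul, h2, ← hθ, FourierTransform.fourier_smul, SchwartzMap.smul_apply,
      dilation_apply, smul_eq_mul, Complex.real_smul]
    have hpi : (Real.pi : ℂ) ≠ 0 := by exact_mod_cast Real.pi_ne_zero
    push_cast
    field_simp
  have h1 := h.integral_uF θ
  have h2 := h'.integral_uF χ
  simp_rw [e]
  calc ∫ x, u x * (-Complex.I * uF θ x) = ∫ x, -Complex.I * (u x * uF θ x) :=
        integral_congr_ae (ae_of_all _ fun x => by ring)
    _ = -Complex.I * ∫ ξ, v ξ * θ ξ := by rw [integral_const_mul, h1]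
    _ = -∫ ξ, Complex.I * (ξ i : ℂ) * v ξ * χ ξ := by
      rw [neg_mul, ← integral_const_mul]
      congr 1
      refine integral_congr_ae (ae_of_all _ fun ξ => ?_)
      simp only [hθx]
      ring
    _ = _ := by rw [← h2]

end HartreeAsymptotics

end

noncomputable section

open MeasureTheory Filter Topology
open scoped ENNReal SchwartzMap FourierTransform NNReal ContDiff

namespace HartreeAsymptotics

variable {n : ℕ}

/-! ### Inverse Fourier transforms -/

lemma memLp_comp_smul {b : Sp n → ℂ} (hb : MemLp b 2) {r : ℝ} (hr : r ≠ 0) :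
    MemLp (fun x => b (r • x)) 2 := by
  have h1 : MemLp b 2 (Measure.map (r • ·) (volume : Measure (Sp n))) := by
    rw [Measure.map_addHaar_smul _ hr]
    exact hb.smul_measure ENNReal.ofReal_ne_top
  exact h1.comp_of_map (measurable_const_smul r).aemeasurable

/-- The bilinear pairing `F ↦ ∫ F g` on `L²`. -/
def pairL (g : Sp n → ℂ) (hg : MemLp g 2) : L2 n →L[ℂ] ℂ :=
  ((ContinuousLinearMap.mul ℂ ℂ).lpPairing volume 2 2).flip hg.toLp

lemma pairL_apply {g : Sp n → ℂ} (hg : MemLp g 2) (F : L2 n) : pairL g hg F = ∫ x, F x * g x := by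
  rw [pairL, ContinuousLinearMap.flip_apply, ContinuousLinearMap.lpPairing_eq_integral]
  refine integral_congr_ae (hg.coeFn_toLp.mono fun x hx => ?_)
  simp [hx]

/-- The inverse Fourier transform on `L²`. -/
def invL2 (F : L2 n) (x : Sp n) : ℂ := c₀ n * (𝓕⁻ F : L2 n) ((2 * Real.pi)⁻¹ • x)

lemma memLp_invL2 (F : L2 n) : MemLp (invL2 F) 2 :=
  (memLp_comp_smul (Lp.memLp (𝓕⁻ F : L2 n)) (inv_ne_zero Real.two_pi_pos.ne')).const_mul _

lemma integral_invL2_mul (F : L2 n) (b : Sp n → ℂ) :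
    ∫ x, invL2 F x * b x = (c₀ n * ((2 * Real.pi) ^ n : ℝ) : ℂ) *
      ∫ y, (𝓕⁻ F : L2 n) y * b ((2 * Real.pi) • y) := by
  have h := integral_dilation (n := n)
    (fun y => c₀ n * ((𝓕⁻ F : L2 n) y * b ((2 * Real.pi) • y)))
  rw [integral_const_mul (c₀ n : ℂ) fun y => (𝓕⁻ F : L2 n) y * b ((2 * Real.pi) • y),
    ← mul_assoc, mul_comm (((2 * Real.pi) ^ n : ℝ) : ℂ)] at h
  rw [← h]
  refine integral_congr_ae (ae_of_all _ fun x => ?_)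
  simp only [invL2, smul_smul, mul_inv_cancel₀ Real.two_pi_pos.ne', one_smul, mul_assoc]

/-- The L² inversion with kernel exp(2πi x·ξ) is carried over by a dilation; the normalizations
cancel because c₀² (2π)^n = 1. -/
lemma hasFourier_invL2 (F : L2 n) : HasFourier (invL2 F) F := by
  refine HasFourier.mk' (IsTempered.of_memLp (memLp_invL2 F)) (IsTempered.of_memLp (Lp.memLp F))
    fun ψ => ?_
  rw [integral_invL2_mul]
  have h1 := congrArg (fun T => T (𝓕 ψ)) (Lp.fourierInv_toTemperedDistribution_eq F)
  simp only [TemperedDistribution.fourierInv_apply, FourierTransform.fourierInv_fourier_eq,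
    Lp.toTemperedDistribution_apply] at h1
  have h2 : ∫ y, (𝓕⁻ F : L2 n) y * uF ψ ((2 * Real.pi) • y) =
      c₀ n * ∫ y, (𝓕 ψ : 𝓢(Sp n, ℂ)) y • (𝓕⁻ F : L2 n) y := by
    rw [← integral_const_mul]
    refine integral_congr_ae (ae_of_all _ fun x => ?_)
    simp only [uF_apply, smul_smul, inv_mul_cancel₀ Real.two_pi_pos.ne', one_smul, smul_eq_mul]
    ring
  have h3 : (c₀ n : ℂ) * c₀ n * ((2 * Real.pi) ^ n : ℝ) = 1 := by exact_mod_cast c₀_sq n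
  rw [h2, ← h1, ← mul_assoc, show (c₀ n * ((2 * Real.pi) ^ n : ℝ) : ℂ) * c₀ n = 1 by
    rw [← h3]; ring, one_mul]
  refine integral_congr_ae (ae_of_all _ fun x => ?_)
  simp [mul_comm]

/-- The inverse Fourier transform of an integrable function. -/
def invL1 (v : Sp n → ℂ) (x : Sp n) : ℂ :=
  c₀ n * ∫ ξ, Complex.exp ((inner ℝ ξ x : ℝ) * Complex.I) * v ξ

lemma norm_exp_inner (ξ x : Sp n) : ‖Complex.exp ((inner ℝ ξ x : ℝ) * Complex.I)‖ = 1 :=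
  Complex.norm_exp_ofReal_mul_I _

lemma norm_invL1_le (v : Sp n → ℂ) (x : Sp n) : ‖invL1 v x‖ ≤ c₀ n * ∫ ξ, ‖v ξ‖ := by
  rw [invL1, norm_mul, Complex.norm_real, Real.norm_of_nonneg (c₀_pos n).le]
  refine mul_le_mul_of_nonneg_left ((norm_integral_le_integral_norm _).trans (le_of_eq ?_))
    (c₀_pos n).le
  simp only [norm_mul, norm_exp_inner, one_mul]

lemma continuous_exp_inner :
    Continuous fun z : Sp n × Sp n => Complex.exp ((inner ℝ z.2 z.1 : ℝ) * Complex.I) := by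
  fun_prop

lemma continuous_invL1 {v : Sp n → ℂ} (hv : Integrable v) : Continuous (invL1 v) := by
  refine continuous_const.mul (continuous_of_dominated (bound := fun ξ => ‖v ξ‖) (fun x => ?_)
    (fun x => ae_of_all _ fun ξ => ?_) hv.norm (ae_of_all _ fun ξ => ?_))
  · exact (Continuous.aestronglyMeasurable (by fun_prop)).mul hv.aestronglyMeasurable
  · rw [norm_mul, norm_exp_inner, one_mul]
  · fun_prop

/-- Fubini for the inverse Fourier transform of an integrable function. -/
lemma integral_invL1_mul {v f : Sp n → ℂ} (hv : Integrable v) (hf : Integrable f) :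
    ∫ x, invL1 v x * f x =
      ∫ ξ, v ξ * (c₀ n * ∫ x, Complex.exp ((inner ℝ ξ x : ℝ) * Complex.I) * f x) := by
  have hi : Integrable (Function.uncurry fun x ξ : Sp n =>
      Complex.exp ((inner ℝ ξ x : ℝ) * Complex.I) * (f x * v ξ)) (volume.prod volume) :=
    (hf.mul_prod hv).bdd_mul (c := 1) continuous_exp_inner.aestronglyMeasurable
      (ae_of_all _ fun z => (norm_exp_inner z.2 z.1).le)
  have h := integral_integral_swap hi
  calc ∫ x, invL1 v x * f x
      = ∫ x, c₀ n * ∫ ξ, Complex.exp ((inner ℝ ξ x : ℝ) * Complex.I) * (f x * v ξ) := by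
        refine integral_congr_ae (ae_of_all _ fun x => ?_)
        simp only [invL1, mul_assoc]
        rw [← integral_mul_const]
        congr 1
        refine integral_congr_ae (ae_of_all _ fun ξ => ?_)
        simp only
        ring
    _ = c₀ n * ∫ ξ, ∫ x, Complex.exp ((inner ℝ ξ x : ℝ) * Complex.I) * (f x * v ξ) := by
        rw [integral_const_mul, h]
    _ = _ := by
        rw [← integral_const_mul]
        refine integral_congr_ae (ae_of_all _ fun ξ => ?_)
        change _ = v ξ * (c₀ n * ∫ x, Complex.exp ((inner ℝ ξ x : ℝ) * Complex.I) * f x)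
        rw [mul_left_comm, ← integral_const_mul (v ξ)]
        refine congrArg ((c₀ n : ℂ) * ·) (integral_congr_ae (ae_of_all _ fun x => ?_))
        simp only
        ring

lemma hasFourier_invL1 {v : Sp n → ℂ} (hv : Integrable v) : HasFourier (invL1 v) v := by
  refine HasFourier.mk' (fun ψ => ?_) (IsTempered.of_integrable hv) fun ψ => ?_
  · exact (SchwartzMap.integrable ψ).bdd_mul (continuous_invL1 hv).aestronglyMeasurable
      (ae_of_all _ (norm_invL1_le v))
  · rw [integral_invL1_mul hv (SchwartzMap.integrable _)]
    simp_rw [uF_inversion]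

/-- The sum of a measurable integrable and a measurable square integrable function. -/
def Adm (v : Sp n → ℂ) : Prop :=
  ∃ a b : Sp n → ℂ, Measurable a ∧ Measurable b ∧ Integrable a ∧ MemLp b 2 ∧ v =ᵐ[volume] a + b

lemma exists_hasFourier_of_memLp {v : Sp n → ℂ} (hv : MemLp v 2) : ∃ u, MemLp u 2 ∧ HasFourier u v :=
  ⟨_, memLp_invL2 hv.toLp, (hasFourier_invL2 hv.toLp).congr (ae_eq_refl _) hv.coeFn_toLp⟩

lemma Adm.exists_hasFourier {v : Sp n → ℂ} (hv : Adm v) : ∃ u, HasFourier u v := by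
  obtain ⟨a, b, -, -, ha, hb, h⟩ := hv
  obtain ⟨u, -, hu⟩ := exists_hasFourier_of_memLp hb
  exact ⟨_, ((hasFourier_invL1 ha).add hu).congr (ae_eq_refl _) h.symm⟩

/-! ### Convolutions -/

/-- The convolution `v₁ ⋆ v₂`. -/
def conv (v₁ v₂ : Sp n → ℂ) (ξ : Sp n) : ℂ := ∫ η, v₁ η * v₂ (ξ - η)

lemma conv_comm (v₁ v₂ : Sp n → ℂ) : conv v₁ v₂ = conv v₂ v₁ := by
  funext ξ
  rw [conv, ← integral_sub_left_eq_self _ volume ξ]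
  refine integral_congr_ae (ae_of_all _ fun η => ?_)
  simp only [sub_sub_cancel, mul_comm]

lemma conv_congr {v₁ v₁' v₂ v₂' : Sp n → ℂ} (h₁ : v₁ =ᵐ[volume] v₁') (h₂ : v₂ =ᵐ[volume] v₂') :
    conv v₁ v₂ = conv v₁' v₂' := by
  funext ξ
  refine integral_congr_ae ?_
  filter_upwards [h₁, ae_reflect h₂ ξ] with η e1 e2
  rw [e1, e2]

/-- Absolute convergence of `∫ (v₁ ⋆ v₂) ψ` for all Schwartz functions `ψ`. -/
def Convolvable (v₁ v₂ : Sp n → ℂ) : Prop :=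
  ∀ ψ : 𝓢(Sp n, ℂ), Integrable (fun z : Sp n × Sp n => v₁ z.2 * v₂ (z.1 - z.2) * ψ z.1)
    (volume.prod volume)

namespace Convolvable

variable {v₁ v₁' v₂ : Sp n → ℂ}

lemma symm (h : Convolvable v₁ v₂) : Convolvable v₂ v₁ := by
  intro ψ
  have mp : MeasurePreserving (fun z : Sp n × Sp n => (z.1, -(-z.1 + z.2)))
      (volume.prod volume) (volume.prod volume) :=
    ((MeasurePreserving.id volume).prod (Measure.measurePreserving_neg volume)).comp
      (measurePreserving_prod_neg_add (volume : Measure (Sp n)) (volume : Measure (Sp n)))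
  refine (mp.integrable_comp_of_integrable (h ψ)).congr (ae_of_all _ fun z => ?_)
  simp only [Function.comp]
  rw [show -(-z.1 + z.2) = z.1 - z.2 by abel, show z.1 - (z.1 - z.2) = z.2 by abel]
  ring

lemma add (h : Convolvable v₁ v₂) (h' : Convolvable v₁' v₂) : Convolvable (v₁ + v₁') v₂ :=
  fun ψ => ((h ψ).add (h' ψ)).congr (ae_of_all _ fun z => by
    simp only [Pi.add_apply]; ring)

lemma isTempered (h : Convolvable v₁ v₂) : IsTempered (conv v₁ v₂) := by
  intro ψ
  refine (h ψ).integral_prod_left.congr (ae_of_all _ fun ξ => ?_)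
  simp only [conv]
  rw [integral_mul_const]

/-- Testing with a bump equal to 1 on the ball of radius N + 1 and applying Fubini gives the claim
on that ball; countably many balls suffice. -/
lemma ae_integrable (h : Convolvable v₁ v₂) :
    ∀ᵐ ξ, Integrable fun η => v₁ η * v₂ (ξ - η) := by
  have key : ∀ N : ℕ, ∀ᵐ ξ : Sp n, ‖ξ‖ ≤ N + 1 → Integrable fun η => v₁ η * v₂ (ξ - η) := by
    intro N
    have hN : (0 : ℝ) < N + 1 := by positivity
    let f : ContDiffBump (0 : Sp n) := ⟨N + 1, N + 2, hN, by linarith⟩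
    have hc : HasCompactSupport (Complex.ofRealCLM ∘ f) := f.hasCompactSupport.comp_left rfl
    have hs : ContDiff ℝ ∞ (Complex.ofRealCLM ∘ f) := Complex.ofRealCLM.contDiff.comp f.contDiff
    filter_upwards [(h (hc.toSchwartzMap hs)).prod_right_ae] with ξ hξ hle
    have h1 : f ξ = 1 := f.one_of_mem_closedBall (by simpa using hle)
    refine hξ.congr (ae_of_all _ fun η => ?_)
    simp [h1]
  rw [← ae_all_iff] at key
  filter_upwards [key] with ξ hξ
  obtain ⟨N, hN⟩ := exists_nat_ge ‖ξ‖
  exact hξ N (hN.trans (by linarith))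

lemma integral_conv_mul (h : Convolvable v₁ v₂) (ψ : 𝓢(Sp n, ℂ)) :
    ∫ ξ, conv v₁ v₂ ξ * ψ ξ = ∫ η, v₁ η * ∫ ξ, v₂ (ξ - η) * ψ ξ := by
  have h1 := integral_integral_swap (f := fun ξ η => v₁ η * v₂ (ξ - η) * ψ ξ) (h ψ)
  simp only [integral_mul_const] at h1
  refine h1.trans (integral_congr_ae (ae_of_all _ fun η => ?_))
  simp only [mul_assoc]
  rw [integral_const_mul]

lemma of_lintegral_lt_top (m₁ : Measurable v₁) (m₂ : Measurable v₂)
    (h : ∀ ψ : 𝓢(Sp n, ℂ), ∫⁻ ξ, (∫⁻ η, ‖v₁ η‖ₑ * ‖v₂ (ξ - η)‖ₑ) * ‖ψ ξ‖ₑ < ⊤) :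
    Convolvable v₁ v₂ := by
  intro ψ
  have hm : Measurable fun z : Sp n × Sp n => v₁ z.2 * v₂ (z.1 - z.2) * ψ z.1 :=
    ((m₁.comp measurable_snd).mul (m₂.comp (measurable_fst.sub measurable_snd))).mul
      (ψ.continuous.measurable.comp measurable_fst)
  refine ⟨hm.aestronglyMeasurable, ?_⟩
  rw [hasFiniteIntegral_iff_enorm, lintegral_prod _ hm.enorm.aemeasurable]
  refine lt_of_eq_of_lt (lintegral_congr fun ξ => ?_) (h ψ)
  simp only [enorm_mul]
  rw [lintegral_mul_const]
  exact m₁.enorm.mul (m₂.comp (measurable_const.sub measurable_id)).enorm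

lemma of_integrable_integrable (m₁ : Measurable v₁) (m₂ : Measurable v₂) (h₁ : Integrable v₁)
    (h₂ : Integrable v₂) : Convolvable v₁ v₂ := by
  intro ψ
  have h := h₁.convolution_integrand (ContinuousLinearMap.mul ℂ ℂ) h₂
  have hψ := ψ.toBoundedContinuousFunction.norm_coe_le_norm
  refine (h.bdd_mul (f := fun z : Sp n × Sp n => ψ z.1) (c := ‖ψ.toBoundedContinuousFunction‖)
    (ψ.continuous.comp continuous_fst).aestronglyMeasurable
    (ae_of_all _ fun z => hψ z.1)).congr (ae_of_all _ fun z => ?_)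
  simp [mul_comm]

lemma nrm_schwartz_lt_top (ψ : 𝓢(Sp n, ℂ)) : nrm (fun x => ‖ψ x‖ₑ) < ⊤ := by
  rw [nrm_enorm_eq]
  exact ψ.eLpNorm_lt_top 2 volume

lemma of_integrable_memLp (m₁ : Measurable v₁) (m₂ : Measurable v₂) (h₁ : Integrable v₁)
    (h₂ : MemLp v₂ 2) : Convolvable v₁ v₂ := by
  refine of_lintegral_lt_top m₁ m₂ fun ψ => ?_
  have hm : Measurable fun ξ => ∫⁻ η, ‖v₁ η‖ₑ * ‖v₂ (ξ - η)‖ₑ :=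
    Measurable.lintegral_prod_right' (f := fun z : Sp n × Sp n => ‖v₁ z.2‖ₑ * ‖v₂ (z.1 - z.2)‖ₑ)
      ((m₁.comp measurable_snd).enorm.mul (m₂.comp (measurable_fst.sub measurable_snd)).enorm)
  refine (lintegral_mul_le_nrm hm ψ.continuous.measurable.enorm).trans_lt ?_
  refine ENNReal.mul_lt_top ((nrm_convolution_le m₁.enorm m₂.enorm).trans_lt ?_)
    (nrm_schwartz_lt_top ψ)
  rw [nrm_enorm_eq]
  exact ENNReal.mul_lt_top h₁.2 h₂.2

lemma of_memLp_memLp (m₁ : Measurable v₁) (m₂ : Measurable v₂) (h₁ : MemLp v₁ 2)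
    (h₂ : MemLp v₂ 2) : Convolvable v₁ v₂ := by
  refine of_lintegral_lt_top m₁ m₂ fun ψ => ?_
  have hb : ∀ ξ, ∫⁻ η, ‖v₁ η‖ₑ * ‖v₂ (ξ - η)‖ₑ ≤ eLpNorm v₁ 2 volume * eLpNorm v₂ 2 volume := by
    intro ξ
    refine (lintegral_mul_le_nrm m₁.enorm
      (m₂.comp (measurable_const.sub measurable_id)).enorm).trans (le_of_eq ?_)
    rw [nrm_enorm_eq, ← nrm_enorm_eq v₂]
    exact congrArg _ (nrm_reflect (f := fun x => ‖v₂ x‖ₑ) ξ)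
  refine (lintegral_mono fun ξ => mul_le_mul' (hb ξ) le_rfl).trans_lt ?_
  rw [lintegral_const_mul _ ψ.continuous.measurable.enorm]
  exact ENNReal.mul_lt_top (ENNReal.mul_lt_top h₁.2 h₂.2) (SchwartzMap.integrable ψ).2

end Convolvable

end HartreeAsymptotics

end

noncomputable section

open MeasureTheory Filter Topology
open scoped ENNReal SchwartzMap FourierTransform NNReal

namespace HartreeAsymptotics

variable {n : ℕ}

/-! ### The Fourier transform of a product -/

lemma exp_mul_uF (ψ : 𝓢(Sp n, ℂ)) (η x : Sp n) :
    Complex.exp ((inner ℝ η x : ℝ) * Complex.I) * uF ψ x =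
      uF (SchwartzMap.compSubConstCLM ℂ (-η) ψ) x := by
  rw [uF_eq_integral, uF_eq_integral, mul_left_comm, ← integral_const_mul,
    ← integral_add_right_eq_self _ η]
  refine congrArg ((c₀ n : ℂ) * ·) (integral_congr_ae (ae_of_all _ fun ξ => ?_))
  simp only [SchwartzMap.compSubConstCLM_apply, sub_neg_eq_add]
  rw [← mul_assoc, ← Complex.exp_add]
  congr 2
  rw [inner_add_left]
  push_cast
  ring

/-- The product rule for the Fourier transform. -/
def ProductRule (v₁ v₂ : Sp n → ℂ) : Prop :=
  Convolvable v₁ v₂ ∧ ∀ u₁ u₂, HasFourier u₁ v₁ → HasFourier u₂ v₂ →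
    HasFourier (fun x => u₁ x * u₂ x) (fun ξ => c₀ n * conv v₁ v₂ ξ)

namespace ProductRule

variable {v₁ v₁' v₂ v₂' : Sp n → ℂ}

lemma symm (h : ProductRule v₁ v₂) : ProductRule v₂ v₁ := by
  refine ⟨h.1.symm, fun u₂ u₁ h₂ h₁ => ?_⟩
  have := h.2 u₁ u₂ h₁ h₂
  rw [conv_comm] at this
  simpa only [mul_comm] using this

lemma add (h : ProductRule v₁ v₂) (h' : ProductRule v₁' v₂) (hu : ∃ u, HasFourier u v₁)
    (hu' : ∃ u, HasFourier u v₁') : ProductRule (v₁ + v₁') v₂ := by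
  obtain ⟨u, hu⟩ := hu
  obtain ⟨u', hu'⟩ := hu'
  refine ⟨h.1.add h'.1, fun u₁ u₂ h₁ h₂ => ?_⟩
  have e := (hu.add hu').unique_left h₁
  refine ((h.2 u u₂ hu h₂).add (h'.2 u' u₂ hu' h₂)).congr ?_ ?_
  · filter_upwards [e] with x hx
    rw [← hx]
    simp only [Pi.add_apply, add_mul]
  · filter_upwards [h.1.ae_integrable, h'.1.ae_integrable] with ξ i1 i2
    simp only [Pi.add_apply, conv, add_mul]
    rw [integral_add i1 i2, mul_add]

/-- With v₁ integrable, u₁ is a superposition of exponentials. Multiplication by one exponential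
translates the transform of u₂, and Fubini sums the translates into the convolution. -/
lemma of_integrable (h : Convolvable v₁ v₂) (h₁ : Integrable v₁) : ProductRule v₁ v₂ := by
  refine ⟨h, fun u₁ u₂ hu₁ hu₂ => ?_⟩
  refine HasFourier.congr (u := fun x => invL1 v₁ x * u₂ x) ?_ ?_ (ae_eq_refl _)
  · refine HasFourier.mk' (fun ψ => ?_) (h.isTempered.const_mul _) fun ψ => ?_
    · simp only [mul_assoc]
      exact (hu₂.1 ψ).bdd_mul (continuous_invL1 h₁).aestronglyMeasurable
        (ae_of_all _ (norm_invL1_le v₁))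
    · simp only [mul_assoc]
      rw [integral_invL1_mul h₁ (hu₂.1 _), integral_const_mul, h.integral_conv_mul,
        ← integral_const_mul]
      refine integral_congr_ae (ae_of_all _ fun η => ?_)
      simp only
      rw [mul_left_comm]
      congr 2
      have e : ∀ x, Complex.exp ((inner ℝ η x : ℝ) * Complex.I) * (u₂ x * uF ψ x) =
          u₂ x * uF (SchwartzMap.compSubConstCLM ℂ (-η) ψ) x := by
        intro x
        rw [← exp_mul_uF]
        ring
      simp_rw [e]
      rw [hu₂.integral_uF, ← integral_add_right_eq_self (fun ξ => v₂ (ξ - η) * ψ ξ) η]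
      refine integral_congr_ae (ae_of_all _ fun ξ => ?_)
      simp
  · filter_upwards [(hasFourier_invL1 h₁).unique_left hu₁] with x hx
    rw [hx]

/-- Tested against a fixed Schwartz function, both sides are continuous linear functionals of v₁ in
L². They agree for Schwartz v₁ by the integrable case, hence everywhere by density. -/
lemma of_memLp (m₁ : Measurable v₁) (m₂ : Measurable v₂) (h₁ : MemLp v₁ 2) (h₂ : MemLp v₂ 2) :
    ProductRule v₁ v₂ := by
  have hcv := Convolvable.of_memLp_memLp m₁ m₂ h₁ h₂
  refine ⟨hcv, fun u₁ u₂ hu₁ hu₂ => ?_⟩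
  have l1 : MemLp u₁ 2 := by
    obtain ⟨u, hu, hF⟩ := exists_hasFourier_of_memLp h₁
    exact hu.ae_eq (hF.unique_left hu₁)
  have l2 : MemLp u₂ 2 := by
    obtain ⟨u, hu, hF⟩ := exists_hasFourier_of_memLp h₂
    exact hu.ae_eq (hF.unique_left hu₂)
  refine HasFourier.mk' (IsTempered.of_integrable (l1.integrable_mul l2))
    (hcv.isTempered.const_mul _) fun ψ => ?_
  -- the right-hand side as a functional of `v₁`
  set g : Sp n → ℂ := fun η => ∫ ξ, v₂ (ξ - η) * ψ ξ with hg
  have gL2 : MemLp g 2 := by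
    have mz : Measurable fun z : Sp n × Sp n => v₂ (z.2 - z.1) * ψ z.2 :=
      (m₂.comp (measurable_snd.sub measurable_fst)).mul
        (ψ.continuous.measurable.comp measurable_snd)
    have mg : StronglyMeasurable g := mz.stronglyMeasurable.integral_prod_right'
    refine ⟨mg.aestronglyMeasurable, ?_⟩
    rw [← nrm_enorm_eq]
    refine (nrm_mono (g := fun η => ∫⁻ ξ, ‖ψ ξ‖ₑ * ‖v₂ (-(η - ξ))‖ₑ) fun η => ?_).trans_lt
      ((nrm_convolution_le ψ.continuous.measurable.enorm
        (g := fun x => ‖v₂ (-x)‖ₑ) (m₂.comp measurable_neg).enorm).trans_lt ?_)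
    · refine (enorm_integral_le_lintegral_enorm _).trans (le_of_eq (lintegral_congr fun ξ => ?_))
      rw [enorm_mul, mul_comm, neg_sub]
    · refine ENNReal.mul_lt_top (SchwartzMap.integrable ψ).2 ?_
      have e := nrm_reflect (f := fun x => ‖v₂ x‖ₑ) (0 : Sp n)
      simp only [zero_sub] at e
      rw [e, nrm_enorm_eq]
      exact h₂.2
  -- the left-hand side as a functional of `v₁`
  set b : Sp n → ℂ := fun x => u₂ x * uF ψ x with hb
  have bL2 : MemLp b 2 := by
    have h3 : MemLp (fun x => uF ψ x * u₂ x) 2 :=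
      l2.mul' ((uF ψ).memLp_top volume)
    simpa only [hb, mul_comm] using h3
  have b'L2 : MemLp (fun y => b ((2 * Real.pi) • y)) 2 :=
    memLp_comp_smul bL2 Real.two_pi_pos.ne'
  let A : L2 n → ℂ := fun F => (c₀ n * ((2 * Real.pi) ^ n : ℝ) : ℂ) * pairL _ b'L2 (𝓕⁻ F : L2 n)
  let B : L2 n → ℂ := fun F => c₀ n * pairL g gL2 F
  have hA : ∀ F, A F = ∫ x, invL2 F x * b x := fun F => by
    rw [integral_invL2_mul]
    simp only [A, pairL_apply]
  have hAc : Continuous A :=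
    continuous_const.mul ((pairL _ b'L2).continuous.comp
      (FourierTransform.fourierInvCLM ℂ (L2 n)).continuous)
  have hBc : Continuous B := continuous_const.mul (pairL g gL2).continuous
  have hAB : A = B := by
    refine DenseRange.equalizer
      (SchwartzMap.denseRange_toLpCLM (E := Sp n) (F := ℂ) (p := 2) (μ := volume)
        ENNReal.ofNat_ne_top) hAc hBc (funext fun χ => ?_)
    have mχ := χ.continuous.measurable
    have e : (SchwartzMap.toLpCLM ℝ ℂ 2 volume χ : Sp n → ℂ) =ᵐ[volume] χ := χ.coeFn_toLp 2 volume
    have hcχ := Convolvable.of_integrable_memLp mχ m₂ (SchwartzMap.integrable χ) h₂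
    have hP := (of_integrable hcχ (SchwartzMap.integrable χ)).2 _ u₂
      ((hasFourier_invL2 (SchwartzMap.toLpCLM ℝ ℂ 2 volume χ)).congr (ae_eq_refl _) e) hu₂
    have h4 := hP.integral_uF ψ
    simp only [mul_assoc] at h4
    rw [integral_const_mul, hcχ.integral_conv_mul] at h4
    change A _ = B _
    rw [hA, h4]
    simp only [B, pairL_apply]
    congr 1
    refine integral_congr_ae (e.mono fun x hx => ?_)
    simp only [hx, hg]
  have e1 := h₁.coeFn_toLp
  have h5 := congrFun hAB h₁.toLp
  rw [hA] at h5
  have e2 := ((hasFourier_invL2 h₁.toLp).congr (ae_eq_refl _) e1).unique_left hu₁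
  have h6 : ∫ x, u₁ x * u₂ x * uF ψ x = ∫ x, invL2 h₁.toLp x * b x := by
    refine integral_congr_ae (e2.mono fun x hx => ?_)
    simp only [hb, hx, mul_assoc]
  rw [h6, h5]
  simp only [mul_assoc, B, pairL_apply]
  rw [integral_const_mul, hcv.integral_conv_mul]
  congr 1
  refine integral_congr_ae (e1.mono fun x hx => ?_)
  simp only [hx, hg]

lemma congr (h : ProductRule v₁ v₂) (e₁ : v₁ =ᵐ[volume] v₁') (e₂ : v₂ =ᵐ[volume] v₂') {u₁ u₂}
    (hu₁ : HasFourier u₁ v₁') (hu₂ : HasFourier u₂ v₂') :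
    (∀ᵐ ξ, Integrable fun η => v₁' η * v₂' (ξ - η)) ∧
      HasFourier (fun x => u₁ x * u₂ x) (fun ξ => c₀ n * conv v₁' v₂' ξ) := by
  constructor
  · filter_upwards [h.1.ae_integrable] with ξ hξ
    refine hξ.congr ?_
    filter_upwards [e₁, ae_reflect e₂ ξ] with η h1 h2
    rw [h1, h2]
  · rw [← conv_congr e₁ e₂]
    exact h.2 u₁ u₂ (hu₁.congr (ae_eq_refl _) e₁.symm) (hu₂.congr (ae_eq_refl _) e₂.symm)

end ProductRule

/-- The Fourier transform of a product is the convolution of the Fourier transforms. -/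
theorem HasFourier.mul {u₁ u₂ v₁ v₂ : Sp n → ℂ} (hv₁ : Adm v₁) (hv₂ : Adm v₂)
    (hu₁ : HasFourier u₁ v₁) (hu₂ : HasFourier u₂ v₂) :
    (∀ᵐ ξ, Integrable fun η => v₁ η * v₂ (ξ - η)) ∧
      HasFourier (fun x => u₁ x * u₂ x) (fun ξ => c₀ n * conv v₁ v₂ ξ) := by
  obtain ⟨a₁, b₁, ma₁, mb₁, ia₁, lb₁, e₁⟩ := hv₁
  obtain ⟨a₂, b₂, ma₂, mb₂, ia₂, lb₂, e₂⟩ := hv₂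
  have xa₁ : ∃ u, HasFourier u a₁ := ⟨_, hasFourier_invL1 ia₁⟩
  have xa₂ : ∃ u, HasFourier u a₂ := ⟨_, hasFourier_invL1 ia₂⟩
  have xb₁ : ∃ u, HasFourier u b₁ := (exists_hasFourier_of_memLp lb₁).imp fun _ h => h.2
  have xb₂ : ∃ u, HasFourier u b₂ := (exists_hasFourier_of_memLp lb₂).imp fun _ h => h.2
  have r1 : ProductRule (a₁ + b₁) a₂ := by
    refine ProductRule.add ?_ ?_ xa₁ xb₁
    · exact ProductRule.of_integrable (.of_integrable_integrable ma₁ ma₂ ia₁ ia₂) ia₁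
    · exact (ProductRule.of_integrable (.of_integrable_memLp ma₂ mb₁ ia₂ lb₁) ia₂).symm
  have r2 : ProductRule (a₁ + b₁) b₂ := by
    refine ProductRule.add ?_ ?_ xa₁ xb₁
    · exact ProductRule.of_integrable (.of_integrable_memLp ma₁ mb₂ ia₁ lb₂) ia₁
    · exact ProductRule.of_memLp mb₁ mb₂ lb₁ lb₂
  exact (ProductRule.add r1.symm r2.symm xa₂ xb₂).symm.congr e₁.symm e₂.symm hu₁ hu₂

end HartreeAsymptotics

end

noncomputable section

open MeasureTheory Filter Topology
open scoped ENNReal SchwartzMap FourierTransform NNReal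

namespace HartreeAsymptotics

variable {n : ℕ}

/-! ### Representation of functions by weighted Fourier transforms -/

/-- The Fourier transform of `u` is `ω⁻¹ F`. -/
def Rep (ω : Sp n → ℝ) (F : L2 n) (u : Sp n → ℂ) : Prop :=
  HasFourier u (fun ξ => (((ω ξ)⁻¹ : ℝ) : ℂ) * F ξ)

namespace Rep

variable {ω : Sp n → ℝ} {F G : L2 n} {u v : Sp n → ℂ}

lemma congr (h : Rep ω F u) (huv : u =ᵐ[volume] v) : Rep ω F v :=
  HasFourier.congr h huv (ae_eq_refl _)

lemma unique (h : Rep ω F u) (h' : Rep ω F v) : u =ᵐ[volume] v := HasFourier.unique_left h h'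

lemma add (h : Rep ω F u) (h' : Rep ω G v) : Rep ω (F + G) (u + v) := by
  refine (HasFourier.add h h').congr (ae_eq_refl _) ?_
  filter_upwards [Lp.coeFn_add F G] with ξ hξ
  simp only [hξ, Pi.add_apply, mul_add]

lemma smul (c : ℝ) (h : Rep ω F u) : Rep ω (c • F) (fun x => (c : ℂ) * u x) := by
  refine (HasFourier.const_mul (c : ℂ) h).congr (ae_eq_refl _) ?_
  filter_upwards [Lp.coeFn_smul c F] with ξ hξ
  simp only [hξ, Pi.smul_apply, Complex.real_smul]
  ring

lemma sub (h : Rep ω F u) (h' : Rep ω G v) : Rep ω (F - G) (u - v) := by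
  refine (HasFourier.sub h h').congr (ae_eq_refl _) ?_
  filter_upwards [Lp.coeFn_sub F G] with ξ hξ
  simp only [hξ, Pi.sub_apply, mul_sub]

lemma zero : Rep ω 0 (0 : Sp n → ℂ) := by
  refine HasFourier.zero.congr (ae_eq_refl _) ?_
  filter_upwards [Lp.coeFn_zero ℂ 2 (volume : Measure (Sp n))] with ξ hξ
  simp [hξ]

lemma sum {ι : Type*} (I : Finset ι) {f : ι → L2 n} {g : ι → Sp n → ℂ}
    (h : ∀ i ∈ I, Rep ω (f i) (g i)) : Rep ω (∑ i ∈ I, f i) (fun x => ∑ i ∈ I, g i x) := by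
  classical
  induction I using Finset.induction_on with
  | empty => simpa only [Finset.sum_empty] using! zero
  | insert a I ha ih =>
    simp only [Finset.sum_insert ha]
    exact (h a (Finset.mem_insert_self a I)).add
      (ih fun i hi => h i (Finset.mem_insert_of_mem hi))

/-- The representing function of a real function is Hermitian, and conversely. -/
lemma eq_ofReal (h : Rep ω F u) (hω : ∀ ξ, ω (-ξ) = ω ξ) (hF : reflConjL F = F) :
    (fun x => ((u x).re : ℂ)) =ᵐ[volume] u := by
  refine HasFourier.eq_ofReal h ?_
  have h1 := reflConjL_ae F
  rw [hF] at h1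
  filter_upwards [h1] with ξ hξ
  simp only [reflConj, map_mul, Complex.conj_ofReal, hω]
  rw [hξ, reflConj]

/-- Testing is a continuous functional of the representing L² function, so derivatives and limits in
L² pass to distributions. -/
lemma integral_uF (h : Rep ω F u) {ψ : 𝓢(Sp n, ℂ)}
    (hψ : MemLp (fun ξ => (((ω ξ)⁻¹ : ℝ) : ℂ) * ψ ξ) 2) :
    ∫ x, u x * uF ψ x = pairL _ hψ F := by
  rw [HasFourier.integral_uF h, pairL_apply]
  refine integral_congr_ae (ae_of_all _ fun ξ => ?_)
  simp only
  ring

variable {W : ℝ → L2 n} {w : ℝ → Sp n → ℂ}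

lemma hasDerivWithinAt (hψ : ∀ ψ : 𝓢(Sp n, ℂ), MemLp (fun ξ => (((ω ξ)⁻¹ : ℝ) : ℂ) * ψ ξ) 2)
    (hw : ∀ t, 1 ≤ t → Rep ω (W t) (w t)) {t : ℝ} (ht : 1 ≤ t)
    (hW : HasDerivWithinAt W F (Set.Ici 1) t) (hu : Rep ω F u) (ψ : 𝓢(Sp n, ℂ)) :
    HasDerivWithinAt (fun τ => ∫ x, w τ x * ψ x) (∫ x, u x * ψ x) (Set.Ici 1) t := by
  obtain ⟨χ, rfl⟩ := uF_surjective ψ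
  rw [hu.integral_uF (hψ χ)]
  have h1 := ((pairL _ (hψ χ)).restrictScalars ℝ).hasFDerivAt.comp_hasDerivWithinAt t hW
  refine h1.congr (fun τ hτ => ?_) ?_
  · exact (hw τ hτ).integral_uF (hψ χ)
  · exact (hw t ht).integral_uF (hψ χ)

lemma vanishesAtInfinity (hψ : ∀ ψ : 𝓢(Sp n, ℂ), MemLp (fun ξ => (((ω ξ)⁻¹ : ℝ) : ℂ) * ψ ξ) 2)
    (hw : ∀ t, 1 ≤ t → Rep ω (W t) (w t)) (hW : Tendsto W atTop (𝓝 0)) :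
    VanishesAtInfinity w := by
  intro ψ
  obtain ⟨χ, rfl⟩ := uF_surjective ψ
  have h1 := ((pairL _ (hψ χ)).continuous.tendsto 0).comp hW
  rw [map_zero] at h1
  refine h1.congr' ?_
  filter_upwards [eventually_ge_atTop 1] with t ht
  exact ((hw t ht).integral_uF (hψ χ)).symm

end Rep

/-! ### The weighted norm -/

lemma eLpNorm_two_eq_enorm {f : Sp n → ℂ} {F : L2 n} (h : f =ᵐ[volume] F) :
    eLpNorm f 2 volume = ‖F‖ₑ := by
  rw [eLpNorm_congr_ae h, Lp.enorm_def]

/-- All competitors in the infimum agree almost everywhere, so they give one value; the weight is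
invertible off the origin. -/
lemma Rep.weightedNorm_eq (hn : 0 < n) {ρ ν a b : ℝ} {F : L2 n} {u : Sp n → ℂ}
    (h : Rep (wt ρ ν a b) F u) : weightedNorm ρ ν a b u = ‖F‖ₑ := by
  have key : ∀ v, HasFourier u v → eLpNorm (fun ξ =>
      (((if 1 < ‖ξ‖ then ‖ξ‖ ^ a else ‖ξ‖ ^ b) * gevreyWeight ρ ν ξ : ℝ) : ℂ) * v ξ) 2 volume =
      ‖F‖ₑ := by
    intro v hv
    refine eLpNorm_two_eq_enorm ?_
    filter_upwards [hv.unique_right h, ae_ne_zero hn] with ξ h1 h2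
    have h3 := (wt_pos ρ ν a b h2).ne'
    change ((wt ρ ν a b ξ : ℝ) : ℂ) * v ξ = F ξ
    rw [h1, ← mul_assoc, ← Complex.ofReal_mul, mul_inv_cancel₀ h3, Complex.ofReal_one, one_mul]
  refine le_antisymm ?_ (le_iInf₂ fun v hv => (key v hv).ge)
  exact iInf₂_le_of_le (fun ξ => (((wt ρ ν a b ξ)⁻¹ : ℝ) : ℂ) * F ξ) h (key _ h).le

lemma exists_rep_of_weightedNorm_lt_top (hn : 0 < n) {ρ ν a b : ℝ} {u : Sp n → ℂ}
    (h : weightedNorm ρ ν a b u < ⊤) : ∃ F : L2 n, Rep (wt ρ ν a b) F u := by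
  simp only [weightedNorm, iInf_lt_iff] at h
  obtain ⟨v, hv, hlt⟩ := h
  have hm : MemLp (fun ξ => ((wt ρ ν a b ξ : ℝ) : ℂ) * v ξ) 2 volume :=
    ⟨((Complex.measurable_ofReal.comp (measurable_wt ρ ν a b)).aestronglyMeasurable).mul
      hv.2.1.aestronglyMeasurable, hlt⟩
  refine ⟨hm.toLp, hv.congr (ae_eq_refl _) ?_⟩
  filter_upwards [hm.coeFn_toLp, ae_ne_zero hn] with ξ h1 h2
  have h3 := (wt_pos ρ ν a b h2).ne'
  rw [h1, ← mul_assoc, ← Complex.ofReal_mul, inv_mul_cancel₀ h3, Complex.ofReal_one, one_mul]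

/-! ### Admissibility of Fourier transforms -/

lemma memLp_hi_lo (hn : 0 < n) {k l : ℝ} (hk : (n : ℝ) / 2 < k) (hl : l < (n : ℝ) / 2) :
    MemLp (fun ξ : Sp n => ((hi ξ ^ (-k) * lo ξ ^ (-l) : ℝ) : ℂ)) 2 volume := by
  refine ⟨(Complex.measurable_ofReal.comp ((measurable_hi.pow_const _).mul
    (measurable_lo.pow_const _))).aestronglyMeasurable, ?_⟩
  rw [← nrm_enorm_eq]
  refine (nrm_mono fun ξ => ?_).trans_lt (nrm_maj_lt_top hn hk hl)
  rw [maj]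
  split_ifs with h
  · exact le_top
  · have p1 := hi_pos ξ
    have p2 := lo_pos h
    rw [enorm_ofReal, Real.enorm_eq_ofReal_abs, abs_of_nonneg (by positivity)]

/-- On the unit ball the bound is a product of two square integrable functions, hence integrable;
outside it `lo` is 1 and the bound is in L². This is the reason for working with sums of the two
classes. -/
lemma adm_of_norm_le (hn : 0 < n) {l : ℝ} (hl : l < (n : ℝ) / 2) {F : L2 n} {v : Sp n → ℂ}
    (hv : Measurable v) (h : ∀ ξ, ξ ≠ 0 → ‖v ξ‖ ≤ lo ξ ^ (-l) * ‖F ξ‖) : Adm v := by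
  have hB : MeasurableSet (Metric.closedBall (0 : Sp n) 1) := measurableSet_closedBall
  refine ⟨(Metric.closedBall 0 1).indicator v, (Metric.closedBall 0 1)ᶜ.indicator v,
    hv.indicator hB, hv.indicator hB.compl, ?_, ?_,
    Filter.Eventually.of_forall fun ξ => (Set.indicator_self_add_compl_apply _ v ξ).symm⟩
  · have hg := (memLp_hi_lo (n := n) hn (k := n / 2 + 1) (l := l) (by linarith) hl).integrable_mul
      (Lp.memLp F)
    refine hg.mono (hv.indicator hB).aestronglyMeasurable ?_
    filter_upwards [ae_ne_zero hn] with ξ hξ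
    by_cases hm : ξ ∈ Metric.closedBall (0 : Sp n) 1
    · have hle : ‖ξ‖ ≤ 1 := by simpa using hm
      have e : hi ξ = 1 := max_eq_right hle
      have p := lo_pos hξ
      rw [Set.indicator_of_mem hm, Pi.mul_apply, norm_mul, e, Real.one_rpow, one_mul,
        Complex.norm_real, Real.norm_of_nonneg (by positivity)]
      exact h ξ hξ
    · rw [Set.indicator_of_notMem hm, norm_zero]
      positivity
  · refine (Lp.memLp F).mono (hv.indicator hB.compl).aestronglyMeasurable ?_
    refine Filter.Eventually.of_forall fun ξ => ?_
    by_cases hm : ξ ∈ Metric.closedBall (0 : Sp n) 1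
    · rw [Set.indicator_of_notMem (by simpa using hm), norm_zero]
      positivity
    · have hlt : 1 < ‖ξ‖ := by simpa using hm
      have hξ : ξ ≠ 0 := by rintro rfl; simp at hlt; linarith
      rw [Set.indicator_of_mem (by simpa using hm)]
      refine (h ξ hξ).trans (le_of_eq ?_)
      rw [show lo ξ = 1 from min_eq_right hlt.le, Real.one_rpow, one_mul]

lemma norm_pow_mul_wt_inv_le {ρ ν a b : ℝ} (hρ : 0 ≤ ρ) {j : ℕ} (hj : j ≤ a) {ξ : Sp n}
    (hξ : ξ ≠ 0) : ‖ξ‖ ^ j * (wt ρ ν a b ξ)⁻¹ ≤ lo ξ ^ (-b) := by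
  have p1 := hi_pos ξ
  have p2 := lo_pos hξ
  have p3 := one_le_gevreyWeight hρ ν ξ
  have p4 := norm_le_hi ξ
  have p5 := wt_pos ρ ν a b hξ
  rw [← div_eq_mul_inv, div_le_iff₀ p5, wt_eq]
  calc ‖ξ‖ ^ j ≤ hi ξ ^ j := pow_le_pow_left₀ (norm_nonneg _) p4 j
    _ = hi ξ ^ (j : ℝ) := (Real.rpow_natCast _ _).symm
    _ ≤ hi ξ ^ a := Real.rpow_le_rpow_of_exponent_le (one_le_hi ξ) hj
    _ = hi ξ ^ a * (lo ξ ^ b * lo ξ ^ (-b)) * 1 := by rw [lo_mul_lo_neg b hξ]; ring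
    _ ≤ hi ξ ^ a * (lo ξ ^ b * lo ξ ^ (-b)) * gevreyWeight ρ ν ξ := by gcongr
    _ = _ := by ring

lemma adm_mul_rep (hn : 0 < n) {ρ ν a b : ℝ} (hρ : 0 ≤ ρ) (hb : b < (n : ℝ) / 2) {j : ℕ}
    (hj : j ≤ a) {σ : Sp n → ℂ} (hσ : Measurable σ) (hσj : ∀ ξ, ‖σ ξ‖ ≤ ‖ξ‖ ^ j) (F : L2 n) :
    Adm (fun ξ => σ ξ * ((((wt ρ ν a b ξ)⁻¹ : ℝ) : ℂ) * F ξ)) := by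
  refine adm_of_norm_le hn hb (F := F) (hσ.mul ((Complex.measurable_ofReal.comp
    (measurable_wt ρ ν a b).inv).mul (measurable_coe F))) fun ξ hξ => ?_
  have p := wt_pos ρ ν a b hξ
  rw [norm_mul, norm_mul, ← mul_assoc, Complex.norm_real, Real.norm_of_nonneg (by positivity)]
  gcongr
  exact (mul_le_mul_of_nonneg_right (hσj ξ) (by positivity)).trans (norm_pow_mul_wt_inv_le hρ hj hξ)

lemma adm_rep (hn : 0 < n) {ρ ν a b : ℝ} (hρ : 0 ≤ ρ) (hb : b < (n : ℝ) / 2)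
    (ha : 0 ≤ a) (F : L2 n) : Adm (fun ξ => (((wt ρ ν a b ξ)⁻¹ : ℝ) : ℂ) * F ξ) := by
  have := adm_mul_rep (n := n) (ν := ν) hn hρ hb (j := 0) (by simpa using ha) (σ := fun _ => 1)
    measurable_const (by simp) F
  simpa using this

lemma memLp_wt_inv_mul_schwartz (hn : 0 < n) {ρ ν a b : ℝ} (hρ : 0 ≤ ρ) (hb : b < (n : ℝ) / 2)
    (hb0 : 0 ≤ b) (ha : 0 ≤ a) (ψ : 𝓢(Sp n, ℂ)) :
    MemLp (fun ξ => (((wt ρ ν a b ξ)⁻¹ : ℝ) : ℂ) * ψ ξ) 2 volume := by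
  set M := ‖ψ.toBoundedContinuousFunction‖
  have hM : ∀ ξ, ‖ψ ξ‖ ≤ M := ψ.toBoundedContinuousFunction.norm_coe_le_norm
  have h1 := ((memLp_hi_lo (n := n) hn (k := n / 2 + 1) (l := b) (by linarith) hb).norm.const_mul
    M).add (ψ.memLp 2 volume).norm
  refine h1.mono ((Complex.measurable_ofReal.comp (measurable_wt ρ ν a b).inv).mul
    ψ.continuous.measurable).aestronglyMeasurable ?_
  filter_upwards [ae_ne_zero hn] with ξ hξ
  have p := wt_pos ρ ν a b hξ
  have q := lo_pos hξ
  have q1 := hi_pos ξ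
  have h2 := norm_pow_mul_wt_inv_le (ν := ν) (b := b) hρ (j := 0) (by simpa using ha) hξ
  rw [pow_zero, one_mul] at h2
  have hM0 : 0 ≤ M := norm_nonneg _
  simp only [Pi.add_apply]
  rw [norm_mul, Complex.norm_real, Complex.norm_real, Real.norm_of_nonneg (by positivity),
    Real.norm_of_nonneg (by positivity), Real.norm_of_nonneg (by positivity)]
  rcases le_total ‖ξ‖ 1 with h | h
  · rw [show hi ξ = 1 from max_eq_right h, Real.one_rpow, one_mul]
    calc (wt ρ ν a b ξ)⁻¹ * ‖ψ ξ‖ ≤ lo ξ ^ (-b) * M := by gcongr; exact hM ξ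
      _ ≤ _ := by rw [mul_comm]; exact le_add_of_nonneg_right (norm_nonneg _)
  · rw [show lo ξ = 1 from min_eq_right h, Real.one_rpow] at h2
    calc (wt ρ ν a b ξ)⁻¹ * ‖ψ ξ‖ ≤ 1 * ‖ψ ξ‖ := by gcongr
      _ ≤ _ := by rw [one_mul]; exact le_add_of_nonneg_left (by positivity)

end HartreeAsymptotics

end

noncomputable section

open MeasureTheory Filter Topology
open scoped ENNReal SchwartzMap FourierTransform NNReal

namespace HartreeAsymptotics

variable {n : ℕ}

/-! ### Fourier transforms of the terms of the system -/

lemma inv_mul_convFun_ker {ω ω₁ ω₂ : Sp n → ℝ} {σ : Sp n → Sp n → ℝ} (F G : Sp n → ℂ) {ξ : Sp n}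
    (h : ω ξ ≠ 0) : (((ω ξ)⁻¹ : ℝ) : ℂ) * convFun (ker ω ω₁ ω₂ σ) F G ξ =
      ∫ η, (σ η (ξ - η) : ℂ) * ((((ω₁ η)⁻¹ : ℝ) : ℂ) * F η *
        ((((ω₂ (ξ - η))⁻¹ : ℝ) : ℂ) * G (ξ - η))) := by
  rw [convFun, ← integral_const_mul]
  refine integral_congr_ae (ae_of_all _ fun η => ?_)
  have h' : (ω ξ : ℂ) ≠ 0 := by exact_mod_cast h
  simp only [ker, add_sub_cancel]
  push_cast
  field_simp

lemma inner_eq_sum (η ζ : Sp n) : inner ℝ η ζ = ∑ i, η i * ζ i := by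
  simp [PiLp.inner_apply, mul_comm]

lemma norm_sq_eq_sum (η : Sp n) : ‖η‖ ^ 2 = ∑ i, η i * η i := by
  rw [← real_inner_self_eq_norm_sq, inner_eq_sum]

lemma sum_I_mul (η ζ : Sp n) (a b : ℂ) :
    ∑ i, (Complex.I * (η i : ℂ) * a) * (Complex.I * (ζ i : ℂ) * b) =
      -((inner ℝ η ζ : ℝ) : ℂ) * (a * b) := by
  rw [inner_eq_sum, Complex.ofReal_sum, ← Finset.sum_neg_distrib, Finset.sum_mul]
  refine Finset.sum_congr rfl fun i _ => ?_
  push_cast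
  linear_combination ((η i : ℂ) * a * (ζ i : ℂ) * b) * Complex.I_mul_I

lemma sum_I_mul_I (η : Sp n) (a b : ℂ) :
    ∑ i, (Complex.I * (η i : ℂ) * (Complex.I * (η i : ℂ) * a)) * b =
      -((‖η‖ ^ 2 : ℝ) : ℂ) * (a * b) := by
  rw [norm_sq_eq_sum, Complex.ofReal_sum, ← Finset.sum_neg_distrib, Finset.sum_mul]
  refine Finset.sum_congr rfl fun i _ => ?_
  push_cast
  linear_combination ((η i : ℂ) * a * (η i : ℂ) * b) * Complex.I_mul_I

/-- The Fourier transform of `∇φ·∇χ`. -/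
lemma exists_gradDot_hasFourier {u u' v v' : Sp n → ℂ} (hu : HasFourier u v)
    (hu' : HasFourier u' v') (h1 : ∀ i, Adm fun ξ : Sp n => Complex.I * (ξ i : ℂ) * v ξ)
    (h1' : ∀ i, Adm fun ξ : Sp n => Complex.I * (ξ i : ℂ) * v' ξ) :
    ∃ s r : Fin n → Sp n → ℂ, (∀ i, HasPartial i u (s i)) ∧ (∀ i, HasPartial i u' (r i)) ∧
      HasFourier (fun x => ∑ i, s i x * r i x)
        (fun ξ => ∫ η, (symD η (ξ - η) : ℂ) * (v η * v' (ξ - η))) := by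
  choose s hs using fun i => (h1 i).exists_hasFourier
  choose r hr using fun i => (h1' i).exists_hasFourier
  refine ⟨s, r, fun i => hu.hasPartial (hs i), fun i => hu'.hasPartial (hr i), ?_⟩
  have hp := fun i => HasFourier.mul (h1 i) (h1' i) (hs i) (hr i)
  refine (HasFourier.sum Finset.univ fun i _ => (hp i).2).congr (ae_eq_refl _) ?_
  filter_upwards [ae_all_iff.2 fun i => (hp i).1] with ξ hξ
  simp only [conv]
  rw [← Finset.mul_sum, ← integral_finsetSum _ fun i _ => hξ i, ← integral_const_mul]
  refine integral_congr_ae (ae_of_all _ fun η => ?_)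
  simp only
  rw [sum_I_mul, symD]
  push_cast
  ring

/-- The Fourier transform of `(2 ∇φ·∇ + Δφ) w`. -/
lemma exists_transport_hasFourier {u u' v v' : Sp n → ℂ} (hu : HasFourier u v)
    (hu' : HasFourier u' v') (h0' : Adm v')
    (h1 : ∀ i, Adm fun ξ : Sp n => Complex.I * (ξ i : ℂ) * v ξ)
    (h2 : ∀ i, Adm fun ξ : Sp n => Complex.I * (ξ i : ℂ) * (Complex.I * (ξ i : ℂ) * v ξ))
    (h1' : ∀ i, Adm fun ξ : Sp n => Complex.I * (ξ i : ℂ) * v' ξ) :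
    ∃ s d r : Fin n → Sp n → ℂ, (∀ i, HasPartial i u (s i)) ∧ (∀ i, HasPartial i (s i) (d i)) ∧
      (∀ i, HasPartial i u' (r i)) ∧
      HasFourier (fun x => 2 * ∑ i, s i x * r i x + (∑ i, d i x) * u' x)
        (fun ξ => ∫ η, (symT η (ξ - η) : ℂ) * (v η * v' (ξ - η))) := by
  choose s hs using fun i => (h1 i).exists_hasFourier
  choose d hd using fun i => (h2 i).exists_hasFourier
  choose r hr using fun i => (h1' i).exists_hasFourier
  refine ⟨s, d, r, fun i => hu.hasPartial (hs i), fun i => (hs i).hasPartial (hd i),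
    fun i => hu'.hasPartial (hr i), ?_⟩
  have hp := fun i => HasFourier.mul (h1 i) (h1' i) (hs i) (hr i)
  have hq := fun i => HasFourier.mul (h2 i) h0' (hd i) hu'
  have hsum := ((HasFourier.sum Finset.univ fun i _ => (hp i).2).const_mul 2).add
    (HasFourier.sum Finset.univ fun i _ => (hq i).2)
  refine hsum.congr (ae_of_all _ fun x => ?_) ?_
  · simp only [Pi.add_apply, Finset.sum_mul]
  filter_upwards [ae_all_iff.2 fun i => (hp i).1, ae_all_iff.2 fun i => (hq i).1] with ξ hξ hξ'
  simp only [conv, Pi.add_apply]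
  rw [← Finset.mul_sum, ← integral_finsetSum _ fun i _ => hξ i, ← Finset.mul_sum,
    ← integral_finsetSum _ fun i _ => hξ' i, ← integral_const_mul, ← integral_const_mul,
    ← integral_const_mul, ← integral_add]
  · refine integral_congr_ae (ae_of_all _ fun η => ?_)
    simp only
    rw [sum_I_mul, sum_I_mul_I, symT]
    push_cast
    ring
  · exact ((integrable_finsetSum _ fun i _ => hξ i).const_mul _).const_mul _
  · exact (integrable_finsetSum _ fun i _ => hξ' i).const_mul _

lemma measurable_I_mul_coord (i : Fin n) : Measurable fun ξ : Sp n => Complex.I * (ξ i : ℂ) := by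
  refine Continuous.measurable ?_
  fun_prop

lemma norm_I_mul_coord_le (i : Fin n) (ξ : Sp n) : ‖Complex.I * (ξ i : ℂ)‖ ≤ ‖ξ‖ := by
  rw [norm_mul, Complex.norm_I, one_mul, Complex.norm_real]
  exact PiLp.norm_apply_le ξ i

namespace Setting

variable (s : Setting n)

lemma adm_kw {m : ℕ} (hm : m ≤ s.p + 1) (W : L2 n) :
    Adm fun ξ => (((s.kw m ξ)⁻¹ : ℝ) : ℂ) * W ξ :=
  adm_rep s.hn s.hρ (half_pos (Nat.cast_pos.2 s.hn)) (s.kExp_nonneg hm) W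

/-- One derivative of an amplitude is absorbed because k_m ≥ 1 for m ≤ p; likewise ℓ_m ≥ 0 leaves
room for two derivatives of a phase. -/
lemma adm_coord_kw {m : ℕ} (hm : m ≤ s.p) (W : L2 n) (i : Fin n) :
    Adm fun ξ : Sp n => Complex.I * (ξ i : ℂ) * ((((s.kw m ξ)⁻¹ : ℝ) : ℂ) * W ξ) :=
  adm_mul_rep s.hn s.hρ (half_pos (Nat.cast_pos.2 s.hn)) (j := 1)
    (by simpa using s.one_le_kExp hm) (measurable_I_mul_coord i)
    (fun ξ => by simpa using norm_I_mul_coord_le i ξ) W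

lemma lExp_add_two_nonneg {m : ℕ} (hm : m ≤ s.p + 1) : 0 ≤ lExp n s.μ s.k m + 2 := by
  rw [lExp_add_two]
  linarith [s.kExp_nonneg hm, s.hμn]

lemma adm_yw {m : ℕ} (hm : m ≤ s.p + 1) (Φ : L2 n) :
    Adm fun ξ => (((s.yw m ξ)⁻¹ : ℝ) : ℂ) * Φ ξ :=
  adm_rep s.hn s.hρ s.hl_lt (s.lExp_add_two_nonneg hm) Φ

lemma adm_coord_yw {m : ℕ} (hm : m ≤ s.p) (Φ : L2 n) (i : Fin n) :
    Adm fun ξ : Sp n => Complex.I * (ξ i : ℂ) * ((((s.yw m ξ)⁻¹ : ℝ) : ℂ) * Φ ξ) :=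
  adm_mul_rep s.hn s.hρ s.hl_lt (j := 1)
    (by have := s.lExp_nonneg hm; push_cast; linarith) (measurable_I_mul_coord i)
    (fun ξ => by simpa using norm_I_mul_coord_le i ξ) Φ

lemma adm_coord_coord_yw {m : ℕ} (hm : m ≤ s.p) (Φ : L2 n) (i : Fin n) :
    Adm fun ξ : Sp n => Complex.I * (ξ i : ℂ) *
      (Complex.I * (ξ i : ℂ) * ((((s.yw m ξ)⁻¹ : ℝ) : ℂ) * Φ ξ)) := by
  have h := adm_mul_rep s.hn (ν := s.ν) s.hρ s.hl_lt (j := 2) (a := lExp n s.μ s.k m + 2)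
    (by have := s.lExp_nonneg hm; push_cast; linarith)
    ((measurable_I_mul_coord i).mul (measurable_I_mul_coord i))
    (fun ξ => by
      simp only [Pi.mul_apply]
      rw [norm_mul, sq]
      exact mul_le_mul (norm_I_mul_coord_le i ξ) (norm_I_mul_coord_le i ξ) (norm_nonneg _)
        (norm_nonneg _)) Φ
  simpa only [Pi.mul_apply, mul_assoc] using! h

/-- The transport term in weighted Fourier variables. -/
theorem exists_isTransportTerm {j q : ℕ} (h : j + q ≤ s.p) {Φ W : L2 n} {φ : Sp n → ℝ}
    {w : Sp n → ℂ} (hφ : Rep (s.yw j) Φ (toC φ)) (hw : Rep (s.kw q) W w) :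
    ∃ G, IsTransportTerm φ w G ∧ Rep (s.kw (j + q + 1)) (s.T j q Φ W) G := by
  obtain ⟨σ, d, r, h1, h2, h3, h4⟩ := exists_transport_hasFourier hφ hw
    (s.adm_kw (by omega) W) (s.adm_coord_yw (by omega) Φ) (s.adm_coord_coord_yw (by omega) Φ)
    (s.adm_coord_kw (by omega) W)
  refine ⟨_, ⟨σ, d, r, h1, h2, h3, rfl⟩, h4.congr (ae_eq_refl _) ?_⟩
  simp only [T, dif_pos h]
  filter_upwards [(s.kerBound_T h).op_ae Φ W] with ξ hξ
  rw [hξ, inv_mul_convFun_ker _ _ (s.kw_pos _ ξ).ne']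

/-- The quadratic phase term in weighted Fourier variables. -/
theorem exists_isGradDot {i j : ℕ} (h : i + j ≤ s.p) {Φ Ψ : L2 n} {φ χ : Sp n → ℝ}
    (hφ : Rep (s.yw i) Φ (toC φ)) (hχ : Rep (s.yw j) Ψ (toC χ)) :
    ∃ G, IsGradDot φ χ G ∧ Rep (s.yw (i + j + 1)) (s.D i j Φ Ψ) G := by
  obtain ⟨σ, r, h1, h2, h4⟩ := exists_gradDot_hasFourier hφ hχ
    (s.adm_coord_yw (by omega) Φ) (s.adm_coord_yw (by omega) Ψ)
  refine ⟨_, ⟨σ, r, h1, h2, rfl⟩, h4.congr (ae_eq_refl _) ?_⟩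
  simp only [D, dif_pos h]
  filter_upwards [(s.kerBound_D h).op_ae Φ Ψ, ae_ne_zero s.hn] with ξ hξ h0
  rw [hξ, inv_mul_convFun_ker _ _ (s.yw_pos _ h0).ne']

lemma rep_conj {m : ℕ} {W : L2 n} {w : Sp n → ℂ} (hw : Rep (s.kw m) W w) :
    Rep (s.kw m) (reflConjL W) (fun x => starRingEnd ℂ (w x)) := by
  refine (HasFourier.conj hw).congr (ae_eq_refl _) ?_
  filter_upwards [reflConjL_ae W] with ξ hξ
  simp only [reflConj, map_mul, Complex.conj_ofReal, s.kw_neg]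
  rw [hξ, reflConj]

/-- The product in weighted Fourier variables. -/
theorem hasFourier_mul_conj {i j : ℕ} (h : i + j ≤ s.p + 1) {W W' : L2 n} {w w' : Sp n → ℂ}
    (hw : Rep (s.kw i) W w) (hw' : Rep (s.kw j) W' w') :
    HasFourier (fun x => w x * starRingEnd ℂ (w' x)) (fun ξ => c₀ n *
      ((((s.kw (i + j) ξ)⁻¹ : ℝ) : ℂ) * s.P i j W (reflConjL W') ξ)) := by
  have h1 := (HasFourier.mul (s.adm_kw (by omega) W) (s.adm_kw (by omega) (reflConjL W')) hw
    (s.rep_conj hw')).2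
  refine h1.congr (ae_eq_refl _) ?_
  simp only [P, dif_pos h]
  filter_upwards [(s.kerBound_P h).op_ae W (reflConjL W')] with ξ hξ
  rw [hξ, inv_mul_convFun_ker _ _ (s.kw_pos _ ξ).ne', conv]
  simp [symP]

/-- The source term of the phase equation in weighted Fourier variables. -/
theorem exists_isG0 {i j : ℕ} (h : i + j ≤ s.p + 1) {W W' : L2 n} {w w' : Sp n → ℂ}
    (hw : Rep (s.kw i) W w) (hw' : Rep (s.kw j) W' w') :
    ∃ g, IsG0 s.κ s.μ w w' g ∧ Rep (s.yw (i + j)) (s.G i j W W') (toC g) := by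
  -- the operator with `κ = 1` gives the existence of `|∇|^(μ-n) (w w̄')`
  let s₁ : Setting n := { s with κ := 1 }
  have hP : ∀ x y, s₁.P i j x y = s.P i j x y := by
    intro x y
    simp only [P, dif_pos h, dif_pos (show i + j ≤ s₁.p + 1 from h)]
    refine Lp.ext ?_
    filter_upwards [(s.kerBound_P h).op_ae x y, (s₁.kerBound_P h).op_ae x y] with ξ h1 h2
    rw [h1, h2]
    rfl
  have hΓ₁ := s₁.Γ_ae_eq h W (reflConjL W')
  rw [hP] at hΓ₁
  obtain ⟨v, hv⟩ := (s.adm_yw (m := i + j) h (s₁.Γ i j W (reflConjL W'))).exists_hasFourier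
  have hprod := s.hasFourier_mul_conj h hw hw'
  have e1 : (fun ξ => (((s.yw (i + j) ξ)⁻¹ : ℝ) : ℂ) * (s₁.Γ i j W (reflConjL W')) ξ) =ᵐ[volume]
      fun ξ => ((‖ξ‖ ^ (s.μ - n) : ℝ) : ℂ) * (c₀ n *
      ((((s.kw (i + j) ξ)⁻¹ : ℝ) : ℂ) * s.P i j W (reflConjL W') ξ)) := by
    filter_upwards [hΓ₁, ae_ne_zero s.hn] with ξ h1 h0
    have h2 := (s.yw_pos (i + j) h0).ne'
    have h3 : (s.yw (i + j) ξ : ℂ) ≠ 0 := by exact_mod_cast h2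
    rw [h1]
    change (((s.yw (i + j) ξ)⁻¹ : ℝ) : ℂ) * (((s.yw (i + j) ξ * (c₀ n * 1 * ‖ξ‖ ^ (s.μ - n)) *
      (s.kw (i + j) ξ)⁻¹ : ℝ) : ℂ) * s.P i j W (reflConjL W') ξ) = _
    push_cast
    field_simp
  refine ⟨fun x => s.κ * (v x).re, ⟨v, ⟨_, hprod, hv.congr (ae_eq_refl _) e1⟩, rfl⟩, ?_⟩
  have e2 : (fun ξ => (s.κ : ℂ) * ((((s.yw (i + j) ξ)⁻¹ : ℝ) : ℂ) *
      (s₁.Γ i j W (reflConjL W')) ξ)) =ᵐ[volume]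
      fun ξ => (((s.yw (i + j) ξ)⁻¹ : ℝ) : ℂ) * s.Γ i j W (reflConjL W') ξ := by
    filter_upwards [hΓ₁, s.Γ_ae_eq h W (reflConjL W')] with ξ h1 h2
    rw [h1, h2]
    change (s.κ : ℂ) * ((((s.yw (i + j) ξ)⁻¹ : ℝ) : ℂ) * (((s.yw (i + j) ξ *
      (c₀ n * 1 * ‖ξ‖ ^ (s.μ - n)) * (s.kw (i + j) ξ)⁻¹ : ℝ) : ℂ) *
        s.P i j W (reflConjL W') ξ)) = _
    push_cast
    ring
  have hκ : Rep (s.yw (i + j)) (s.Γ i j W (reflConjL W')) (fun x => (s.κ : ℂ) * v x) :=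
    (hv.const_mul (s.κ : ℂ)).congr (ae_eq_refl _) e2
  have hκ' : Rep (s.yw (i + j)) (reflConjL (s.Γ i j W (reflConjL W')))
      (fun x => starRingEnd ℂ ((s.κ : ℂ) * v x)) := by
    refine (HasFourier.conj hκ).congr (ae_eq_refl _) ?_
    filter_upwards [reflConjL_ae (s.Γ i j W (reflConjL W'))] with ξ hξ
    simp only [reflConj, map_mul, Complex.conj_ofReal, s.yw_neg]
    rw [hξ, reflConj]
  refine ((hκ.add hκ').smul (1 / 2)).congr (ae_of_all _ fun x => ?_)
  simp only [Pi.add_apply, toC, map_mul, Complex.conj_ofReal]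
  rw [← mul_add, Complex.add_conj]
  push_cast
  ring

lemma memLp_kw_inv_mul {m : ℕ} (hm : m ≤ s.p + 1) (ψ : 𝓢(Sp n, ℂ)) :
    MemLp (fun ξ => (((s.kw m ξ)⁻¹ : ℝ) : ℂ) * ψ ξ) 2 volume :=
  memLp_wt_inv_mul_schwartz s.hn s.hρ (half_pos (Nat.cast_pos.2 s.hn)) le_rfl
    (s.kExp_nonneg hm) ψ

lemma memLp_yw_inv_mul {m : ℕ} (hm : m ≤ s.p + 1) (ψ : 𝓢(Sp n, ℂ)) :
    MemLp (fun ξ => (((s.yw m ξ)⁻¹ : ℝ) : ℂ) * ψ ξ) 2 volume :=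
  memLp_wt_inv_mul_schwartz s.hn s.hρ s.hl_lt s.hl (s.lExp_add_two_nonneg hm) ψ

end Setting

end HartreeAsymptotics

end

noncomputable section

open MeasureTheory Filter Topology
open scoped ENNReal SchwartzMap FourierTransform NNReal

namespace HartreeAsymptotics

variable {n : ℕ}

/-! ### Uniqueness -/

lemma eq_of_hasDerivWithinAt_zero {f : ℝ → ℂ}
    (hder : ∀ t, 1 ≤ t → HasDerivWithinAt f 0 (Set.Ici 1) t) {t : ℝ} (ht : 1 ≤ t) : f t = f 1 :=
  (convex_Ici (1 : ℝ)).is_const_of_fderivWithin_eq_zero (𝕜 := ℝ)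
    (fun x hx => (hder x hx).differentiableWithinAt)
    (fun x hx => by
      have := (hder x hx).hasFDerivWithinAt.fderivWithin ((uniqueDiffOn_Ici (1 : ℝ)) x hx)
      rw [this]; ext; simp) ht (Set.mem_Ici.2 le_rfl)

namespace HasTimeDeriv

variable {u u' G G' : ℝ → Sp n → ℂ} (hu : HasTimeDeriv u G) (hu' : HasTimeDeriv u' G')
  (hG : ∀ t, 1 ≤ t → G t =ᵐ[volume] G' t)

include hu hu' hG

/-- Equal right-hand sides make the tested difference constant in time; the condition at 1 or at
infinity then decides its value. -/
lemma integral_sub_eq (ψ : 𝓢(Sp n, ℂ)) {t : ℝ} (ht : 1 ≤ t) :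
    (∫ x, u t x * ψ x) - ∫ x, u' t x * ψ x = (∫ x, u 1 x * ψ x) - ∫ x, u' 1 x * ψ x := by
  refine eq_of_hasDerivWithinAt_zero
    (f := fun t => (∫ x, u t x * ψ x) - ∫ x, u' t x * ψ x) (fun s hs => ?_) ht
  refine (((hu s hs).2.2 ψ).sub ((hu' s hs).2.2 ψ)).congr_deriv (sub_eq_zero.2 ?_)
  exact integral_congr_ae ((hG s hs).mono fun x hx => by simp only [hx])

lemma ae_eq_of_one (h1 : u 1 =ᵐ[volume] u' 1) {t : ℝ} (ht : 1 ≤ t) : u t =ᵐ[volume] u' t := by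
  refine (hu t ht).1.ae_eq (hu' t ht).1 fun ψ => ?_
  rw [← sub_eq_zero, hu.integral_sub_eq hu' hG ψ ht, sub_eq_zero]
  exact integral_congr_ae (h1.mono fun x hx => by simp only [hx])

lemma ae_eq_of_vanishes (h : VanishesAtInfinity u) (h' : VanishesAtInfinity u') {t : ℝ}
    (ht : 1 ≤ t) : u t =ᵐ[volume] u' t := by
  refine (hu t ht).1.ae_eq (hu' t ht).1 fun ψ => ?_
  rw [← sub_eq_zero, hu.integral_sub_eq hu' hG ψ ht]
  have hlim := (h ψ).sub (h' ψ)
  rw [sub_zero] at hlim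
  refine tendsto_nhds_unique (tendsto_const_nhds.congr' ?_) hlim
  filter_upwards [eventually_ge_atTop 1] with s hs
  exact (hu.integral_sub_eq hu' hG ψ hs).symm

end HasTimeDeriv

lemma toC_congr {φ φ' : Sp n → ℝ} (h : φ =ᵐ[volume] φ') : toC φ =ᵐ[volume] toC φ' :=
  h.mono fun x hx => by simp only [toC, hx]

lemma ae_eq_of_toC {φ φ' : Sp n → ℝ} (h : toC φ =ᵐ[volume] toC φ') : φ =ᵐ[volume] φ' :=
  h.mono fun _ hx => Complex.ofReal_injective hx

lemma IsTransportTerm.ae_eq {φ φ' : Sp n → ℝ} {w w' G G' : Sp n → ℂ}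
    (h : IsTransportTerm φ w G) (h' : IsTransportTerm φ' w' G') (hφ : φ =ᵐ[volume] φ')
    (hw : w =ᵐ[volume] w') : G =ᵐ[volume] G' := by
  obtain ⟨s, d, v, h1, h2, h3, rfl⟩ := h
  obtain ⟨s', d', v', h1', h2', h3', rfl⟩ := h'
  have e1 := fun i => (h1 i).unique (h1' i) (toC_congr hφ)
  have e2 := fun i => (h2 i).unique (h2' i) (e1 i)
  have e3 := fun i => (h3 i).unique (h3' i) hw
  filter_upwards [ae_all_iff.2 e1, ae_all_iff.2 e2, ae_all_iff.2 e3, hw] with x a1 a2 a3 a4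
  simp only [a1, a2, a3, a4]

lemma IsGradDot.ae_eq {φ φ' χ χ' : Sp n → ℝ} {G G' : Sp n → ℂ}
    (h : IsGradDot φ χ G) (h' : IsGradDot φ' χ' G') (hφ : φ =ᵐ[volume] φ')
    (hχ : χ =ᵐ[volume] χ') : G =ᵐ[volume] G' := by
  obtain ⟨s, r, h1, h2, rfl⟩ := h
  obtain ⟨s', r', h1', h2', rfl⟩ := h'
  have e1 := fun i => (h1 i).unique (h1' i) (toC_congr hφ)
  have e2 := fun i => (h2 i).unique (h2' i) (toC_congr hχ)
  filter_upwards [ae_all_iff.2 e1, ae_all_iff.2 e2] with x a1 a2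
  simp only [a1, a2]

lemma IsG0.ae_eq {κ μ : ℝ} {w₁ w₁' w₂ w₂' : Sp n → ℂ} {g g' : Sp n → ℝ}
    (h : IsG0 κ μ w₁ w₂ g) (h' : IsG0 κ μ w₁' w₂' g') (h₁ : w₁ =ᵐ[volume] w₁')
    (h₂ : w₂ =ᵐ[volume] w₂') : g =ᵐ[volume] g' := by
  obtain ⟨v, ⟨f, hf, hv⟩, rfl⟩ := h
  obtain ⟨v', ⟨f', hf', hv'⟩, rfl⟩ := h'
  have e1 : f =ᵐ[volume] f' := by
    refine (hf.congr ?_ (ae_eq_refl _)).unique_right hf'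
    filter_upwards [h₁, h₂] with x a1 a2
    rw [a1, a2]
  have e2 : v =ᵐ[volume] v' := by
    refine (hv.congr (ae_eq_refl _) ?_).unique_left hv'
    filter_upwards [e1] with ξ a
    rw [a]
  filter_upwards [e2] with x a
  rw [a]

section Uniqueness

variable {κ μ γ : ℝ} {p : ℕ} {wPlus : Sp n → ℂ} {w w' : ℕ → ℝ → Sp n → ℂ}
  {φ φ' : ℕ → ℝ → Sp n → ℝ}

lemma AmplitudeEq.ae_eq {m : ℕ} (h : AmplitudeEq w φ m) (h' : AmplitudeEq w' φ' m)
    (hi : VanishesAtInfinity (w (m + 1))) (hi' : VanishesAtInfinity (w' (m + 1)))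
    (hw : ∀ i ≤ m, ∀ t, 1 ≤ t → w i t =ᵐ[volume] w' i t)
    (hφ : ∀ i ≤ m, ∀ t, 1 ≤ t → φ i t =ᵐ[volume] φ' i t) {t : ℝ} (ht : 1 ≤ t) :
    w (m + 1) t =ᵐ[volume] w' (m + 1) t := by
  obtain ⟨G, hG, hd⟩ := h
  obtain ⟨G', hG', hd'⟩ := h'
  refine hd.ae_eq_of_vanishes hd' (fun t ht => ?_) hi hi' ht
  have e : ∀ j ∈ Finset.range (m + 1), ∀ᵐ x, G j t x = G' j t x := fun j hj => by
    have := Finset.mem_range.1 hj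
    exact (hG j hj t ht).ae_eq (hG' j hj t ht) (hφ j (by omega) t ht) (hw _ (by omega) t ht)
  filter_upwards [(ae_ball_iff (Finset.countable_toSet _)).2 e] with x hx
  rw [Finset.sum_congr rfl fun j hj => hx j hj]

lemma PhaseEq.exists_hasTimeDeriv {m : ℕ} (h : PhaseEq κ μ γ w φ m) (h' : PhaseEq κ μ γ w' φ' m)
    (hw : ∀ i ≤ m, ∀ t, 1 ≤ t → w i t =ᵐ[volume] w' i t)
    (hφ : ∀ i < m, ∀ t, 1 ≤ t → φ i t =ᵐ[volume] φ' i t) :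
    ∃ R R' : ℝ → Sp n → ℂ, HasTimeDeriv (fun t => toC (φ m t)) R ∧
      HasTimeDeriv (fun t => toC (φ' m t)) R' ∧ ∀ t, 1 ≤ t → R t =ᵐ[volume] R' t := by
  obtain ⟨G, g, hG, hg, hd⟩ := h
  obtain ⟨G', g', hG', hg', hd'⟩ := h'
  refine ⟨_, _, hd, hd', fun t ht => ?_⟩
  have e1 : ∀ j ∈ Finset.range m, ∀ᵐ x, G j t x = G' j t x := fun j hj => by
    have := Finset.mem_range.1 hj
    exact (hG j hj t ht).ae_eq (hG' j hj t ht) (hφ j (by omega) t ht) (hφ _ (by omega) t ht)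
  have e2 : ∀ j ∈ Finset.range (m + 1), ∀ᵐ x, g j t x = g' j t x := fun j hj => by
    have := Finset.mem_range.1 hj
    exact (hg j hj t ht).ae_eq (hg' j hj t ht) (hw j (by omega) t ht) (hw _ (by omega) t ht)
  filter_upwards [(ae_ball_iff (Finset.countable_toSet _)).2 e1,
    (ae_ball_iff (Finset.countable_toSet _)).2 e2] with x hx hx'
  rw [Finset.sum_congr rfl fun j hj => hx j hj,
    Finset.sum_congr rfl fun j hj => congrArg Complex.ofReal (hx' j hj)]

/-- The derivatives and potentials in the equations are determined almost everywhere by the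
functions they come from. Hence agreement at lower indices makes the right-hand sides agree, and the
induction follows the triangular order, amplitude before phase. -/
lemma IsSolution.ae_eq (h : IsSolution κ μ γ p wPlus w φ) (h' : IsSolution κ μ γ p wPlus w' φ')
    (m : ℕ) : (m ≤ p + 1 → ∀ t, 1 ≤ t → w m t =ᵐ[volume] w' m t) ∧
      (m ≤ p → ∀ t, 1 ≤ t → φ m t =ᵐ[volume] φ' m t) := by
  induction m using Nat.strong_induction_on with
  | _ m ih =>
    have hw : m ≤ p + 1 → ∀ t, 1 ≤ t → w m t =ᵐ[volume] w' m t := by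
      intro hm t ht
      cases m with
      | zero => exact (h.zero t ht).trans (h'.zero t ht).symm
      | succ m =>
        exact (h.amplitude m (by omega)).ae_eq (h'.amplitude m (by omega))
          (h.amplitude_infty m (by omega)) (h'.amplitude_infty m (by omega))
          (fun i hi => (ih i (by omega)).1 (by omega)) (fun i hi => (ih i (by omega)).2 (by omega))
          ht
    refine ⟨hw, fun hm t ht => ?_⟩
    obtain ⟨R, R', h1, h2, h3⟩ := (h.phase m hm).exists_hasTimeDeriv (h'.phase m hm)
      (fun i hi => by
        rcases hi.lt_or_eq with hlt | rfl
        · exact (ih i hlt).1 (by omega)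
        · exact hw (by omega))
      (fun i hi => (ih i hi).2 (by omega))
    exact ae_eq_of_toC (h1.ae_eq_of_one h2 h3
      (toC_congr ((h.phase_one m hm).trans (h'.phase_one m hm).symm)) ht)

lemma IsTopPhase.ae_eq (h : IsSolution κ μ γ p wPlus w φ) (h' : IsSolution κ μ γ p wPlus w' φ')
    (ht : IsTopPhase κ μ γ p w φ) (ht' : IsTopPhase κ μ γ p w' φ') {t : ℝ} (h1 : 1 ≤ t) :
    φ (p + 1) t =ᵐ[volume] φ' (p + 1) t := by
  obtain ⟨R, R', hR, hR', e⟩ := ht.phase.exists_hasTimeDeriv ht'.phase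
    (fun i hi => (h.ae_eq h' i).1 hi) (fun i hi => (h.ae_eq h' i).2 (by omega))
  exact ae_eq_of_toC (hR.ae_eq_of_vanishes hR' e ht.phase_infty ht'.phase_infty h1)

end Uniqueness

/-! ### Existence -/

namespace Setting

open Evolution

variable (s : Setting n) {γ : ℝ}

/-- The phase of index `p + 1` in weighted Fourier variables. -/
def topPhase (γ : ℝ) (W Φ : ℕ → ℝ → L2 n) (t : ℝ) : L2 n :=
  -∫ τ in Set.Ioi t, phaseRHS s.D s.G γ W Φ (s.p + 1) τ

variable {W Φ : ℕ → ℝ → L2 n} {w : ℕ → ℝ → Sp n → ℂ} {φ : ℕ → ℝ → Sp n → ℝ}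

lemma amplitudeEq {m : ℕ} (hm : m ≤ s.p)
    (hw : ∀ i ≤ s.p + 1, ∀ t, 1 ≤ t → Rep (s.kw i) (W i t) (w i t))
    (hφ : ∀ i ≤ s.p, ∀ t, 1 ≤ t → Rep (s.yw i) (Φ i t) (toC (φ i t)))
    (hd : ∀ t, 1 ≤ t → HasDerivWithinAt (W (m + 1)) (ampRHS s.T W Φ m t) (Set.Ici 1) t) :
    AmplitudeEq w φ m := by
  -- The index and time conditions sit inside the existential so that a choice yields total
  -- functions; the value 0 outside the range is never used.
  have key : ∀ j t, ∃ g, j ≤ m → 1 ≤ t → IsTransportTerm (φ j t) (w (m - j) t) g ∧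
      Rep (s.kw (m + 1)) (s.T j (m - j) (Φ j t) (W (m - j) t)) g := by
    intro j t
    by_cases h : j ≤ m ∧ 1 ≤ t
    · obtain ⟨g, h1, h2⟩ := s.exists_isTransportTerm (j := j) (q := m - j) (by omega)
        (hφ j (by omega) t h.2) (hw (m - j) (by omega) t h.2)
      rw [show j + (m - j) + 1 = m + 1 by omega] at h2
      exact ⟨g, fun _ _ => ⟨h1, h2⟩⟩
    · exact ⟨0, fun h1 h2 => absurd ⟨h1, h2⟩ h⟩
  choose G hG using key
  refine ⟨G, fun j hj t ht => (hG j t (Nat.lt_succ_iff.1 (Finset.mem_range.1 hj)) ht).1,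
    fun t ht => ?_⟩
  have hR : Rep (s.kw (m + 1)) (ampRHS s.T W Φ m t) (fun x =>
      (((2 * t ^ 2)⁻¹ : ℝ) : ℂ) * ∑ j ∈ Finset.range (m + 1), G j t x) :=
    (Rep.sum _ fun j hj => (hG j t (Nat.lt_succ_iff.1 (Finset.mem_range.1 hj)) ht).2).smul _
  exact ⟨(hw (m + 1) (by omega) t ht).1, hR.1, Rep.hasDerivWithinAt
    (s.memLp_kw_inv_mul (by omega)) (hw (m + 1) (by omega)) ht (hd t ht) hR⟩

lemma phaseEq {m : ℕ} (hm : m ≤ s.p + 1)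
    (hw : ∀ i ≤ s.p + 1, ∀ t, 1 ≤ t → Rep (s.kw i) (W i t) (w i t))
    (hφ : ∀ i ≤ s.p, ∀ t, 1 ≤ t → Rep (s.yw i) (Φ i t) (toC (φ i t))) {Ψ : ℝ → L2 n}
    (hΨ : ∀ t, 1 ≤ t → Rep (s.yw m) (Ψ t) (toC (φ m t)))
    (hd : ∀ t, 1 ≤ t → HasDerivWithinAt Ψ (phaseRHS s.D s.G γ W Φ m t) (Set.Ici 1) t) :
    PhaseEq s.κ s.μ γ w φ m := by
  have key1 : ∀ j t, ∃ g, j < m → 1 ≤ t → IsGradDot (φ j t) (φ (m - 1 - j) t) g ∧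
      Rep (s.yw m) (s.D j (m - 1 - j) (Φ j t) (Φ (m - 1 - j) t)) g := by
    intro j t
    by_cases h : j < m ∧ 1 ≤ t
    · obtain ⟨g, h1, h2⟩ := s.exists_isGradDot (i := j) (j := m - 1 - j) (by omega)
        (hφ j (by omega) t h.2) (hφ (m - 1 - j) (by omega) t h.2)
      rw [show j + (m - 1 - j) + 1 = m by omega] at h2
      exact ⟨g, fun _ _ => ⟨h1, h2⟩⟩
    · exact ⟨0, fun h1 h2 => absurd ⟨h1, h2⟩ h⟩
  have key2 : ∀ j t, ∃ g, j ≤ m → 1 ≤ t → IsG0 s.κ s.μ (w j t) (w (m - j) t) g ∧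
      Rep (s.yw m) (s.G j (m - j) (W j t) (W (m - j) t)) (toC g) := by
    intro j t
    by_cases h : j ≤ m ∧ 1 ≤ t
    · obtain ⟨g, h1, h2⟩ := s.exists_isG0 (i := j) (j := m - j) (by omega)
        (hw j (by omega) t h.2) (hw (m - j) (by omega) t h.2)
      rw [show j + (m - j) = m by omega] at h2
      exact ⟨g, fun _ _ => ⟨h1, h2⟩⟩
    · exact ⟨0, fun h1 h2 => absurd ⟨h1, h2⟩ h⟩
  choose G hG using key1
  choose g hg using key2
  refine ⟨G, g, fun j hj t ht => (hG j t (Finset.mem_range.1 hj) ht).1,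
    fun j hj t ht => (hg j t (Nat.lt_succ_iff.1 (Finset.mem_range.1 hj)) ht).1, fun t ht => ?_⟩
  have hR : Rep (s.yw m) (phaseRHS s.D s.G γ W Φ m t) (fun x =>
      (((2 * t ^ 2)⁻¹ : ℝ) : ℂ) * ∑ j ∈ Finset.range m, G j t x +
        ((t ^ (-γ) : ℝ) : ℂ) * ∑ j ∈ Finset.range (m + 1), (g j t x : ℂ)) :=
    ((Rep.sum _ fun j hj => (hG j t (Finset.mem_range.1 hj) ht).2).smul _).add
      ((Rep.sum _ fun j hj => (hg j t (Nat.lt_succ_iff.1 (Finset.mem_range.1 hj)) ht).2).smul _)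
  exact ⟨(hΨ t ht).1, hR.1, Rep.hasDerivWithinAt (s.memLp_yw_inv_mul hm) hΨ ht (hd t ht) hR⟩

/-- Invariance under the reflected conjugation is Hermitian symmetry of the transform, as the weight
is even; it is what makes the phases real functions. -/
lemma exists_real_rep {m : ℕ} (hm : m ≤ s.p + 1) {F : L2 n} (hF : reflConjL F = F) :
    ∃ f : Sp n → ℝ, Rep (s.yw m) F (toC f) := by
  obtain ⟨u, hu⟩ := (s.adm_yw hm F).exists_hasFourier
  have h : Rep (s.yw m) F u := hu
  exact ⟨fun x => (u x).re, h.congr (h.eq_ofReal (s.yw_neg m) hF).symm⟩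

/-- The solution represented by the evolution in weighted Fourier variables. -/
structure IsRepresented (γ : ℝ) (W Φ : ℕ → ℝ → L2 n) (w : ℕ → ℝ → Sp n → ℂ)
    (φ : ℕ → ℝ → Sp n → ℝ) : Prop where
  amplitude : ∀ m ≤ s.p + 1, ∀ t, 1 ≤ t → Rep (s.kw m) (W m t) (w m t)
  phase : ∀ m ≤ s.p, ∀ t, 1 ≤ t → Rep (s.yw m) (Φ m t) (toC (φ m t))
  top : 1 < ((s.p : ℝ) + 2) * γ → ∀ t, 1 ≤ t →
    Rep (s.yw (s.p + 1)) (s.topPhase γ W Φ t) (toC (φ (s.p + 1) t))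

variable (hγ0 : 0 < γ) (hγ1 : γ ≤ 1) {F₀ : L2 n} (hW : Evolves s.T s.D s.G γ F₀ W Φ)
include hγ0 hγ1 hW

lemma hasDerivWithinAt_topPhase (hp : 1 < ((s.p : ℝ) + 2) * γ) {t : ℝ} (ht : 1 ≤ t) :
    HasDerivWithinAt (s.topPhase γ W Φ) (phaseRHS s.D s.G γ W Φ (s.p + 1) t) (Set.Ici 1) t := by
  have hi := hW.integrableOn_top hγ0 hγ1 s.norm_T_le s.norm_D_le s.norm_G_le hp
  refine ((hasDerivWithinAt_integral_Ici (hW.continuousOn_phaseRHS hγ0 hγ1 s.norm_T_le s.norm_D_le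
    s.norm_G_le (s.p + 1)) ht).const_add
    (-(∫ τ in Set.Ioi 1, phaseRHS s.D s.G γ W Φ (s.p + 1) τ))).congr (fun u hu => ?_) ?_
  · rw [topPhase, integral_Ioi_eq_sub hi hu]
  · rw [topPhase, integral_Ioi_eq_sub hi ht]

theorem exists_solution {wPlus : Sp n → ℂ} (h0 : Rep (s.kw 0) F₀ wPlus) :
    ∃ w φ, IsSolution s.κ s.μ γ s.p wPlus w φ ∧
      (1 < ((s.p : ℝ) + 2) * γ → IsTopPhase s.κ s.μ γ s.p w φ) ∧
      s.IsRepresented γ W Φ w φ := by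
  have kw : ∀ m t, ∃ u, m ≤ s.p + 1 → Rep (s.kw m) (W m t) u := by
    intro m t
    by_cases h : m ≤ s.p + 1
    · obtain ⟨u, hu⟩ := (s.adm_kw h (W m t)).exists_hasFourier
      exact ⟨u, fun _ => hu⟩
    · exact ⟨0, fun h' => absurd h' h⟩
  -- One sequence holds both kinds of phase. At index `p + 1` the function `Φ (p + 1)` of the
  -- evolution, which vanishes at 1, is replaced by `topPhase`, which vanishes at infinity.
  have kφ : ∀ m t, ∃ f : Sp n → ℝ, (m ≤ s.p → 1 ≤ t → Rep (s.yw m) (Φ m t) (toC f)) ∧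
      (m = s.p + 1 → 1 < ((s.p : ℝ) + 2) * γ → 1 ≤ t →
        Rep (s.yw m) (s.topPhase γ W Φ t) (toC f)) := by
    intro m t
    by_cases ht : 1 ≤ t
    · by_cases h : m ≤ s.p
      · obtain ⟨f, hf⟩ := s.exists_real_rep (m := m) (by omega)
          (hW.map_phase hγ0 hγ1 s.norm_T_le s.norm_D_le s.norm_G_le s.reflConjL_D s.reflConjL_G m ht)
        exact ⟨f, fun _ _ => hf, fun h' => by omega⟩
      · by_cases h' : m = s.p + 1 ∧ 1 < ((s.p : ℝ) + 2) * γ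
        · obtain ⟨f, hf⟩ := s.exists_real_rep (m := m) (by omega)
            (hW.map_top hγ0 hγ1 s.norm_T_le s.norm_D_le s.norm_G_le s.reflConjL_D s.reflConjL_G
              h'.2 ht)
          exact ⟨f, fun h1 => absurd h1 h, fun _ _ _ => hf⟩
        · exact ⟨0, fun h1 => absurd h1 h, fun h1 h2 => absurd ⟨h1, h2⟩ h'⟩
    · exact ⟨0, fun _ h => absurd h ht, fun _ _ h => absurd h ht⟩
  choose w hw using kw
  choose φ hφ using kφ
  have hw' : ∀ i ≤ s.p + 1, ∀ t, 1 ≤ t → Rep (s.kw i) (W i t) (w i t) := fun i hi t _ => hw i t hi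
  have hφ' : ∀ i ≤ s.p, ∀ t, 1 ≤ t → Rep (s.yw i) (Φ i t) (toC (φ i t)) := fun i hi t ht =>
    (hφ i t).1 hi ht
  have htop : 1 < ((s.p : ℝ) + 2) * γ → ∀ t, 1 ≤ t →
      Rep (s.yw (s.p + 1)) (s.topPhase γ W Φ t) (toC (φ (s.p + 1) t)) := fun h t ht =>
    (hφ (s.p + 1) t).2 rfl h ht
  refine ⟨w, φ, ⟨fun t ht => ?_, fun m hm => ?_, fun m hm => ?_, fun m hm => ?_, fun m hm => ?_⟩,
    fun hp => ⟨?_, ?_⟩, ⟨hw', hφ', htop⟩⟩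
  · have := hw' 0 (by omega) t ht
    rw [hW.zero] at this
    exact this.unique h0
  · exact s.amplitudeEq hm hw' hφ' fun t ht =>
      hW.hasDerivWithinAt_succ hγ0 hγ1 s.norm_T_le s.norm_D_le s.norm_G_le m ht
  · exact Rep.vanishesAtInfinity (s.memLp_kw_inv_mul (m := m + 1) (by omega)) (hw' _ (by omega))
      (hW.tendsto_succ hγ0 hγ1 s.norm_T_le s.norm_D_le s.norm_G_le m)
  · exact s.phaseEq (by omega) hw' hφ' (hφ' m hm) fun t ht =>
      hW.hasDerivWithinAt_phase hγ0 hγ1 s.norm_T_le s.norm_D_le s.norm_G_le m ht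
  · have h1 := hφ' m hm 1 le_rfl
    rw [hW.phase, intervalIntegral.integral_same] at h1
    refine ae_eq_of_toC ((h1.unique Rep.zero).trans (ae_of_all _ fun x => ?_))
    simp [toC]
  · exact s.phaseEq le_rfl hw' hφ' (htop hp) fun t ht => s.hasDerivWithinAt_topPhase hγ0 hγ1 hW hp ht
  · exact Rep.vanishesAtInfinity (s.memLp_yw_inv_mul (m := s.p + 1) le_rfl) (htop hp)
      (tendsto_neg_integral_Ioi
        (hW.integrableOn_top hγ0 hγ1 s.norm_T_le s.norm_D_le s.norm_G_le hp))

end Setting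

end HartreeAsymptotics

end

/-! ### Norms of solutions: estimates, gauge invariance, Lipschitz continuity, and the conclusion.
-/

noncomputable section

open MeasureTheory Filter Topology
open scoped ENNReal SchwartzMap FourierTransform NNReal

namespace HartreeAsymptotics

open Time Evolution

variable {n : ℕ}

/-- The bound for solutions whose initial datum has norm at most `R`. -/
def growth (C : ℝ≥0) (p : ℕ) (R : ℝ) : ℝ≥0 :=
  (coeff (2 * C) (max R 1).toNNReal (p + 1)).1 + (coeff (2 * C) (max R 1).toNNReal (p + 1)).2

lemma growth_mono (C : ℝ≥0) (p : ℕ) : Monotone (growth C p) := by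
  intro R R' h
  have := coeff_mono (2 * C) (p + 1) (Real.toNNReal_le_toNNReal (max_le_max_right 1 h))
  exact add_le_add this.1 this.2

lemma le_ofReal_growth_mul {C : ℝ≥0} {p : ℕ} {R B : ℝ} {c : ℝ≥0} {x y : ℝ≥0∞}
    (hx : x ≤ c * y) (hy : y = ENNReal.ofReal B) (hc : c ≤ growth C p R) :
    x ≤ ENNReal.ofReal (growth C p R * B) := by
  rw [ENNReal.ofReal_mul (by positivity), ENNReal.ofReal_coe_nnreal, ← hy]
  exact hx.trans (by gcongr)

lemma le_ofReal_growth_mul_mul {C : ℝ≥0} {p : ℕ} {R B : ℝ} {c : ℝ≥0} {x y d : ℝ≥0∞}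
    (hd : d ≠ ⊤) (hx : x ≤ d * (c * y)) (hy : y = ENNReal.ofReal B) (hc : c ≤ growth C p R) :
    x ≤ ENNReal.ofReal (growth C p R * d.toReal * B) := by
  rw [ENNReal.ofReal_mul (by positivity), ENNReal.ofReal_mul (by positivity),
    ENNReal.ofReal_coe_nnreal, ENNReal.ofReal_toReal hd, ← hy]
  refine hx.trans ?_
  rw [← mul_assoc, mul_comm d]
  gcongr

lemma enorm_sub_le_of_lipSize_le {E : Type*} [NormedAddCommGroup E] [NormedSpace ℝ E]
    {δ b : ℝ≥0∞} (h0 : δ ≠ 0) (ht : δ ≠ ⊤) {x x' : E} (h : lipSize δ x x' ≤ b) : ‖x - x'‖ₑ ≤ δ * b :=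
  (ENNReal.inv_mul_le_iff h0 ht).1 ((enorm_sub_le_lipSize δ x x').trans h)

/-- The scaled difference is at most 1 when δ bounds the distance; this explains the maximum with 1
in `growth`. -/
lemma lipSize_le_of_enorm_le {E : Type*} [NormedAddCommGroup E] [NormedSpace ℝ E] {x x' : E} {R : ℝ}
    (hx : ‖x‖ₑ ≤ ENNReal.ofReal R) (hx' : ‖x'‖ₑ ≤ ENNReal.ofReal R) {δ : ℝ≥0∞}
    (h : ‖x - x'‖ₑ ≤ δ) : lipSize δ x x' ≤ ((max R 1).toNNReal : ℝ≥0) := by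
  have hR : ENNReal.ofReal R ≤ ((max R 1).toNNReal : ℝ≥0) :=
    ENNReal.ofReal_le_ofReal (le_max_left _ _)
  have h1 : (1 : ℝ≥0∞) ≤ ((max R 1).toNNReal : ℝ≥0) := by
    rw [← ENNReal.ofReal_one]
    exact ENNReal.ofReal_le_ofReal (le_max_right _ _)
  refine max_le (max_le (hx.trans hR) (hx'.trans hR)) (le_trans ?_ h1)
  calc _ ≤ δ⁻¹ * δ := by gcongr
    _ ≤ 1 := ENNReal.inv_mul_le_one δ

lemma toC_sub (φ ψ : Sp n → ℝ) : toC (φ - ψ) = toC φ - toC ψ := by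
  ext x
  simp [toC]

namespace Setting

variable (s : Setting n) {γ : ℝ}

lemma kw_zero : s.kw 0 = wt s.ρ s.ν s.k 0 := by
  simp [kw, kExp]

lemma normK_eq {m : ℕ} {F : L2 n} {u : Sp n → ℂ} (h : Rep (s.kw m) F u) :
    normK s.ρ s.ν (kExp n s.μ s.k m) u = ‖F‖ₑ := Rep.weightedNorm_eq s.hn h

lemma normK_datum_eq {F : L2 n} {u : Sp n → ℂ} (h : Rep (s.kw 0) F u) :
    normK s.ρ s.ν s.k u = ‖F‖ₑ := Rep.weightedNorm_eq s.hn (s.kw_zero ▸ h)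

lemma normY_eq {m : ℕ} {F : L2 n} {f : Sp n → ℝ} (h : Rep (s.yw m) F (toC f)) :
    normY s.lLow s.ρ s.ν (lExp n s.μ s.k m) f = ‖F‖ₑ := Rep.weightedNorm_eq s.hn h

lemma normY_sub_eq {m : ℕ} {F G : L2 n} {f g : Sp n → ℝ} (h : Rep (s.yw m) F (toC f))
    (h' : Rep (s.yw m) G (toC g)) :
    normY s.lLow s.ρ s.ν (lExp n s.μ s.k m) (f - g) = ‖F - G‖ₑ :=
  s.normY_eq (by rw [toC_sub]; exact h.sub h')

lemma exists_rep_datum {wPlus : Sp n → ℂ} (h : normK s.ρ s.ν s.k wPlus < ⊤) :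
    ∃ F, Rep (s.kw 0) F wPlus := by
  rw [kw_zero]
  exact exists_rep_of_weightedNorm_lt_top s.hn h

lemma contK {m : ℕ} {F : ℝ → L2 n} {w : ℝ → Sp n → ℂ}
    (h : ∀ t, 1 ≤ t → Rep (s.kw m) (F t) (w t)) (hc : ContinuousOn F (Set.Ici 1)) :
    ContK s.ρ s.ν (kExp n s.μ s.k m) w := by
  refine fun t ht => ⟨by rw [s.normK_eq (h t ht)]; exact enorm_lt_top, ?_⟩
  have h1 : Tendsto (fun τ => ‖F τ - F t‖ₑ) (𝓝[Set.Ici 1] t) (𝓝 0) := by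
    simpa using ((hc t ht).sub_const (F t)).enorm
  refine h1.congr' (eventually_mem_nhdsWithin.mono fun τ hτ => ?_)
  exact (s.normK_eq ((h τ hτ).sub (h t ht))).symm

lemma contY {m : ℕ} {F : ℝ → L2 n} {φ : ℝ → Sp n → ℝ}
    (h : ∀ t, 1 ≤ t → Rep (s.yw m) (F t) (toC (φ t))) (hc : ContinuousOn F (Set.Ici 1)) :
    ContY s.lLow s.ρ s.ν (lExp n s.μ s.k m) φ := by
  refine fun t ht => ⟨by rw [s.normY_eq (h t ht)]; exact enorm_lt_top, ?_⟩
  have h1 : Tendsto (fun τ => ‖F τ - F t‖ₑ) (𝓝[Set.Ici 1] t) (𝓝 0) := by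
    simpa using ((hc t ht).sub_const (F t)).enorm
  refine h1.congr' (eventually_mem_nhdsWithin.mono fun τ hτ => ?_)
  exact (s.normY_sub_eq (h τ hτ) (h t ht)).symm

variable {W Φ W' Φ' : ℕ → ℝ → L2 n} {F₀ F₀' : L2 n} {wPlus wPlus' : Sp n → ℂ}
  {w w' : ℕ → ℝ → Sp n → ℂ} {φ φ' : ℕ → ℝ → Sp n → ℝ} (hγ0 : 0 < γ) (hγ1 : γ ≤ 1)

/-- A phase factor has modulus one, so the data have the same |w₊|². The transforms of the two
densities agree, and the positive weight can be divided out. -/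
lemma density_zero_eq (h : Rep (s.kw 0) F₀ wPlus) (h' : Rep (s.kw 0) F₀' wPlus') {ω : Sp n → ℝ}
    (hω : ∀ᵐ x, wPlus' x = wPlus x * Complex.exp (Complex.I * (ω x : ℂ))) :
    s.P 0 0 F₀ (reflConjL F₀) = s.P 0 0 F₀' (reflConjL F₀') := by
  have h1 := s.hasFourier_mul_conj (i := 0) (j := 0) (by omega) h h
  have h2 := s.hasFourier_mul_conj (i := 0) (j := 0) (by omega) h' h'
  have e : (fun x => wPlus x * starRingEnd ℂ (wPlus x)) =ᵐ[volume]
      fun x => wPlus' x * starRingEnd ℂ (wPlus' x) := by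
    filter_upwards [hω] with x hx
    rw [hx, Complex.mul_conj, Complex.mul_conj, map_mul, mul_comm Complex.I,
      Complex.normSq_eq_norm_sq (Complex.exp _), Complex.norm_exp_ofReal_mul_I]
    simp
  refine Lp.ext ?_
  filter_upwards [(h1.congr e (ae_eq_refl _)).unique_right h2] with ξ hξ
  have h3 : (((s.kw (0 + 0) ξ)⁻¹ : ℝ) : ℂ) ≠ 0 := by
    exact_mod_cast (inv_pos.2 (s.kw_pos (0 + 0) ξ)).ne'
  exact mul_left_cancel₀ h3 (mul_left_cancel₀ (by exact_mod_cast (c₀_pos n).ne') hξ)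

include hγ0 hγ1

section Solution

variable (hW : Evolves s.T s.D s.G γ F₀ W Φ) (hF : Rep (s.kw 0) F₀ wPlus)
  (h : IsSolution s.κ s.μ γ s.p wPlus w φ)
include hW hF h

/-- By uniqueness an arbitrary solution coincides with the constructed one, so what is known of the
evolution in L² applies to it. -/
lemma rep_amplitude {m : ℕ} (hm : m ≤ s.p + 1) {t : ℝ} (ht : 1 ≤ t) :
    Rep (s.kw m) (W m t) (w m t) := by
  obtain ⟨w₁, φ₁, h₁, -, hr⟩ := s.exists_solution hγ0 hγ1 hW hF
  exact (hr.amplitude m hm t ht).congr ((h₁.ae_eq h m).1 hm t ht)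

lemma rep_phase {m : ℕ} (hm : m ≤ s.p) {t : ℝ} (ht : 1 ≤ t) :
    Rep (s.yw m) (Φ m t) (toC (φ m t)) := by
  obtain ⟨w₁, φ₁, h₁, -, hr⟩ := s.exists_solution hγ0 hγ1 hW hF
  exact (hr.phase m hm t ht).congr (toC_congr ((h₁.ae_eq h m).2 hm t ht))

lemma rep_top (hp : 1 < ((s.p : ℝ) + 2) * γ) (htop : IsTopPhase s.κ s.μ γ s.p w φ) {t : ℝ}
    (ht : 1 ≤ t) : Rep (s.yw (s.p + 1)) (s.topPhase γ W Φ t) (toC (φ (s.p + 1) t)) := by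
  obtain ⟨w₁, φ₁, h₁, ht₁, hr⟩ := s.exists_solution hγ0 hγ1 hW hF
  exact (hr.top hp t ht).congr (toC_congr (IsTopPhase.ae_eq h₁ h (ht₁ hp) htop ht))

end Solution

section Estimates

variable (hW : Evolves s.T s.D s.G γ F₀ W Φ) (hW' : Evolves s.T s.D s.G γ F₀' W' Φ')
  {δ : ℝ≥0∞} (hδ : δ ≠ 0) {R : ℝ} (h0 : lipSize δ F₀ F₀' ≤ ((max R 1).toNNReal : ℝ≥0))
include hW hW' hδ h0

lemma lipSize_amplitude_le {m : ℕ} (hm : m ≤ s.p) {t : ℝ} (ht : 1 ≤ t) :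
    ∃ c ≤ growth s.C s.p R, lipSize δ (W (m + 1) t) (W' (m + 1) t) ≤ c * Q (powMeasure γ) m t :=
  ⟨_, le_self_add, (hW.lipSize_le hγ0 hγ1 s.norm_T_le s.norm_D_le s.norm_G_le hW' hδ h0 (s.p + 1)
    (m + 1) (by omega) t ht).1⟩

lemma lipSize_phase_le {m : ℕ} (hm : m ≤ s.p) {t : ℝ} (ht : 1 ≤ t) :
    ∃ c ≤ growth s.C s.p R, lipSize δ (Φ m t) (Φ' m t) ≤ c * N (powMeasure γ) m t :=
  ⟨_, le_add_self, (hW.lipSize_le hγ0 hγ1 s.norm_T_le s.norm_D_le s.norm_G_le hW' hδ h0 (s.p + 1)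
    m (by omega) t ht).2⟩

lemma lipSize_topPhase_le (hp : 1 < ((s.p : ℝ) + 2) * γ) {t : ℝ} (ht : 1 ≤ t) :
    ∃ c ≤ growth s.C s.p R,
      lipSize δ (s.topPhase γ W Φ t) (s.topPhase γ W' Φ' t) ≤ c * Time.P (powMeasure γ) s.p t :=
  ⟨_, le_add_self, hW.lipSize_top_le hγ0 hγ1 s.norm_T_le s.norm_D_le s.norm_G_le hW' hδ h0 hp ht⟩

end Estimates

theorem regularity (hf : normK s.ρ s.ν s.k wPlus < ⊤) (h : IsSolution s.κ s.μ γ s.p wPlus w φ) :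
    (∀ m ≤ s.p,
      ContK s.ρ s.ν (kExp n s.μ s.k (m + 1)) (w (m + 1)) ∧
      ContY s.lLow s.ρ s.ν (lExp n s.μ s.k m) (φ m) ∧
      ∀ t, 1 ≤ t →
        normK s.ρ s.ν (kExp n s.μ s.k (m + 1)) (w (m + 1) t) ≤
          ENNReal.ofReal (growth s.C s.p (normK s.ρ s.ν s.k wPlus).toReal * QBar γ m t) ∧
        normY s.lLow s.ρ s.ν (lExp n s.μ s.k m) (φ m t) ≤
          ENNReal.ofReal (growth s.C s.p (normK s.ρ s.ν s.k wPlus).toReal * NBar γ m t)) ∧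
    (1 < ((s.p : ℝ) + 2) * γ → IsTopPhase s.κ s.μ γ s.p w φ →
      ContY s.lLow s.ρ s.ν (lExp n s.μ s.k (s.p + 1)) (φ (s.p + 1)) ∧
      ∀ t, 1 ≤ t →
        normY s.lLow s.ρ s.ν (lExp n s.μ s.k (s.p + 1)) (φ (s.p + 1) t) ≤
          ENNReal.ofReal (growth s.C s.p (normK s.ρ s.ν s.k wPlus).toReal * PBar γ s.p t)) := by
  obtain ⟨F, hF⟩ := s.exists_rep_datum hf
  obtain ⟨W, Φ, hW⟩ := exists_evolves s.T s.D s.G γ F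
  have hb : ‖F‖ₑ ≤ ENNReal.ofReal (normK s.ρ s.ν s.k wPlus).toReal := by
    rw [ENNReal.ofReal_toReal hf.ne, s.normK_datum_eq hF]
  -- Comparing the evolution with itself at δ = 1 makes the size a norm, so the constant `growth` of
  -- the Lipschitz bounds also serves here.
  have h0 := lipSize_le_of_enorm_le (δ := 1) hb hb (by simp)
  refine ⟨fun m hm => ⟨s.contK (fun t ht => s.rep_amplitude hγ0 hγ1 hW hF h (by omega) ht)
      (hW.continuousOn hγ0 hγ1 s.norm_T_le s.norm_D_le s.norm_G_le (m + 1)).1,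
    s.contY (fun t ht => s.rep_phase hγ0 hγ1 hW hF h hm ht)
      (hW.continuousOn hγ0 hγ1 s.norm_T_le s.norm_D_le s.norm_G_le m).2,
    fun t ht => ⟨?_, ?_⟩⟩, fun hp htop => ⟨s.contY
      (fun t ht => s.rep_top hγ0 hγ1 hW hF h hp htop ht) fun t ht =>
        (s.hasDerivWithinAt_topPhase hγ0 hγ1 hW hp ht).continuousWithinAt, fun t ht => ?_⟩⟩
  · rw [s.normK_eq (s.rep_amplitude hγ0 hγ1 hW hF h (by omega) ht)]
    obtain ⟨c, hc, hle⟩ := s.lipSize_amplitude_le hγ0 hγ1 hW hW one_ne_zero h0 hm ht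
    exact le_ofReal_growth_mul ((enorm_left_le_lipSize _ _ _).trans hle)
      (Q_powMeasure_eq hγ0 hγ1 m ht) hc
  · rw [s.normY_eq (s.rep_phase hγ0 hγ1 hW hF h hm ht)]
    obtain ⟨c, hc, hle⟩ := s.lipSize_phase_le hγ0 hγ1 hW hW one_ne_zero h0 hm ht
    exact le_ofReal_growth_mul ((enorm_left_le_lipSize _ _ _).trans hle)
      (N_powMeasure_eq hγ0 hγ1 m ht) hc
  · rw [s.normY_eq (s.rep_top hγ0 hγ1 hW hF h hp htop ht)]
    obtain ⟨c, hc, hle⟩ := s.lipSize_topPhase_le hγ0 hγ1 hW hW one_ne_zero h0 hp ht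
    exact le_ofReal_growth_mul ((enorm_left_le_lipSize _ _ _).trans hle)
      (P_powMeasure_eq hγ0 hγ1 s.p hp ht) hc

theorem gauge_invariance (hf : normK s.ρ s.ν s.k wPlus < ⊤) (hf' : normK s.ρ s.ν s.k wPlus' < ⊤)
    {ω : Sp n → ℝ} (hω : ∀ᵐ x, wPlus' x = wPlus x * Complex.exp (Complex.I * (ω x : ℂ)))
    (h : IsSolution s.κ s.μ γ s.p wPlus w φ) (h' : IsSolution s.κ s.μ γ s.p wPlus' w' φ') :
    (∀ m ≤ s.p, ∀ t, 1 ≤ t → φ' m t =ᵐ[volume] φ m t) ∧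
    (1 < ((s.p : ℝ) + 2) * γ → IsTopPhase s.κ s.μ γ s.p w φ → IsTopPhase s.κ s.μ γ s.p w' φ' →
      ∀ t, 1 ≤ t → φ' (s.p + 1) t =ᵐ[volume] φ (s.p + 1) t) := by
  obtain ⟨F, hF⟩ := s.exists_rep_datum hf
  obtain ⟨F', hF'⟩ := s.exists_rep_datum hf'
  obtain ⟨W, Φ, hW⟩ := exists_evolves s.T s.D s.G γ F
  obtain ⟨W', Φ', hW'⟩ := exists_evolves s.T s.D s.G γ F'
  have key : ∀ m ≤ s.p + 1, ∀ t, 1 ≤ t →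
      phaseRHS s.D s.G γ W Φ m t = phaseRHS s.D s.G γ W' Φ' m t ∧ Φ m t = Φ' m t :=
    fun m hm t ht => (hW.gauge hγ0 hγ1 s.norm_T_le s.norm_D_le s.norm_G_le hW' s.reflConjL_D
      s.reflConjL_G s.reflConjL_T s.transport_product s.sum_G_eq_of_density_eq
      (s.density_zero_eq hF hF' hω) hm ht).2
  refine ⟨fun m hm t ht => ae_eq_of_toC ?_, fun hp htop htop' t ht => ae_eq_of_toC ?_⟩
  · refine Rep.unique (s.rep_phase hγ0 hγ1 hW' hF' h' hm ht) ?_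
    rw [← (key m (by omega) t ht).2]
    exact s.rep_phase hγ0 hγ1 hW hF h hm ht
  · refine Rep.unique (s.rep_top hγ0 hγ1 hW' hF' h' hp htop' ht) ?_
    -- The last phase is an integral to infinity of the right-hand side of index `p + 1`, so
    -- equality of right-hand sides, not of the `Φ (p + 1)`, is used.
    have e : s.topPhase γ W' Φ' t = s.topPhase γ W Φ t := by
      rw [topPhase, topPhase]
      congr 1
      exact setIntegral_congr_fun measurableSet_Ioi fun τ (hτ : t < τ) =>
        (key (s.p + 1) le_rfl τ (ht.trans hτ.le)).1.symm
    rw [e]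
    exact s.rep_top hγ0 hγ1 hW hF h hp htop ht

theorem lipschitz {R : ℝ} (hf : normK s.ρ s.ν s.k wPlus ≤ ENNReal.ofReal R)
    (hf' : normK s.ρ s.ν s.k wPlus' ≤ ENNReal.ofReal R)
    (h : IsSolution s.κ s.μ γ s.p wPlus w φ) (h' : IsSolution s.κ s.μ γ s.p wPlus' w' φ') :
    (∀ m ≤ s.p, ∀ t, 1 ≤ t →
      normK s.ρ s.ν (kExp n s.μ s.k (m + 1)) (w (m + 1) t - w' (m + 1) t) ≤
        ENNReal.ofReal (growth s.C s.p R * (normK s.ρ s.ν s.k (wPlus - wPlus')).toReal *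
          QBar γ m t) ∧
      normY s.lLow s.ρ s.ν (lExp n s.μ s.k m) (φ m t - φ' m t) ≤
        ENNReal.ofReal (growth s.C s.p R * (normK s.ρ s.ν s.k (wPlus - wPlus')).toReal *
          NBar γ m t)) ∧
    (1 < ((s.p : ℝ) + 2) * γ → IsTopPhase s.κ s.μ γ s.p w φ → IsTopPhase s.κ s.μ γ s.p w' φ' →
      ∀ t, 1 ≤ t →
        normY s.lLow s.ρ s.ν (lExp n s.μ s.k (s.p + 1)) (φ (s.p + 1) t - φ' (s.p + 1) t) ≤
          ENNReal.ofReal (growth s.C s.p R * (normK s.ρ s.ν s.k (wPlus - wPlus')).toReal *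
            PBar γ s.p t)) := by
  obtain ⟨F, hF⟩ := s.exists_rep_datum (hf.trans_lt ENNReal.ofReal_lt_top)
  obtain ⟨F', hF'⟩ := s.exists_rep_datum (hf'.trans_lt ENNReal.ofReal_lt_top)
  rw [s.normK_datum_eq hF] at hf
  rw [s.normK_datum_eq hF'] at hf'
  rw [s.normK_datum_eq (hF.sub hF')]
  obtain ⟨W, Φ, hW⟩ := exists_evolves s.T s.D s.G γ F
  -- The scaling by δ⁻¹ requires distinct data; equal data are compared through a single evolution,
  -- and the differences vanish.
  by_cases hδ : ‖F - F'‖ₑ = 0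
  · obtain rfl : F = F' := sub_eq_zero.1 (enorm_eq_zero.1 hδ)
    refine ⟨fun m hm t ht => ⟨?_, ?_⟩, fun hp htop htop' t ht => ?_⟩
    · rw [s.normK_eq ((s.rep_amplitude hγ0 hγ1 hW hF h (by omega) ht).sub
        (s.rep_amplitude hγ0 hγ1 hW hF' h' (by omega) ht))]
      simp
    · rw [s.normY_sub_eq (s.rep_phase hγ0 hγ1 hW hF h hm ht)
        (s.rep_phase hγ0 hγ1 hW hF' h' hm ht)]
      simp
    · rw [s.normY_sub_eq (s.rep_top hγ0 hγ1 hW hF h hp htop ht)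
        (s.rep_top hγ0 hγ1 hW hF' h' hp htop' ht)]
      simp
  obtain ⟨W', Φ', hW'⟩ := exists_evolves s.T s.D s.G γ F'
  -- With δ the distance of the data, a bound on the size of a pair is a bound on its difference by
  -- δ times the rate.
  have h0 := lipSize_le_of_enorm_le hf hf' (le_refl ‖F - F'‖ₑ)
  have ht : ‖F - F'‖ₑ ≠ ⊤ := enorm_ne_top
  refine ⟨fun m hm t h1 => ⟨?_, ?_⟩, fun hp htop htop' t h1 => ?_⟩
  · rw [s.normK_eq ((s.rep_amplitude hγ0 hγ1 hW hF h (by omega) h1).sub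
      (s.rep_amplitude hγ0 hγ1 hW' hF' h' (by omega) h1))]
    obtain ⟨c, hc, hle⟩ := s.lipSize_amplitude_le hγ0 hγ1 hW hW' hδ h0 hm h1
    exact le_ofReal_growth_mul_mul ht (enorm_sub_le_of_lipSize_le hδ ht hle)
      (Q_powMeasure_eq hγ0 hγ1 m h1) hc
  · rw [s.normY_sub_eq (s.rep_phase hγ0 hγ1 hW hF h hm h1)
      (s.rep_phase hγ0 hγ1 hW' hF' h' hm h1)]
    obtain ⟨c, hc, hle⟩ := s.lipSize_phase_le hγ0 hγ1 hW hW' hδ h0 hm h1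
    exact le_ofReal_growth_mul_mul ht (enorm_sub_le_of_lipSize_le hδ ht hle)
      (N_powMeasure_eq hγ0 hγ1 m h1) hc
  · rw [s.normY_sub_eq (s.rep_top hγ0 hγ1 hW hF h hp htop h1)
      (s.rep_top hγ0 hγ1 hW' hF' h' hp htop' h1)]
    obtain ⟨c, hc, hle⟩ := s.lipSize_topPhase_le hγ0 hγ1 hW hW' hδ h0 hp h1
    exact le_ofReal_growth_mul_mul ht (enorm_sub_le_of_lipSize_le hδ ht hle)
      (P_powMeasure_eq hγ0 hγ1 s.p hp h1) hc

end Setting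

end HartreeAsymptotics

end

open HartreeAsymptotics in
theorem proposition5p2 (n : ℕ) (μ : ℝ) (hμ : 0 < μ) (hμn : μ ≤ n) (κ : ℝ)
    (lLow : ℝ) (hlLow : 0 ≤ lLow) (hlLow_lt : lLow < (n : ℝ) / 2)
    (hlLow_gt : (n : ℝ) / 2 - μ < lLow)
    (p : ℕ) (k : ℝ) (hk : (n : ℝ) / 2 < k) (hk' : ((p : ℝ) + 2) * lamBar n μ - 1 ≤ k)
    (γ₀ : ℝ) (hγ₀ : 0 < γ₀) :
    ∃ A : ℝ → ℝ, Monotone A ∧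
      ∀ γ : ℝ, γ₀ ≤ γ → γ ≤ 1 → ∀ ν : ℝ, 0 ≤ ν → ν ≤ 1 → ∀ ρ : ℝ, 0 ≤ ρ →
        -- the solution exists
        (∀ wPlus : Sp n → ℂ, normK ρ ν k wPlus < ⊤ →
          ∃ (w : ℕ → ℝ → Sp n → ℂ) (φ : ℕ → ℝ → Sp n → ℝ),
            IsSolution κ μ γ p wPlus w φ ∧
            (1 < ((p : ℝ) + 2) * γ → IsTopPhase κ μ γ p w φ)) ∧
        -- and it is unique
        (∀ wPlus : Sp n → ℂ, normK ρ ν k wPlus < ⊤ →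
          ∀ (w w' : ℕ → ℝ → Sp n → ℂ) (φ φ' : ℕ → ℝ → Sp n → ℝ),
            IsSolution κ μ γ p wPlus w φ → IsSolution κ μ γ p wPlus w' φ' →
            (∀ m ≤ p, ∀ t, 1 ≤ t →
              w (m + 1) t =ᵐ[MeasureTheory.volume] w' (m + 1) t ∧
              φ m t =ᵐ[MeasureTheory.volume] φ' m t) ∧
            (1 < ((p : ℝ) + 2) * γ → IsTopPhase κ μ γ p w φ → IsTopPhase κ μ γ p w' φ' →
              ∀ t, 1 ≤ t → φ (p + 1) t =ᵐ[MeasureTheory.volume] φ' (p + 1) t)) ∧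
        -- (1) regularity and estimates
        (∀ wPlus : Sp n → ℂ, normK ρ ν k wPlus < ⊤ →
          ∀ (w : ℕ → ℝ → Sp n → ℂ) (φ : ℕ → ℝ → Sp n → ℝ),
            IsSolution κ μ γ p wPlus w φ →
            (∀ m ≤ p,
              ContK ρ ν (kExp n μ k (m + 1)) (w (m + 1)) ∧
              ContY lLow ρ ν (lExp n μ k m) (φ m) ∧
              ∀ t, 1 ≤ t →
                normK ρ ν (kExp n μ k (m + 1)) (w (m + 1) t) ≤
                  ENNReal.ofReal (A (normK ρ ν k wPlus).toReal * QBar γ m t) ∧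
                normY lLow ρ ν (lExp n μ k m) (φ m t) ≤
                  ENNReal.ofReal (A (normK ρ ν k wPlus).toReal * NBar γ m t)) ∧
            (1 < ((p : ℝ) + 2) * γ → IsTopPhase κ μ γ p w φ →
              ContY lLow ρ ν (lExp n μ k (p + 1)) (φ (p + 1)) ∧
              ∀ t, 1 ≤ t →
                normY lLow ρ ν (lExp n μ k (p + 1)) (φ (p + 1) t) ≤
                  ENNReal.ofReal (A (normK ρ ν k wPlus).toReal * PBar γ p t))) ∧
        -- (2) gauge invariance of the phases
        (∀ wPlus wPlus' : Sp n → ℂ, normK ρ ν k wPlus < ⊤ → normK ρ ν k wPlus' < ⊤ →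
          ∀ ω : Sp n → ℝ,
            (∀ᵐ x, wPlus' x = wPlus x * Complex.exp (Complex.I * (ω x : ℂ))) →
          ∀ (w w' : ℕ → ℝ → Sp n → ℂ) (φ φ' : ℕ → ℝ → Sp n → ℝ),
            IsSolution κ μ γ p wPlus w φ → IsSolution κ μ γ p wPlus' w' φ' →
            (∀ m ≤ p, ∀ t, 1 ≤ t → φ' m t =ᵐ[MeasureTheory.volume] φ m t) ∧
            (1 < ((p : ℝ) + 2) * γ → IsTopPhase κ μ γ p w φ → IsTopPhase κ μ γ p w' φ' →
              ∀ t, 1 ≤ t → φ' (p + 1) t =ᵐ[MeasureTheory.volume] φ (p + 1) t)) ∧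
        -- (3) Lipschitz continuity, uniform on bounded sets
        (∀ R : ℝ, 0 ≤ R → ∀ wPlus wPlus' : Sp n → ℂ,
          normK ρ ν k wPlus ≤ ENNReal.ofReal R → normK ρ ν k wPlus' ≤ ENNReal.ofReal R →
          ∀ (w w' : ℕ → ℝ → Sp n → ℂ) (φ φ' : ℕ → ℝ → Sp n → ℝ),
            IsSolution κ μ γ p wPlus w φ → IsSolution κ μ γ p wPlus' w' φ' →
            (∀ m ≤ p, ∀ t, 1 ≤ t →
              normK ρ ν (kExp n μ k (m + 1)) (w (m + 1) t - w' (m + 1) t) ≤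
                ENNReal.ofReal (A R * (normK ρ ν k (wPlus - wPlus')).toReal * QBar γ m t) ∧
              normY lLow ρ ν (lExp n μ k m) (φ m t - φ' m t) ≤
                ENNReal.ofReal (A R * (normK ρ ν k (wPlus - wPlus')).toReal * NBar γ m t)) ∧
            (1 < ((p : ℝ) + 2) * γ → IsTopPhase κ μ γ p w φ → IsTopPhase κ μ γ p w' φ' →
              ∀ t, 1 ≤ t →
                normY lLow ρ ν (lExp n μ k (p + 1)) (φ (p + 1) t - φ' (p + 1) t) ≤
                  ENNReal.ofReal
                    (A R * (normK ρ ν k (wPlus - wPlus')).toReal * PBar γ p t))) := by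
  -- The kernel constant involves none of γ, ν, ρ, and the constants of the majorant induction do
  -- not depend on the time measure; this choice of A is even independent of γ₀.
  refine ⟨fun R => growth (kerConst n μ κ lLow k) p R, fun R R' h => growth_mono _ p h,
    fun γ hγ hγ1 ν hν0 hν1 ρ hρ => ?_⟩
  have hγ0 := hγ₀.trans_le hγ
  let s : Setting n := ⟨μ, κ, lLow, k, ρ, ν, p, hμ, hμn, hlLow, hlLow_lt, hlLow_gt, hk, hk', hν0,
    hν1, hρ⟩
  refine ⟨fun wPlus hf => ?_, fun wPlus hf w w' φ φ' h h' => ⟨fun m hm t ht => ⟨?_, ?_⟩, ?_⟩,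
    fun wPlus hf w φ h => s.regularity hγ0 hγ1 hf h,
    fun wPlus wPlus' hf hf' ω hω w w' φ φ' h h' => s.gauge_invariance hγ0 hγ1 hf hf' hω h h',
    fun R _ wPlus wPlus' hf hf' w w' φ φ' h h' => s.lipschitz hγ0 hγ1 hf hf' h h'⟩
  · obtain ⟨F, hF⟩ := s.exists_rep_datum hf
    obtain ⟨W, Φ, hW⟩ := Evolution.exists_evolves s.T s.D s.G γ F
    obtain ⟨w, φ, h, htop, -⟩ := s.exists_solution hγ0 hγ1 hW hF
    exact ⟨w, φ, h, htop⟩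
  · exact (h.ae_eq h' (m + 1)).1 (by omega) t ht
  · exact (h.ae_eq h' m).2 hm t ht
  · exact fun _ htop htop' t ht => IsTopPhase.ae_eq h h' htop htop' ht
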